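/- **Cost model.** A straight-line program is a list of instructions: read an input, load a complex constant, one arithmetic operation $+,-,\times,/$ on earlier results, or a selection by a zero test. Its cost is the number of its instructions; arithmetic is exact. All programs below depend only on the discretization parameter $n$ (and, for a single radial solve, on the degree $l$ and the half-order $q$ of the operator); the parameters $\Gamma_0,\Gamma_2,\Gamma_4,\Delta t$, the operator coefficients and all data are inputs, so factorizations of the linear systems are counted. Constants that depend only on $n$ (and on $l$, $q$) are tabulated. **Discretization.** Let $n\ge 2$ be even, $M=n/2$. A scalar on the unit ball is given by Chebyshev–spherical-harmonic (CSH) coefficients, $\sum_{k=0}^{M}\sum_{l=0}^{M}\sum_{|m|\le l}u_{klm}T_k(r)Y_l^m$ with orthonormal $Y_l^m$, or by Chebyshev–Fourier–Fourier (CFF) coefficients, $\sum_{k=0}^{M}\sum_{a,b=-M}^{M}d_{kab}T_k(r)e^{ia\lambda}e^{ib\theta}$; the CFF grid consists of the points $(r,\lambda,\theta)=(\cos\frac{2k\pi}{n},\frac{2a\pi}{n},\frac{2b\pi}{n})$ with the same index ranges. $N=3(n/2+1)(n+1)^2$ is the number of degrees of freedom of a velocity field. *Radial solves.* For $q\in\{1,2,3\}$,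 coefficients $a_0,\dots,a_q$ and $l\le M$, let $A_l$ be the matrix of $r^{2q}\sum_{j\le q}a_j\nabla_l^{2j}$, $\nabla_l^2u=r^{-2}(r^2u')'-l(l+1)r^{-2}u$, from the Chebyshev basis to the ultraspherical basis $C^{(2q)}$ ($q=1$, $a=(K^2,1)$: Helmholtz). The Dirichlet system for $u=\sum_{k\le M}X_kT_k$ consists of the first rows of $A_lX=SF$ ($S$ converts $T$ to $C^{(2q)}$; the last $2q$ of the $M+1$ rows are removed), of $u(1)=g$, $u(-1)=(-1)^lg$, and of the closing conditions $\nabla_l^{2j}u(\pm1)=0$, $1\le j<q$. In the integral system the last $2q-1$ rows are removed, and the two Dirichlet conditions are replaced by the single condition $\sum_k\bigl(\int_0^1r^{l+2}T_k\,dr\bigr)X_k=-p$; for $l=0$ its solution is set to $X=0$. Inside a time step, $F$ is the vector of the Chebyshev coefficients of degree $\le M$ of $r^{2q}$ times the right-hand side. *Time step (IMEX-BDF1).* From CSH coefficients of $P_\omega,T_\omega$ and spherical-harmonic coefficients $g_{lm},f_{lm}$ of the boundary potentials: 1. solve $\nabla^2P_v=-T_\omega$ with $P_v=0$ on the sphere;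 put $T_v=P_\omega$; 2. form $v=\nabla\times\nabla\times(\mathbf rP_v)+\nabla\times(\mathbf rT_v)$, $\omega=\nabla\times v$ in Cartesian components; multiply pointwise at the CFF grid with parameter $n'$, the least even integer $\ge 3n/2$, and interpolate by a CFF series to obtain $\omega\times v$; put $\mathbf N=\nabla\times(\omega\times v)$ and define $P_N,T_N$ by $-\nabla_1^2P_N=\mathbf r\cdot\mathbf N$, $-\nabla_1^2T_N=\mathbf r\cdot\nabla\times\mathbf N$, no $l=0$ part, projected onto the spherical harmonics and truncated to the CSH coefficients with $k,l\le M$. ($\nabla_1^2$ is the Laplacian of the unit sphere. In the differential operators, the quotient of $h$ by $r$ is $(h-h|_{r=0})/r$, and the quotient by $\sin\theta$ is that of $h$ minus its interpolant $\alpha+\beta\cos\theta$ at $\theta=0,\pi$; both are the exact quotients when these exist. Interpolants are normalized to have equal coefficients at the frequencies $-n'/2$ and $n'/2$.) 3. solve $(\tfrac1{\Delta t}-\Gamma_0\nabla^2+\Gamma_2\nabla^4-\Gamma_4\nabla^6)P_\omega'=\tfrac1{\Delta t}P_\omega-P_N$ with Dirichlet data $g$, and the same equation for $T_\omega'$, with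 right-hand side $\tfrac1{\Delta t}T_\omega-T_N$, with the integral conditions with $p=f_{lm}$; here $q=3$ if $\Gamma_4\ne0$, $q=2$ if $\Gamma_4=0\neq\Gamma_2$, and $q=1$ otherwise. **Theorem.** There is an absolute constant $C$ such that for every even $n\ge2$: (a) $N\le Cn^3$, and there is a program of cost at most $C\,N\log^2N$ that, for all real $\Gamma_0,\Gamma_2,\Gamma_4$ and $\Delta t>0$ for which the radial systems of stages 1 and 3 are uniquely solvable, and for all data, computes the time step $(P_\omega,T_\omega)\mapsto(P_\omega',T_\omega')$; under this hypothesis the result of the step exists and is unique. (b) Stage 1 is computed at cost at most $Cn^3$, stage 2 at cost at most $Cn^3\log^2n$, and stage 3 at cost at most $Cn^3$ (stages 1 and 3 whenever their radial systems are uniquely solvable). (c) The conversion of CSH coefficients to the CFF coefficients of the same function, and that of CFF coefficients to CSH coefficients ($L^2$ projection on spheres; it inverts the former), are computed at cost at most $Cn^3\log^2n$. The conversion of CFF coefficients to values at the CFF grid, and that of periodic grid values to the CFF coefficients of their (normalized) interpolant, are computed at cost at most $Cn^3\log n$. (d) For $q\in\{1,2,3\}$ and $l\le n/2$, the matrix $A_l$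 is banded: its entry $(j,k)$ vanishes unless $-6q\le j-k\le 2q$. There are programs of cost at most $Cn$ that solve the Dirichlet system, respectively the integral system, from the inputs $a,F,g$, respectively $a,F,p$, whenever it is uniquely solvable for all right-hand sides. -/

import Mathlib

noncomputable section

namespace BallNS

open Polynomial Complex

/-! ### Operation count: straight-line programs over the complex numbers -/

/-- One instruction of a program with inputs indexed by `ι`. An instruction refers to the results of
earlier instructions by their position. `sel a b c` returns the result number `b` if the result
number `a` is zero, and the result number `c` otherwise. -/
inductive Gate (ι : Type) : Type
  | input (i : ι)
  | const (z : ℂ)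
  | add (a b : ℕ)
  | sub (a b : ℕ)
  | mul (a b : ℕ)
  | div (a b : ℕ)
  | sel (a b c : ℕ)

/-- The result of one instruction, given the inputs `x` and the list `vals` of earlier results. -/
def Gate.val {ι : Type} (x : ι → ℂ) (vals : List ℂ) : Gate ι → ℂ
  | .input i => x i
  | .const z => z
  | .add a b => vals.getD a 0 + vals.getD b 0
  | .sub a b => vals.getD a 0 - vals.getD b 0
  | .mul a b => vals.getD a 0 * vals.getD b 0
  | .div a b => vals.getD a 0 / vals.getD b 0
  | .sel a b c => if vals.getD a 0 = 0 then vals.getD b 0 else vals.getD c 0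

/-- A straight-line program: a list of instructions, and for each output the position of the
instruction that computes it. -/
structure Program (ι κ : Type) where
  gates : List (Gate ι)
  out : κ → ℕ

/-- All intermediate results of a list of instructions, in order. -/
def Gate.run {ι : Type} (gates : List (Gate ι)) (x : ι → ℂ) : List ℂ :=
  gates.foldl (fun vals g => vals ++ [g.val x vals]) []

def Program.eval {ι κ : Type} (P : Program ι κ) (x : ι → ℂ) : κ → ℂ :=
  fun k => (Gate.run P.gates x).getD (P.out k) 0

/-- The number of executed instructions, loading of inputs and of constants included. -/
def Program.cost {ι κ : Type} (P : Program ι κ) : ℕ := P.gates.length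

/-! ### Chebyshev and ultraspherical bases -/

/-- The Chebyshev polynomials of the first kind, as a basis. -/
def chebBasis : Module.Basis ℕ ℂ ℂ[X] :=
  Sequence.basis ⟨fun k => Chebyshev.T ℂ (k : ℤ), fun k => by simp [Chebyshev.degree_T]⟩
    (fun _ => isUnit_iff_ne_zero.2 (leadingCoeff_ne_zero.2 (Sequence.ne_zero _ _)))

/-- The coefficient of `T_k` in the Chebyshev expansion of `p`. -/
def chebCoeff (p : ℂ[X]) (k : ℕ) : ℂ := chebBasis.repr p k

/-- The ultraspherical polynomial `C_j^{(s + 1)}`, from the identity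
`(d/dx)^s U_{j + s} = 2^s s! C_j^{(s + 1)}`. -/
def ultra (s j : ℕ) : ℂ[X] :=
  C (1 / (2 ^ s * (s.factorial : ℂ))) * derivative^[s] (Chebyshev.U ℂ ((j + s : ℕ) : ℤ))

theorem degree_iterate_derivative (s j : ℕ) (p : ℂ[X]) (hp : p.degree = ((j + s : ℕ) : WithBot ℕ)) :
    (derivative^[s] p).degree = (j : WithBot ℕ) := by
  induction s generalizing p with
  | zero => simpa using hp
  | succ s ih =>
    rw [Function.iterate_succ_apply]
    apply ih
    have hn : p.natDegree = j + (s + 1) := natDegree_eq_of_degree_eq_some hp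
    rw [degree_derivative (by omega), hn]
    simp

theorem degree_ultra (s j : ℕ) : (ultra s j).degree = (j : WithBot ℕ) := by
  unfold ultra
  rw [degree_C_mul (by simp [Nat.factorial_ne_zero])]
  exact degree_iterate_derivative s j _ (Chebyshev.degree_U_natCast ℂ _)

/-- The basis `C_0^{(s + 1)}, C_1^{(s + 1)}, …` of the polynomials. -/
def ultraBasis (s : ℕ) : Module.Basis ℕ ℂ ℂ[X] :=
  Sequence.basis ⟨ultra s, degree_ultra s⟩
    (fun _ => isUnit_iff_ne_zero.2 (leadingCoeff_ne_zero.2 (Sequence.ne_zero _ _)))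

/-- `∑_{k ≤ n/2} c_k T_k`. -/
def chebSum {n : ℕ} (c : Fin (n / 2 + 1) → ℂ) : ℂ[X] :=
  ∑ k, C (c k) * Chebyshev.T ℂ ((k : ℕ) : ℤ)

/-! ### The ultraspherical discretization of the radial problems -/

/-- `r^{2 j} ∇_l^{2 j} p`, where `∇_l² p = p'' + (2 / r) p' - l (l + 1) r^{-2} p` is the radial part
of the Laplacian on spherical harmonics of degree `l`; this is again a polynomial. It uses
`r^{2 j + 2} ∇_l² (r^{-2 j} v) = r² v'' + (2 - 4 j) r v' + (2 j (2 j - 1) - l (l + 1)) v`. -/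
def lapPow (l : ℕ) : ℕ → ℂ[X] → ℂ[X]
  | 0, p => p
  | j + 1, p =>
    X ^ 2 * derivative (derivative (lapPow l j p))
      + C (2 - 4 * (j : ℂ)) * X * derivative (lapPow l j p)
      + C (2 * (j : ℂ) * (2 * (j : ℂ) - 1) - (l : ℂ) * ((l : ℂ) + 1)) * lapPow l j p

/-- `r^{2 q} ∑_{j ≤ q} a_j ∇_l^{2 j} p`. For `q = 1`, `a = (K², 1)` this is the Helmholtz operator
`(r² p')' + (K² r² - l (l + 1)) p`. -/
def radialOp (q : ℕ) (a : Fin 4 → ℂ) (l : ℕ) (p : ℂ[X]) : ℂ[X] :=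
  ∑ j : Fin 4, if (j : ℕ) ≤ q then C (a j) * X ^ (2 * (q - (j : ℕ))) * lapPow l j p else 0

/-- The (infinite) matrix `A_l` of `radialOp q a l` from the Chebyshev basis to the basis
`C^{(2 q)}`. -/
def ultraMatrix (q : ℕ) (a : Fin 4 → ℂ) (l j k : ℕ) : ℂ :=
  (ultraBasis (2 * q - 1)).repr (radialOp q a l (Chebyshev.T ℂ (k : ℤ))) j

/-- The matrix of the conversion from the Chebyshev basis to the basis `C^{(2 q)}`. -/
def convMatrix (q j k : ℕ) : ℂ :=
  (ultraBasis (2 * q - 1)).repr (Chebyshev.T ℂ (k : ℤ)) j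

/-- The first rows of the ultraspherical system `A_l X = S F`, the last `d` of the `n / 2 + 1` rows
being removed. -/
def RowsHold (n q : ℕ) (a : Fin 4 → ℂ) (l d : ℕ) (F X : Fin (n / 2 + 1) → ℂ) : Prop :=
  ∀ j : ℕ, j + d ≤ n / 2 →
    ∑ k : Fin (n / 2 + 1), ultraMatrix q a l j k * X k =
      ∑ k : Fin (n / 2 + 1), convMatrix q j k * F k

/-- The closing conditions `∇² u = … = ∇^{2 (q - 1)} u = 0` on the unit sphere for the problem of
order `2 q`, in the variable `r` extended to `[-1, 1]`. They are void for `q = 1`. -/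
def ClosingConditions (n q l : ℕ) (X : Fin (n / 2 + 1) → ℂ) : Prop :=
  ∀ j : ℕ, 1 ≤ j → j < q →
    (lapPow l j (chebSum X)).eval 1 = 0 ∧ (lapPow l j (chebSum X)).eval (-1) = 0

/-- The almost banded system with Dirichlet conditions `u(1) = g`, `u(-1) = (-1)^l g`. -/
def DirichletSystem (n q : ℕ) (a : Fin 4 → ℂ) (l : ℕ) (F : Fin (n / 2 + 1) → ℂ) (g : ℂ)
    (X : Fin (n / 2 + 1) → ℂ) : Prop :=
  RowsHold n q a l (2 * q) F X ∧
  (chebSum X).eval 1 = g ∧ (chebSum X).eval (-1) = (-1) ^ l * g ∧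
  ClosingConditions n q l X

/-- The almost banded system with the integral condition
`∑_k (∫₀¹ r^{l+2} T_k(r) dr) X_k = -p`; for `l = 0` the solution is set to zero. -/
def IntegralSystem (n q : ℕ) (a : Fin 4 → ℂ) (l : ℕ) (F : Fin (n / 2 + 1) → ℂ) (p : ℂ)
    (X : Fin (n / 2 + 1) → ℂ) : Prop :=
  if l = 0 then X = 0 else
    RowsHold n q a l (2 * q - 1) F X ∧
    ∑ k : Fin (n / 2 + 1), (((∫ r in (0 : ℝ)..1,
      r ^ (l + 2) * (Chebyshev.T ℝ ((k : ℕ) : ℤ)).eval r) : ℝ) : ℂ) * X k = -p ∧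
    ClosingConditions n q l X

def DirichletWellPosed (n q : ℕ) (a : Fin 4 → ℂ) (l : ℕ) : Prop :=
  ∀ F g, ∃! X, DirichletSystem n q a l F g X

def IntegralWellPosed (n q : ℕ) (a : Fin 4 → ℂ) (l : ℕ) : Prop :=
  ∀ F p, ∃! X, IntegralSystem n q a l F p X

/-- The Chebyshev coefficients up to degree `n / 2` of `r^{2 q} f`. -/
def rhsVec {n : ℕ} (q : ℕ) (f : Fin (n / 2 + 1) → ℂ) : Fin (n / 2 + 1) → ℂ :=
  fun k => chebCoeff (X ^ (2 * q) * chebSum f) k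

/-! ### Functions on the ball -/

/-- Functions of `(r, λ, θ)` that are polynomial in `r` and trigonometric polynomials in the azimuth
`λ` and in the polar angle `θ`; the coefficient at `(a, b)` is the polynomial multiplying
`exp (i (a λ + b θ))`. -/
abbrev BallFn : Type := AddMonoidAlgebra ℂ[X] (ℤ × ℤ)

/-- `p(r) exp (i (a λ + b θ))`. -/
def mode (a b : ℤ) (p : ℂ[X]) : BallFn := AddMonoidAlgebra.single (a, b) p

def BallFn.eval (f : BallFn) (r lam θ : ℝ) : ℂ :=
  f.coeff.sum fun ab p =>
    p.eval (r : ℂ) * Complex.exp (I * ((ab.1 : ℂ) * (lam : ℂ) + (ab.2 : ℂ) * (θ : ℂ)))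

/-- The additive map that sends each mode `p(r) exp (i (a λ + b θ))` to `φ a b p`. -/
def mapModes (φ : ℤ → ℤ → ℂ[X] → BallFn) (f : BallFn) : BallFn :=
  f.coeff.sum fun ab p => φ ab.1 ab.2 p

def cosLam : BallFn := mode 1 0 (C (1 / 2)) + mode (-1) 0 (C (1 / 2))
def sinLam : BallFn := mode 1 0 (C (-I / 2)) + mode (-1) 0 (C (I / 2))
def cosTheta : BallFn := mode 0 1 (C (1 / 2)) + mode 0 (-1) (C (1 / 2))
def sinTheta : BallFn := mode 0 1 (C (-I / 2)) + mode 0 (-1) (C (I / 2))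
def radius : BallFn := mode 0 0 X

def dR : BallFn → BallFn := mapModes fun a b p => mode a b (derivative p)
def dLam : BallFn → BallFn := mapModes fun a b p => mode a b (C (I * (a : ℂ)) * p)
def dTheta : BallFn → BallFn := mapModes fun a b p => mode a b (C (I * (b : ℂ)) * p)

/-- Division by `r`: the quotient `(f - f|_{r = 0}) / r`, which is `f / r` whenever `f` is divisible
by `r`. -/
def divR : BallFn → BallFn := mapModes fun a b p => mode a b p.divX

/-- The quotient of `exp (i b θ)`, minus `1` or `cos θ` according to the parity of `b`, by
`sin θ`. -/
def sinQuot (b : ℤ) : BallFn :=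
  mode 0 0 (C (I * ((b % 2 : ℤ) : ℂ)))
    + ∑ t ∈ Finset.Ico 0 (b / 2), mode 0 (b % 2 + 2 * t + 1) (C (2 * I))
    - ∑ t ∈ Finset.Ico (b / 2) 0, mode 0 (b % 2 + 2 * t + 1) (C (2 * I))

/-- Division by `sin θ`: the quotient `(f - α - β cos θ) / sin θ`, where `α + β cos θ` interpolates
`f` at `θ = 0` and `θ = π`; it is `f / sin θ` whenever `f` is divisible by `sin θ`. -/
def divSin : BallFn → BallFn := mapModes fun a b p => mode a 0 p * sinQuot b

/-- The Cartesian partial derivatives in spherical coordinates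
`(x, y, z) = (r cos λ sin θ, r sin λ sin θ, r cos θ)`. -/
def pd (f : BallFn) : Fin 3 → BallFn :=
  ![sinTheta * cosLam * dR f + divR (cosTheta * cosLam * dTheta f - sinLam * divSin (dLam f)),
    sinTheta * sinLam * dR f + divR (cosTheta * sinLam * dTheta f + cosLam * divSin (dLam f)),
    cosTheta * dR f - divR (sinTheta * dTheta f)]

/-- The curl of a vector field, given by its Cartesian components. -/
def curl (v : Fin 3 → BallFn) : Fin 3 → BallFn :=
  ![pd (v 2) 1 - pd (v 1) 2, pd (v 0) 2 - pd (v 2) 0, pd (v 1) 0 - pd (v 0) 1]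

/-- The position vector. -/
def pos : Fin 3 → BallFn :=
  ![radius * sinTheta * cosLam, radius * sinTheta * sinLam, radius * cosTheta]

def dot (u v : Fin 3 → BallFn) : BallFn := u 0 * v 0 + u 1 * v 1 + u 2 * v 2

/-- `∇ × ∇ × (𝐫 P) + ∇ × (𝐫 T)`. -/
def ptField (P T : BallFn) : Fin 3 → BallFn :=
  curl (curl fun i => pos i * P) + curl fun i => pos i * T

/-! ### Spherical harmonics -/

/-- The Legendre polynomial of degree `l`. -/
def legendre (l : ℕ) : ℂ[X] :=
  C (1 / (2 ^ l * (l.factorial : ℂ))) * derivative^[l] ((X ^ 2 - 1) ^ l)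

/-- The orthonormal spherical harmonic `Y_l^m`, `|m| ≤ l`, a normalization constant times
`sin^{|m|} θ P_l^{(|m|)}(cos θ) exp (i m λ)`. -/
def sphY (l : ℕ) (m : ℤ) : BallFn :=
  mode m 0 (C ((Real.sqrt ((2 * l + 1) / (4 * Real.pi) * ((l - m.natAbs).factorial : ℝ)
      / ((l + m.natAbs).factorial : ℝ)) : ℝ) : ℂ))
    * sinTheta ^ m.natAbs * aeval cosTheta (derivative^[m.natAbs] (legendre l))

/-- The coefficient of `T_k Y_l^m` of a function: for each `r`, the `L²` projection on the sphere
onto `Y_l^m`; then the Chebyshev coefficient in `r`. -/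
def cshCoeff (f : BallFn) (k l : ℕ) (m : ℤ) : ℂ :=
  f.coeff.sum fun ab p => chebCoeff p k *
    ∫ θ in (0 : ℝ)..Real.pi, ∫ lam in (-Real.pi)..Real.pi,
      Complex.exp (I * ((ab.1 : ℂ) * (lam : ℂ) + (ab.2 : ℂ) * (θ : ℂ)))
        * (starRingEnd ℂ) ((sphY l m).eval 1 lam θ) * (Real.sin θ : ℂ)

/-! ### Truncated expansions -/

/-- Degrees and orders `(l, m)`, `0 ≤ l ≤ n/2`, `-l ≤ m ≤ l`. -/
abbrev SHIdx (n : ℕ) : Type :=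
  (l : Fin (n / 2 + 1)) × {m : ℤ // m ∈ Finset.Icc (-((l : ℕ) : ℤ)) ((l : ℕ) : ℤ)}

/-- Indices `(k, (l, m))` of the Chebyshev-spherical harmonic (CSH) series. -/
abbrev CSHIdx (n : ℕ) : Type := Fin (n / 2 + 1) × SHIdx n

/-- Azimuthal or polar frequencies (or grid indices) `-n/2, …, n/2`. -/
abbrev Freq (n : ℕ) : Type := {a : ℤ // a ∈ Finset.Icc (-((n / 2 : ℕ) : ℤ)) ((n / 2 : ℕ) : ℤ)}

/-- Indices of the Chebyshev-Fourier-Fourier (CFF) series, and also of the CFF grid. -/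
abbrev CFFIdx (n : ℕ) : Type := Fin (n / 2 + 1) × Freq n × Freq n

/-- The function with given CSH coefficients. -/
def ofCSH {n : ℕ} (c : CSHIdx n → ℂ) : BallFn :=
  ∑ i : CSHIdx n, mode 0 0 (C (c i) * Chebyshev.T ℂ ((i.1 : ℕ) : ℤ)) * sphY i.2.1 i.2.2

/-- The function with given CFF coefficients. -/
def ofCFF {n : ℕ} (d : CFFIdx n → ℂ) : BallFn :=
  ∑ i : CFFIdx n, mode i.2.1 i.2.2 (C (d i) * Chebyshev.T ℂ ((i.1 : ℕ) : ℤ))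

/-- The truncated CSH coefficients of a function. -/
def toCSH (n : ℕ) (f : BallFn) : CSHIdx n → ℂ := fun i => cshCoeff f i.1 i.2.1 i.2.2

/-- The values of a function at the CFF grid `(cos (2 k π / n), 2 a π / n, 2 b π / n)`. -/
def gridValues (n : ℕ) (f : BallFn) : CFFIdx n → ℂ := fun i =>
  f.eval (Real.cos (2 * ((i.1 : ℕ) : ℝ) * Real.pi / n))
    (2 * ((i.2.1 : ℤ) : ℝ) * Real.pi / n) (2 * ((i.2.2 : ℤ) : ℝ) * Real.pi / n)

/-- The entries at the extreme indices `-n/2` and `n/2` of each angular variable agree. For values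
at the CFF grid this is periodicity. For CFF coefficients it is the usual normalization of an
interpolant, as the two extreme exponentials coincide on the grid. -/
def EdgeSymm {n : ℕ} (d : CFFIdx n → ℂ) : Prop :=
  (∀ (k : Fin (n / 2 + 1)) (a a' b : Freq n), (a : ℤ) = -((n / 2 : ℕ) : ℤ) →
    (a' : ℤ) = ((n / 2 : ℕ) : ℤ) → d (k, a, b) = d (k, a', b)) ∧
  (∀ (k : Fin (n / 2 + 1)) (a b b' : Freq n), (b : ℤ) = -((n / 2 : ℕ) : ℤ) →
    (b' : ℤ) = ((n / 2 : ℕ) : ℤ) → d (k, a, b) = d (k, a, b'))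

/-- The CFF series with coefficients `d` interpolates the values `v` at the CFF grid. -/
def Interpolates {n : ℕ} (v d : CFFIdx n → ℂ) : Prop :=
  EdgeSymm d ∧ gridValues n (ofCFF d) = v

/-- The discretization parameter of the dealiased products: the least even integer that is at least
`3 n / 2`. -/
def dealias (n : ℕ) : ℕ := 2 * ((3 * n + 3) / 4)

/-- The number of degrees of freedom of the velocity field. -/
def dof (n : ℕ) : ℕ := 3 * (n / 2 + 1) * (n + 1) ^ 2

/-! ### One time step -/

/-- The coefficients of the radial function that belongs to the spherical harmonic `i`. -/
def column {n : ℕ} (c : CSHIdx n → ℂ) (i : SHIdx n) : Fin (n / 2 + 1) → ℂ := fun k => c (k, i)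

/-- The coefficients of the Laplacian. -/
def poissonCoeffs : Fin 4 → ℂ := ![0, 1, 0, 0]

/-- The coefficients of `1/Δt - Γ₀ ∇² + Γ₂ ∇⁴ - Γ₄ ∇⁶`. -/
def stepCoeffs (Γ₀ Γ₂ Γ₄ Δt : ℝ) : Fin 4 → ℂ :=
  ![((1 / Δt : ℝ) : ℂ), ((-Γ₀ : ℝ) : ℂ), (Γ₂ : ℂ), ((-Γ₄ : ℝ) : ℂ)]

/-- Half of the order of the operator `1/Δt - Γ₀ ∇² + Γ₂ ∇⁴ - Γ₄ ∇⁶`. -/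
def halfOrder (Γ₂ Γ₄ : ℝ) : ℕ :=
  open Classical in if Γ₄ ≠ 0 then 3 else if Γ₂ ≠ 0 then 2 else 1

/-- First stage: `∇² P_v = -T_ω` with `P_v = 0` on the sphere, and `T_v = P_ω`. -/
def IsVelocity {n : ℕ} (Pω Tω Pv Tv : CSHIdx n → ℂ) : Prop :=
  (∀ i : SHIdx n, DirichletSystem n 1 poissonCoeffs i.1 (rhsVec 1 (-column Tω i)) 0 (column Pv i)) ∧
  Tv = Pω

/-- Second stage: the poloidal and toroidal scalars `P_N`, `T_N` of `N = ∇ × (ω × v)`. The product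
`ω × v` is formed pointwise at the CFF grid of the `3/2` rule and transformed back to a CFF series;
`P_N`, `T_N` are given by `-∇₁² P_N = 𝐫 ⋅ N`, `-∇₁² T_N = 𝐫 ⋅ (∇ × N)` and have no `l = 0`
component. -/
def IsNonlinear {n : ℕ} (Pv Tv PN TN : CSHIdx n → ℂ) : Prop :=
  ∃ w : Fin 3 → CFFIdx (dealias n) → ℂ,
    let v := ptField (ofCSH Pv) (ofCSH Tv)
    let ω := curl v
    let V := fun i => gridValues (dealias n) (v i)
    let W := fun i => gridValues (dealias n) (ω i)
    let N := curl fun i => ofCFF (w i)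
    Interpolates (W 1 * V 2 - W 2 * V 1) (w 0) ∧
    Interpolates (W 2 * V 0 - W 0 * V 2) (w 1) ∧
    Interpolates (W 0 * V 1 - W 1 * V 0) (w 2) ∧
    (∀ i : CSHIdx n, PN i = if (i.2.1 : ℕ) = 0 then 0 else
      toCSH n (dot pos N) i / (((i.2.1 : ℕ) : ℂ) * (((i.2.1 : ℕ) : ℂ) + 1))) ∧
    (∀ i : CSHIdx n, TN i = if (i.2.1 : ℕ) = 0 then 0 else
      toCSH n (dot pos (curl N)) i / (((i.2.1 : ℕ) : ℂ) * (((i.2.1 : ℕ) : ℂ) + 1)))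

/-- Third stage: the implicit equations
`(1/Δt - Γ₀ ∇² + Γ₂ ∇⁴ - Γ₄ ∇⁶) P_ω' = P_ω/Δt - P_N` with Dirichlet data `g` and
`(1/Δt - Γ₀ ∇² + Γ₂ ∇⁴ - Γ₄ ∇⁶) T_ω' = T_ω/Δt - T_N` with integral conditions for `f`. -/
def IsVorticity {n : ℕ} (Γ₀ Γ₂ Γ₄ Δt : ℝ) (Pω Tω PN TN : CSHIdx n → ℂ) (g f : SHIdx n → ℂ)
    (Pω' Tω' : CSHIdx n → ℂ) : Prop :=
  ∀ i : SHIdx n,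
    DirichletSystem n (halfOrder Γ₂ Γ₄) (stepCoeffs Γ₀ Γ₂ Γ₄ Δt) i.1
      (rhsVec (halfOrder Γ₂ Γ₄) (((1 / Δt : ℝ) : ℂ) • column Pω i - column PN i))
      (g i) (column Pω' i) ∧
    IntegralSystem n (halfOrder Γ₂ Γ₄) (stepCoeffs Γ₀ Γ₂ Γ₄ Δt) i.1
      (rhsVec (halfOrder Γ₂ Γ₄) (((1 / Δt : ℝ) : ℂ) • column Tω i - column TN i))
      (f i) (column Tω' i)

/-- One IMEX-BDF1 time step, from `(P_ω, T_ω)` to `(P_ω', T_ω')`. -/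
def IsTimeStep {n : ℕ} (Γ₀ Γ₂ Γ₄ Δt : ℝ) (Pω Tω : CSHIdx n → ℂ) (g f : SHIdx n → ℂ)
    (Pω' Tω' : CSHIdx n → ℂ) : Prop :=
  ∃ Pv Tv PN TN : CSHIdx n → ℂ,
    IsVelocity Pω Tω Pv Tv ∧ IsNonlinear Pv Tv PN TN ∧
    IsVorticity Γ₀ Γ₂ Γ₄ Δt Pω Tω PN TN g f Pω' Tω'

/-- The linear systems of the first stage are uniquely solvable. -/
def VelocityWellPosed (n : ℕ) : Prop :=
  ∀ l ≤ n / 2, DirichletWellPosed n 1 poissonCoeffs l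

/-- The linear systems of the third stage are uniquely solvable. -/
def VorticityWellPosed (n : ℕ) (Γ₀ Γ₂ Γ₄ Δt : ℝ) : Prop :=
  ∀ l ≤ n / 2, DirichletWellPosed n (halfOrder Γ₂ Γ₄) (stepCoeffs Γ₀ Γ₂ Γ₄ Δt) l ∧
    IntegralWellPosed n (halfOrder Γ₂ Γ₄) (stepCoeffs Γ₀ Γ₂ Γ₄ Δt) l

/-- The parameters `Γ₀, Γ₂, Γ₄, Δt`, as inputs of a program. -/
def params (Γ₀ Γ₂ Γ₄ Δt : ℝ) : Fin 4 → ℂ := ![(Γ₀ : ℂ), (Γ₂ : ℂ), (Γ₄ : ℂ), (Δt : ℂ)]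

end BallNS

end

/-!
A function of the data is computable with few instructions once the functions it is made of are
available. This is the relation `Der A c B` between sets of functions of the data; it composes, and
`Der.exists_program` turns a derivation from the inputs into a straight-line program. Each part of
the statement is thus a derivation together with a proof that its result is the object described by
the discretization, and that this object is unique.

*Radial solves.* Differentiation takes `C^(s)` to `C^(s+1)`, while conversion between the
ultraspherical bases and multiplication by `r` have bounded bandwidth; hence the operator matrices
are banded (`ultraMatrix_band`). At most six dense rows, the boundary, closing and integral
conditions, come on top, and their coefficients do not depend on the data. With the partial sums of
the dense rows as additional unknowns the whole system becomes banded, of width independent of `n`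
(`Der.almostBanded`). Gaussian elimination on a window of bounded size solves it with `O(n)`
operations; zero tests choose the pivots, so the program does not depend on the data
(`Der.banded`). Uniqueness of the solution is all that elimination requires. The order of the
operator in the time step is itself determined by the data, so the solutions for all three orders
are computed and zero tests select one (`Der.selectOrder`).

*Fourier transforms.* Evaluation at the grid and interpolation are, in each direction, trigonometric
sums at the points of a geometric progression whose ratio is a root of unity of arbitrary order.
Such a chirp transform is a convolution, which radix-two fast Fourier transforms carry out
(`Der.fft`, `Der.toeplitz`, `Der.chirp`). Data that agree at opposite ends of each period have
exactly one normalized interpolant (`interpolates_iff`).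

*Spherical harmonics.* For fixed order `m` the associated Legendre functions satisfy a three-term
recurrence in the degree, with `cos θ = (z + z⁻¹) / 2` as the multiplier, where `z` shifts the polar
frequency. Propagation over `i` steps of the recurrence is convolution with kernels of length `O(i)`
(`IsRec.exists_kernel`), so divide and conquer with fast convolutions evaluates all degrees at cost
`O(n log² n)`: in one direction for synthesis (`Der.rec_synthesis`, `Der.ofCSH`), and in the other,
applied to the moments of `e^{ibθ}` against the Legendre functions, for projection
(`Der.rec_analysis`, `Der.toCSH`). Orthonormality of the spherical harmonics makes the projection a
left inverse (`toCSH_ofCSH`). There are `O(n²)` pairs of a radial degree and an order `m`, which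
gives `O(n³ log² n)` in total.

*Nonlinear terms.* The differential operators, including the quotients by `r` and by `sin θ`, act on
coefficients through recurrences of bounded length and raise degrees by a bounded amount (`Fast`,
`FastOp`), at cost `O(n³)`. Between them the nonlinear stage needs two conversions from spherical
harmonics, six evaluations at a grid, three interpolations and two projections
(`exists_der_nonlinear`). The time step is its composition with the two linear stages
(`Der.velocity`, `Der.vorticity`).
-/


namespace BallNS

open Polynomial Complex

/-! ### Derivations: the cost calculus behind the programs -/

/-- `Op A f`: the function `f` of the data `x : X` is the result of one instruction, other than
reading an input, whose operands are functions in `A`. -/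
inductive Op {X : Type} (A : Set (X → ℂ)) : (X → ℂ) → Prop
  | const (z : ℂ) : Op A fun _ => z
  | add {f g : X → ℂ} (hf : f ∈ A) (hg : g ∈ A) : Op A fun x => f x + g x
  | sub {f g : X → ℂ} (hf : f ∈ A) (hg : g ∈ A) : Op A fun x => f x - g x
  | mul {f g : X → ℂ} (hf : f ∈ A) (hg : g ∈ A) : Op A fun x => f x * g x
  | div {f g : X → ℂ} (hf : f ∈ A) (hg : g ∈ A) : Op A fun x => f x / g x
  | sel {f g h : X → ℂ} (hf : f ∈ A) (hg : g ∈ A) (hh : h ∈ A) :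
      Op A fun x => if f x = 0 then g x else h x

/-- `Der A c B`: once the functions in `A` have been computed, at most `c` further instructions
compute all the functions in `B`. The instructions do not depend on the data `x : X`. -/
inductive Der {X : Type} : Set (X → ℂ) → ℕ → Set (X → ℂ) → Prop
  | done {A B : Set (X → ℂ)} {c : ℕ} (h : B ⊆ A) : Der A c B
  | step {A B : Set (X → ℂ)} {c : ℕ} {f : X → ℂ} (hf : Op A f) (h : Der (insert f A) c B) :
      Der A (c + 1) B

variable {X : Type} {A A' B B' C : Set (X → ℂ)} {c d : ℕ}

theorem Op.mono (hA : A ⊆ A') {f : X → ℂ} (h : Op A f) : Op A' f := by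
  cases h with
  | const z => exact .const z
  | add hf hg => exact .add (hA hf) (hA hg)
  | sub hf hg => exact .sub (hA hf) (hA hg)
  | mul hf hg => exact .mul (hA hf) (hA hg)
  | div hf hg => exact .div (hA hf) (hA hg)
  | sel hf hg hh => exact .sel (hA hf) (hA hg) (hA hh)

theorem Der.mono (h : Der A c B) (hA : A ⊆ A') (hc : c ≤ d) (hB : B' ⊆ B) : Der A' d B' := by
  induction h generalizing A' d with
  | done h => exact .done (hB.trans (h.trans hA))
  | @step A B c f hf h ih =>
    obtain ⟨e, rfl⟩ : ∃ e, d = e + 1 := ⟨d - 1, by omega⟩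
    exact .step (hf.mono hA) (ih (Set.insert_subset_insert hA) (by omega) hB)

theorem Der.mono_left (h : Der A c B) (hA : A ⊆ A') : Der A' c B := h.mono hA le_rfl le_rfl
theorem Der.mono_cost (h : Der A c B) (hc : c ≤ d) : Der A d B := h.mono le_rfl hc le_rfl
theorem Der.mono_right (h : Der A c B) (hB : B' ⊆ B) : Der A c B' := h.mono le_rfl le_rfl hB

theorem Der.keep (h : Der A c B) : Der A c (A ∪ B) := by
  induction h with
  | done h => exact .done (Set.union_subset le_rfl h)
  | step hf h ih =>
    exact .step hf (ih.mono_right (Set.union_subset_union_left _ (Set.subset_insert _ _)))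

theorem Der.trans (h : Der A c B) (h' : Der (A ∪ B) d C) : Der A (c + d) C := by
  induction h with
  | done h => exact h'.mono (Set.union_subset le_rfl h) (by omega) le_rfl
  | @step A B c f hf h ih =>
    rw [show c + 1 + d = c + d + 1 by ring]
    exact .step hf (ih (h'.mono_left (Set.union_subset_union_left _ (Set.subset_insert _ _))))

theorem Der.union (h : Der A c B) (h' : Der A d C) : Der A (c + d) (B ∪ C) := by
  refine h.trans ?_
  refine ((h'.mono_left Set.subset_union_left : Der (A ∪ B) d C).keep).mono_right ?_
  exact Set.union_subset_union_left _ Set.subset_union_right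

theorem Der.biUnion {ι : Type*} (s : Finset ι) (B : ι → Set (X → ℂ)) (h : ∀ i ∈ s, Der A c (B i)) :
    Der A (s.card * c) (⋃ i ∈ s, B i) := by
  classical
  induction s using Finset.induction_on with
  | empty => exact .done (by simp)
  | insert a s ha ih =>
    rw [Finset.card_insert_of_notMem ha, Finset.set_biUnion_insert]
    refine ((h a (by simp)).union (ih fun i hi => h i (by simp [hi]))).mono_cost ?_
    ring_nf; rfl

theorem Der.image {ι : Type*} (s : Finset ι) (F : ι → X → ℂ) (h : ∀ i ∈ s, Der A c {F i}) :
    Der A (s.card * c) (F '' s) := by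
  refine (Der.biUnion s (fun i => {F i}) h).mono_right ?_
  rintro _ ⟨i, hi, rfl⟩
  simpa using ⟨i, hi, rfl⟩

theorem Der.of_mem {f : X → ℂ} (h : f ∈ A) : Der A c {f} := .done (by simpa using h)

theorem Der.op {f : X → ℂ} (h : Op A f) : Der A 1 {f} := .step h (.done (by simp))

theorem Der.const (z : ℂ) : Der A 1 {fun _ : X => z} := .op (.const z)

section Combinators

variable {f g h : X → ℂ} {a b : ℕ}

theorem Der.op₂ (hf : Der A a {f}) (hg : Der A b {g}) (hh : Op (insert f (insert g A)) h) :
    Der A (a + b + 1) {h} :=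
  (hf.union hg).trans (.op (hh.mono (by
    intro u hu
    simp only [Set.mem_insert_iff, Set.mem_union, Set.mem_singleton_iff] at hu ⊢
    tauto)))

theorem Der.add (hf : Der A a {f}) (hg : Der A b {g}) :
    Der A (a + b + 1) {fun x => f x + g x} := hf.op₂ hg (.add (by simp) (by simp))

theorem Der.sub (hf : Der A a {f}) (hg : Der A b {g}) :
    Der A (a + b + 1) {fun x => f x - g x} := hf.op₂ hg (.sub (by simp) (by simp))

theorem Der.mul (hf : Der A a {f}) (hg : Der A b {g}) :
    Der A (a + b + 1) {fun x => f x * g x} := hf.op₂ hg (.mul (by simp) (by simp))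

theorem Der.div (hf : Der A a {f}) (hg : Der A b {g}) :
    Der A (a + b + 1) {fun x => f x / g x} := hf.op₂ hg (.div (by simp) (by simp))

theorem Der.smul (z : ℂ) (hf : Der A a {f}) : Der A (a + 2) {fun x => z * f x} :=
  ((Der.const z).mul hf).mono_cost (by omega)

theorem Der.sel (hf : Der A a {f}) (hg : Der A b {g}) (hh : Der A c {h}) :
    Der A (a + b + c + 1) {fun x => if f x = 0 then g x else h x} :=
  ((hf.union hg).union hh).trans (.op (.sel (by simp) (by simp) (by simp)))

theorem Der.sum {ι : Type*} (s : Finset ι) (F : ι → X → ℂ) (h : ∀ i ∈ s, Der A c {F i}) :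
    Der A (s.card * (c + 1) + 1) {fun x => ∑ i ∈ s, F i x} := by
  classical
  induction s using Finset.induction_on with
  | empty => simpa using Der.const 0
  | insert i s hi ih =>
    simp only [Finset.sum_insert hi, Finset.card_insert_of_notMem hi]
    refine ((h i (by simp)).add (ih fun j hj => h j (by simp [hj]))).mono_cost ?_
    ring_nf; rfl

theorem Der.lincomb {ι : Type*} (s : Finset ι) (z : ι → ℂ) (F : ι → X → ℂ) (h : ∀ i ∈ s, F i ∈ A) :
    Der A (3 * s.card + 1) {fun x => ∑ i ∈ s, z i * F i x} :=
  (Der.sum s (fun i x => z i * F i x) (c := 2) fun i hi =>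
    (Der.smul (z i) (Der.of_mem (c := 0) (h i hi)))).mono_cost (by omega)

end Combinators

/-- A recurrence solved from the top: each term costs at most `c` given the two terms above it. -/
theorem Der.chain (G : ℕ → X → ℂ) (N : ℕ) (htop : ∀ j, N < j → G j ∈ A)
    (h : ∀ j ≤ N, Der (A ∪ {G (j + 1), G (j + 2)}) c {G j}) :
    Der A ((N + 1) * c) (G '' Set.univ) := by
  have key : ∀ m ≤ N + 1, Der A (m * c) (G '' {j | N + 1 - m ≤ j}) := by
    intro m
    induction m with
    | zero =>
      intro _
      refine .done ?_
      rintro _ ⟨j, hj, rfl⟩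
      exact htop j (by simpa using hj)
    | succ m ih =>
      intro hm
      have h1 := h (N - m) (by omega)
      have h2 : Der (A ∪ G '' {j | N + 1 - m ≤ j}) c {G (N - m)} := by
        refine h1.mono_left (Set.union_subset_union_right _ ?_)
        rintro _ (rfl | rfl)
        · exact ⟨N - m + 1, by simp only [Set.mem_ofPred_eq]; omega, rfl⟩
        · exact ⟨N - m + 2, by simp only [Set.mem_ofPred_eq]; omega, rfl⟩
      refine ((ih (by omega)).trans h2.keep).mono le_rfl (by rw [Nat.succ_mul]) ?_
      rintro _ ⟨j, hj, rfl⟩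
      rcases Nat.lt_or_ge j (N + 1 - m) with hlt | hge
      · simp only [Set.mem_ofPred_eq] at hj
        right
        rw [show j = N - m by omega]; rfl
      · exact Or.inl (Or.inr ⟨j, hge, rfl⟩)
  refine (key (N + 1) le_rfl).mono_right ?_
  rintro _ ⟨j, -, rfl⟩
  exact ⟨j, by simp, rfl⟩

theorem Gate.run_append {ι : Type} (gs : List (Gate ι)) (g : Gate ι) (x : ι → ℂ) :
    Gate.run (gs ++ [g]) x = Gate.run gs x ++ [g.val x (Gate.run gs x)] := by
  simp [Gate.run, List.foldl_append]

theorem Gate.length_run {ι : Type} (gs : List (Gate ι)) (x : ι → ℂ) :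
    (Gate.run gs x).length = gs.length := by
  induction gs using List.reverseRecOn with
  | nil => rfl
  | append_singleton gs g ih => simp [Gate.run_append, ih]

/-- The functions of the data computed by a list of instructions whose inputs are the
functions `π`. -/
def Gate.results {ι : Type} (π : X → ι → ℂ) (gs : List (Gate ι)) : Set (X → ℂ) :=
  {f | ∃ i < gs.length, ∀ x, f x = (Gate.run gs (π x)).getD i 0}

theorem Gate.results_append {ι : Type} (π : X → ι → ℂ) (gs : List (Gate ι)) (g : Gate ι) :
    Gate.results π gs ⊆ Gate.results π (gs ++ [g]) := by
  rintro f ⟨i, hi, hf⟩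
  refine ⟨i, by simp; omega, fun x => ?_⟩
  rw [Gate.run_append, List.getD_append _ _ _ _ (by rwa [Gate.length_run])]
  exact hf x

theorem Gate.val_mem_results {ι : Type} (π : X → ι → ℂ) (gs : List (Gate ι)) (g : Gate ι) :
    (fun x => g.val (π x) (Gate.run gs (π x))) ∈ Gate.results π (gs ++ [g]) := by
  refine ⟨gs.length, by simp, fun x => ?_⟩
  rw [Gate.run_append, List.getD_append_right _ _ _ _ (by rw [Gate.length_run])]
  simp [Gate.length_run]

theorem Op.exists_gate {ι : Type} (π : X → ι → ℂ) (gs : List (Gate ι)) {f : X → ℂ}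
    (h : Op (Gate.results π gs) f) :
    ∃ g : Gate ι, f = fun x => g.val (π x) (Gate.run gs (π x)) := by
  cases h with
  | const z => exact ⟨.const z, rfl⟩
  | add hf hg =>
    obtain ⟨i, -, hi⟩ := hf
    obtain ⟨j, -, hj⟩ := hg
    exact ⟨.add i j, by funext x; simp [Gate.val, hi, hj]⟩
  | sub hf hg =>
    obtain ⟨i, -, hi⟩ := hf
    obtain ⟨j, -, hj⟩ := hg
    exact ⟨.sub i j, by funext x; simp [Gate.val, hi, hj]⟩
  | mul hf hg =>
    obtain ⟨i, -, hi⟩ := hf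
    obtain ⟨j, -, hj⟩ := hg
    exact ⟨.mul i j, by funext x; simp [Gate.val, hi, hj]⟩
  | div hf hg =>
    obtain ⟨i, -, hi⟩ := hf
    obtain ⟨j, -, hj⟩ := hg
    exact ⟨.div i j, by funext x; simp [Gate.val, hi, hj]⟩
  | sel hf hg hh =>
    obtain ⟨i, -, hi⟩ := hf
    obtain ⟨j, -, hj⟩ := hg
    obtain ⟨k, -, hk⟩ := hh
    exact ⟨.sel i j k, by funext x; simp [Gate.val, hi, hj, hk]⟩

theorem Der.exists_gates {ι : Type} (π : X → ι → ℂ) (h : Der A c B) (gs : List (Gate ι))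
    (hA : A ⊆ Gate.results π gs) :
    ∃ gs' : List (Gate ι), gs'.length ≤ gs.length + c ∧ B ⊆ Gate.results π gs' := by
  induction h generalizing gs with
  | done h => exact ⟨gs, by omega, h.trans hA⟩
  | @step A B c f hf h ih =>
    obtain ⟨g, rfl⟩ := (hf.mono hA).exists_gate π gs
    obtain ⟨gs', hl, hB⟩ := ih (gs ++ [g])
      (Set.insert_subset (Gate.val_mem_results π gs g) (hA.trans (Gate.results_append π gs g)))
    exact ⟨gs', by simp at hl; omega, hB⟩

theorem Gate.exists_inputs {ι : Type} (s : Finset ι) (π : X → ι → ℂ) :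
    ∃ gs : List (Gate ι), gs.length = s.card ∧ ∀ i ∈ s, (fun x => π x i) ∈ Gate.results π gs := by
  classical
  induction s using Finset.induction_on with
  | empty => exact ⟨[], by simp⟩
  | insert i s hi ih =>
    obtain ⟨gs, hl, hgs⟩ := ih
    refine ⟨gs ++ [.input i], by simp [hl, hi], fun j hj => ?_⟩
    rcases Finset.mem_insert.1 hj with rfl | hj
    · exact Gate.val_mem_results π gs (.input j)
    · exact Gate.results_append π gs _ (hgs j hj)

/-- A derivation from the coordinates of the input vector is carried out by a program. -/
theorem Der.exists_program {ι κ : Type} [Fintype ι] (π : X → ι → ℂ) (G : κ → X → ℂ)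
    (h : Der (Set.range fun i x => π x i) c (Set.range G)) :
    ∃ P : Program ι κ, P.cost ≤ Fintype.card ι + c ∧ ∀ x, P.eval (π x) = fun k => G k x := by
  obtain ⟨gs, hl, hgs⟩ := Gate.exists_inputs Finset.univ π
  obtain ⟨gs', hl', hB⟩ := h.exists_gates π gs (by
    rintro _ ⟨i, rfl⟩; exact hgs i (Finset.mem_univ i))
  choose out hout hval using fun k => hB ⟨k, rfl⟩
  refine ⟨⟨gs', out⟩, ?_, fun x => ?_⟩
  · simpa [Program.cost, hl, Finset.card_univ] using hl'
  · funext k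
    exact (hval k x).symm

end BallNS

namespace BallNS

open Polynomial Complex

/-! ### Fast Fourier, Toeplitz and chirp transforms -/

theorem sum_range_two_mul {M : Type*} [AddCommMonoid M] (f : ℕ → M) (n : ℕ) :
    ∑ i ∈ Finset.range (2 * n), f i =
      ∑ i ∈ Finset.range n, f (2 * i) + ∑ i ∈ Finset.range n, f (2 * i + 1) := by
  induction n with
  | zero => simp
  | succ n ih =>
    rw [show 2 * (n + 1) = 2 * n + 1 + 1 by ring, Finset.sum_range_succ, Finset.sum_range_succ, ih,
      Finset.sum_range_succ, Finset.sum_range_succ]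
    abel

section

variable {X : Type} {A : Set (X → ℂ)}

/-- The radix-two fast Fourier transform. -/
theorem Der.fft (k : ℕ) (ω : ℂ) (hω : ω ^ 2 ^ k = 1) (F : ℕ → X → ℂ) (hF : ∀ i < 2 ^ k, F i ∈ A) :
    Der A (4 * k * 2 ^ k)
      ((fun j x => ∑ i ∈ Finset.range (2 ^ k), ω ^ (i * j) * F i x) '' Finset.range (2 ^ k)) := by
  induction k generalizing ω F with
  | zero =>
    refine .done ?_
    rintro _ ⟨j, -, rfl⟩
    simpa using hF 0 (by simp)
  | succ k ih =>
    have hω2 : (ω ^ 2) ^ 2 ^ k = 1 := by rw [← pow_mul, ← pow_succ', hω]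
    have hE := ih (ω ^ 2) hω2 (fun i => F (2 * i)) fun i hi => hF _ (by rw [pow_succ]; omega)
    have hO := ih (ω ^ 2) hω2 (fun i => F (2 * i + 1)) fun i hi => hF _ (by rw [pow_succ]; omega)
    have hpos : 0 < 2 ^ k := by positivity
    refine ((hE.union hO).trans (Der.image (c := 3) (Finset.range (2 ^ (k + 1)))
      (fun j x => ∑ i ∈ Finset.range (2 ^ (k + 1)), ω ^ (i * j) * F i x) ?_)).mono_cost ?_
    · intro j _
      -- the two half-size transforms are periodic with period `2 ^ k`
      have hper : ∀ i, (ω ^ 2) ^ (i * (j % 2 ^ k)) = (ω ^ 2) ^ (i * j) := by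
        intro i
        conv_rhs => rw [← Nat.mod_add_div j (2 ^ k), mul_add, pow_add,
          show i * (2 ^ k * (j / 2 ^ k)) = 2 ^ k * (i * (j / 2 ^ k)) by ring, pow_mul _ (2 ^ k),
          hω2, one_pow, mul_one]
      have heq : (fun x => ∑ i ∈ Finset.range (2 ^ (k + 1)), ω ^ (i * j) * F i x) = fun x =>
          (∑ i ∈ Finset.range (2 ^ k), (ω ^ 2) ^ (i * (j % 2 ^ k)) * F (2 * i) x) + ω ^ j *
            ∑ i ∈ Finset.range (2 ^ k), (ω ^ 2) ^ (i * (j % 2 ^ k)) * F (2 * i + 1) x := by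
        funext x
        rw [show 2 ^ (k + 1) = 2 * 2 ^ k by ring, sum_range_two_mul]
        simp only [hper, Finset.mul_sum, ← pow_mul]
        congr 1
        · exact Finset.sum_congr rfl fun i _ => by ring_nf
        · exact Finset.sum_congr rfl fun i _ => by ring_nf
      rw [heq]
      refine (Der.add (a := 0) (b := 2) (Der.of_mem ?_) (Der.smul _ (Der.of_mem (c := 0) ?_)))
      · exact Or.inr (Or.inl ⟨j % 2 ^ k, by simpa using Nat.mod_lt _ hpos, rfl⟩)
      · exact Or.inr (Or.inr ⟨j % 2 ^ k, by simpa using Nat.mod_lt _ hpos, rfl⟩)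
    · rw [Finset.card_range, pow_succ]
      nlinarith

/-- Every function on `ℤ/K` is a combination of the powers of a `K`-th root of unity. -/
theorem exists_fourier_expansion (K : ℕ) [NeZero K] : ∃ ω : ℂ, ω ^ K = 1 ∧
    ∀ t : ZMod K → ℂ, ∃ c : ℕ → ℂ, ∀ i j : ℕ, t ((j : ZMod K) - (i : ZMod K)) =
      ∑ m ∈ Finset.range K, ω ^ (m * j) * (c m * (ω⁻¹) ^ (i * m)) := by
  let ω : ℂ := ZMod.stdAddChar (1 : ZMod K)
  have hpow : ∀ m : ℕ, ω ^ m = ZMod.stdAddChar (m : ZMod K) := by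
    intro m
    rw [← nsmul_one m]
    exact (AddChar.map_nsmul_eq_pow ZMod.stdAddChar m 1).symm
  have h1 : ω ^ K = 1 := by rw [hpow]; simp
  have h0 : ω ≠ 0 := by
    intro h; rw [h, zero_pow (NeZero.ne K)] at h1; exact zero_ne_one h1
  refine ⟨ω, h1, fun t => ⟨fun m => (K : ℂ)⁻¹ * ZMod.dft t (m : ZMod K), fun i j => ?_⟩⟩
  have := congrFun (ZMod.dft.symm_apply_apply t) ((j : ZMod K) - (i : ZMod K))
  rw [← this, ZMod.invDFT_apply]
  simp only [smul_eq_mul, Finset.mul_sum]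
  refine (Finset.sum_bij (s := Finset.range K) (t := (Finset.univ : Finset (ZMod K)))
    (fun m _ => (m : ZMod K)) (fun _ _ => Finset.mem_univ _) ?_ ?_ ?_).symm
  · intro a ha b hb hab
    have := congrArg ZMod.val hab
    rwa [ZMod.val_natCast_of_lt (Finset.mem_range.1 ha),
      ZMod.val_natCast_of_lt (Finset.mem_range.1 hb)] at this
  · intro b _
    exact ⟨b.val, Finset.mem_range.2 (ZMod.val_lt b), ZMod.natCast_zmod_val b⟩
  · intro m _
    rw [mul_sub, AddChar.map_sub_eq_div, ← Nat.cast_mul, ← Nat.cast_mul, ← hpow, ← hpow, inv_pow,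
      mul_comm i m]
    field_simp

/-- The logarithmic factor in the cost of the fast transforms. -/
def lg (N : ℕ) : ℕ := Nat.size N + 2

theorem lg_mono {M N : ℕ} (h : M ≤ N) : lg M ≤ lg N := Nat.add_le_add_right (Nat.size_le_size h) 2

theorem four_mul_lt_two_pow_lg (N : ℕ) : 4 * N < 2 ^ lg N := by
  have := Nat.lt_size_self N
  rw [lg, pow_add]; omega

theorem two_pow_lg_le (N : ℕ) : 2 ^ lg N ≤ 8 * N + 4 := by
  rw [lg, pow_add]
  rcases Nat.eq_zero_or_pos N with rfl | h
  · simp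
  · obtain ⟨s, hs⟩ : ∃ s, Nat.size N = s + 1 :=
      ⟨Nat.size N - 1, by have := Nat.size_pos.2 h; omega⟩
    have : 2 ^ s ≤ N := Nat.lt_size.1 (by omega)
    rw [hs, pow_succ]; omega

/-- The product of a fixed Toeplitz matrix and a vector, through a circulant matrix whose size is a
power of two and which is diagonalized by the Fourier transform. -/
theorem Der.toeplitz (N : ℕ) (t : ℤ → ℂ) (F : ℤ → X → ℂ)
    (hF : ∀ i ∈ Finset.Icc (-N : ℤ) N, F i ∈ A) :
    Der A (100 * (N + 1) * lg N)
      ((fun j x => ∑ i ∈ Finset.Icc (-N : ℤ) N, t (j - i) * F i x) '' Finset.Icc (-N : ℤ) N) := by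
  set k := lg N with hk
  have hK := four_mul_lt_two_pow_lg N
  have hK2 := two_pow_lg_le N
  rw [← hk] at hK hK2
  set K := 2 ^ k with hKdef
  have : NeZero K := ⟨by positivity⟩
  obtain ⟨ω, hω, hex⟩ := exists_fourier_expansion K
  -- a function on `ℤ/K` that agrees with `t` on `[-2 N, 2 N]`
  let t' : ZMod K → ℂ := fun z =>
    if (z.val : ℤ) ≤ 2 * N then t z.val else t ((z.val : ℤ) - K)
  have ht' : ∀ i j : ℕ, i ≤ 2 * N → j ≤ 2 * N →
      t' ((j : ZMod K) - (i : ZMod K)) = t ((j : ℤ) - i) := by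
    intro i j hi hj
    rcases Nat.lt_or_ge j i with h | h
    · have : ((j : ZMod K) - (i : ZMod K)) = ((K + j - i : ℕ) : ZMod K) := by
        rw [Nat.cast_sub (by omega)]; simp
      simp only [t']
      rw [this, ZMod.val_natCast_of_lt (by omega), if_neg (by omega)]
      congr 1; omega
    · have : ((j : ZMod K) - (i : ZMod K)) = ((j - i : ℕ) : ZMod K) := by
        rw [Nat.cast_sub h]
      simp only [t']
      rw [this, ZMod.val_natCast_of_lt (by omega), if_pos (by omega)]
      congr 1; omega
  obtain ⟨c, hc⟩ := hex t'
  let F' : ℕ → X → ℂ := fun i => if i ≤ 2 * N then F ((i : ℤ) - N) else fun _ => 0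
  have h1 : Der A 1 (F' '' Finset.range K) := by
    refine ((Der.const 0).keep).mono_right ?_
    rintro _ ⟨i, -, rfl⟩
    by_cases hi : i ≤ 2 * N
    · simp only [F', if_pos hi]
      exact Or.inl (hF _ (by simp only [Finset.mem_Icc]; omega))
    · simp only [F', if_neg hi]; exact Or.inr rfl
  have hω' : (ω⁻¹) ^ 2 ^ k = 1 := by rw [inv_pow, ← hKdef, hω, inv_one]
  have h2 := Der.fft (A := A ∪ F' '' Finset.range K) k ω⁻¹ hω' F' fun i hi =>
    Or.inr ⟨i, by simpa using hi, rfl⟩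
  rw [← hKdef] at h2
  let G : ℕ → X → ℂ := fun m x => c m * ∑ i ∈ Finset.range K, ω⁻¹ ^ (i * m) * F' i x
  have h3 : Der (A ∪ F' '' Finset.range K ∪
      (fun j x => ∑ i ∈ Finset.range K, ω⁻¹ ^ (i * j) * F' i x) '' Finset.range K)
      (K * 2) (G '' Finset.range K) := by
    have := Der.image (c := 2) (A := (A ∪ F' '' Finset.range K ∪
      (fun j x => ∑ i ∈ Finset.range K, ω⁻¹ ^ (i * j) * F' i x) '' Finset.range K))
      (Finset.range K) G fun m hm => Der.smul (c m) (Der.of_mem (c := 0) (Or.inr ⟨m, hm, rfl⟩))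
    simpa using this
  have h4 := Der.fft (A := G '' Finset.range K) k ω (by rw [← hKdef, hω]) G fun i hi =>
    ⟨i, by simpa using hi, rfl⟩
  rw [← hKdef] at h4
  refine ((h1.trans (h2.trans (h3.trans (h4.mono_left Set.subset_union_right)))).mono le_rfl ?_ ?_)
  · have : 1 ≤ k := by simp [hk, lg]
    nlinarith
  · rintro _ ⟨j, hj, rfl⟩
    simp only [Finset.coe_Icc, Set.mem_Icc] at hj
    obtain ⟨j', rfl⟩ : ∃ j' : ℕ, j = (j' : ℤ) - N := ⟨(j + N).toNat, by omega⟩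
    refine ⟨j', by simp; omega, ?_⟩
    funext x
    have hsum : ∑ i ∈ Finset.Icc (-N : ℤ) N, t ((j' : ℤ) - N - i) * F i x =
        ∑ i ∈ Finset.range (2 * N + 1), t ((j' : ℤ) - i) * F ((i : ℤ) - N) x := by
      refine (Finset.sum_bij (fun (i : ℕ) _ => (i : ℤ) - N) ?_ ?_ ?_ ?_).symm
      · intro i hi; simp only [Finset.mem_range, Finset.mem_Icc] at hi ⊢; omega
      · intro i _ i' _ h; omega
      · intro b hb
        simp only [Finset.mem_Icc] at hb
        exact ⟨(b + N).toNat, by simp; omega, by omega⟩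
      · intro i hi; congr 2; ring
    have hsum' : ∑ i ∈ Finset.range (2 * N + 1), t ((j' : ℤ) - i) * F ((i : ℤ) - N) x =
        ∑ i ∈ Finset.range K, t' ((j' : ZMod K) - (i : ZMod K)) * F' i x := by
      rw [← Finset.sum_subset (Finset.range_subset_range.2 (by omega : 2 * N + 1 ≤ K))]
      · refine Finset.sum_congr rfl fun i hi => ?_
        have hi' : i ≤ 2 * N := by simp at hi; omega
        rw [ht' i j' hi' (by omega)]
        simp [F', hi']
      · intro i _ hi
        have : ¬ i ≤ 2 * N := by simp at hi; omega
        simp [F', this]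
    beta_reduce
    rw [hsum, hsum']
    simp only [hc, G, Finset.sum_mul, Finset.mul_sum]
    rw [Finset.sum_comm]
    refine Finset.sum_congr rfl fun i _ => Finset.sum_congr rfl fun m _ => ?_
    ring

/-- Evaluation of a trigonometric sum at the points of a geometric progression. -/
theorem Der.chirp (N : ℕ) (ω : ℂ) (hω : ω ≠ 0) (F : ℤ → X → ℂ)
    (hF : ∀ i ∈ Finset.Icc (-N : ℤ) N, F i ∈ A) :
    Der A (120 * (N + 1) * lg N)
      ((fun j x => ∑ i ∈ Finset.Icc (-N : ℤ) N, ω ^ (i * j) * F i x) '' Finset.Icc (-N : ℤ) N) := by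
  obtain ⟨ζ, rfl⟩ : ∃ ζ : ℂ, ζ ^ 2 = ω := IsAlgClosed.exists_pow_nat_eq ω two_pos
  have hζ : ζ ≠ 0 := by rintro rfl; simp at hω
  -- `2 i j = i² + j² - (j - i)²`
  let G : ℤ → X → ℂ := fun i x => ζ ^ (i ^ 2) * F i x
  have h1 := Der.image (A := A) (c := 2) (Finset.Icc (-N : ℤ) N) G fun i hi =>
    Der.smul _ (Der.of_mem (c := 0) (hF i hi))
  have h2 := Der.toeplitz (A := A ∪ G '' Finset.Icc (-N : ℤ) N) N (fun s => ζ ^ (-s ^ 2)) G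
    fun i hi => Or.inr ⟨i, hi, rfl⟩
  let H : ℤ → X → ℂ := fun j x => ∑ i ∈ Finset.Icc (-N : ℤ) N, ζ ^ (-(j - i) ^ 2) * G i x
  have h3 := Der.image (A := H '' Finset.Icc (-N : ℤ) N) (c := 2) (Finset.Icc (-N : ℤ) N)
    (fun j x => ζ ^ (j ^ 2) * H j x) fun i hi => Der.smul _ (Der.of_mem (c := 0) ⟨i, hi, rfl⟩)
  refine (h1.trans (h2.trans (h3.mono_left Set.subset_union_right))).mono le_rfl ?_ ?_
  · have : (Finset.Icc (-N : ℤ) N).card = 2 * N + 1 := by simp; omega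
    rw [this]
    have : 2 ≤ lg N := by simp [lg]
    nlinarith
  · rintro _ ⟨j, hj, rfl⟩
    refine ⟨j, hj, ?_⟩
    funext x
    simp only [H, G, Finset.mul_sum, ← mul_assoc, ← zpow_add₀ hζ]
    refine Finset.sum_congr rfl fun i _ => ?_
    rw [← zpow_natCast, ← zpow_mul]
    congr 2; push_cast; ring

end

end BallNS

namespace BallNS

open Polynomial Complex

/-! ### Fast transforms for three-term recurrences -/

theorem sum_Icc_eq_finsum (N : ℕ) (f : ℤ → ℂ) (hf : ∀ s, s ∉ Finset.Icc (-N : ℤ) N → f s = 0) :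
    ∑ s ∈ Finset.Icc (-N : ℤ) N, f s = ∑ᶠ s, f s :=
  (finsum_eq_sum_of_support_subset f fun s hs => by
    by_contra h; exact hs (hf s h)).symm

theorem sum_Icc_shift (N : ℕ) (i : ℤ) (f : ℤ → ℂ) (hf : ∀ s, s ∉ Finset.Icc (-N : ℤ) N → f s = 0)
    (hf' : ∀ s, s ∉ Finset.Icc (-N : ℤ) N → f (s + i) = 0) :
    ∑ s ∈ Finset.Icc (-N : ℤ) N, f (s + i) = ∑ s ∈ Finset.Icc (-N : ℤ) N, f s := by
  rw [sum_Icc_eq_finsum N f hf, sum_Icc_eq_finsum N (fun s => f (s + i)) hf']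
  exact finsum_comp_equiv (Equiv.addRight i)

theorem sum_Icc_neg (N : ℕ) (f : ℤ → ℂ) :
    ∑ s ∈ Finset.Icc (-N : ℤ) N, f (-s) = ∑ s ∈ Finset.Icc (-N : ℤ) N, f s :=
  Finset.sum_bij (fun s _ => -s) (fun s hs => by simp only [Finset.mem_Icc] at hs ⊢; omega)
    (fun _ _ _ _ h => neg_injective h)
    (fun b hb => ⟨-b, by simp only [Finset.mem_Icc] at hb ⊢; omega, neg_neg b⟩) fun _ _ => rfl

theorem sum_Icc_kernel (N m : ℕ) (U f : ℤ → ℂ) (hU : ∀ s : ℤ, (m : ℤ) < |s| → U s = 0) (i : ℤ)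
    (hi : |i| + m ≤ N) :
    ∑ s ∈ Finset.Icc (-N : ℤ) N, U (s - i) * f s =
      ∑ s ∈ Finset.Icc (-N : ℤ) N, U s * f (s + i) := by
  have h0 := abs_nonneg i
  have hm : (m : ℤ) ≤ N := by omega
  rw [← sum_Icc_shift N i (fun s => U (s - i) * f s)]
  · simp
  · intro s hs
    rw [hU _ ?_, zero_mul]
    simp only [Finset.mem_Icc] at hs
    rcases abs_cases (s - i) with h | h <;> rcases abs_cases i with h' | h' <;> omega
  · intro s hs
    simp only [add_sub_cancel_right]
    rw [hU _ ?_, zero_mul]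
    simp only [Finset.mem_Icc] at hs
    rcases abs_cases s with h | h <;> omega

/-- Arrays `a j l` with `a_{l + 2} = α_l (z + z⁻¹) a_{l + 1} + γ_l a_l`, where `z` acts as the shift
in the index `j`. -/
def IsRec (α γ : ℕ → ℂ) (a : ℤ → ℕ → ℂ) : Prop :=
  ∀ j l, a j (l + 2) = α l * (a (j - 1) (l + 1) + a (j + 1) (l + 1)) + γ l * a j l

/-- The columns `L + i` of all arrays that satisfy the same recurrence depend on the columns `L` and
`L + 1` through convolution with fixed sequences of length `O(i)`. -/
theorem IsRec.exists_kernel (α γ : ℕ → ℂ) (L i : ℕ) : ∃ U V : ℤ → ℂ,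
    (∀ s : ℤ, (i : ℤ) < |s| → U s = 0) ∧ (∀ s : ℤ, (i : ℤ) < |s| → V s = 0) ∧
    ∀ a : ℤ → ℕ → ℂ, IsRec α γ a → ∀ (j : ℤ) (N : ℕ), i ≤ N → a j (L + i) =
      ∑ s ∈ Finset.Icc (-N : ℤ) N, (U s * a (s + j) L + V s * a (s + j) (L + 1)) := by
  induction i using Nat.twoStepInduction with
  | zero =>
    refine ⟨fun s => if s = 0 then 1 else 0, fun _ => 0, ?_, fun _ _ => rfl, ?_⟩
    · intro s hs
      exact if_neg (by rintro rfl; simp at hs)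
    · intro a _ j N _
      simp
  | one =>
    refine ⟨fun _ => 0, fun s => if s = 0 then 1 else 0, fun _ _ => rfl, ?_, ?_⟩
    · intro s hs
      exact if_neg (by rintro rfl; simp at hs)
    · intro a _ j N _
      simp
  | more i ih ih' =>
    obtain ⟨U, V, hU, hV, h⟩ := ih
    obtain ⟨U', V', hU', hV', h'⟩ := ih'
    have habs : ∀ s : ℤ, ((i + 2 : ℕ) : ℤ) < |s| →
        ((i + 1 : ℕ) : ℤ) < |s + 1| ∧ ((i + 1 : ℕ) : ℤ) < |s - 1| ∧ (i : ℤ) < |s| := by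
      intro s hs
      rcases abs_cases s with h | h <;> rcases abs_cases (s + 1) with h' | h' <;>
        rcases abs_cases (s - 1) with h'' | h'' <;> push_cast at hs ⊢ <;> omega
    refine ⟨fun s => α (L + i) * (U' (s + 1) + U' (s - 1)) + γ (L + i) * U s,
      fun s => α (L + i) * (V' (s + 1) + V' (s - 1)) + γ (L + i) * V s, ?_, ?_, ?_⟩
    · intro s hs
      obtain ⟨h1, h2, h3⟩ := habs s hs
      simp [hU' _ h1, hU' _ h2, hU _ h3]
    · intro s hs
      obtain ⟨h1, h2, h3⟩ := habs s hs
      simp [hV' _ h1, hV' _ h2, hV _ h3]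
    · intro a ha j N hN
      have e1 : ∀ (W : ℤ → ℂ) (l : ℕ), (∀ s : ℤ, ((i + 1 : ℕ) : ℤ) < |s| → W s = 0) →
          ∑ s ∈ Finset.Icc (-N : ℤ) N, W (s + 1) * a (s + j) l =
            ∑ s ∈ Finset.Icc (-N : ℤ) N, W s * a (s + (j - 1)) l := by
        intro W l hW
        have := sum_Icc_kernel N (i + 1) W (fun s => a (s + j) l) hW (-1) (by simp; omega)
        simp only [sub_neg_eq_add] at this
        rw [this]
        exact Finset.sum_congr rfl fun s _ => by congr 2; ring
      have e2 : ∀ (W : ℤ → ℂ) (l : ℕ), (∀ s : ℤ, ((i + 1 : ℕ) : ℤ) < |s| → W s = 0) →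
          ∑ s ∈ Finset.Icc (-N : ℤ) N, W (s - 1) * a (s + j) l =
            ∑ s ∈ Finset.Icc (-N : ℤ) N, W s * a (s + (j + 1)) l := by
        intro W l hW
        have := sum_Icc_kernel N (i + 1) W (fun s => a (s + j) l) hW 1 (by simp; omega)
        rw [this]
        exact Finset.sum_congr rfl fun s _ => by congr 2; ring
      rw [← add_assoc, ha, add_assoc L i 1, h' a ha (j - 1) N (by omega),
        h' a ha (j + 1) N (by omega), h a ha j N (by omega)]
      simp only [Finset.sum_add_distrib]
      rw [← e1 U' L hU', ← e1 V' (L + 1) hV', ← e2 U' L hU', ← e2 V' (L + 1) hV']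
      simp only [← Finset.sum_add_distrib, Finset.mul_sum]
      exact Finset.sum_congr rfl fun s _ => by ring

theorem lg_two_pow (k : ℕ) : lg (2 ^ k) = k + 3 := by
  simp [lg, Nat.size_pow]

section

variable {X : Type} {A : Set (X → ℂ)}

/-- Two Toeplitz products and the sum of the results. -/
theorem Der.toeplitz₂ (N : ℕ) (t t' : ℤ → ℂ) (F F' : ℤ → X → ℂ)
    (hF : ∀ i ∈ Finset.Icc (-N : ℤ) N, F i ∈ A) (hF' : ∀ i ∈ Finset.Icc (-N : ℤ) N, F' i ∈ A) :
    Der A (202 * (N + 1) * lg N)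
      ((fun j x => ∑ i ∈ Finset.Icc (-N : ℤ) N, (t (j - i) * F i x + t' (j - i) * F' i x)) ''
        Finset.Icc (-N : ℤ) N) := by
  have h1 := Der.toeplitz N t F hF
  have h2 := Der.toeplitz N t' F' hF'
  refine ((h1.union h2).trans (Der.image (c := 1) (Finset.Icc (-N : ℤ) N) _ fun j hj =>
    ?_)).mono_cost ?_
  · simp only [Finset.sum_add_distrib]
    exact .op (.add (Or.inr (Or.inl ⟨j, hj, rfl⟩)) (Or.inr (Or.inr ⟨j, hj, rfl⟩)))
  · have h3 : (Finset.Icc (-N : ℤ) N).card = 2 * N + 1 := by simp; omega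
    have h4 : 2 ≤ lg N := by simp [lg]
    rw [h3]; nlinarith

/-- Divide and conquer: the entries `a_0 (L + i)`, `i < 2 ^ h`, of a recurrent array, from a window
of the columns `L` and `L + 1`. -/
theorem Der.rec_analysis (α γ : ℕ → ℂ) (h : ℕ) : ∀ (A : Set (X → ℂ)) (L : ℕ) (a : X → ℤ → ℕ → ℂ),
    (∀ x, IsRec α γ (a x)) →
    (∀ j ∈ Finset.Icc (-(2 * 2 ^ h : ℕ) : ℤ) (2 * 2 ^ h : ℕ),
      (fun x => a x j L) ∈ A ∧ (fun x => a x j (L + 1)) ∈ A) →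
    Der A (1100 * 2 ^ h * (h + 5) ^ 2) ((fun i x => a x 0 (L + i)) '' Finset.range (2 ^ h)) := by
  induction h with
  | zero =>
    intro A L a _ hA
    refine .done ?_
    rintro _ ⟨i, hi, rfl⟩
    obtain rfl : i = 0 := by simpa using hi
    exact (hA 0 (by simp)).1
  | succ h ih =>
    intro A L a ha hA
    set H := 2 ^ h with hH
    have hH1 : 1 ≤ H := Nat.one_le_two_pow
    have hpow : 2 ^ (h + 1) = 2 * H := by rw [pow_succ]; ring
    have h1 := ih A L a ha fun j hj => hA j (by
      simp only [Finset.mem_Icc] at hj ⊢; rw [hpow]; push_cast at hj ⊢; omega)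
    set N := 4 * H with hN
    have hA' : ∀ j ∈ Finset.Icc (-N : ℤ) N,
        (fun x => a x j L) ∈ A ∧ (fun x => a x j (L + 1)) ∈ A := fun j hj => hA j (by
      simp only [Finset.mem_Icc] at hj ⊢; rw [hpow]; push_cast at hj ⊢; omega)
    obtain ⟨U, V, hU, hV, hk⟩ := IsRec.exists_kernel α γ L H
    obtain ⟨U', V', hU', hV', hk'⟩ := IsRec.exists_kernel α γ L (H + 1)
    have key : ∀ (m : ℕ) (U V : ℤ → ℂ), m ≤ H + 1 → (∀ s : ℤ, (m : ℤ) < |s| → U s = 0) →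
        (∀ s : ℤ, (m : ℤ) < |s| → V s = 0) →
        (∀ a : ℤ → ℕ → ℂ, IsRec α γ a → ∀ (j : ℤ) (N : ℕ), m ≤ N → a j (L + m) =
          ∑ s ∈ Finset.Icc (-N : ℤ) N, (U s * a (s + j) L + V s * a (s + j) (L + 1))) →
        Der A (202 * (N + 1) * lg N) ((fun j x => a x j (L + m)) ''
          Finset.Icc (-(2 * H : ℕ) : ℤ) (2 * H : ℕ)) := by
      intro m U V hm hU hV hk
      refine (Der.toeplitz₂ N (fun s => U (-s)) (fun s => V (-s)) (fun i x => a x i L)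
        (fun i x => a x i (L + 1)) (fun i hi => (hA' i hi).1) fun i hi => (hA' i hi).2).mono_right
        ?_
      rintro _ ⟨j, hj, rfl⟩
      simp only [Finset.coe_Icc, Set.mem_Icc] at hj
      refine ⟨j, by simp only [Finset.coe_Icc, Set.mem_Icc]; push_cast at hj ⊢; omega, ?_⟩
      funext x
      have hj' : |j| + m ≤ N := by
        rcases abs_cases j with h | h <;> push_cast at hj ⊢ <;> omega
      beta_reduce
      rw [hk (a x) (ha x) j N (by omega), Finset.sum_add_distrib, Finset.sum_add_distrib]
      simp only [neg_sub]
      rw [sum_Icc_kernel N m U (fun s => a x s L) hU j hj',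
        sum_Icc_kernel N m V (fun s => a x s (L + 1)) hV j hj']
    have h2 := (key H U V (by omega) hU hV hk).union (key (H + 1) U' V' le_rfl hU' hV' hk')
    have h3 := h2.trans (ih _ (L + H) a ha fun j hj =>
      ⟨Or.inr (Or.inl ⟨j, hj, rfl⟩), Or.inr (Or.inr ⟨j, hj, rfl⟩)⟩)
    refine (h1.union h3).mono le_rfl ?_ ?_
    · have hlg : lg N = h + 5 := by
        rw [hN, hH, show 4 * 2 ^ h = 2 ^ (h + 2) by ring, lg_two_pow]
      rw [hlg, hpow]
      nlinarith [Nat.zero_le (H * h), Nat.zero_le (H * h * h)]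
    · rintro _ ⟨i, hi, rfl⟩
      simp only [Finset.coe_range, Set.mem_Iio, hpow] at hi
      rcases Nat.lt_or_ge i H with hlt | hge
      · exact Or.inl ⟨i, by simpa using hlt, rfl⟩
      · refine Or.inr ⟨i - H, by simp; omega, ?_⟩
        funext x
        beta_reduce
        rw [add_assoc, Nat.add_sub_cancel' hge]

/-- Divide and conquer, transposed: a combination of the columns `L + i`, `i < 2 ^ h`, of any
array with the given recurrence is expressed by its columns `L` and `L + 1`. -/
theorem Der.rec_synthesis (α γ : ℕ → ℂ) (h : ℕ) : ∀ (A : Set (X → ℂ)) (L : ℕ) (c : ℕ → X → ℂ),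
    (fun _ => 0) ∈ A → (∀ i < 2 ^ h, c i ∈ A) →
    ∃ P Q : ℤ → X → ℂ,
      (∀ s : ℤ, (2 * 2 ^ h : ℕ) < |s| → P s = fun _ => 0) ∧
      (∀ s : ℤ, (2 * 2 ^ h : ℕ) < |s| → Q s = fun _ => 0) ∧
      Der A (1100 * 2 ^ h * (h + 5) ^ 2) (Set.range P ∪ Set.range Q) ∧
      ∀ (x : X) (a : ℤ → ℕ → ℂ), IsRec α γ a → ∀ (j : ℤ) (N : ℕ), 2 * 2 ^ h ≤ N →
        ∑ i ∈ Finset.range (2 ^ h), c i x * a j (L + i) =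
          ∑ s ∈ Finset.Icc (-N : ℤ) N, (P s x * a (s + j) L + Q s x * a (s + j) (L + 1)) := by
  induction h with
  | zero =>
    intro A L c hA hc
    refine ⟨fun s => if s = 0 then c 0 else fun _ => 0, fun _ _ => 0, ?_, fun _ _ => rfl, .done ?_,
      ?_⟩
    · intro s hs
      exact if_neg (by rintro rfl; simp at hs)
    · rintro _ (⟨s, rfl⟩ | ⟨s, rfl⟩)
      · beta_reduce
        split_ifs
        exacts [hc 0 (by simp), hA]
      · exact hA
    · intro x a _ j N _
      rw [Finset.sum_eq_single_of_mem (0 : ℤ) (by simp)]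
      · simp
      · intro s _ hs
        simp [hs]
  | succ h ih =>
    intro A L c hA hc
    set H := 2 ^ h with hH
    have hH1 : 1 ≤ H := Nat.one_le_two_pow
    have hpow : 2 ^ (h + 1) = 2 * H := by rw [pow_succ]; ring
    rw [hpow] at hc ⊢
    obtain ⟨P₁, Q₁, hP₁, hQ₁, hd₁, hs₁⟩ := ih A L c hA fun i hi => hc i (by omega)
    obtain ⟨P₂, Q₂, hP₂, hQ₂, hd₂, hs₂⟩ := ih A (L + H) (fun i => c (H + i)) hA fun i hi =>
      hc _ (by omega)
    obtain ⟨U, V, hU, hV, hk⟩ := IsRec.exists_kernel α γ L H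
    obtain ⟨U', V', hU', hV', hk'⟩ := IsRec.exists_kernel α γ L (H + 1)
    set N := 4 * H with hN
    -- the second half is carried back to the columns `L` and `L + 1` by the kernels
    let P : ℤ → X → ℂ := fun s => if s ∈ Finset.Icc (-N : ℤ) N then fun x => P₁ s x +
      ∑ i ∈ Finset.Icc (-N : ℤ) N, (U (s - i) * P₂ i x + U' (s - i) * Q₂ i x) else fun _ => 0
    let Q : ℤ → X → ℂ := fun s => if s ∈ Finset.Icc (-N : ℤ) N then fun x => Q₁ s x +
      ∑ i ∈ Finset.Icc (-N : ℤ) N, (V (s - i) * P₂ i x + V' (s - i) * Q₂ i x) else fun _ => 0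
    have hcard : (Finset.Icc (-N : ℤ) N).card = 2 * N + 1 := by simp; omega
    refine ⟨P, Q, ?_, ?_, ?_, ?_⟩
    · intro s hs
      simp only [P]
      rw [if_neg]
      simp only [Finset.mem_Icc]
      rcases abs_cases s with h | h <;> push_cast at hs ⊢ <;> omega
    · intro s hs
      simp only [Q]
      rw [if_neg]
      simp only [Finset.mem_Icc]
      rcases abs_cases s with h | h <;> push_cast at hs ⊢ <;> omega
    · have key : ∀ (U U' : ℤ → ℂ) (P₁ : ℤ → X → ℂ),
          Der (A ∪ (Set.range P₁ ∪ (Set.range P₂ ∪ Set.range Q₂)))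
            (202 * (N + 1) * lg N + (2 * N + 1)) (Set.range fun s : ℤ =>
              if s ∈ Finset.Icc (-N : ℤ) N then fun x => P₁ s x +
                ∑ i ∈ Finset.Icc (-N : ℤ) N, (U (s - i) * P₂ i x + U' (s - i) * Q₂ i x)
              else fun _ => 0) := by
        intro U U' P₁
        have h1 := Der.toeplitz₂ (A := A ∪ (Set.range P₁ ∪ (Set.range P₂ ∪ Set.range Q₂))) N U U' P₂
          Q₂ (fun i _ => Or.inr (Or.inr (Or.inl ⟨i, rfl⟩)))
          (fun i _ => Or.inr (Or.inr (Or.inr ⟨i, rfl⟩)))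
        have h2 := h1.trans (Der.keep (Der.image (c := 1) (Finset.Icc (-N : ℤ) N) (fun s x =>
            P₁ s x + ∑ i ∈ Finset.Icc (-N : ℤ) N, (U (s - i) * P₂ i x + U' (s - i) * Q₂ i x))
          fun s hs =>
          .op (.add (f := P₁ s) (Or.inl (Or.inr (Or.inl ⟨s, rfl⟩))) (Or.inr ⟨s, hs, rfl⟩))))
        refine h2.mono le_rfl (by rw [hcard, mul_one]) ?_
        rintro _ ⟨s, rfl⟩
        beta_reduce
        split_ifs with hs
        · exact Or.inr ⟨s, hs, rfl⟩
        · exact Or.inl (Or.inl (Or.inl hA))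
      have h3 := (hd₁.union hd₂).trans (((key U U' P₁).mono_left (A' := A ∪ (Set.range P₁ ∪
        Set.range Q₁ ∪ (Set.range P₂ ∪ Set.range Q₂))) ?_).union ((key V V' Q₁).mono_left ?_))
      · refine h3.mono_cost ?_
        have hlg : lg N = h + 5 := by
          rw [hN, hH, show 4 * 2 ^ h = 2 ^ (h + 2) by ring, lg_two_pow]
        rw [hlg]
        nlinarith [Nat.zero_le (H * h), Nat.zero_le (H * h * h)]
      · intro u; simp only [Set.mem_union]; tauto
      · intro u; simp only [Set.mem_union]; tauto
    · intro x a ha j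
      -- the window may be chosen to be exactly `[-N, N]`
      have main : ∑ i ∈ Finset.range (2 * H), c i x * a j (L + i) =
          ∑ s ∈ Finset.Icc (-N : ℤ) N, (P s x * a (s + j) L + Q s x * a (s + j) (L + 1)) := by
        rw [two_mul, Finset.sum_range_add, hs₁ x a ha j N (by omega)]
        have e := hs₂ x a ha j N (by omega)
        simp only [add_assoc L H] at e
        rw [e]
        have hkey : ∀ (m : ℕ) (U V : ℤ → ℂ) (R : ℤ → X → ℂ), m ≤ H + 1 →
            (∀ s : ℤ, (m : ℤ) < |s| → U s = 0) → (∀ s : ℤ, (m : ℤ) < |s| → V s = 0) →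
            (∀ a : ℤ → ℕ → ℂ, IsRec α γ a → ∀ (j : ℤ) (N : ℕ), m ≤ N → a j (L + m) =
              ∑ s ∈ Finset.Icc (-N : ℤ) N, (U s * a (s + j) L + V s * a (s + j) (L + 1))) →
            (∀ s : ℤ, (2 * H : ℕ) < |s| → R s = fun _ => 0) →
            ∑ s ∈ Finset.Icc (-N : ℤ) N, R s x * a (s + j) (L + m) =
              ∑ s ∈ Finset.Icc (-N : ℤ) N, ∑ i ∈ Finset.Icc (-N : ℤ) N,
                (U (s - i) * R i x * a (s + j) L + V (s - i) * R i x * a (s + j) (L + 1)) := by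
          intro m U V R hm hU hV hk hR
          rw [Finset.sum_comm]
          refine Finset.sum_congr rfl fun i _ => ?_
          by_cases hi : (2 * H : ℕ) < |i|
          · simp [hR i hi]
          · have hi' : |i| + m ≤ N := by push_cast at hi ⊢; omega
            rw [hk a ha (i + j) N (by omega), Finset.mul_sum, Finset.sum_add_distrib]
            have e1 := sum_Icc_kernel N m U (fun s => a (s + j) L) hU i hi'
            have e2 := sum_Icc_kernel N m V (fun s => a (s + j) (L + 1)) hV i hi'
            have e3 : ∀ (W : ℤ → ℂ) (l : ℕ), ∑ s ∈ Finset.Icc (-N : ℤ) N,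
                W (s - i) * R i x * a (s + j) l =
                R i x * ∑ s ∈ Finset.Icc (-N : ℤ) N, W (s - i) * a (s + j) l := by
              intro W l
              rw [Finset.mul_sum]
              exact Finset.sum_congr rfl fun s _ => by ring
            rw [e3, e3, e1, e2, Finset.mul_sum, Finset.mul_sum, ← Finset.sum_add_distrib]
            exact Finset.sum_congr rfl fun s _ => by rw [add_assoc s i j]; ring
        simp only [Finset.sum_add_distrib] at hkey hk hk' ⊢
        rw [hkey H U V P₂ (by omega) hU hV hk hP₂, hkey (H + 1) U' V' Q₂ le_rfl hU' hV' hk' hQ₂]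
        simp only [← Finset.sum_add_distrib]
        refine Finset.sum_congr rfl fun s hs => ?_
        simp only [P, Q, if_pos hs, add_mul, Finset.sum_mul, Finset.sum_add_distrib]
        ring
      intro N' hN'
      rw [main]
      refine Finset.sum_subset (Finset.Icc_subset_Icc ?_ ?_) fun s _ hs => ?_
      · omega
      · omega
      · simp only [P, Q, if_neg hs]; ring

theorem lg_four_mul_add_two (N : ℕ) : lg (4 * N + 2) ≤ lg N + 2 := by
  have h := Nat.lt_size_self N
  have : Nat.size (4 * N + 2) ≤ Nat.size N + 2 := Nat.size_le.2 (by rw [pow_add]; omega)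
  simp only [lg]; omega

theorem two_pow_size_le (N : ℕ) : 2 ^ N.size ≤ 2 * N + 1 := by
  have := two_pow_lg_le N
  rw [lg, pow_add] at this; omega

/-- The products `∑_l c_l Y_{j l}`, `|j| ≤ N`, with a fixed recurrent array. -/
theorem Der.recSum (N : ℕ) (α γ : ℕ → ℂ) (Y : ℤ → ℕ → ℂ) (hY : IsRec α γ Y) (c : ℕ → X → ℂ)
    (hc : ∀ l ≤ N, c l ∈ A) :
    Der A (20000 * (N + 1) * lg N ^ 2) ((fun j x => ∑ l ∈ Finset.range (N + 1), c l x * Y j l) ''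
      Finset.Icc (-N : ℤ) N) := by
  set h := N.size with hh
  have hN : N < 2 ^ h := Nat.lt_size_self N
  have hN' : 2 ^ h ≤ 2 * N + 1 := two_pow_size_le N
  set W := 4 * N + 2 with hW
  let c' : ℕ → X → ℂ := fun l => if l ≤ N then c l else fun _ => 0
  obtain ⟨P, Q, hP, hQ, hd, hs⟩ := Der.rec_synthesis α γ h (insert (fun _ => 0) A) 0 c'
    (by simp) fun l _ => by
      simp only [c']
      split_ifs with hl
      exacts [Or.inr (hc l hl), Or.inl rfl]
  have h1 := Der.toeplitz₂ (A := insert (fun _ => 0) A ∪ (Set.range P ∪ Set.range Q)) W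
    (fun s => Y s 0) (fun s => Y s 1) (fun i => P (-i)) (fun i => Q (-i))
    (fun i _ => Or.inr (Or.inl ⟨-i, rfl⟩)) (fun i _ => Or.inr (Or.inr ⟨-i, rfl⟩))
  refine (Der.step (.const 0) (hd.trans h1)).mono le_rfl ?_ ?_
  · have h2 : lg W ≤ lg N + 2 := lg_four_mul_add_two N
    have h3 : h = lg N - 2 := by simp [lg, hh]
    obtain ⟨m, hm⟩ : ∃ m, lg N = m + 2 := ⟨h, rfl⟩
    have h4 : 2 ^ h * (h + 5) ^ 2 ≤ (2 * (N + 1)) * (m + 5) ^ 2 := by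
      rw [show h = m by omega] at hN' ⊢
      exact Nat.mul_le_mul_right _ (by omega)
    have h5 : (W + 1) * lg W ≤ (4 * (N + 1)) * (m + 4) :=
      Nat.mul_le_mul (by omega) (by omega)
    have h6 : 1100 * (2 * (m + 5) ^ 2) + 202 * (4 * (m + 4)) + 1 ≤ 20000 * (m + 2) ^ 2 := by
      nlinarith
    rw [hm]
    calc 1100 * 2 ^ h * (h + 5) ^ 2 + 202 * (W + 1) * lg W + 1
        ≤ (N + 1) * (1100 * (2 * (m + 5) ^ 2) + 202 * (4 * (m + 4)) + 1) := by nlinarith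
      _ ≤ (N + 1) * (20000 * (m + 2) ^ 2) := Nat.mul_le_mul_left _ h6
      _ = _ := by ring
  · rintro _ ⟨j, hj, rfl⟩
    simp only [Finset.coe_Icc, Set.mem_Icc] at hj
    refine ⟨j, by simp only [Finset.coe_Icc, Set.mem_Icc]; omega, ?_⟩
    funext x
    have e := hs x Y hY j W (by omega)
    simp only [zero_add] at e
    have e' : ∑ l ∈ Finset.range (N + 1), c l x * Y j l =
        ∑ l ∈ Finset.range (2 ^ h), c' l x * Y j l := by
      refine (Finset.sum_congr rfl fun l hl => ?_).trans
        (Finset.sum_subset (Finset.range_subset_range.2 (by omega : N + 1 ≤ 2 ^ h))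
          fun l _ hl => ?_)
      · have : l ≤ N := by simp at hl; omega
        simp [c', this]
      · have : ¬ l ≤ N := by simp at hl; omega
        simp [c', this]
    beta_reduce
    rw [e', e, ← sum_Icc_neg]
    refine Finset.sum_congr rfl fun s _ => ?_
    rw [neg_neg, sub_neg_eq_add, add_comm j s]
    ring

/-- The products `∑_j d_j Y_{j l}`, `l ≤ N`, with a fixed recurrent array. -/
theorem Der.recMoments (N : ℕ) (α γ : ℕ → ℂ) (Y : ℤ → ℕ → ℂ) (hY : IsRec α γ Y) (d : ℤ → X → ℂ)
    (hd : ∀ j ∈ Finset.Icc (-N : ℤ) N, d j ∈ A) :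
    Der A (20000 * (N + 1) * lg N ^ 2)
      ((fun l x => ∑ j ∈ Finset.Icc (-N : ℤ) N, d j x * Y j l) '' Finset.range (N + 1)) := by
  set h := N.size with hh
  have hN : N < 2 ^ h := Nat.lt_size_self N
  have hN' : 2 ^ h ≤ 2 * N + 1 := two_pow_size_le N
  set W := 4 * N + 2 with hW
  let d' : ℤ → X → ℂ := fun j => if j ∈ Finset.Icc (-N : ℤ) N then d j else fun _ => 0
  let a : X → ℤ → ℕ → ℂ := fun x i l => ∑ j ∈ Finset.Icc (-N : ℤ) N, d j x * Y (i + j) l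
  have ha : ∀ x, IsRec α γ (a x) := by
    intro x i l
    simp only [a, hY (i + _) l, Finset.mul_sum, ← Finset.sum_add_distrib]
    refine Finset.sum_congr rfl fun j _ => ?_
    rw [show i - 1 + j = i + j - 1 by ring, show i + 1 + j = i + j + 1 by ring]
    ring
  have ha' : ∀ l i x, a x i l = ∑ j ∈ Finset.Icc (-W : ℤ) W, Y (i - j) l * d' (-j) x := by
    intro l i x
    rw [← sum_Icc_neg]
    simp only [sub_neg_eq_add, neg_neg]
    refine (Finset.sum_congr rfl fun j hj => ?_).trans
      (Finset.sum_subset (Finset.Icc_subset_Icc ?_ ?_) fun j _ hj => ?_)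
    · simp only [d', if_pos hj]; ring
    · omega
    · omega
    · simp only [d', if_neg hj]; ring
  have hd' : ∀ i, d' (-i) ∈ insert (fun _ => 0) A := by
    intro i
    simp only [d']
    split_ifs with hi
    exacts [Or.inr (hd _ hi), Or.inl rfl]
  have h1 : ∀ l : ℕ, Der (insert (fun _ => 0) A) (100 * (W + 1) * lg W)
      ((fun i x => a x i l) '' Finset.Icc (-W : ℤ) W) := by
    intro l
    simp only [ha']
    exact Der.toeplitz W (fun s => Y s l) (fun i => d' (-i)) fun i _ => hd' i
  have h2 := ((h1 0).union (h1 1)).trans (Der.rec_analysis α γ h _ 0 a ha fun j hj => by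
    have hj' : j ∈ Finset.Icc (-W : ℤ) W := by
      generalize 2 ^ h = H at hj hN'
      simp only [Finset.mem_Icc] at hj ⊢; omega
    exact ⟨Or.inr (Or.inl ⟨j, hj', rfl⟩), Or.inr (Or.inr ⟨j, hj', rfl⟩)⟩)
  refine (Der.step (.const 0) h2).mono le_rfl ?_ ?_
  · have h2 : lg W ≤ lg N + 2 := lg_four_mul_add_two N
    obtain ⟨m, hm⟩ : ∃ m, lg N = m + 2 := ⟨h, rfl⟩
    have h3 : h = m := by simp only [lg] at hm; omega
    have h4 : 2 ^ h * (h + 5) ^ 2 ≤ (2 * (N + 1)) * (m + 5) ^ 2 := by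
      rw [h3] at hN' ⊢
      exact Nat.mul_le_mul_right _ (by omega)
    have h5 : (W + 1) * lg W ≤ (4 * (N + 1)) * (m + 4) :=
      Nat.mul_le_mul (by omega) (by omega)
    have h6 : 1100 * (2 * (m + 5) ^ 2) + 200 * (4 * (m + 4)) + 1 ≤ 20000 * (m + 2) ^ 2 := by
      nlinarith
    rw [hm]
    calc 100 * (W + 1) * lg W + 100 * (W + 1) * lg W + 1100 * 2 ^ h * (h + 5) ^ 2 + 1
        ≤ (N + 1) * (1100 * (2 * (m + 5) ^ 2) + 200 * (4 * (m + 4)) + 1) := by nlinarith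
      _ ≤ (N + 1) * (20000 * (m + 2) ^ 2) := Nat.mul_le_mul_left _ h6
      _ = _ := by ring
  · rintro _ ⟨l, hl, rfl⟩
    refine ⟨l, by simp at hl ⊢; omega, ?_⟩
    funext x
    simp [a]

end

end BallNS

namespace BallNS

open Polynomial Complex

/-! ### Chebyshev coefficients of products, derivatives and quotients -/

/-- The coefficient of `T_k`, as a linear functional. -/
noncomputable def chebCoeffL (k : ℕ) : ℂ[X] →ₗ[ℂ] ℂ := Finsupp.lapply k ∘ₗ
    chebBasis.repr.toLinearMap

theorem chebCoeffL_apply (k : ℕ) (p : ℂ[X]) : chebCoeffL k p = chebCoeff p k := rfl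

theorem chebBasis_apply (j : ℕ) : chebBasis j = Chebyshev.T ℂ j := by
  rw [chebBasis, Sequence.basis_eq_self]

theorem chebCoeff_T (j k : ℕ) : chebCoeff (Chebyshev.T ℂ j) k = if j = k then 1 else 0 := by
  rw [← chebBasis_apply, chebCoeff, chebBasis.repr_self, Finsupp.single_apply]

theorem chebCoeff_add (p q : ℂ[X]) (k : ℕ) :
    chebCoeff (p + q) k = chebCoeff p k + chebCoeff q k := map_add (chebCoeffL k) p q

theorem chebCoeff_sub (p q : ℂ[X]) (k : ℕ) :
    chebCoeff (p - q) k = chebCoeff p k - chebCoeff q k := map_sub (chebCoeffL k) p q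

@[simp] theorem chebCoeff_zero (k : ℕ) : chebCoeff 0 k = 0 := map_zero (chebCoeffL k)

theorem chebCoeff_C_mul (z : ℂ) (p : ℂ[X]) (k : ℕ) : chebCoeff (C z * p) k = z * chebCoeff p k := by
  rw [← smul_eq_C_mul]; exact map_smul (chebCoeffL k) z p

theorem chebCoeff_sum {ι : Type*} (s : Finset ι) (f : ι → ℂ[X]) (k : ℕ) :
    chebCoeff (∑ i ∈ s, f i) k = ∑ i ∈ s, chebCoeff (f i) k := map_sum (chebCoeffL k) f s

theorem chebCoeff_C (z : ℂ) (k : ℕ) : chebCoeff (C z) k = if k = 0 then z else 0 := by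
  rw [← mul_one (C z), ← Chebyshev.T_zero ℂ, chebCoeff_C_mul]
  have := chebCoeff_T 0 k
  rw [Nat.cast_zero] at this
  rw [this]
  simp [eq_comm]

theorem cheb_ext {p q : ℂ[X]} (h : ∀ k, chebCoeff p k = chebCoeff q k) : p = q :=
  chebBasis.repr.injective (Finsupp.ext h)

theorem cheb_linear_ext {f g : ℂ[X] →ₗ[ℂ] ℂ}
    (h : ∀ j : ℕ, f (Chebyshev.T ℂ j) = g (Chebyshev.T ℂ j)) : f = g :=
  chebBasis.ext fun j => by rw [chebBasis_apply, h]

theorem exists_chebCoeff_eq_zero (p : ℂ[X]) : ∃ K, ∀ k, K ≤ k → chebCoeff p k = 0 := by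
  refine ⟨(chebBasis.repr p).support.sup id + 1, fun k hk => ?_⟩
  by_contra h
  have : k ∈ (chebBasis.repr p).support := Finsupp.mem_support_iff.2 h
  have := Finset.le_sup (f := id) this
  simp only [id_eq] at this
  omega

theorem X_mul_T (j : ℕ) : (X : ℂ[X]) * Chebyshev.T ℂ (j + 1 : ℕ) =
    C (1 / 2) * Chebyshev.T ℂ (j + 2 : ℕ) + C (1 / 2) * Chebyshev.T ℂ j := by
  have h := Chebyshev.T_add_two ℂ (j : ℤ)
  have h2 : (C (1 / 2 : ℂ)) * 2 = 1 := by
    rw [show (2 : ℂ[X]) = C 2 from rfl, ← C_mul]; norm_num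
  push_cast
  rw [h]
  linear_combination (-X * Chebyshev.T ℂ ((j : ℤ) + 1)) * h2

theorem chebCoeff_X_mul_zero (p : ℂ[X]) : chebCoeff (X * p) 0 = chebCoeff p 1 / 2 := by
  suffices chebCoeffL 0 ∘ₗ LinearMap.mulLeft ℂ (X : ℂ[X]) = (1 / 2 : ℂ) • chebCoeffL 1 by
    have := LinearMap.congr_fun this p
    simp only [LinearMap.comp_apply, LinearMap.mulLeft_apply, LinearMap.smul_apply, smul_eq_mul,
      chebCoeffL_apply] at this
    rw [this]; ring
  refine cheb_linear_ext fun j => ?_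
  simp only [LinearMap.comp_apply, LinearMap.mulLeft_apply, LinearMap.smul_apply, smul_eq_mul,
      chebCoeffL_apply]
  rcases j with _ | j
  · have := chebCoeff_T 1 0
    simp only [Nat.cast_one, Chebyshev.T_one] at this
    simp [this]
    have := chebCoeff_C 1 1
    simpa using this
  · rw [X_mul_T, chebCoeff_add, chebCoeff_C_mul, chebCoeff_C_mul, chebCoeff_T, chebCoeff_T,
      chebCoeff_T]
    rcases j with _ | j <;> simp

theorem chebCoeff_X_mul_succ (p : ℂ[X]) (k : ℕ) : chebCoeff (X * p) (k + 1) =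
    (if k = 0 then 1 else 1 / 2) * chebCoeff p k + 1 / 2 * chebCoeff p (k + 2) := by
  suffices chebCoeffL (k + 1) ∘ₗ LinearMap.mulLeft ℂ (X : ℂ[X]) =
      (if k = 0 then 1 else 1 / 2 : ℂ) • chebCoeffL k + (1 / 2 : ℂ) • chebCoeffL (k + 2) by
    have := LinearMap.congr_fun this p
    simpa only [LinearMap.comp_apply, LinearMap.mulLeft_apply, LinearMap.smul_apply, smul_eq_mul,
      chebCoeffL_apply, LinearMap.add_apply] using this
  refine cheb_linear_ext fun j => ?_
  simp only [LinearMap.comp_apply, LinearMap.mulLeft_apply, LinearMap.smul_apply, smul_eq_mul,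
      chebCoeffL_apply, LinearMap.add_apply]
  rcases j with _ | j
  · have h1 := chebCoeff_T 1 (k + 1)
    rw [Nat.cast_one, Chebyshev.T_one] at h1
    have h2 := chebCoeff_T 0 k
    have h3 := chebCoeff_T 0 (k + 2)
    rw [Nat.cast_zero] at h2 h3 ⊢
    rw [h2, h3, Chebyshev.T_zero, mul_one, h1]
    rcases k with _ | k <;> simp
  · rw [X_mul_T, chebCoeff_add, chebCoeff_C_mul, chebCoeff_C_mul, chebCoeff_T, chebCoeff_T,
      chebCoeff_T, chebCoeff_T]
    have e1 : (j + 2 = k + 1) ↔ (j + 1 = k) := by omega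
    have e2 : (j = k + 1) ↔ (j + 1 = k + 2) := by omega
    simp only [e1, e2]
    rcases k with _ | k <;> simp

theorem chebCoeff_U (m k : ℕ) : chebCoeff (Chebyshev.U ℂ m) k =
    (if k = 0 then 1 / 2 else 1) * chebCoeff (Chebyshev.U ℂ m) (k + 2) +
      if m = k then (if k = 0 then 1 else 2) else 0 := by
  induction m using Nat.twoStepInduction generalizing k with
  | zero =>
    have h : Chebyshev.U ℂ ((0 : ℕ) : ℤ) = C 1 := by simp
    rw [h, chebCoeff_C, chebCoeff_C]
    rcases k with _ | k <;> simp
  | one =>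
    have h : Chebyshev.U ℂ ((1 : ℕ) : ℤ) = C 2 * Chebyshev.T ℂ (1 : ℕ) := by
      simp; rfl
    rw [h, chebCoeff_C_mul, chebCoeff_C_mul, chebCoeff_T, chebCoeff_T]
    rcases k with _ | _ | k <;> simp
  | more m ih _ =>
    have h : Chebyshev.U ℂ ((m + 2 : ℕ) : ℤ) =
        C 2 * Chebyshev.T ℂ (m + 2 : ℕ) + Chebyshev.U ℂ (m : ℕ) := by
      push_cast; exact Chebyshev.U_eq_two_mul_T_add_U ℂ m
    rw [h, chebCoeff_add, chebCoeff_add, chebCoeff_C_mul, chebCoeff_C_mul, chebCoeff_T, chebCoeff_T,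
      ih]
    rcases k with _ | k
    · rcases m with _ | m <;> simp; ring
    · by_cases h1 : m + 2 = k + 1
      · have : m = k + 1 - 2 := by omega
        simp [h1, show m ≠ k + 1 by omega, add_comm]
      · by_cases h2 : m = k + 1
        · subst h2
          simp [add_comm]
        · simp [h1, h2]

theorem chebCoeff_derivative (p : ℂ[X]) (k : ℕ) : chebCoeff (derivative p) k =
    (if k = 0 then 1 / 2 else 1) * chebCoeff (derivative p) (k + 2) +
      (if k = 0 then 1 else 2 * ((k : ℂ) + 1)) * chebCoeff p (k + 1) := by
  suffices chebCoeffL k ∘ₗ derivative =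
      (if k = 0 then 1 / 2 else 1 : ℂ) • chebCoeffL (k + 2) ∘ₗ derivative +
      (if k = 0 then 1 else 2 * ((k : ℂ) + 1)) • chebCoeffL (k + 1) from LinearMap.congr_fun this p
  refine cheb_linear_ext fun j => ?_
  simp only [LinearMap.comp_apply, LinearMap.add_apply, LinearMap.smul_apply, smul_eq_mul,
    chebCoeffL_apply, Chebyshev.T_derivative_eq_U, chebCoeff_T]
  rcases j with _ | j
  · simp
  · have h : (((j + 1 : ℕ) : ℤ) : ℂ[X]) * Chebyshev.U ℂ (((j + 1 : ℕ) : ℤ) - 1) =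
        C ((j : ℂ) + 1) * Chebyshev.U ℂ (j : ℕ) := by
      push_cast; simp
    rw [h, chebCoeff_C_mul, chebCoeff_C_mul, chebCoeff_U]
    by_cases h2 : j = k
    · subst h2
      rcases j with _ | j
      · simp
      · simp; ring
    · have h3 : ¬ j + 1 = k + 1 := by omega
      simp only [h2, h3, if_false, add_zero]
      ring

theorem chebCoeff_divX (p : ℂ[X]) (k : ℕ) : chebCoeff p.divX k =
    (if k = 0 then 1 else 2) * chebCoeff p (k + 1) -
      (if k = 0 then 1 / 2 else 1) * chebCoeff p.divX (k + 2) := by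
  have h : chebCoeff p (k + 1) = chebCoeff (X * p.divX) (k + 1) := by
    conv_lhs => rw [← divX_mul_X_add p, chebCoeff_add, chebCoeff_C, mul_comm]
    simp
  rw [h, chebCoeff_X_mul_succ]
  rcases k with _ | k
  · simp
  · simp; ring

/-- A finitely supported sequence in which every term from `D` on is a multiple of the term two
places further on vanishes from `D` on. -/
theorem eq_zero_of_period_two {g : ℕ → ℂ} {D : ℕ} (hg : ∃ K, ∀ k, K ≤ k → g k = 0) (z : ℕ → ℂ)
    (h : ∀ k, D ≤ k → g k = z k * g (k + 2)) (k : ℕ) (hk : D ≤ k) : g k = 0 := by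
  obtain ⟨K, hK⟩ := hg
  have key : ∀ m k, D ≤ k → K ≤ k + 2 * m → g k = 0 := by
    intro m
    induction m with
    | zero => intro k _ h; exact hK k (by omega)
    | succ m ih =>
      intro k hk hm
      rw [h k hk, ih (k + 2) (by omega) (by omega), mul_zero]
  exact key K k hk (by omega)

/-! ### Coefficients of functions on the ball -/

/-- The coefficient of `T_k(r) exp (i (a λ + b θ))`. -/
noncomputable def cf (f : BallFn) (k : ℕ) (a b : ℤ) : ℂ := chebCoeff (f.coeff (a, b)) k

theorem cf_ext {f g : BallFn} (h : ∀ k a b, cf f k a b = cf g k a b) : f = g := by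
  ext ab : 2
  exact cheb_ext fun k => h k ab.1 ab.2

@[simp] theorem cf_zero (k : ℕ) (a b : ℤ) : cf 0 k a b = 0 := by simp [cf]

theorem cf_add (f g : BallFn) (k : ℕ) (a b : ℤ) : cf (f + g) k a b = cf f k a b + cf g k a b := by
  simp [cf, chebCoeff_add]

theorem cf_sub (f g : BallFn) (k : ℕ) (a b : ℤ) : cf (f - g) k a b = cf f k a b - cf g k a b := by
  simp [cf, AddMonoidAlgebra.coeff_sub, chebCoeff_sub]

theorem cf_sum {ι : Type*} (s : Finset ι) (f : ι → BallFn) (k : ℕ) (a b : ℤ) :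
    cf (∑ i ∈ s, f i) k a b = ∑ i ∈ s, cf (f i) k a b := by
  simp [cf, AddMonoidAlgebra.coeff_sum, chebCoeff_sum]

theorem coeff_mode (a b : ℤ) (p : ℂ[X]) (a' b' : ℤ) :
    (mode a b p).coeff (a', b') = if a' = a ∧ b' = b then p else 0 := by
  simp only [mode, AddMonoidAlgebra.coeff_single, Finsupp.single_apply, Prod.mk.injEq]
  simp only [eq_comm]

theorem coeff_mode_mul (a b : ℤ) (p : ℂ[X]) (f : BallFn) (a' b' : ℤ) :
    (mode a b p * f).coeff (a', b') = p * f.coeff (a' - a, b' - b) := by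
  unfold mode
  rw [AddMonoidAlgebra.coeff_single_mul_apply]
  congr 2
  simp; omega

theorem mode_add (a b : ℤ) (p q : ℂ[X]) : mode a b (p + q) = mode a b p + mode a b q :=
  AddMonoidAlgebra.single_add _ _ _

@[simp] theorem mode_zero (a b : ℤ) : mode a b 0 = 0 := AddMonoidAlgebra.single_zero _

theorem mapModes_add (φ : ℤ → ℤ → ℂ[X] → BallFn) (h0 : ∀ a b, φ a b 0 = 0)
    (hφ : ∀ a b p q, φ a b (p + q) = φ a b p + φ a b q) (f g : BallFn) :
    mapModes φ (f + g) = mapModes φ f + mapModes φ g :=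
  Finsupp.sum_add_index' (fun ab => h0 ab.1 ab.2) fun ab => hφ ab.1 ab.2

theorem mapModes_mode (φ : ℤ → ℤ → ℂ[X] → BallFn) (h0 : ∀ a b, φ a b 0 = 0) (a b : ℤ) (p : ℂ[X]) :
    mapModes φ (mode a b p) = φ a b p := by
  simp only [mapModes, mode, AddMonoidAlgebra.coeff_single]
  exact Finsupp.sum_single_index (h0 a b)

theorem coeff_mapModes_mode (L : ℤ → ℤ → ℂ[X] → ℂ[X]) (h0 : ∀ a b, L a b 0 = 0) (f : BallFn)
    (a b : ℤ) : (mapModes (fun a b p => mode a b (L a b p)) f).coeff (a, b) =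
      L a b (f.coeff (a, b)) := by
  rw [mapModes, AddMonoidAlgebra.coeff_finsuppSum, Finsupp.sum_apply, Finsupp.sum,
    Finset.sum_eq_single (a, b)]
  · simp [coeff_mode]
  · intro ab _ h
    rw [coeff_mode, if_neg]
    rintro ⟨rfl, rfl⟩; exact h rfl
  · intro h
    rw [Finsupp.notMem_support_iff.1 h, h0, mode_zero]; simp

theorem cf_mode_C_mul (a₀ b₀ : ℤ) (z : ℂ) (f : BallFn) (k : ℕ) (a b : ℤ) :
    cf (mode a₀ b₀ (C z) * f) k a b = z * cf f k (a - a₀) (b - b₀) := by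
  simp [cf, coeff_mode_mul, chebCoeff_C_mul]

theorem coeff_dR (f : BallFn) (a b : ℤ) : (dR f).coeff (a, b) = derivative (f.coeff (a, b)) :=
  coeff_mapModes_mode (fun _ _ p => derivative p) (by simp) f a b

theorem cf_dLam (f : BallFn) (k : ℕ) (a b : ℤ) : cf (dLam f) k a b = I * a * cf f k a b := by
  rw [cf, dLam, coeff_mapModes_mode (fun a _ p => C (I * (a : ℂ)) * p) (by simp), chebCoeff_C_mul,
    cf]

theorem cf_dTheta (f : BallFn) (k : ℕ) (a b : ℤ) : cf (dTheta f) k a b = I * b * cf f k a b := by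
  rw [cf, dTheta, coeff_mapModes_mode (fun _ b p => C (I * (b : ℂ)) * p) (by simp), chebCoeff_C_mul,
    cf]

theorem coeff_divR (f : BallFn) (a b : ℤ) : (divR f).coeff (a, b) = (f.coeff (a, b)).divX :=
  coeff_mapModes_mode (fun _ _ p => p.divX) (by simp) f a b

/-- The coefficient of `exp (i j θ)` in `sinQuot b`. -/
noncomputable def sinQuotCoeff (b j : ℤ) : ℂ :=
  if j = 0 then (if b % 2 = 0 then 0 else if 0 < b then I else -I)
  else if 0 < j then (if j < b ∧ (b - j) % 2 = 1 then 2 * I else 0)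
  else (if b < j ∧ (b - j) % 2 = 1 then -(2 * I) else 0)

theorem coeff_sinQuot (b a j : ℤ) : (sinQuot b).coeff (a, j) = if a = 0 then C (sinQuotCoeff b j)
    else 0 := by
  by_cases ha : a = 0
  · have key : ∀ s : Finset ℤ, (∑ t ∈ s, mode 0 (b % 2 + 2 * t + 1) (C (2 * I))).coeff (a, j) =
        if (j - b % 2 - 1) / 2 ∈ s ∧ (j - b % 2 - 1) % 2 = 0 then C (2 * I) else 0 := by
      intro s
      have e : ∀ t : ℤ, (a = 0 ∧ j = b % 2 + 2 * t + 1) ↔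
          ((j - b % 2 - 1) / 2 = t ∧ (j - b % 2 - 1) % 2 = 0) := by intro t; omega
      simp only [AddMonoidAlgebra.coeff_sum, Finsupp.finsetSum_apply, coeff_mode, e, ite_and]
      rw [Finset.sum_ite_eq s]
    rw [sinQuot, AddMonoidAlgebra.coeff_sub, AddMonoidAlgebra.coeff_add]
    rw [Finsupp.sub_apply, Finsupp.add_apply, key, key, coeff_mode]
    simp only [ha, if_true, true_and, Finset.mem_Ico]
    rw [sinQuotCoeff]
    rcases Int.emod_two_eq_zero_or_one b with hb | hb <;> rw [hb] <;>
      split_ifs <;> first | contradiction | omega | (simp; done) | skip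
    rw [add_zero, ← C_sub]
    congr 1
    push_cast
    ring

  · have key : ∀ s : Finset ℤ,
        (∑ t ∈ s, mode 0 (b % 2 + 2 * t + 1) (C (2 * I))).coeff (a, j) = 0 := by
      intro s
      simp [AddMonoidAlgebra.coeff_sum, Finsupp.finsetSum_apply, coeff_mode, ha]
    rw [sinQuot, AddMonoidAlgebra.coeff_sub, AddMonoidAlgebra.coeff_add]
    rw [Finsupp.sub_apply, Finsupp.add_apply, key, key, coeff_mode]
    simp [ha]

theorem divSin_add (f g : BallFn) : divSin (f + g) = divSin f + divSin g :=
  mapModes_add _ (by simp) (by intros; rw [mode_add, add_mul]) f g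

theorem cf_divSin_mode (a₀ b₀ : ℤ) (p : ℂ[X]) (k : ℕ) (a b : ℤ) :
    cf (divSin (mode a₀ b₀ p)) k a b = if a = a₀ then sinQuotCoeff b₀ b * chebCoeff p k else 0 := by
  rw [divSin, mapModes_mode _ (by simp), cf, coeff_mode_mul, coeff_sinQuot]
  simp only [sub_eq_zero]
  split_ifs
  · rw [sub_zero, mul_comm, chebCoeff_C_mul]
  · simp

theorem cf_mode (a₀ b₀ : ℤ) (p : ℂ[X]) (k : ℕ) (a b : ℤ) :
    cf (mode a₀ b₀ p) k a b = if a = a₀ ∧ b = b₀ then chebCoeff p k else 0 := by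
  rw [cf, coeff_mode]; split_ifs <;> simp

theorem divSin_zero : divSin 0 = 0 := by simp [divSin, mapModes]

theorem cf_divSin_of_pos (f : BallFn) (k : ℕ) (a j : ℤ) (hj : 0 < j) :
    cf (divSin f) k a j = cf (divSin f) k a (j + 2) + 2 * I * cf f k a (j + 1) := by
  induction f using AddMonoidAlgebra.induction_linear with
  | zero => simp [divSin_zero]
  | add f g hf hg => rw [divSin_add, cf_add, cf_add, cf_add, hf, hg]; ring
  | single ab p =>
    change cf (divSin (mode ab.1 ab.2 p)) k a j = cf (divSin (mode ab.1 ab.2 p)) k a (j + 2) +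
      2 * I * cf (mode ab.1 ab.2 p) k a (j + 1)
    have hs : sinQuotCoeff ab.2 j =
        sinQuotCoeff ab.2 (j + 2) + if j + 1 = ab.2 then 2 * I else 0 := by
      simp only [sinQuotCoeff]
      split_ifs <;> first | omega | simp
    rw [cf_divSin_mode, cf_divSin_mode, cf_mode, hs]
    split_ifs <;> first | omega | ring1

theorem cf_divSin_of_neg (f : BallFn) (k : ℕ) (a j : ℤ) (hj : j < 0) :
    cf (divSin f) k a j = cf (divSin f) k a (j - 2) - 2 * I * cf f k a (j - 1) := by
  induction f using AddMonoidAlgebra.induction_linear with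
  | zero => simp [divSin_zero]
  | add f g hf hg => rw [divSin_add, cf_add, cf_add, cf_add, hf, hg]; ring
  | single ab p =>
    change cf (divSin (mode ab.1 ab.2 p)) k a j = cf (divSin (mode ab.1 ab.2 p)) k a (j - 2) -
      2 * I * cf (mode ab.1 ab.2 p) k a (j - 1)
    have hs : sinQuotCoeff ab.2 j =
        sinQuotCoeff ab.2 (j - 2) - if j - 1 = ab.2 then 2 * I else 0 := by
      simp only [sinQuotCoeff]
      split_ifs <;> first | omega | simp
    rw [cf_divSin_mode, cf_divSin_mode, cf_mode, hs]
    split_ifs <;> first | omega | ring1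

theorem cf_divSin_zero (f : BallFn) (k : ℕ) (a : ℤ) :
    cf (divSin f) k a 0 = 1 / 2 * (cf (divSin f) k a 2 + cf (divSin f) k a (-2)) +
      I * (cf f k a 1 - cf f k a (-1)) := by
  induction f using AddMonoidAlgebra.induction_linear with
  | zero => simp [divSin_zero]
  | add f g hf hg => rw [divSin_add]; simp only [cf_add, hf, hg]; ring
  | single ab p =>
    change cf (divSin (mode ab.1 ab.2 p)) k a 0 = 1 / 2 * (cf (divSin (mode ab.1 ab.2 p)) k a 2 +
      cf (divSin (mode ab.1 ab.2 p)) k a (-2)) +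
      I * (cf (mode ab.1 ab.2 p) k a 1 - cf (mode ab.1 ab.2 p) k a (-1))
    have hs : sinQuotCoeff ab.2 0 = 1 / 2 * (sinQuotCoeff ab.2 2 + sinQuotCoeff ab.2 (-2)) +
        I * ((if 1 = ab.2 then 1 else 0) - if -1 = ab.2 then 1 else 0) := by
      simp only [sinQuotCoeff]
      split_ifs <;> first | contradiction | omega | ring1
    simp only [cf_divSin_mode, cf_mode, hs]
    split_ifs <;> first | contradiction | omega | ring1

end BallNS

namespace BallNS

open Polynomial Complex

/-! ### Operators on the ball of linear cost in the number of coefficients -/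

/-- The function is a polynomial of degree at most `D` in each of `r`, `exp (± i λ)` and
`exp (± i θ)`. -/
def Bd (D : ℕ) (f : BallFn) : Prop :=
  ∀ k a b, cf f k a b ≠ 0 → k ≤ D ∧ |a| ≤ D ∧ |b| ≤ D

theorem Bd.mono {D E : ℕ} (h : D ≤ E) {f : BallFn} (hf : Bd D f) : Bd E f := fun k a b hk => by
  obtain ⟨h1, h2, h3⟩ := hf k a b hk
  omega

theorem Bd.cf_eq_zero {D : ℕ} {f : BallFn} (hf : Bd D f) {k : ℕ} {a b : ℤ}
    (h : D < k ∨ (D : ℤ) < |a| ∨ (D : ℤ) < |b|) : cf f k a b = 0 := by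
  by_contra h'
  obtain ⟨h1, h2, h3⟩ := hf k a b h'
  omega

/-- The indices of the coefficients of a function that is bounded in degree by `D`. -/
noncomputable def box (D : ℕ) : Finset (ℕ × ℤ × ℤ) :=
  Finset.range (D + 1) ×ˢ Finset.Icc (-D : ℤ) D ×ˢ Finset.Icc (-D : ℤ) D

theorem mem_box {D k : ℕ} {a b : ℤ} : (k, a, b) ∈ box D ↔ k ≤ D ∧ |a| ≤ D ∧ |b| ≤ D := by
  simp only [box, Finset.mem_product, Finset.mem_range, Finset.mem_Icc, abs_le]
  omega

theorem card_Icc_neg (D : ℕ) : (Finset.Icc (-D : ℤ) D).card = 2 * D + 1 := by simp; omega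

theorem card_box (D : ℕ) : (box D).card = (D + 1) * (2 * D + 1) ^ 2 := by
  rw [box, Finset.card_product, Finset.card_product, card_Icc_neg, Finset.card_range]; ring

section

variable {X : Type}

/-- The coefficients of a function on the ball that depends on the data. -/
def arr (f : X → BallFn) : Set (X → ℂ) :=
  Set.range fun i : ℕ × ℤ × ℤ => fun x => cf (f x) i.1 i.2.1 i.2.2

theorem mem_arr (f : X → BallFn) (k : ℕ) (a b : ℤ) : (fun x => cf (f x) k a b) ∈ arr f :=
  ⟨(k, a, b), rfl⟩

variable {A : Set (X → ℂ)} {c D : ℕ} {f g : X → BallFn}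

theorem zero_mem_arr (hf : ∀ x, Bd D (f x)) : (fun _ => 0) ∈ arr f :=
  ⟨(D + 1, 0, 0), by funext x; exact (hf x).cf_eq_zero (Or.inl (Nat.lt_succ_self D))⟩

/-- Only the finitely many coefficients in the box have to be computed: all others vanish. -/
theorem Der.arr_of_box (hf : ∀ x, Bd D (f x))
    (h : Der A c ((fun i : ℕ × ℤ × ℤ => fun x => cf (f x) i.1 i.2.1 i.2.2) '' box D)) :
    Der A (c + 1) (arr f) := by
  refine (h.union (Der.const 0)).mono_right ?_
  rintro _ ⟨i, rfl⟩
  by_cases hi : i ∈ box D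
  · exact Or.inl ⟨i, hi, rfl⟩
  · refine Or.inr ?_
    simp only [Set.mem_singleton_iff]
    funext x
    obtain ⟨k, a, b⟩ := i
    refine (hf x).cf_eq_zero ?_
    rw [mem_box] at hi
    dsimp only
    omega

/-- The coefficients are computed one by one. -/
theorem Der.arr_of_each (hf : ∀ x, Bd D (f x))
    (h : ∀ k a b, Der A c {fun x => cf (f x) k a b}) :
    Der A ((box D).card * c + 1) (arr f) :=
  Der.arr_of_box hf (Der.image (box D) _ fun i _ => h i.1 i.2.1 i.2.2)

/-- The coefficients are computed in families along the radial index, as a recurrence between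
neighbouring radial degrees requires. -/
theorem Der.arr_of_radial (hf : ∀ x, Bd D (f x))
    (h : ∀ a b, Der A c ((fun k x => cf (f x) k a b) '' Set.univ)) :
    Der A ((2 * D + 1) ^ 2 * c + 1) (arr f) := by
  have h1 := Der.biUnion (Finset.Icc (-D : ℤ) D ×ˢ Finset.Icc (-D : ℤ) D) _ fun i _ => h i.1 i.2
  rw [Finset.card_product, card_Icc_neg, ← sq] at h1
  refine Der.arr_of_box hf (h1.mono_right ?_)
  rintro _ ⟨⟨k, a, b⟩, hi, rfl⟩
  simp only [Set.mem_iUnion]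
  simp only [box, Finset.coe_product, Set.mem_prod, Finset.mem_coe] at hi
  exact ⟨(a, b), Finset.mem_product.2 hi.2, k, trivial, rfl⟩

/-- The coefficients are computed in families along the polar frequency, as a recurrence between
neighbouring polar frequencies requires. -/
theorem Der.arr_of_polar (hf : ∀ x, Bd D (f x))
    (h : ∀ k a, Der A c ((fun b x => cf (f x) k a b) '' Set.univ)) :
    Der A ((D + 1) * (2 * D + 1) * c + 1) (arr f) := by
  have h1 := Der.biUnion (Finset.range (D + 1) ×ˢ Finset.Icc (-D : ℤ) D) _ fun i _ => h i.1 i.2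
  rw [Finset.card_product, card_Icc_neg, Finset.card_range] at h1
  refine Der.arr_of_box hf (h1.mono_right ?_)
  rintro _ ⟨⟨k, a, b⟩, hi, rfl⟩
  simp only [Set.mem_iUnion]
  simp only [box, Finset.coe_product, Set.mem_prod, Finset.mem_coe] at hi
  exact ⟨(k, a), Finset.mem_product.2 ⟨hi.1, hi.2.1⟩, b, trivial, rfl⟩

end

/-- The operator raises degrees by at most a constant, and its result for arguments of degree at
most `D` is computed from their coefficients at cost `O(D³)`. -/
def Fast {ι : Type} (Φ : (ι → BallFn) → BallFn) : Prop :=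
  ∃ d C : ℕ, ∀ D : ℕ, (∀ f, (∀ i, Bd D (f i)) → Bd (D + d) (Φ f)) ∧
    ∀ (X : Type) (f : X → ι → BallFn), (∀ x i, Bd D (f x i)) →
      Der (⋃ i, arr fun x => f x i) (C * (D + 1) ^ 3) (arr fun x => Φ (f x))

/-- `Fast` for operators with one argument. -/
def FastOp (φ : BallFn → BallFn) : Prop :=
  ∃ d C : ℕ, ∀ D : ℕ, (∀ f, Bd D f → Bd (D + d) (φ f)) ∧
    ∀ (X : Type) (f : X → BallFn), (∀ x, Bd D (f x)) →
      Der (arr f) (C * (D + 1) ^ 3) (arr fun x => φ (f x))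

theorem add_cube_le (D d : ℕ) : (D + d + 1) ^ 3 ≤ (d + 1) ^ 3 * (D + 1) ^ 3 := by
  rw [← mul_pow]
  exact Nat.pow_le_pow_left (by nlinarith [Nat.zero_le (d * D)]) 3

section

variable {ι : Type} {Φ Ψ : (ι → BallFn) → BallFn}

theorem Fast.proj (i : ι) : Fast fun f : ι → BallFn => f i :=
  ⟨0, 0, fun _ => ⟨fun _ hf => hf i, fun _ f _ => .done (Set.subset_iUnion
    (fun i => arr fun x => f x i) i)⟩⟩

theorem Fast.comp {φ : BallFn → BallFn} (hφ : FastOp φ) (hΦ : Fast Φ) : Fast fun f => φ (Φ f) := by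
  obtain ⟨d, C, h⟩ := hφ
  obtain ⟨e, K, h'⟩ := hΦ
  refine ⟨e + d, K + C * (e + 1) ^ 3, fun D => ⟨fun f hf => ?_, fun X f hf => ?_⟩⟩
  · exact ((h (D + e)).1 _ ((h' D).1 f hf)).mono (by omega)
  · have h1 := (h' D).2 X f hf
    have h2 := (h (D + e)).2 X (fun x => Φ (f x)) fun x => (h' D).1 _ (hf x)
    refine (h1.trans (h2.mono_left Set.subset_union_right)).mono_cost ?_
    calc K * (D + 1) ^ 3 + C * (D + e + 1) ^ 3
        ≤ K * (D + 1) ^ 3 + C * ((e + 1) ^ 3 * (D + 1) ^ 3) :=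
          Nat.add_le_add_left (Nat.mul_le_mul_left _ (add_cube_le D e)) _
      _ = _ := by ring

theorem Bd.add {D : ℕ} {f g : BallFn} (hf : Bd D f) (hg : Bd D g) : Bd D (f + g) := by
  intro k a b h
  by_contra h'
  rw [cf_add] at h
  exact h (by rw [not_imp_comm.1 (hf k a b) h', not_imp_comm.1 (hg k a b) h', add_zero])

theorem Bd.sub {D : ℕ} {f g : BallFn} (hf : Bd D f) (hg : Bd D g) : Bd D (f - g) := by
  intro k a b h
  by_contra h'
  rw [cf_sub] at h
  exact h (by rw [not_imp_comm.1 (hf k a b) h', not_imp_comm.1 (hg k a b) h', sub_zero])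

theorem card_box_le (D d : ℕ) : (box (D + d)).card ≤ 4 * (d + 1) ^ 3 * (D + 1) ^ 3 := by
  rw [card_box]
  calc (D + d + 1) * (2 * (D + d) + 1) ^ 2
      ≤ (D + d + 1) * (2 * (D + d + 1)) ^ 2 :=
        Nat.mul_le_mul_left _ (Nat.pow_le_pow_left (by omega) 2)
    _ = 4 * (D + d + 1) ^ 3 := by ring
    _ ≤ 4 * ((d + 1) ^ 3 * (D + 1) ^ 3) := Nat.mul_le_mul_left _ (add_cube_le D d)
    _ = _ := by ring

theorem Fast.binary (hΦ : Fast Φ) (hΨ : Fast Ψ) (op : BallFn → BallFn → BallFn)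
    (hbd : ∀ D f g, Bd D f → Bd D g → Bd D (op f g))
    (hop : ∀ (X : Type) (f g : X → BallFn) k a b, Op (arr f ∪ arr g) fun x =>
      cf (op (f x) (g x)) k a b) : Fast fun f => op (Φ f) (Ψ f) := by
  obtain ⟨d, C, h⟩ := hΦ
  obtain ⟨e, K, h'⟩ := hΨ
  refine ⟨d + e, C + K + 4 * (d + e + 1) ^ 3 + 1, fun D => ?_⟩
  have hb : ∀ f, (∀ i, Bd D (f i)) → Bd (D + (d + e)) (op (Φ f) (Ψ f)) := fun f hf =>
    hbd _ _ _ (((h D).1 f hf).mono (by omega)) (((h' D).1 f hf).mono (by omega))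
  refine ⟨hb, fun X f hf => ?_⟩
  have h1 := ((h D).2 X f hf).union ((h' D).2 X f hf)
  have h2 := Der.arr_of_each (f := fun x => op (Φ (f x)) (Ψ (f x))) (fun x => hb _ (hf x))
    (c := 1) fun k a b => Der.op (hop X (fun x => Φ (f x)) (fun x => Ψ (f x)) k a b)
  refine (h1.trans (h2.mono_left Set.subset_union_right)).mono_cost ?_
  have h3 := card_box_le D (d + e)
  have h4 : 1 ≤ (D + 1) ^ 3 := Nat.one_le_pow _ _ (by omega)
  nlinarith

theorem Fast.add (hΦ : Fast Φ) (hΨ : Fast Ψ) : Fast fun f => Φ f + Ψ f :=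
  hΦ.binary hΨ (fun f g => f + g) (fun _ _ _ => Bd.add) fun X f g k a b => by
    simp only [cf_add]
    exact .add (Or.inl (mem_arr f k a b)) (Or.inr (mem_arr g k a b))

theorem Fast.sub (hΦ : Fast Φ) (hΨ : Fast Ψ) : Fast fun f => Φ f - Ψ f :=
  hΦ.binary hΨ (fun f g => f - g) (fun _ _ _ => Bd.sub) fun X f g k a b => by
    simp only [cf_sub]
    exact .sub (Or.inl (mem_arr f k a b)) (Or.inr (mem_arr g k a b))

end

theorem FastOp.of_fast {φ : BallFn → BallFn} (h : Fast fun f : Unit → BallFn => φ (f ())) :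
    FastOp φ := by
  obtain ⟨d, C, h⟩ := h
  refine ⟨d, C, fun D => ⟨fun f hf => (h D).1 (fun _ => f) fun _ => hf, fun X f hf => ?_⟩⟩
  have := (h D).2 X (fun x _ => f x) fun x _ => hf x
  rwa [Set.iUnion_const] at this

theorem FastOp.to_fast {φ : BallFn → BallFn} (h : FastOp φ) :
    Fast fun f : Unit → BallFn => φ (f ()) := Fast.comp h (Fast.proj ())

theorem FastOp.comp {φ ψ : BallFn → BallFn} (hφ : FastOp φ) (hψ : FastOp ψ) :
    FastOp fun f => φ (ψ f) := .of_fast (Fast.comp hφ hψ.to_fast)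

theorem FastOp.add {φ ψ : BallFn → BallFn} (hφ : FastOp φ) (hψ : FastOp ψ) :
    FastOp fun f => φ f + ψ f := .of_fast (hφ.to_fast.add hψ.to_fast)

theorem FastOp.sub {φ ψ : BallFn → BallFn} (hφ : FastOp φ) (hψ : FastOp ψ) :
    FastOp fun f => φ f - ψ f := .of_fast (hφ.to_fast.sub hψ.to_fast)

/-- Operators each of whose output coefficients costs a constant. -/
theorem FastOp.of_local {φ : BallFn → BallFn} (d c : ℕ) (hbd : ∀ D f, Bd D f → Bd (D + d) (φ f))
    (h : ∀ (X : Type) (f : X → BallFn) k a b, Der (arr f) c {fun x => cf (φ (f x)) k a b}) :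
    FastOp φ := by
  refine ⟨d, 4 * (d + 1) ^ 3 * c + 1, fun D => ⟨hbd D, fun X f hf => ?_⟩⟩
  refine (Der.arr_of_each (fun x => hbd D _ (hf x)) (h X f)).mono_cost ?_
  have h4 : 1 ≤ (D + 1) ^ 3 := Nat.one_le_pow _ _ (by omega)
  nlinarith [Nat.mul_le_mul_right c (card_box_le D d)]

theorem FastOp.mode_mul (a₀ b₀ : ℤ) (z : ℂ) : FastOp fun f => mode a₀ b₀ (C z) * f := by
  refine .of_local (a₀.natAbs + b₀.natAbs) 2 ?_ ?_
  · intro D f hf k a b h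
    rw [cf_mode_C_mul] at h
    obtain ⟨h1, h2, h3⟩ := hf _ _ _ (right_ne_zero_of_mul h)
    rw [abs_le] at h2 h3
    refine ⟨by omega, ?_, ?_⟩ <;> rw [abs_le] <;> omega
  · intro X f k a b
    simp only [cf_mode_C_mul]
    exact Der.smul z (Der.of_mem (c := 0) (mem_arr f _ _ _))

theorem FastOp.dLam : FastOp dLam := by
  refine .of_local 0 2 ?_ ?_
  · intro D f hf k a b h
    rw [cf_dLam] at h
    exact hf _ _ _ (right_ne_zero_of_mul h)
  · intro X f k a b
    simp only [cf_dLam]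
    exact Der.smul _ (Der.of_mem (c := 0) (mem_arr f _ _ _))

theorem FastOp.dTheta : FastOp dTheta := by
  refine .of_local 0 2 ?_ ?_
  · intro D f hf k a b h
    rw [cf_dTheta] at h
    exact hf _ _ _ (right_ne_zero_of_mul h)
  · intro X f k a b
    simp only [cf_dTheta]
    exact Der.smul _ (Der.of_mem (c := 0) (mem_arr f _ _ _))

theorem cf_radius_mul_zero (f : BallFn) (a b : ℤ) :
    cf (radius * f) 0 a b = 1 / 2 * cf f 1 a b := by
  rw [cf, radius, coeff_mode_mul, chebCoeff_X_mul_zero, sub_zero, sub_zero, cf]; ring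

theorem cf_radius_mul_succ (f : BallFn) (k : ℕ) (a b : ℤ) : cf (radius * f) (k + 1) a b =
    (if k = 0 then 1 else 1 / 2) * cf f k a b + 1 / 2 * cf f (k + 2) a b := by
  rw [cf, radius, coeff_mode_mul, chebCoeff_X_mul_succ, sub_zero, sub_zero, cf, cf]

theorem FastOp.radius_mul : FastOp fun f => radius * f := by
  refine .of_local 1 5 ?_ ?_
  · intro D f hf k a b h
    rcases k with _ | k
    · rw [cf_radius_mul_zero] at h
      have := hf _ _ _ (right_ne_zero_of_mul h)
      omega
    · rw [cf_radius_mul_succ] at h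
      by_cases h1 : cf f k a b = 0
      · rw [h1, mul_zero, zero_add] at h
        have := hf _ _ _ (right_ne_zero_of_mul h)
        omega
      · have := hf _ _ _ h1
        omega
  · intro X f k a b
    rcases k with _ | k
    · simp only [cf_radius_mul_zero]
      exact (Der.smul _ (Der.of_mem (c := 0) (mem_arr f _ _ _))).mono_cost (by omega)
    · simp only [cf_radius_mul_succ]
      exact (Der.smul _ (Der.of_mem (c := 0) (mem_arr f _ _ _))).add
        (Der.smul _ (Der.of_mem (c := 0) (mem_arr f _ _ _)))

theorem cf_dR (f : BallFn) (k : ℕ) (a b : ℤ) : cf (dR f) k a b =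
    (if k = 0 then 1 / 2 else 1) * cf (dR f) (k + 2) a b +
      (if k = 0 then 1 else 2 * ((k : ℂ) + 1)) * cf f (k + 1) a b := by
  simp only [cf, coeff_dR]
  exact chebCoeff_derivative _ k

theorem cf_divR (f : BallFn) (k : ℕ) (a b : ℤ) : cf (divR f) k a b =
    (if k = 0 then 2⁻¹ else 1) * (-cf (divR f) (k + 2) a b) +
      (if k = 0 then 1 else 2) * cf f (k + 1) a b := by
  simp only [cf, coeff_divR]
  rw [chebCoeff_divX]
  split_ifs <;> ring

theorem exists_cf_eq_zero (f : BallFn) (a b : ℤ) : ∃ K, ∀ k, K ≤ k → cf f k a b = 0 :=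
  exists_chebCoeff_eq_zero _

/-- Operators that act on the radial variable by a recurrence solved from the top. -/
theorem FastOp.of_radial_recurrence {φ : BallFn → BallFn} (u v : ℕ → ℂ)
    (h : ∀ f k a b, cf (φ f) k a b = u k * cf (φ f) (k + 2) a b + v k * cf f (k + 1) a b) :
    FastOp φ := by
  have hbd : ∀ D f, Bd D f → Bd (D + 0) (φ f) := by
    intro D f hf k a b hk
    by_contra hn
    refine hk ?_
    by_cases hab : |a| ≤ D ∧ |b| ≤ D
    · refine eq_zero_of_period_two (D := D) (exists_cf_eq_zero (φ f) a b) u ?_ k (by omega)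
      intro k hk
      rw [h f k a b, hf.cf_eq_zero (k := k + 1) (Or.inl (by omega)), mul_zero, add_zero]
    · refine eq_zero_of_period_two (D := 0) (exists_cf_eq_zero (φ f) a b) u ?_ k (by omega)
      intro k _
      rw [h f k a b, hf.cf_eq_zero (k := k + 1) (Or.inr (by omega)), mul_zero, add_zero]
  refine ⟨0, 21, fun D => ⟨hbd D, fun X f hf => ?_⟩⟩
  have hbd' : ∀ x, Bd D (φ (f x)) := fun x => hbd D _ (hf x)
  refine (Der.arr_of_radial (c := (D + 1) * 5) hbd' fun a b => ?_).mono_cost ?_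
  · refine Der.chain (fun k x => cf (φ (f x)) k a b) D ?_ ?_
    · intro j hj
      have : (fun x => cf (φ (f x)) j a b) = fun _ => 0 := by
        funext x; exact (hbd' x).cf_eq_zero (Or.inl hj)
      rw [this]
      exact zero_mem_arr hf
    · intro j _
      have e : (fun x => cf (φ (f x)) j a b) = fun x =>
          u j * cf (φ (f x)) (j + 2) a b + v j * cf (f x) (j + 1) a b := by
        funext x; exact h (f x) j a b
      rw [e]
      exact (Der.smul _ (Der.of_mem (c := 0) (by simp))).add
        (Der.smul _ (Der.of_mem (c := 0) (Or.inl (mem_arr f _ _ _))))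
  · have h4 : 1 ≤ (D + 1) ^ 3 := Nat.one_le_pow _ _ (by omega)
    calc (2 * D + 1) ^ 2 * ((D + 1) * 5) + 1 ≤ (2 * (D + 1)) ^ 2 * ((D + 1) * 5) + (D + 1) ^ 3 :=
          Nat.add_le_add (Nat.mul_le_mul_right _ (Nat.pow_le_pow_left (by omega) 2)) h4
      _ = 21 * (D + 1) ^ 3 := by ring

theorem FastOp.dR : FastOp dR := .of_radial_recurrence _ _ cf_dR

theorem FastOp.divR : FastOp divR :=
  .of_radial_recurrence (fun k => -if k = 0 then 2⁻¹ else 1) (fun k => if k = 0 then 1 else 2)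
    fun f k a b => by rw [cf_divR f k a b]; ring

theorem exists_cf_eq_zero_polar (f : BallFn) (k : ℕ) (a : ℤ) :
    ∃ K : ℕ, ∀ b : ℤ, (K : ℤ) ≤ |b| → cf f k a b = 0 := by
  refine ⟨(f.coeff.support.sup fun ab => ab.2.natAbs) + 1, fun b hb => ?_⟩
  by_contra h
  have h1 : (a, b) ∈ f.coeff.support := by
    rw [Finsupp.mem_support_iff]
    intro h0
    exact h (by rw [cf, h0, chebCoeff_zero])
  have := Finset.le_sup (f := fun ab : ℤ × ℤ => ab.2.natAbs) h1
  rw [Int.abs_eq_natAbs] at hb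
  dsimp only at this
  omega

/-- Division by `sin θ` does not raise degrees: the recurrences of step two, run from both ends of
the range of the polar frequencies, start from zero beyond the degree of the function. -/
theorem Bd.divSin {D : ℕ} {f : BallFn} (hf : Bd D f) : Bd D (divSin f) := by
  have hpos : ∀ (k : ℕ) (a : ℤ) (E : ℕ), (∀ b : ℤ, (E : ℤ) < b → cf f k a b = 0) →
      ∀ j : ℕ, E ≤ j → cf (BallNS.divSin f) k a (j + 1) = 0 := by
    intro k a E h0 j hj
    obtain ⟨K, hK⟩ := exists_cf_eq_zero_polar (BallNS.divSin f) k a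
    refine eq_zero_of_period_two (g := fun j : ℕ => cf (BallNS.divSin f) k a (j + 1)) (D := E)
      ⟨K, fun j hj => hK _ (by rw [abs_of_nonneg (by omega)]; omega)⟩ (fun _ => 1) ?_ j hj
    intro j hj
    rw [cf_divSin_of_pos f k a _ (by omega), h0 _ (by omega), mul_zero, add_zero, one_mul]
    congr 1
  have hneg : ∀ (k : ℕ) (a : ℤ) (E : ℕ), (∀ b : ℤ, b < -(E : ℤ) → cf f k a b = 0) →
      ∀ j : ℕ, E ≤ j → cf (BallNS.divSin f) k a (-(j + 1)) = 0 := by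
    intro k a E h0 j hj
    obtain ⟨K, hK⟩ := exists_cf_eq_zero_polar (BallNS.divSin f) k a
    refine eq_zero_of_period_two (g := fun j : ℕ => cf (BallNS.divSin f) k a (-(j + 1))) (D := E)
      ⟨K, fun j hj => hK _ (by rw [abs_of_neg (by omega)]; omega)⟩ (fun _ => 1) ?_ j hj
    intro j hj
    rw [cf_divSin_of_neg f k a _ (by omega), h0 _ (by omega), mul_zero, sub_zero, one_mul]
    congr 1
  intro k a b h
  by_contra hn
  refine h ?_
  by_cases hka : k ≤ D ∧ |a| ≤ D
  · have hb : (D : ℤ) < |b| := by omega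
    rcases le_or_gt 0 b with hb0 | hb0
    · rw [abs_of_nonneg hb0] at hb
      have := hpos k a D (fun b hb => hf.cf_eq_zero (Or.inr (Or.inr (by
        rw [abs_of_pos (by omega)]; exact hb)))) (b - 1).toNat (by omega)
      rwa [show (((b - 1).toNat : ℕ) : ℤ) + 1 = b by omega] at this
    · rw [abs_of_neg hb0] at hb
      have := hneg k a D (fun b hb => hf.cf_eq_zero (Or.inr (Or.inr (by
        rw [abs_of_neg (by omega)]; omega)))) (-b - 1).toNat (by omega)
      rwa [show -((((-b - 1).toNat : ℕ) : ℤ) + 1) = b by omega] at this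
  · have h0 : ∀ b, cf f k a b = 0 := fun b => hf.cf_eq_zero (by omega)
    rcases lt_trichotomy b 0 with hb0 | hb0 | hb0
    · have := hneg k a 0 (fun b _ => h0 b) (-b - 1).toNat (by omega)
      rwa [show -((((-b - 1).toNat : ℕ) : ℤ) + 1) = b by omega] at this
    · have h2 := hpos k a 0 (fun b _ => h0 b) 1 (by omega)
      have h3 := hneg k a 0 (fun b _ => h0 b) 1 (by omega)
      norm_num at h2 h3
      rw [hb0, cf_divSin_zero, h0, h0, h2, h3]; ring
    · have := hpos k a 0 (fun b _ => h0 b) (b - 1).toNat (by omega)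
      rwa [show (((b - 1).toNat : ℕ) : ℤ) + 1 = b by omega] at this

/-- The coefficients of the quotient by `sin θ` at positive polar frequencies are computed downwards
from the largest one, those at negative frequencies upwards from the smallest one, and the one at
frequency zero from its neighbours. -/
theorem FastOp.divSin : FastOp divSin := by
  refine ⟨0, 40, fun D => ⟨fun f hf => hf.divSin, fun X f hf => ?_⟩⟩
  have hbd' : ∀ x, Bd D (BallNS.divSin (f x)) := fun x => (hf x).divSin
  refine (Der.arr_of_polar (c := (D + 1) * 3 + (D + 1) * 3 + 8) hbd' fun k a => ?_).mono_cost ?_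
  · have hz : ∀ b : ℤ, (D : ℤ) < |b| → (fun x => cf (BallNS.divSin (f x)) k a b) ∈ arr f := by
      intro b hb
      have : (fun x => cf (BallNS.divSin (f x)) k a b) = fun _ => 0 := by
        funext x; exact (hbd' x).cf_eq_zero (Or.inr (Or.inr hb))
      rw [this]
      exact zero_mem_arr hf
    have h1 : Der (arr f) ((D + 1) * 3)
        ((fun (j : ℕ) x => cf (BallNS.divSin (f x)) k a (j + 1)) '' Set.univ) := by
      refine Der.chain (fun (j : ℕ) x => cf (BallNS.divSin (f x)) k a (j + 1)) D ?_ ?_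
      · intro j hj
        exact hz _ (by rw [abs_of_nonneg (by omega)]; omega)
      · intro j _
        have e : (fun x => cf (BallNS.divSin (f x)) k a (j + 1)) = fun x =>
            cf (BallNS.divSin (f x)) k a ((j + 2 : ℕ) + 1) + 2 * I * cf (f x) k a (j + 1 + 1) := by
          funext x
          rw [cf_divSin_of_pos _ _ _ _ (by omega)]
          congr 2
        rw [e]
        exact (Der.of_mem (c := 0) (by simp)).add
          (Der.smul _ (Der.of_mem (c := 0) (Or.inl (mem_arr f _ _ _))))
    have h2 : Der (arr f) ((D + 1) * 3)
        ((fun (j : ℕ) x => cf (BallNS.divSin (f x)) k a (-(j + 1))) '' Set.univ) := by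
      refine Der.chain (fun (j : ℕ) x => cf (BallNS.divSin (f x)) k a (-(j + 1))) D ?_ ?_
      · intro j hj
        exact hz _ (by rw [abs_of_neg (by omega)]; omega)
      · intro j _
        have e : (fun x => cf (BallNS.divSin (f x)) k a (-(j + 1))) = fun x =>
            cf (BallNS.divSin (f x)) k a (-((j + 2 : ℕ) + 1)) - 2 * I *
              cf (f x) k a (-(j + 1) - 1) := by
          funext x
          rw [cf_divSin_of_neg _ _ _ _ (by omega)]
          congr 2
        rw [e]
        exact (Der.of_mem (c := 0) (by simp)).sub
          (Der.smul _ (Der.of_mem (c := 0) (Or.inl (mem_arr f _ _ _))))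
    have h3 : Der (arr f ∪ ((fun (j : ℕ) x => cf (BallNS.divSin (f x)) k a (j + 1)) '' Set.univ ∪
        (fun (j : ℕ) x => cf (BallNS.divSin (f x)) k a (-(j + 1))) '' Set.univ)) 8
        {fun x => cf (BallNS.divSin (f x)) k a 0} := by
      simp only [cf_divSin_zero]
      refine (((Der.of_mem (c := 0) ?_).add (Der.of_mem (c := 0) ?_)).smul _).add
        (((Der.of_mem (c := 0) ?_).sub (Der.of_mem (c := 0) ?_)).smul _) |>.mono_cost (by omega)
      · exact Or.inr (Or.inl ⟨1, trivial, by norm_num⟩)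
      · exact Or.inr (Or.inr ⟨1, trivial, by norm_num⟩)
      · exact Or.inl (mem_arr f _ _ _)
      · exact Or.inl (mem_arr f _ _ _)
    refine ((h1.union h2).trans h3.keep).mono_right ?_
    rintro _ ⟨b, -, rfl⟩
    rcases lt_trichotomy b 0 with hb0 | rfl | hb0
    · exact Or.inl (Or.inr (Or.inr ⟨(-b - 1).toNat, trivial, by
        beta_reduce
        rw [show -((((-b - 1).toNat : ℕ) : ℤ) + 1) = b by omega]⟩))
    · exact Or.inr rfl
    · exact Or.inl (Or.inr (Or.inl ⟨(b - 1).toNat, trivial, by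
        beta_reduce
        rw [show (((b - 1).toNat : ℕ) : ℤ) + 1 = b by omega]⟩))
  · have h4 : 1 ≤ (D + 1) ^ 3 := Nat.one_le_pow _ _ (by omega)
    calc (D + 1) * (2 * D + 1) * ((D + 1) * 3 + (D + 1) * 3 + 8) + 1
        ≤ (D + 1) * (2 * (D + 1)) * ((D + 1) * 3 + (D + 1) * 3 + 8 * (D + 1)) + (D + 1) ^ 3 :=
          Nat.add_le_add (Nat.mul_le_mul (Nat.mul_le_mul_left _ (by omega)) (by omega)) h4
      _ = 29 * (D + 1) ^ 3 := by ring
      _ ≤ 40 * (D + 1) ^ 3 := Nat.mul_le_mul_right _ (by omega)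

theorem FastOp.cosLam_mul : FastOp fun f => cosLam * f := by
  simp only [cosLam, add_mul]
  exact (FastOp.mode_mul _ _ _).add (.mode_mul _ _ _)

theorem FastOp.sinLam_mul : FastOp fun f => sinLam * f := by
  simp only [sinLam, add_mul]
  exact (FastOp.mode_mul _ _ _).add (.mode_mul _ _ _)

theorem FastOp.cosTheta_mul : FastOp fun f => cosTheta * f := by
  simp only [cosTheta, add_mul]
  exact (FastOp.mode_mul _ _ _).add (.mode_mul _ _ _)

theorem FastOp.sinTheta_mul : FastOp fun f => sinTheta * f := by
  simp only [sinTheta, add_mul]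
  exact (FastOp.mode_mul _ _ _).add (.mode_mul _ _ _)

theorem FastOp.pd (i : Fin 3) : FastOp fun f => pd f i := by
  have h1 : FastOp fun f => sinTheta * cosLam * BallNS.dR f + BallNS.divR
      (cosTheta * cosLam * BallNS.dTheta f - sinLam * BallNS.divSin (BallNS.dLam f)) := by
    simp only [mul_assoc]
    exact (FastOp.sinTheta_mul.comp (FastOp.cosLam_mul.comp .dR)).add (FastOp.divR.comp
      ((FastOp.cosTheta_mul.comp (FastOp.cosLam_mul.comp .dTheta)).sub
        (FastOp.sinLam_mul.comp (FastOp.divSin.comp .dLam))))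
  have h2 : FastOp fun f => sinTheta * sinLam * BallNS.dR f + BallNS.divR
      (cosTheta * sinLam * BallNS.dTheta f + cosLam * BallNS.divSin (BallNS.dLam f)) := by
    simp only [mul_assoc]
    exact (FastOp.sinTheta_mul.comp (FastOp.sinLam_mul.comp .dR)).add (FastOp.divR.comp
      ((FastOp.cosTheta_mul.comp (FastOp.sinLam_mul.comp .dTheta)).add
        (FastOp.cosLam_mul.comp (FastOp.divSin.comp .dLam))))
  have h3 : FastOp fun f => cosTheta * BallNS.dR f - BallNS.divR (sinTheta * BallNS.dTheta f) :=
    (FastOp.cosTheta_mul.comp .dR).sub (FastOp.divR.comp (FastOp.sinTheta_mul.comp .dTheta))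
  fin_cases i
  exacts [h1, h2, h3]

theorem FastOp.pos_mul (i : Fin 3) : FastOp fun f => pos i * f := by
  have h1 : FastOp fun f => radius * sinTheta * cosLam * f := by
    simp only [mul_assoc]
    exact FastOp.radius_mul.comp (FastOp.sinTheta_mul.comp .cosLam_mul)
  have h2 : FastOp fun f => radius * sinTheta * sinLam * f := by
    simp only [mul_assoc]
    exact FastOp.radius_mul.comp (FastOp.sinTheta_mul.comp .sinLam_mul)
  have h3 : FastOp fun f => radius * cosTheta * f := by
    simp only [mul_assoc]
    exact FastOp.radius_mul.comp .cosTheta_mul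
  fin_cases i
  exacts [h1, h2, h3]

theorem Fast.curl {ι : Type} {Φ : Fin 3 → (ι → BallFn) → BallFn} (h : ∀ i, Fast (Φ i)) (j : Fin 3) :
    Fast fun f => curl (fun i => Φ i f) j := by
  have key : ∀ i i' k k', Fast fun f => pd (Φ i f) k - pd (Φ i' f) k' := fun i i' k k' =>
    (Fast.comp (.pd k) (h i)).sub (Fast.comp (.pd k') (h i'))
  fin_cases j
  exacts [key 2 1 1 2, key 0 2 2 0, key 1 0 0 1]

theorem Fast.ptField (j : Fin 3) : Fast fun f : Bool → BallFn => ptField (f false) (f true) j := by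
  have h : ∀ (b : Bool) (i : Fin 3), Fast fun f : Bool → BallFn => pos i * f b := fun b i =>
    Fast.comp (.pos_mul i) (.proj b)
  exact (Fast.curl (fun i => Fast.curl (h false) i) j).add (Fast.curl (h true) j)

theorem Fast.dot_pos {ι : Type} {Φ : Fin 3 → (ι → BallFn) → BallFn} (h : ∀ i, Fast (Φ i)) :
    Fast fun f => dot pos fun i => Φ i f :=
  ((Fast.comp (.pos_mul 0) (h 0)).add (Fast.comp (.pos_mul 1) (h 1))).add
    (Fast.comp (.pos_mul 2) (h 2))

end BallNS

namespace BallNS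

open Polynomial Complex

/-! ### Evaluation at the grid and interpolation -/

/-- Evaluation at a point, as a ring homomorphism. -/
noncomputable def evalHom (r lam θ : ℝ) : BallFn →+* ℂ :=
  AddMonoidAlgebra.liftNCRingHom (evalRingHom (r : ℂ))
    { toFun := fun ab => exp (I * ((ab.toAdd.1 : ℂ) * (lam : ℂ) + (ab.toAdd.2 : ℂ) * (θ : ℂ)))
      map_one' := by simp
      map_mul' := fun x y => by
        rw [← exp_add]
        congr 1
        simp only [toAdd_mul, Prod.fst_add, Prod.snd_add]
        push_cast
        ring } fun _ _ => Commute.all _ _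

theorem evalHom_apply (f : BallFn) (r lam θ : ℝ) : evalHom r lam θ f = f.eval r lam θ := rfl

theorem evalHom_mode (a b : ℤ) (p : ℂ[X]) (r lam θ : ℝ) : evalHom r lam θ (mode a b p) =
    p.eval (r : ℂ) * exp (I * ((a : ℂ) * (lam : ℂ) + (b : ℂ) * (θ : ℂ))) := by
  rw [evalHom_apply, BallFn.eval, mode, AddMonoidAlgebra.coeff_single, Finsupp.sum_single_index]
  simp

theorem eq_sum_modes {D : ℕ} {f : BallFn} (hf : Bd D f) : f = ∑ i ∈ box D,
    mode i.2.1 i.2.2 (C (cf f i.1 i.2.1 i.2.2) * Chebyshev.T ℂ (i.1 : ℕ)) := by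
  refine cf_ext fun k a b => ?_
  simp only [cf_sum, cf_mode, chebCoeff_C_mul, chebCoeff_T]
  have e : ∀ i : ℕ × ℤ × ℤ, (if a = i.2.1 ∧ b = i.2.2 then
      cf f i.1 i.2.1 i.2.2 * (if i.1 = k then 1 else 0) else 0) =
      if (k, a, b) = i then cf f k a b else 0 := by
    rintro ⟨k', a', b'⟩
    simp only [Prod.mk.injEq]
    by_cases h1 : k = k' <;> by_cases h2 : a = a' <;> by_cases h3 : b = b' <;> simp [h1, h2, h3]
    simp [Ne.symm h1]
  simp only [e]
  rw [Finset.sum_ite_eq]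
  split_ifs with h
  · rfl
  · rw [mem_box] at h
    exact hf.cf_eq_zero (by omega)

/-- The root of unity of the grid. -/
noncomputable def gridRoot (n : ℕ) : ℂ := exp (2 * Real.pi * I / n)

theorem gridRoot_ne_zero (n : ℕ) : gridRoot n ≠ 0 := exp_ne_zero _

theorem gridRoot_zpow (n : ℕ) (m : ℤ) : gridRoot n ^ m = exp (m * (2 * Real.pi * I / n)) := by
  rw [gridRoot, ← exp_int_mul]

theorem gridRoot_zpow_self {n : ℕ} (hn : n ≠ 0) (m : ℤ) : gridRoot n ^ (n * m) = 1 := by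
  rw [zpow_mul, zpow_natCast, gridRoot, (Complex.isPrimitiveRoot_exp n hn).pow_eq_one, one_zpow]

theorem gridValues_eq {D : ℕ} {f : BallFn} (hf : Bd D f) {n : ℕ} (i : CFFIdx n) :
    gridValues n f i = ∑ p ∈ box D, cf f p.1 p.2.1 p.2.2 *
      ((gridRoot n ^ ((p.1 : ℤ) * (i.1 : ℕ)) + gridRoot n ^ (-((p.1 : ℤ) * (i.1 : ℕ)))) / 2 *
        gridRoot n ^ (p.2.1 * i.2.1) * gridRoot n ^ (p.2.2 * i.2.2)) := by
  rw [gridValues, ← evalHom_apply]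
  conv_lhs => rw [eq_sum_modes hf]
  rw [map_sum]
  refine Finset.sum_congr rfl fun p _ => ?_
  rw [evalHom_mode, eval_mul, eval_C, Complex.ofReal_cos, Chebyshev.T_complex_cos, mul_assoc]
  congr 1
  rw [mul_assoc ((gridRoot n ^ _ + gridRoot n ^ _) / 2)]
  congr 1
  · rw [Complex.cos, gridRoot_zpow, gridRoot_zpow]
    congr 2 <;> congr 1 <;> push_cast <;> ring
  · rw [gridRoot_zpow, gridRoot_zpow, ← exp_add]
    congr 1; push_cast; ring

section

variable {X : Type} {A : Set (X → ℂ)}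

/-- The cube `[-N, N]³`. -/
noncomputable def cube (N : ℕ) : Finset (ℤ × ℤ × ℤ) :=
  Finset.Icc (-N : ℤ) N ×ˢ Finset.Icc (-N : ℤ) N ×ˢ Finset.Icc (-N : ℤ) N

/-- The three-dimensional Fourier sums, one direction at a time. -/
theorem Der.chirp₃ (N : ℕ) (ω : ℂ) (hω : ω ≠ 0) (c : ℤ × ℤ × ℤ → X → ℂ)
    (hc : ∀ i ∈ cube N, c i ∈ A) :
    Der A (1440 * (N + 1) ^ 3 * lg N) ((fun (j : ℤ × ℤ × ℤ) x => ∑ p ∈ cube N,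
      ω ^ (p.1 * j.1) * ω ^ (p.2.1 * j.2.1) * ω ^ (p.2.2 * j.2.2) * c p x) '' cube N) := by
  set Q := Finset.Icc (-N : ℤ) N with hQ
  have hcard : (Q ×ˢ Q).card * (120 * (N + 1) * lg N) ≤ 480 * (N + 1) ^ 3 * lg N := by
    rw [Finset.card_product, hQ, card_Icc_neg]
    calc (2 * N + 1) * (2 * N + 1) * (120 * (N + 1) * lg N)
        ≤ (2 * (N + 1)) * (2 * (N + 1)) * (120 * (N + 1) * lg N) :=
          Nat.mul_le_mul_right _ (Nat.mul_le_mul (by omega) (by omega))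
      _ = _ := by ring
  have axis : ∀ (A : Set (X → ℂ)) (F : ℤ × ℤ → ℤ → X → ℂ),
      (∀ p ∈ Q ×ˢ Q, ∀ i ∈ Q, F p i ∈ A) → Der A (480 * (N + 1) ^ 3 * lg N)
        (⋃ p ∈ Q ×ˢ Q, (fun j x => ∑ i ∈ Q, ω ^ (i * j) * F p i x) '' Q) := fun A F hF =>
    (Der.biUnion (Q ×ˢ Q) _ fun p hp => Der.chirp N ω hω (F p) (hF p hp)).mono_cost hcard
  let F1 : ℤ × ℤ → ℤ → X → ℂ := fun p i => c (p.1, p.2, i)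
  let F2 : ℤ × ℤ → ℤ → X → ℂ := fun p i x => ∑ l ∈ Q, ω ^ (l * p.2) * F1 (p.1, i) l x
  let F3 : ℤ × ℤ → ℤ → X → ℂ := fun p i x => ∑ l ∈ Q, ω ^ (l * p.1) * F2 (i, p.2) l x
  have h1 := axis A F1 fun p hp i hi => hc _ (by
    simp only [cube, Finset.mem_product] at hp ⊢; exact ⟨hp.1, hp.2, hi⟩)
  have h2 := axis (A ∪ ⋃ p ∈ Q ×ˢ Q, (fun j x => ∑ i ∈ Q, ω ^ (i * j) * F1 p i x) '' Q) F2
    fun p hp i hi => Or.inr (by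
      simp only [Finset.mem_product] at hp
      simp only [Set.mem_iUnion]
      exact ⟨(p.1, i), Finset.mem_product.2 ⟨hp.1, hi⟩, p.2, hp.2, rfl⟩)
  have h3 := axis (A ∪ (⋃ p ∈ Q ×ˢ Q, (fun j x => ∑ i ∈ Q, ω ^ (i * j) * F1 p i x) '' Q) ∪
      ⋃ p ∈ Q ×ˢ Q, (fun j x => ∑ i ∈ Q, ω ^ (i * j) * F2 p i x) '' Q) F3
    fun p hp i hi => Or.inr (by
      simp only [Finset.mem_product] at hp
      simp only [Set.mem_iUnion]
      exact ⟨(i, p.2), Finset.mem_product.2 ⟨hi, hp.2⟩, p.1, hp.1, rfl⟩)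
  refine (h1.trans (h2.trans h3)).mono le_rfl (le_of_eq (by ring)) ?_
  rintro _ ⟨⟨j1, j2, j3⟩, hj, rfl⟩
  simp only [cube, Finset.coe_product, Set.mem_prod, Finset.mem_coe] at hj
  simp only [Set.mem_iUnion]
  refine ⟨(j2, j3), Finset.mem_product.2 hj.2, j1, hj.1, ?_⟩
  funext x
  simp only [F3, F2, F1, cube, Finset.sum_product, Finset.mul_sum]
  refine Finset.sum_congr rfl fun i _ => Finset.sum_congr rfl fun j _ =>
    Finset.sum_congr rfl fun k _ => ?_
  ring

theorem card_CFFIdx (n : ℕ) : Fintype.card (CFFIdx n) = (n / 2 + 1) * (2 * (n / 2) + 1) ^ 2 := by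
  simp only [CFFIdx, Freq, Fintype.card_prod, Fintype.card_fin, Fintype.card_coe, card_Icc_neg]
  ring

theorem card_CFFIdx_le {n N : ℕ} (h : n ≤ N) : Fintype.card (CFFIdx n) ≤ 4 * (N + 1) ^ 3 := by
  rw [card_CFFIdx]
  calc (n / 2 + 1) * (2 * (n / 2) + 1) ^ 2 ≤ (N + 1) * (2 * (N + 1)) ^ 2 :=
        Nat.mul_le_mul (by omega) (Nat.pow_le_pow_left (by omega) 2)
    _ = _ := by ring

theorem Der.range {κ : Type} [Fintype κ] {c : ℕ} (F : κ → X → ℂ) (h : ∀ k, Der A c {F k}) :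
    Der A (Fintype.card κ * c) (Set.range F) := by
  have := Der.image Finset.univ F fun k _ => h k
  rwa [Finset.coe_univ, Set.image_univ, Finset.card_univ] at this

/-- Evaluation at the grid of a function of bounded degree. -/
theorem Der.gridValues (D n : ℕ) (f : X → BallFn) (hf : ∀ x, Bd D (f x)) :
    Der (arr f) (1500 * (D + n + 1) ^ 3 * lg (D + n))
      (Set.range fun i x => gridValues n (f x) i) := by
  set N := D + n with hN
  let c : ℤ × ℤ × ℤ → X → ℂ := fun p =>
    if 0 ≤ p.1 then fun x => cf (f x) p.1.toNat p.2.1 p.2.2 else fun _ => 0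
  have hc : ∀ p, c p ∈ arr f := by
    intro p
    simp only [c]
    split_ifs
    exacts [mem_arr f _ _ _, zero_mem_arr hf]
  let G : ℤ × ℤ × ℤ → X → ℂ := fun j x => ∑ p ∈ cube N, gridRoot n ^ (p.1 * j.1) *
    gridRoot n ^ (p.2.1 * j.2.1) * gridRoot n ^ (p.2.2 * j.2.2) * c p x
  have h1 := Der.chirp₃ N (gridRoot n) (gridRoot_ne_zero n) c fun i _ => hc i
  have hG : ∀ (j : ℤ × ℤ × ℤ) x, G j x = ∑ p ∈ box D, cf (f x) p.1 p.2.1 p.2.2 *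
      (gridRoot n ^ (p.1 * j.1) * gridRoot n ^ (p.2.1 * j.2.1) * gridRoot n ^ (p.2.2 * j.2.2)) := by
    intro j x
    refine (Finset.sum_bij_ne_zero (fun p _ _ => ((p.1 : ℤ), p.2)) ?_ ?_ ?_ ?_).symm
    · intro p hp _
      obtain ⟨k, a, b⟩ := p
      simp only [mem_box, abs_le] at hp
      simp only [cube, Finset.mem_product, Finset.mem_Icc]
      omega
    · intro p _ _ q _ _ h
      simpa [Prod.ext_iff] using h
    · intro q hq h
      obtain ⟨k, a, b⟩ := q
      by_cases hk : 0 ≤ k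
      · simp only [c, hk, if_true] at h
        have h0 := right_ne_zero_of_mul h
        have := hf x _ _ _ h0
        refine ⟨(k.toNat, a, b), mem_box.2 this, ?_, by simp [hk]⟩
        rw [mul_comm]
        simpa [hk] using h
      · simp [c, hk] at h
    · intro p _ _
      simp [c]
      ring
  have h2 : Der (arr f ∪ G '' cube N) (Fintype.card (CFFIdx n) * 3)
      (Set.range fun i x => BallNS.gridValues n (f x) i) := by
    refine Der.range (fun (i : CFFIdx n) x => BallNS.gridValues n (f x) i) fun i => ?_
    have hi : (((i.1 : ℕ) : ℤ), (i.2.1 : ℤ), (i.2.2 : ℤ)) ∈ cube N ∧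
        (-((i.1 : ℕ) : ℤ), (i.2.1 : ℤ), (i.2.2 : ℤ)) ∈ cube N := by
      have h1 := i.1.2
      have h2 := Finset.mem_Icc.1 i.2.1.2
      have h3 := Finset.mem_Icc.1 i.2.2.2
      simp only [cube, Finset.mem_product, Finset.mem_Icc]
      omega
    have e : (fun x => BallNS.gridValues n (f x) i) = fun x => 1 / 2 *
        (G ((i.1 : ℕ), i.2.1, i.2.2) x + G (-((i.1 : ℕ) : ℤ), i.2.1, i.2.2) x) := by
      funext x
      rw [gridValues_eq (hf x), hG, hG, ← Finset.sum_add_distrib, Finset.mul_sum]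
      refine Finset.sum_congr rfl fun p _ => ?_
      rw [mul_neg]; ring
    rw [e]
    exact ((Der.of_mem (c := 0) (Or.inr ⟨_, hi.1, rfl⟩)).add
      (Der.of_mem (c := 0) (Or.inr ⟨_, hi.2, rfl⟩))).smul _
  refine (h1.trans h2).mono_cost ?_
  have h3 := card_CFFIdx_le (n := n) (N := N) (by omega)
  have h4 : 2 ≤ lg N := by simp [lg]
  nlinarith [Nat.mul_le_mul_left (6 * (N + 1) ^ 3) h4]

end

/-! ### Interpolation at the grid -/

/-- Extension of an array by zero. -/
noncomputable def extend {n : ℕ} (d : CFFIdx n → ℂ) (k : ℕ) (a b : ℤ) : ℂ :=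
  ∑ i : CFFIdx n, if k = i.1 ∧ a = i.2.1 ∧ b = i.2.2 then d i else 0

theorem extend_apply {n : ℕ} (d : CFFIdx n → ℂ) (i : CFFIdx n) :
    extend d i.1 i.2.1 i.2.2 = d i := by
  rw [extend, Finset.sum_eq_single i]
  · simp
  · intro j _ hj
    refine if_neg fun ⟨h1, h2, h3⟩ => hj ?_
    exact Prod.ext (Fin.ext h1.symm) (Prod.ext (Subtype.ext h2.symm) (Subtype.ext h3.symm))
  · simp

theorem extend_add {n : ℕ} (d d' : CFFIdx n → ℂ) (k : ℕ) (a b : ℤ) :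
    extend (d + d') k a b = extend d k a b + extend d' k a b := by
  simp only [extend, ← Finset.sum_add_distrib]
  exact Finset.sum_congr rfl fun i _ => by split_ifs <;> simp

theorem extend_smul {n : ℕ} (z : ℂ) (d : CFFIdx n → ℂ) (k : ℕ) (a b : ℤ) :
    extend (z • d) k a b = z * extend d k a b := by
  simp only [extend, Finset.mul_sum]
  exact Finset.sum_congr rfl fun i _ => by split_ifs <;> simp

theorem extend_eq_zero {n : ℕ} (d : CFFIdx n → ℂ) {k : ℕ} {a b : ℤ}
    (h : ¬ (k ≤ n / 2 ∧ |a| ≤ (n / 2 : ℕ) ∧ |b| ≤ (n / 2 : ℕ))) : extend d k a b = 0 := by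
  refine Finset.sum_eq_zero fun i _ => if_neg ?_
  rintro ⟨rfl, rfl, rfl⟩
  have h1 := i.1.2
  have h2 := Finset.mem_Icc.1 i.2.1.2
  have h3 := Finset.mem_Icc.1 i.2.2.2
  simp only [abs_le] at h
  omega

theorem cf_ofCFF {n : ℕ} (d : CFFIdx n → ℂ) (k : ℕ) (a b : ℤ) :
    cf (ofCFF d) k a b = extend d k a b := by
  simp only [ofCFF, cf_sum, cf_mode, chebCoeff_C_mul, chebCoeff_T, extend]
  refine Finset.sum_congr rfl fun i _ => ?_
  by_cases h1 : k = i.1 <;> by_cases h2 : a = i.2.1 <;> by_cases h3 : b = i.2.2 <;>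
    simp [h1, h2, h3]
  simp [Ne.symm h1]

theorem Bd.ofCFF {n : ℕ} (d : CFFIdx n → ℂ) : Bd (n / 2) (ofCFF d) := by
  intro k a b h
  rw [cf_ofCFF] at h
  by_contra h'
  exact h (extend_eq_zero d h')

/-- A periodic array has equal values at the two ends of each angular range. -/
theorem EdgeSymm.extend_eq {n : ℕ} {d : CFFIdx n → ℂ} (hd : EdgeSymm d) :
    (∀ k b, extend d k (n / 2 : ℕ) b = extend d k (-(n / 2 : ℕ)) b) ∧
    ∀ k a, extend d k a (n / 2 : ℕ) = extend d k a (-(n / 2 : ℕ)) := by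
  have hm : ((n / 2 : ℕ) : ℤ) ∈ Finset.Icc (-((n / 2 : ℕ) : ℤ)) ((n / 2 : ℕ) : ℤ) := by
    rw [Finset.mem_Icc]; omega
  have hm' : -((n / 2 : ℕ) : ℤ) ∈ Finset.Icc (-((n / 2 : ℕ) : ℤ)) ((n / 2 : ℕ) : ℤ) := by
    rw [Finset.mem_Icc]; omega
  constructor
  · intro k b
    by_cases h : k ≤ n / 2 ∧ |b| ≤ (n / 2 : ℕ)
    · let k' : Fin (n / 2 + 1) := ⟨k, by omega⟩
      let b' : Freq n := ⟨b, by rw [Finset.mem_Icc, ← abs_le]; exact h.2⟩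
      exact (extend_apply d (k', ⟨_, hm⟩, b')).trans
        ((hd.1 k' ⟨_, hm'⟩ ⟨_, hm⟩ b' rfl rfl).symm.trans
        (extend_apply d (k', ⟨_, hm'⟩, b')).symm)
    · rw [extend_eq_zero, extend_eq_zero] <;> tauto
  · intro k a
    by_cases h : k ≤ n / 2 ∧ |a| ≤ (n / 2 : ℕ)
    · let k' : Fin (n / 2 + 1) := ⟨k, by omega⟩
      let a' : Freq n := ⟨a, by rw [Finset.mem_Icc, ← abs_le]; exact h.2⟩
      exact (extend_apply d (k', a', ⟨_, hm⟩)).trans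
        ((hd.2 k' a' ⟨_, hm'⟩ ⟨_, hm⟩ rfl rfl).symm.trans
        (extend_apply d (k', a', ⟨_, hm'⟩)).symm)
    · rw [extend_eq_zero, extend_eq_zero] <;> tauto

/-- The sum of the powers of `ω^m` over one period. -/
theorem sum_gridRoot {n : ℕ} (hn : n ≠ 0) (he : Even n) (m : ℤ) :
    ∑ j ∈ Finset.Ico (-(n / 2 : ℕ) : ℤ) (n / 2 : ℕ), gridRoot n ^ (m * j) =
      if (n : ℤ) ∣ m then (n : ℂ) else 0 := by
  obtain ⟨M, rfl⟩ := he
  have hM : (M + M) / 2 = M := by omega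
  rw [hM]
  set ω := gridRoot (M + M) with hω
  have hω0 : ω ≠ 0 := gridRoot_ne_zero _
  split_ifs with h
  · obtain ⟨c, rfl⟩ := h
    simp only [mul_assoc]
    simp only [hω, gridRoot_zpow_self hn]
    rw [Finset.sum_const, Int.card_Ico, show ((M : ℤ) - -M).toNat = M + M by omega]
    simp
  · have h1 : ω ^ m ≠ 1 := by
      rw [Ne, hω, gridRoot, (Complex.isPrimitiveRoot_exp (M + M) hn).zpow_eq_one_iff_dvd]
      exact h
    have h2 : ω ^ m * ∑ j ∈ Finset.Ico (-(M : ℤ)) M, ω ^ (m * j) =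
        ∑ j ∈ Finset.Ico (-(M : ℤ)) M, ω ^ (m * j) := by
      have e : ω ^ m * ∑ j ∈ Finset.Ico (-(M : ℤ)) M, ω ^ (m * j) =
          ∑ j ∈ Finset.Ico (-(M : ℤ) + 1) (M + 1), ω ^ (m * j) := by
        rw [Finset.mul_sum]
        refine Finset.sum_bij (fun j _ => j + 1) ?_ ?_ ?_ ?_
        · intro j hj; rw [Finset.mem_Ico] at hj ⊢; omega
        · intro _ _ _ _ h; omega
        · intro j hj
          rw [Finset.mem_Ico] at hj
          exact ⟨j - 1, by rw [Finset.mem_Ico]; omega, by omega⟩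
        · intro j _
          rw [← zpow_add₀ hω0]; congr 1; ring
      have hM0 : 0 < M := by omega
      have s1 : Finset.Ico (-(M : ℤ)) M = insert (-(M : ℤ)) (Finset.Ico (-(M : ℤ) + 1) M) := by
        ext j; simp only [Finset.mem_insert, Finset.mem_Ico]; omega
      have s2 : Finset.Ico (-(M : ℤ) + 1) (M + 1) =
          insert (M : ℤ) (Finset.Ico (-(M : ℤ) + 1) M) := by
        ext j; simp only [Finset.mem_insert, Finset.mem_Ico]; omega
      rw [e, s1, s2, Finset.sum_insert (by simp), Finset.sum_insert (by simp)]
      congr 1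
      have : m * (M : ℤ) = ((M + M : ℕ) : ℤ) * m + m * (-(M : ℤ)) := by push_cast; ring
      rw [this, zpow_add₀ hω0, hω, gridRoot_zpow_self hn, one_mul]
    have h3 : (ω ^ m - 1) * ∑ j ∈ Finset.Ico (-(M : ℤ)) M, ω ^ (m * j) = 0 := by
      rw [sub_mul, h2, one_mul, sub_self]
    exact (mul_eq_zero.1 h3).resolve_left (sub_ne_zero.2 h1)

/-- The sum over one period of a power of the root of unity of the grid. -/
noncomputable def periodSum (n : ℕ) (m : ℤ) : ℂ :=
  ∑ j ∈ Finset.Ico (-(n / 2 : ℕ) : ℤ) (n / 2 : ℕ), gridRoot n ^ (m * j)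

theorem sum_mul_periodSum {n : ℕ} (hn : n ≠ 0) (he : Even n) (g : ℤ → ℂ)
    (hg : g (n / 2 : ℕ) = g (-(n / 2 : ℕ))) (a : ℤ) (ha : |a| ≤ (n / 2 : ℕ)) :
    ∑ a' ∈ Finset.Icc (-(n / 2 : ℕ) : ℤ) (n / 2 : ℕ), g a' * periodSum n (a' - a) =
      n * (if |a| = (n / 2 : ℕ) then 2 else 1) * g a := by
  simp only [periodSum, sum_gridRoot hn he]
  obtain ⟨M, rfl⟩ := he
  have hM : (M + M) / 2 = M := by omega
  simp only [hM] at ha hg ⊢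
  have hM0 : 0 < M := by omega
  split_ifs with h
  · have key : ∀ a' ∈ Finset.Icc (-(M : ℤ)) M, g a' *
        (if ((M + M : ℕ) : ℤ) ∣ a' - a then ((M + M : ℕ) : ℂ) else 0) =
        (if a' = M then (M + M : ℕ) * g a else 0) + if a' = -M then (M + M : ℕ) * g a else 0 := by
      intro a' ha'
      rw [Finset.mem_Icc] at ha'
      have hd : ((M + M : ℕ) : ℤ) ∣ a' - a ↔ (a' = M ∨ a' = -M) := by
        constructor
        · rintro ⟨c, hc⟩
          push_cast at hc
          have : c = 0 ∨ c = 1 ∨ c = -1 := by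
            have h1 : c < 2 := by
              by_contra h2
              rcases abs_cases a with h' | h' <;> nlinarith
            have h2 : -2 < c := by
              by_contra h2
              rcases abs_cases a with h' | h' <;> nlinarith
            omega
          rcases abs_cases a with h' | h' <;> rcases this with rfl | rfl | rfl <;> omega
        · intro h1
          have : a' - a = 0 ∨ a' - a = ((M + M : ℕ) : ℤ) ∨ a' - a = -((M + M : ℕ) : ℤ) := by
            rcases abs_cases a with h' | h' <;> push_cast <;> omega
          rcases this with h | h | h <;> rw [h]
          exacts [dvd_zero _, Int.dvd_neg.2 (Int.dvd_refl _)]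
      have hga : g a = g M := by
        rcases abs_cases a with h' | h'
        · rw [show a = M by omega]
        · rw [show a = -M by omega, hg]
      simp only [hd]
      rcases eq_or_ne a' M with h1 | h1
      · rw [if_pos (Or.inl h1), if_pos h1, if_neg (by omega), h1, hga]; ring
      · rcases eq_or_ne a' (-M) with h2 | h2
        · rw [if_pos (Or.inr h2), if_pos h2, if_neg h1, h2, hga, hg]; ring
        · rw [if_neg (by tauto), if_neg h1, if_neg h2]; ring
    rw [Finset.sum_congr rfl key, Finset.sum_add_distrib, Finset.sum_ite_eq', Finset.sum_ite_eq',
      if_pos (by rw [Finset.mem_Icc]; omega), if_pos (by rw [Finset.mem_Icc]; omega)]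
    ring
  · rw [Finset.sum_eq_single a]
    · rw [sub_self, if_pos (dvd_zero _)]; ring
    · intro a' ha' hne
      rw [Finset.mem_Icc] at ha'
      rw [if_neg, mul_zero]
      rintro ⟨c, hc⟩
      push_cast at hc
      have : c ≠ 0 := by rintro rfl; omega
      rcases lt_or_gt_of_ne this with h1 | h1
      · have h2 : ((M : ℤ) + M) * c ≤ -(M + M) := by nlinarith
        rcases abs_cases a with h' | h' <;> omega
      · have h2 : (M : ℤ) + M ≤ (M + M) * c := by nlinarith
        rcases abs_cases a with h' | h' <;> omega
    · intro h'
      rw [Finset.mem_Icc, ← abs_le] at h'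
      exact absurd ha h'

theorem sum_mul_periodSum_radial {n : ℕ} (hn : n ≠ 0) (he : Even n) (g : ℕ → ℂ) (k : ℕ)
    (hk : k ≤ n / 2) :
    ∑ k' ∈ Finset.range (n / 2 + 1), g k' * ((periodSum n ((k' : ℤ) - k) +
      periodSum n (-(k' : ℤ) - k)) / 2) = n * (if k = 0 ∨ k = n / 2 then 1 else 1 / 2) * g k := by
  simp only [periodSum, sum_gridRoot hn he]
  obtain ⟨M, rfl⟩ := he
  have hM : (M + M) / 2 = M := by omega
  simp only [hM] at hk ⊢
  have hM0 : 0 < M := by omega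
  rw [Finset.sum_eq_single k]
  · rw [sub_self, if_pos (dvd_zero _)]
    have : ((M + M : ℕ) : ℤ) ∣ -(k : ℤ) - k ↔ (k = 0 ∨ k = M) := by
      constructor
      · rintro ⟨c, hc⟩
        push_cast at hc
        have h1 : c ≤ 0 := by by_contra h; nlinarith
        have h2 : -2 < c := by by_contra h; nlinarith
        have h3 : c = 0 ∨ c = -1 := by omega
        rcases h3 with rfl | rfl <;> omega
      · rintro (rfl | rfl)
        · simp
        · exact ⟨-1, by push_cast; ring⟩
    simp only [this]
    split_ifs <;> ring
  · intro k' hk' hne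
    rw [Finset.mem_range] at hk'
    rw [if_neg, if_neg]
    · simp
    · rintro ⟨c, hc⟩
      push_cast at hc
      have h1 : c ≤ 0 := by by_contra h; nlinarith
      have h2 : -2 < c := by by_contra h; nlinarith
      have h3 : c = 0 ∨ c = -1 := by omega
      rcases h3 with rfl | rfl <;> omega
    · rintro ⟨c, hc⟩
      push_cast at hc
      have h1 : c < 1 := by by_contra h; nlinarith
      have h2 : -1 < c := by by_contra h; nlinarith
      obtain rfl : c = 0 := by omega
      omega
  · intro h; exact absurd (Finset.mem_range.2 (by omega)) h

/-- The coefficients of the normalized interpolant of a periodic array of grid values. -/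
noncomputable def interp {n : ℕ} (v : CFFIdx n → ℂ) : CFFIdx n → ℂ := fun i =>
  (n : ℂ)⁻¹ ^ 3 * (if (i.1 : ℕ) = 0 ∨ (i.1 : ℕ) = n / 2 then 1 else 2) *
    (if |(i.2.1 : ℤ)| = (n / 2 : ℕ) then 1 / 2 else 1) *
    (if |(i.2.2 : ℤ)| = (n / 2 : ℕ) then 1 / 2 else 1) *
    ∑ j ∈ Finset.Ico (-(n / 2 : ℕ) : ℤ) (n / 2 : ℕ) ×ˢ Finset.Ico (-(n / 2 : ℕ) : ℤ) (n / 2 : ℕ) ×ˢ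
      Finset.Ico (-(n / 2 : ℕ) : ℤ) (n / 2 : ℕ),
      (gridRoot n)⁻¹ ^ (j.1 * (i.1 : ℕ)) * (gridRoot n)⁻¹ ^ (j.2.1 * i.2.1) *
        (gridRoot n)⁻¹ ^ (j.2.2 * i.2.2) * extend v j.1.natAbs j.2.1 j.2.2

theorem extend_gridValues {n : ℕ} {D : ℕ} {f : BallFn} (hf : Bd D f) {k a b : ℤ}
    (h : |k| ≤ (n / 2 : ℕ) ∧ |a| ≤ (n / 2 : ℕ) ∧ |b| ≤ (n / 2 : ℕ)) :
    extend (gridValues n f) k.natAbs a b = ∑ p ∈ box D, cf f p.1 p.2.1 p.2.2 *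
      ((gridRoot n ^ ((p.1 : ℤ) * k) + gridRoot n ^ (-((p.1 : ℤ) * k))) / 2 *
        gridRoot n ^ (p.2.1 * a) * gridRoot n ^ (p.2.2 * b)) := by
  obtain ⟨h1, h2, h3⟩ := h
  have e := extend_apply (gridValues n f) (⟨k.natAbs, by rw [Int.abs_eq_natAbs] at h1; omega⟩,
    ⟨a, by rw [Finset.mem_Icc, ← abs_le]; exact h2⟩,
    ⟨b, by rw [Finset.mem_Icc, ← abs_le]; exact h3⟩)
  simp only at e
  rw [e, gridValues_eq hf]
  refine Finset.sum_congr rfl fun p _ => ?_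
  simp only
  rcases abs_cases k with h | h
  · rw [show ((k.natAbs : ℕ) : ℤ) = k by omega]
  · rw [show ((k.natAbs : ℕ) : ℤ) = -k by omega, mul_neg, neg_neg]; ring

theorem sum_product₃ {α β γ : Type*} (s : Finset α) (t : Finset β) (u : Finset γ) (z : ℂ)
    (f : α → ℂ) (g : β → ℂ) (h : γ → ℂ) :
    ∑ j ∈ s ×ˢ t ×ˢ u, z * f j.1 * g j.2.1 * h j.2.2 =
      z * (∑ i ∈ s, f i) * (∑ i ∈ t, g i) * ∑ i ∈ u, h i := by
  simp only [Finset.sum_product, ← Finset.mul_sum, ← Finset.sum_mul]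

theorem interp_gridValues {n : ℕ} (hn : n ≠ 0) (he : Even n) {d : CFFIdx n → ℂ} (hd : EdgeSymm d) :
    interp (gridValues n (ofCFF d)) = d := by
  funext i
  obtain ⟨k, a, b⟩ := i
  have hk := k.2
  have ha := Finset.mem_Icc.1 a.2
  have hb := Finset.mem_Icc.1 b.2
  rw [← abs_le] at ha hb
  set R := Finset.Ico (-(n / 2 : ℕ) : ℤ) (n / 2 : ℕ) with hR
  have hω := gridRoot_ne_zero n
  have e1 : ∑ j ∈ R ×ˢ R ×ˢ R,
      (gridRoot n)⁻¹ ^ (j.1 * (k : ℕ)) * (gridRoot n)⁻¹ ^ (j.2.1 * a) *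
        (gridRoot n)⁻¹ ^ (j.2.2 * b) *
        extend (gridValues n (ofCFF d)) j.1.natAbs j.2.1 j.2.2 =
      ∑ p ∈ box (n / 2), extend d p.1 p.2.1 p.2.2 *
        ((periodSum n ((p.1 : ℤ) - (k : ℕ)) + periodSum n (-(p.1 : ℤ) - (k : ℕ))) / 2) *
        periodSum n (p.2.1 - a) * periodSum n (p.2.2 - b) := by
    have e2 : ∀ j ∈ R ×ˢ R ×ˢ R,
        (gridRoot n)⁻¹ ^ (j.1 * (k : ℕ)) * (gridRoot n)⁻¹ ^ (j.2.1 * a) *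
        (gridRoot n)⁻¹ ^ (j.2.2 * b) *
        extend (gridValues n (ofCFF d)) j.1.natAbs j.2.1 j.2.2 =
        ∑ p ∈ box (n / 2), extend d p.1 p.2.1 p.2.2 * ((gridRoot n ^ (((p.1 : ℤ) - (k : ℕ)) * j.1) +
          gridRoot n ^ ((-(p.1 : ℤ) - (k : ℕ)) * j.1)) / 2) *
          gridRoot n ^ ((p.2.1 - a) * j.2.1) * gridRoot n ^ ((p.2.2 - b) * j.2.2) := by
      rintro ⟨j1, j2, j3⟩ hj
      simp only [hR, Finset.mem_product, Finset.mem_Ico] at hj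
      rw [extend_gridValues (Bd.ofCFF d) (by simp only [abs_le]; omega), Finset.mul_sum]
      refine Finset.sum_congr rfl fun p _ => ?_
      rw [cf_ofCFF]
      simp only [sub_mul, zpow_sub₀ hω, inv_zpow', zpow_neg, neg_mul]
      rw [mul_comm j1, mul_comm j2, mul_comm j3]
      field_simp
    rw [Finset.sum_congr rfl e2, Finset.sum_comm]
    refine Finset.sum_congr rfl fun p _ => ?_
    rw [sum_product₃ R R R _ (fun j => (gridRoot n ^ (((p.1 : ℤ) - (k : ℕ)) * j) +
      gridRoot n ^ ((-(p.1 : ℤ) - (k : ℕ)) * j)) / 2) (fun j => gridRoot n ^ ((p.2.1 - a) * j))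
      (fun j => gridRoot n ^ ((p.2.2 - b) * j)), ← Finset.sum_div, Finset.sum_add_distrib]
    rfl
  have e3 : ∑ p ∈ box (n / 2), extend d p.1 p.2.1 p.2.2 *
        ((periodSum n ((p.1 : ℤ) - (k : ℕ)) + periodSum n (-(p.1 : ℤ) - (k : ℕ))) / 2) *
        periodSum n (p.2.1 - a) * periodSum n (p.2.2 - b) =
      (n * if (k : ℕ) = 0 ∨ (k : ℕ) = n / 2 then 1 else 1 / 2) *
      (n * if |(a : ℤ)| = (n / 2 : ℕ) then 2 else 1) *
      (n * if |(b : ℤ)| = (n / 2 : ℕ) then 2 else 1) * extend d k a b := by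
    rw [box, Finset.sum_product]
    have e4 : ∀ k' : ℕ, ∑ p ∈ Finset.Icc (-(n / 2 : ℕ) : ℤ) (n / 2 : ℕ) ×ˢ
        Finset.Icc (-(n / 2 : ℕ) : ℤ) (n / 2 : ℕ), extend d k' p.1 p.2 *
        ((periodSum n ((k' : ℤ) - (k : ℕ)) + periodSum n (-(k' : ℤ) - (k : ℕ))) / 2) *
        periodSum n (p.1 - a) * periodSum n (p.2 - b) =
        ((n * if |(a : ℤ)| = (n / 2 : ℕ) then 2 else 1) *
        (n * if |(b : ℤ)| = (n / 2 : ℕ) then 2 else 1) * extend d k' a b) *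
        ((periodSum n ((k' : ℤ) - (k : ℕ)) + periodSum n (-(k' : ℤ) - (k : ℕ))) / 2) := by
      intro k'
      rw [Finset.sum_product]
      have e5 : ∀ a' : ℤ, ∑ b' ∈ Finset.Icc (-(n / 2 : ℕ) : ℤ) (n / 2 : ℕ), extend d k' a' b' *
        ((periodSum n ((k' : ℤ) - (k : ℕ)) + periodSum n (-(k' : ℤ) - (k : ℕ))) / 2) *
        periodSum n (a' - a) * periodSum n (b' - b) =
        ((n * (if |(b : ℤ)| = (n / 2 : ℕ) then 2 else 1) * extend d k' a' b) *
          periodSum n (a' - a)) *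
        ((periodSum n ((k' : ℤ) - (k : ℕ)) + periodSum n (-(k' : ℤ) - (k : ℕ))) / 2) := by
        intro a'
        rw [← sum_mul_periodSum hn he (fun b' => extend d k' a' b') (hd.extend_eq.2 k' a') b hb,
          Finset.sum_mul, Finset.sum_mul]
        exact Finset.sum_congr rfl fun b' _ => by ring
      simp only [e5]
      rw [← Finset.sum_mul, sum_mul_periodSum hn he (fun a' =>
        n * (if |(b : ℤ)| = (n / 2 : ℕ) then 2 else 1) * extend d k' a' b)
        (by rw [hd.extend_eq.1 k' b]) a ha]
      ring
    simp only [e4]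
    rw [sum_mul_periodSum_radial hn he (fun k' => (n * if |(a : ℤ)| = (n / 2 : ℕ) then 2 else 1) *
        (n * if |(b : ℤ)| = (n / 2 : ℕ) then 2 else 1) * extend d k' a b) k (by omega)]
    ring
  have hn' : (n : ℂ) ≠ 0 := Nat.cast_ne_zero.2 hn
  have e6 : extend d k a b = d (k, a, b) := extend_apply d (k, a, b)
  rw [interp]
  simp only
  rw [e1, e3, e6]
  split_ifs <;> field_simp

/-- The arrays with equal values at the two ends of each angular range, as a subspace. -/
def edgeSymmSubmodule (n : ℕ) : Submodule ℂ (CFFIdx n → ℂ) where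
  carrier := {d | EdgeSymm d}
  zero_mem' := ⟨fun _ _ _ _ _ _ => rfl, fun _ _ _ _ _ _ => rfl⟩
  add_mem' := fun hd he =>
    ⟨fun k a a' b h h' => congrArg₂ (· + ·) (hd.1 k a a' b h h') (he.1 k a a' b h h'),
      fun k a b b' h h' => congrArg₂ (· + ·) (hd.2 k a b b' h h') (he.2 k a b b' h h')⟩
  smul_mem' := fun z _ hd =>
    ⟨fun k a a' b h h' => congrArg (z * ·) (hd.1 k a a' b h h'),
      fun k a b b' h h' => congrArg (z * ·) (hd.2 k a b b' h h')⟩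

theorem gridValues_edgeSymm {n : ℕ} (hn : n ≠ 0) (he : Even n) {D : ℕ} {f : BallFn} (hf : Bd D f) :
    EdgeSymm (gridValues n f) := by
  have hω := gridRoot_ne_zero n
  have key : ∀ p : ℤ, gridRoot n ^ (p * ((n / 2 : ℕ) : ℤ)) =
      gridRoot n ^ (p * -((n / 2 : ℕ) : ℤ)) := by
    intro p
    obtain ⟨M, rfl⟩ := he
    have hM : (M + M) / 2 = M := by omega
    rw [hM, show p * (M : ℤ) = ((M + M : ℕ) : ℤ) * p + p * -(M : ℤ) by push_cast; ring,
      zpow_add₀ hω, gridRoot_zpow_self hn, one_mul]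
  constructor
  · intro k a a' b ha ha'
    simp only [gridValues_eq hf, ha, ha', key]
  · intro k a b b' hb hb'
    simp only [gridValues_eq hf, hb, hb', key]

/-- Evaluation at the grid of normalized series. It is injective, hence bijective, as its source and
its target are the same space. -/
noncomputable def gridMap {n : ℕ} (hn : n ≠ 0) (he : Even n) :
    edgeSymmSubmodule n →ₗ[ℂ] edgeSymmSubmodule n where
  toFun d := ⟨gridValues n (ofCFF (d : CFFIdx n → ℂ)), gridValues_edgeSymm hn he (Bd.ofCFF _)⟩
  map_add' d e := by
    refine Subtype.ext (funext fun i => ?_)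
    simp only [Submodule.coe_add, Pi.add_apply, gridValues_eq (Bd.ofCFF _), cf_ofCFF, extend_add,
      add_mul, Finset.sum_add_distrib]
  map_smul' z d := by
    refine Subtype.ext (funext fun i => ?_)
    simp only [Submodule.coe_smul, Pi.smul_apply, gridValues_eq (Bd.ofCFF _), cf_ofCFF, extend_smul,
      mul_assoc, ← Finset.mul_sum, RingHom.id_apply, smul_eq_mul]

theorem interpolates_iff {n : ℕ} (hn : n ≠ 0) (he : Even n) {v : CFFIdx n → ℂ} (hv : EdgeSymm v)
    (d : CFFIdx n → ℂ) : Interpolates v d ↔ d = interp v := by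
  have hinj : Function.Injective (gridMap hn he) := by
    intro d e h
    have h1 := congrArg Subtype.val h
    refine Subtype.ext ?_
    rw [← interp_gridValues hn he d.2, ← interp_gridValues hn he e.2]
    exact congrArg interp h1
  constructor
  · rintro ⟨h1, rfl⟩
    exact (interp_gridValues hn he h1).symm
  · rintro rfl
    obtain ⟨d, hd⟩ := (LinearMap.injective_iff_surjective.1 hinj) ⟨v, hv⟩
    have h1 : gridValues n (ofCFF (d : CFFIdx n → ℂ)) = v := congrArg Subtype.val hd
    rw [← h1, interp_gridValues hn he d.2]
    exact ⟨d.2, rfl⟩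

/-- Interpolation at the grid by fast Fourier transforms. -/
theorem Der.interp {X : Type} (n : ℕ) (v : X → CFFIdx n → ℂ) :
    Der (Set.range fun i x => v x i) (1500 * (n + 1) ^ 3 * lg n)
      (Set.range fun i x => interp (v x) i) := by
  set A : Set (X → ℂ) := Set.range fun i x => v x i with hA
  set R := Finset.Ico (-(n / 2 : ℕ) : ℤ) (n / 2 : ℕ) with hR
  let c : ℤ × ℤ × ℤ → X → ℂ := fun j =>
    if j ∈ R ×ˢ R ×ˢ R then fun x => extend (v x) j.1.natAbs j.2.1 j.2.2 else fun _ => 0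
  let F : ℤ × ℤ × ℤ → X → ℂ := fun j x => ∑ p ∈ cube n, (gridRoot n)⁻¹ ^ (p.1 * j.1) *
    (gridRoot n)⁻¹ ^ (p.2.1 * j.2.1) * (gridRoot n)⁻¹ ^ (p.2.2 * j.2.2) * c p x
  have h0 : Der A 1 {fun _ => 0} := Der.const 0
  have hc : ∀ j ∈ cube n, c j ∈ A ∪ {fun _ => 0} := by
    rintro ⟨j1, j2, j3⟩ _
    simp only [c]
    split_ifs with h
    · simp only [hR, Finset.mem_product, Finset.mem_Ico] at h
      refine Or.inl ⟨(⟨j1.natAbs, by omega⟩, ⟨j2, by rw [Finset.mem_Icc]; omega⟩,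
        ⟨j3, by rw [Finset.mem_Icc]; omega⟩), ?_⟩
      funext x
      exact (extend_apply (v x) (⟨j1.natAbs, by omega⟩, ⟨j2, by rw [Finset.mem_Icc]; omega⟩,
        ⟨j3, by rw [Finset.mem_Icc]; omega⟩)).symm
    · exact Or.inr rfl
  have h1 : Der (A ∪ {fun _ => 0}) _ (F '' cube n) :=
    Der.chirp₃ n (gridRoot n)⁻¹ (inv_ne_zero (gridRoot_ne_zero n)) c hc
  have h2 : Der (A ∪ {fun _ => 0} ∪ F '' cube n) (Fintype.card (CFFIdx n) * 2)
      (Set.range fun i x => BallNS.interp (v x) i) := by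
    refine Der.range (fun (i : CFFIdx n) x => BallNS.interp (v x) i) fun i => ?_
    have hi : (((i.1 : ℕ) : ℤ), (i.2.1 : ℤ), (i.2.2 : ℤ)) ∈ cube n := by
      have h1 := i.1.2
      have h2 := Finset.mem_Icc.1 i.2.1.2
      have h3 := Finset.mem_Icc.1 i.2.2.2
      simp only [cube, Finset.mem_product, Finset.mem_Icc]
      omega
    have e : (fun x => BallNS.interp (v x) i) = fun x => ((n : ℂ)⁻¹ ^ 3 *
        (if (i.1 : ℕ) = 0 ∨ (i.1 : ℕ) = n / 2 then 1 else 2) *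
        (if |(i.2.1 : ℤ)| = (n / 2 : ℕ) then 1 / 2 else 1) *
        (if |(i.2.2 : ℤ)| = (n / 2 : ℕ) then 1 / 2 else 1)) * F ((i.1 : ℕ), i.2.1, i.2.2) x := by
      funext x
      rw [BallNS.interp]
      congr 1
      refine Finset.sum_subset_zero_on_sdiff ?_ ?_ ?_
      · rintro ⟨j1, j2, j3⟩ h
        simp only [Finset.mem_product, Finset.mem_Ico] at h
        simp only [cube, Finset.mem_product, Finset.mem_Icc]
        omega
      · intro j hj
        simp only [c]
        rw [if_neg (Finset.mem_sdiff.1 hj).2, mul_zero]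
      · intro j hj
        simp only [c]
        rw [if_pos hj]
    rw [e]
    exact (Der.of_mem (c := 0) (Or.inr ⟨_, hi, rfl⟩)).smul _
  refine (h0.trans (h1.trans h2)).mono_cost ?_
  have h3 := card_CFFIdx_le (n := n) (N := n) le_rfl
  have h4 : 2 ≤ lg n := by simp [lg]
  have h5 : 1 ≤ (n + 1) ^ 3 := Nat.one_le_pow _ _ (by omega)
  nlinarith [Nat.mul_le_mul_left (6 * (n + 1) ^ 3) h4]

end BallNS

namespace BallNS

open Polynomial Complex

/-! ### Legendre polynomials -/

/-- `(x² - 1)^l / (2^l l!)`, whose `l`-th derivative is the Legendre polynomial. -/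
noncomputable def rodrigues (l : ℕ) : ℂ[X] := C (1 / (2 ^ l * (l.factorial : ℂ))) * (X ^ 2 - 1) ^ l

theorem legendre_eq (l : ℕ) : legendre l = derivative^[l] (rodrigues l) := by
  rw [legendre, rodrigues, iterate_derivative_C_mul]

theorem derivative_rodrigues_succ (l : ℕ) : derivative (rodrigues (l + 1)) = X * rodrigues l := by
  have h : (1 / (2 ^ (l + 1) * ((l + 1).factorial : ℂ))) * (2 * (l + 1)) =
      1 / (2 ^ l * (l.factorial : ℂ)) := by
    rw [Nat.factorial_succ]
    have h1 := Nat.cast_ne_zero (R := ℂ).2 (Nat.factorial_ne_zero l)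
    have h2 := Nat.cast_add_one_ne_zero (R := ℂ) l
    push_cast
    field_simp
    ring
  rw [rodrigues, rodrigues, ← h]
  simp only [derivative_mul, derivative_C, derivative_pow, derivative_sub, derivative_X,
    derivative_one, C_mul, C_add, map_natCast, C_1, map_ofNat, Nat.add_sub_cancel]
  push_cast
  ring

theorem derivative_derivative_rodrigues (l : ℕ) : derivative (derivative (rodrigues (l + 2))) =
    C (2 * (l + 1) + 1 : ℂ) * rodrigues (l + 1) + rodrigues l := by
  have h : C (2 * (l + 1) : ℂ) * rodrigues (l + 1) = (X ^ 2 - 1) * rodrigues l := by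
    rw [rodrigues, rodrigues, ← mul_assoc, ← C_mul]
    have h : (2 * (l + 1)) * (1 / (2 ^ (l + 1) * ((l + 1).factorial : ℂ))) =
        1 / (2 ^ l * (l.factorial : ℂ)) := by
      rw [Nat.factorial_succ]
      have h1 := Nat.cast_ne_zero (R := ℂ).2 (Nat.factorial_ne_zero l)
      have h2 := Nat.cast_add_one_ne_zero (R := ℂ) l
      push_cast
      field_simp
      ring
    rw [h]; ring
  rw [derivative_rodrigues_succ, derivative_mul, derivative_X, derivative_rodrigues_succ, C_add,
    add_mul, h, C_1]
  ring

theorem iterate_derivative_X_mul (k : ℕ) (p : ℂ[X]) : derivative^[k + 1] (X * p) =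
    X * derivative^[k + 1] p + C ((k : ℂ) + 1) * derivative^[k] p := by
  induction k with
  | zero => simp; ring
  | succ k ih =>
    rw [Function.iterate_succ_apply', ih, derivative_add, derivative_mul, derivative_X,
      derivative_C_mul, ← Function.iterate_succ_apply' derivative,
      ← Function.iterate_succ_apply' derivative]
    simp only [C_add, C_1]
    push_cast
    simp only [C_add, C_1]
    ring

/-- Bonnet's recurrence. -/
theorem legendre_add_two (l : ℕ) : C ((l : ℂ) + 2) * legendre (l + 2) =
    C (2 * (l : ℂ) + 3) * (X * legendre (l + 1)) - C ((l : ℂ) + 1) * legendre l := by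
  have h1 : legendre (l + 2) = X * legendre (l + 1) +
      C ((l : ℂ) + 1) * derivative^[l] (rodrigues (l + 1)) := by
    rw [legendre_eq, Function.iterate_succ_apply, derivative_rodrigues_succ,
      iterate_derivative_X_mul, legendre_eq]
  have h2 : legendre (l + 2) = C (2 * (l + 1) + 1 : ℂ) * derivative^[l] (rodrigues (l + 1)) +
      legendre l := by
    rw [legendre_eq, Function.iterate_succ_apply, Function.iterate_succ_apply,
      derivative_derivative_rodrigues, iterate_map_add, iterate_derivative_C_mul, legendre_eq]
  simp only [C_add, C_mul, C_1, map_ofNat] at h1 h2 ⊢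
  linear_combination (2 * (C (l : ℂ)) + 3) * h1 - (C (l : ℂ) + 1) * h2

theorem derivative_legendre_add_two (l : ℕ) : derivative (legendre (l + 2)) =
    C (2 * (l : ℂ) + 3) * legendre (l + 1) + derivative (legendre l) := by
  rw [legendre_eq, ← Function.iterate_succ_apply' derivative, Function.iterate_succ_apply,
    Function.iterate_succ_apply, derivative_derivative_rodrigues, iterate_map_add,
    iterate_derivative_C_mul, ← legendre_eq, Function.iterate_succ_apply', ← legendre_eq]
  congr 3; ring

/-- The recurrence in the degree for the derivatives of a fixed order. -/
theorem iterate_derivative_legendre_add_two (m l : ℕ) :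
    C ((l : ℂ) + 2 - m) * derivative^[m] (legendre (l + 2)) =
      C (2 * (l : ℂ) + 3) * (X * derivative^[m] (legendre (l + 1))) -
        C ((l : ℂ) + 1 + m) * derivative^[m] (legendre l) := by
  cases m with
  | zero => simpa using legendre_add_two l
  | succ m =>
    have h1 := congrArg derivative^[m + 1] (legendre_add_two l)
    have h2 := congrArg derivative^[m] (derivative_legendre_add_two l)
    rw [iterate_derivative_C_mul, iterate_derivative_sub, iterate_derivative_C_mul,
      iterate_derivative_C_mul, iterate_derivative_X_mul] at h1
    rw [iterate_map_add, iterate_derivative_C_mul, ← Function.iterate_succ_apply,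
      ← Function.iterate_succ_apply] at h2
    push_cast
    simp only [C_add, C_mul, C_sub, C_1, map_ofNat, Nat.succ_eq_add_one] at h1 h2 ⊢
    linear_combination h1 - (C (m : ℂ) + 1) * h2

theorem natDegree_legendre_le (l : ℕ) : (legendre l).natDegree ≤ l := by
  rw [legendre]
  refine (natDegree_C_mul_le _ _).trans ((natDegree_iterate_derivative _ _).trans ?_)
  have h : ((X ^ 2 - 1 : ℂ[X]) ^ l).natDegree ≤ l * 2 := by
    refine natDegree_pow_le_of_le l ?_
    compute_degree
  omega

/-- The start of the recurrence for the derivatives of order `m`. -/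
theorem iterate_derivative_legendre_self (m : ℕ) : ∃ z : ℂ, derivative^[m] (legendre m) = C z ∧
    derivative^[m] (legendre (m + 1)) = C z * (C (2 * (m : ℂ) + 1) * X) := by
  have h0 : (derivative^[m] (legendre m)).natDegree ≤ 0 :=
    (natDegree_iterate_derivative _ _).trans (by have := natDegree_legendre_le m; omega)
  refine ⟨_, eq_C_of_natDegree_le_zero h0, ?_⟩
  rw [← eq_C_of_natDegree_le_zero h0]
  cases m with
  | zero =>
    rw [legendre_eq, legendre_eq, Function.iterate_zero_apply, Function.iterate_zero_apply,
      Function.iterate_zero_apply, Function.iterate_one, derivative_rodrigues_succ]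
    simp [mul_comm]
  | succ m =>
    have h1 := iterate_derivative_legendre_add_two (m + 1) m
    have h2 : derivative^[m + 1] (legendre m) = 0 :=
      iterate_derivative_eq_zero (by have := natDegree_legendre_le m; omega)
    rw [h2, mul_zero, sub_zero] at h1
    have h3 : ((m : ℂ) + 2 - (m + 1 : ℕ)) = 1 := by push_cast; ring
    rw [h3, C_1, one_mul] at h1
    rw [h1]
    push_cast
    rw [show 2 * ((m : ℂ) + 1) + 1 = 2 * (m : ℂ) + 3 by ring]
    ring

/-- The differentiated form of `(x² - 1) v' = 2 l x v` for `v = (x² - 1)^l`; for `k ≥ l` it is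
Legendre's differential equation and its derivatives. -/
theorem rodrigues_ode (l k : ℕ) : (X ^ 2 - 1) * derivative^[k + 2] (rodrigues l) +
    C (2 * ((k : ℂ) + 1 - l)) * (X * derivative^[k + 1] (rodrigues l)) +
      C (((k : ℂ) + 1) * (k - 2 * l)) * derivative^[k] (rodrigues l) = 0 := by
  have h0 : (X ^ 2 - 1) * derivative (rodrigues l) = C (2 * (l : ℂ)) * (X * rodrigues l) := by
    cases l with
    | zero => simp [rodrigues]
    | succ l =>
      rw [rodrigues]
      simp only [derivative_mul, derivative_C, derivative_pow, derivative_sub, derivative_X,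
        derivative_one, C_mul, map_natCast, map_ofNat, Nat.add_sub_cancel]
      push_cast
      ring
  induction k with
  | zero =>
    have h := congrArg derivative h0
    simp only [derivative_mul, derivative_C, derivative_pow, derivative_sub, derivative_X,
      derivative_one] at h
    simp only [Function.iterate_succ_apply, Function.iterate_zero_apply]
    simp only [C_mul, C_add, C_sub, map_natCast, C_1, map_ofNat] at h ⊢
    push_cast at h ⊢
    linear_combination h
  | succ k ih =>
    have h := congrArg derivative ih
    simp only [derivative_mul, derivative_C, derivative_pow, derivative_sub, derivative_X,
      derivative_one, derivative_add, ← Function.iterate_succ_apply' derivative,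
      derivative_zero] at h
    simp only [Nat.succ_eq_add_one, C_mul, C_add, C_sub, map_natCast, C_1, map_ofNat] at h ⊢
    push_cast at h ⊢
    linear_combination h

theorem legendre_ode (l m : ℕ) : (1 - X ^ 2) * derivative^[m + 2] (legendre l) -
    C (2 * ((m : ℂ) + 1)) * (X * derivative^[m + 1] (legendre l)) =
      -(C (((l : ℂ) - m) * (l + m + 1)) * derivative^[m] (legendre l)) := by
  have h := rodrigues_ode l (m + l)
  rw [legendre_eq, ← Function.iterate_add_apply, ← Function.iterate_add_apply,
    ← Function.iterate_add_apply, show m + 2 + l = m + l + 2 by ring,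
    show m + 1 + l = m + l + 1 by ring]
  simp only [C_mul, C_add, C_sub, map_natCast, C_1, map_ofNat] at h ⊢
  push_cast at h ⊢
  linear_combination -h

/-! ### Orthogonality -/

/-- The integral of `p(cos θ)` over the polar angle with the surface weight `sin θ`. -/
noncomputable def polarInt (p : ℂ[X]) : ℂ :=
  ∫ θ in (0 : ℝ)..Real.pi, p.eval (Real.cos θ : ℂ) * (Real.sin θ : ℂ)

theorem continuous_eval_cos (p : ℂ[X]) : Continuous fun θ : ℝ => p.eval (Real.cos θ : ℂ) :=
  p.continuous.comp (Complex.continuous_ofReal.comp Real.continuous_cos)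

theorem polarInt_intervalIntegrable (p : ℂ[X]) :
    IntervalIntegrable (fun θ : ℝ => p.eval (Real.cos θ : ℂ) * (Real.sin θ : ℂ))
      MeasureTheory.volume 0 Real.pi :=
  ((continuous_eval_cos p).mul (Complex.continuous_ofReal.comp
    Real.continuous_sin)).intervalIntegrable _ _

theorem polarInt_add (p q : ℂ[X]) : polarInt (p + q) = polarInt p + polarInt q := by
  rw [polarInt, polarInt, polarInt, ← intervalIntegral.integral_add (polarInt_intervalIntegrable p)
    (polarInt_intervalIntegrable q)]
  simp only [eval_add, add_mul]

theorem polarInt_C_mul (z : ℂ) (p : ℂ[X]) : polarInt (C z * p) = z * polarInt p := by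
  simp only [polarInt, eval_mul, eval_C, mul_assoc, intervalIntegral.integral_const_mul]

theorem polarInt_derivative (p : ℂ[X]) : polarInt (derivative p) = p.eval 1 - p.eval (-1) := by
  have h : ∀ θ ∈ Set.uIcc 0 Real.pi, HasDerivAt (fun θ : ℝ => -p.eval (Real.cos θ : ℂ))
      ((derivative p).eval (Real.cos θ : ℂ) * (Real.sin θ : ℂ)) θ := by
    intro θ _
    have h1 := (p.hasDerivAt (Real.cos θ : ℂ)).comp θ (Real.hasDerivAt_cos θ).ofReal_comp
    have h2 := h1.neg
    have e : (derivative p).eval (Real.cos θ : ℂ) * (Real.sin θ : ℂ) =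
        -((derivative p).eval (Real.cos θ : ℂ) * ((-Real.sin θ : ℝ) : ℂ)) := by push_cast; ring
    rw [e]
    exact h2
  rw [polarInt, intervalIntegral.integral_eq_sub_of_hasDerivAt h (polarInt_intervalIntegrable _),
    Real.cos_pi, Real.cos_zero]
  push_cast
  ring

/-- The inner products of the associated Legendre functions of order `m`. -/
noncomputable def legendreGram (m l l' : ℕ) : ℂ :=
  polarInt ((1 - X ^ 2) ^ m * (derivative^[m] (legendre l) * derivative^[m] (legendre l')))

theorem legendreGram_comm (m l l' : ℕ) : legendreGram m l l' = legendreGram m l' l := by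
  rw [legendreGram, legendreGram, mul_comm (derivative^[m] (legendre l))]

/-- Integration by parts. -/
theorem legendreGram_succ (m l l' : ℕ) :
    legendreGram (m + 1) l l' = ((l : ℂ) - m) * (l + m + 1) * legendreGram m l l' := by
  have h := polarInt_derivative ((1 - X ^ 2) ^ (m + 1) *
    (derivative^[m + 1] (legendre l) * derivative^[m] (legendre l')))
  have e : derivative ((1 - X ^ 2) ^ (m + 1) *
      (derivative^[m + 1] (legendre l) * derivative^[m] (legendre l'))) =
      (1 - X ^ 2) ^ (m + 1) * (derivative^[m + 1] (legendre l) * derivative^[m + 1] (legendre l')) +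
      C (-(((l : ℂ) - m) * (l + m + 1))) * ((1 - X ^ 2) ^ m *
        (derivative^[m] (legendre l) * derivative^[m] (legendre l'))) := by
    have h0 := legendre_ode l m
    simp only [derivative_mul, derivative_pow, derivative_sub, derivative_X,
      derivative_one, ← Function.iterate_succ_apply' derivative, Nat.add_sub_cancel]
    simp only [Nat.succ_eq_add_one, C_mul, C_add, C_sub, C_neg, map_natCast, C_1, map_ofNat] at h0 ⊢
    push_cast at h0 ⊢
    linear_combination (1 - X ^ 2) ^ m * derivative^[m] (legendre l') * h0
  rw [e, polarInt_add, polarInt_C_mul] at h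
  simp only [eval_mul, eval_pow, eval_sub, eval_one, eval_X, one_pow, sub_self, even_two,
    Even.neg_pow, zero_pow (Nat.succ_ne_zero m), zero_mul] at h
  rw [legendreGram, legendreGram]
  linear_combination h

/-- Orthogonality. By symmetry, integration by parts evaluates the inner product of order one in
two ways, with the different factors `l (l + 1)` and `l' (l' + 1)`; higher orders follow by
induction. -/
theorem legendreGram_ne {l l' : ℕ} (h : l ≠ l') (m : ℕ) : legendreGram m l l' = 0 := by
  induction m with
  | zero =>
    have h1 := legendreGram_succ 0 l l'
    have h2 := legendreGram_succ 0 l' l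
    rw [legendreGram_comm 1, legendreGram_comm 0 l', h1] at h2
    have h3 : ((l : ℂ) - l') * ((l : ℂ) + l' + 1) * legendreGram 0 l l' = 0 := by
      push_cast at h2
      linear_combination h2
    refine (mul_eq_zero.1 h3).resolve_left
      (mul_ne_zero (sub_ne_zero.2 (Nat.cast_injective.ne h)) ?_)
    exact_mod_cast Nat.succ_ne_zero (l + l')
  | succ m ih => rw [legendreGram_succ, ih, mul_zero]

theorem legendre_zero : legendre 0 = 1 := by simp [legendre]

theorem legendre_one : legendre 1 = X := by
  rw [legendre_eq, Function.iterate_one, derivative_rodrigues_succ, rodrigues]; simp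

theorem polarInt_X_mul (l l' : ℕ) :
    (2 * (l : ℂ) + 3) * polarInt (X * legendre (l + 1) * legendre l') =
      ((l : ℂ) + 2) * legendreGram 0 (l + 2) l' + ((l : ℂ) + 1) * legendreGram 0 l l' := by
  have h : C (2 * (l : ℂ) + 3) * (X * legendre (l + 1) * legendre l') =
      C ((l : ℂ) + 2) * (legendre (l + 2) * legendre l') + C ((l : ℂ) + 1) *
        (legendre l * legendre l') := by
    linear_combination -legendre l' * legendre_add_two l
  have h1 := congrArg polarInt h
  rw [polarInt_add, polarInt_C_mul, polarInt_C_mul, polarInt_C_mul] at h1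
  simpa only [legendreGram, pow_zero, one_mul, Function.iterate_zero_apply] using h1

/-- The three-term recurrence, multiplied by neighbouring Legendre polynomials and integrated,
expresses each norm by the preceding one. -/
theorem legendreGram_zero_self (l : ℕ) : (2 * (l : ℂ) + 1) * legendreGram 0 l l = 2 := by
  induction l using Nat.twoStepInduction with
  | zero =>
    have := polarInt_derivative X
    simp only [derivative_X, eval_X] at this
    simp [legendreGram, legendre_zero, this]; norm_num
  | one =>
    have := polarInt_derivative (C (1 / 3) * (X * X * X))
    have e : derivative (C (1 / 3 : ℂ) * (X * X * X)) = X * X := by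
      have h : C (1 / 3 : ℂ) * 3 = 1 := by rw [show (3 : ℂ[X]) = C 3 from rfl, ← C_mul]; norm_num
      simp only [derivative_mul, derivative_C, derivative_X]
      linear_combination X * X * h
    rw [e] at this
    simp [legendreGram, legendre_one, this]; norm_num
  | more l _ ih =>
    have h1 := polarInt_X_mul l (l + 2)
    have h2 := polarInt_X_mul (l + 1) (l + 1)
    rw [legendreGram_ne (by omega : l ≠ l + 2)] at h1
    rw [legendreGram_ne (by omega : l + 1 + 2 ≠ l + 1)] at h2
    rw [show X * legendre (l + 1 + 1) * legendre (l + 1) =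
        X * legendre (l + 1) * legendre (l + 2) by
      rw [show l + 1 + 1 = l + 2 by ring]; ring] at h2
    have h3 : (2 * (l : ℂ) + 3) ≠ 0 := by exact_mod_cast (by omega : 2 * l + 3 ≠ 0)
    have h4 : ((l : ℂ) + 2) ≠ 0 := by exact_mod_cast (by omega : l + 2 ≠ 0)
    push_cast at h2 ih ⊢
    apply mul_left_cancel₀ h4
    linear_combination (2 * (l : ℂ) + 3) * h2 - (2 * (l : ℂ) + 5) * h1 + ((l : ℂ) + 2) * ih

/-- The norms of the associated Legendre functions. -/
theorem legendreGram_self (l m : ℕ) (h : m ≤ l) : (2 * (l : ℂ) + 1) * ((l - m).factorial : ℂ) *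
    legendreGram m l l = 2 * ((l + m).factorial : ℂ) := by
  induction m with
  | zero => rw [mul_right_comm, legendreGram_zero_self]; simp
  | succ m ih =>
    have h1 := ih (by omega)
    rw [show l - m = (l - (m + 1)) + 1 by omega, Nat.factorial_succ] at h1
    have h2 : ((l - (m + 1) : ℕ) : ℂ) = (l : ℂ) - m - 1 := by
      rw [Nat.cast_sub h]; push_cast; ring
    rw [legendreGram_succ, show l + (m + 1) = l + m + 1 by ring, Nat.factorial_succ]
    push_cast at h1 ⊢
    rw [h2] at h1
    linear_combination ((l : ℂ) + m + 1) * h1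

end BallNS

namespace BallNS

open Polynomial Complex

/-! ### Spherical harmonics as trigonometric polynomials -/

theorem cf_smul (z : ℂ) (f : BallFn) (k : ℕ) (a b : ℤ) : cf (z • f) k a b = z * cf f k a b := by
  rw [cf, cf, AddMonoidAlgebra.coeff_smul, Finsupp.smul_apply, smul_eq_C_mul, chebCoeff_C_mul]

theorem cf_cosTheta_mul (f : BallFn) (k : ℕ) (a b : ℤ) :
    cf (cosTheta * f) k a b = 1 / 2 * (cf f k a (b - 1) + cf f k a (b + 1)) := by
  rw [cosTheta, add_mul, cf_add, cf_mode_C_mul, cf_mode_C_mul, sub_zero, sub_neg_eq_add]; ring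

theorem cf_sinTheta_mul (f : BallFn) (k : ℕ) (a b : ℤ) :
    cf (sinTheta * f) k a b = I / 2 * (cf f k a (b + 1) - cf f k a (b - 1)) := by
  rw [sinTheta, add_mul, cf_add, cf_mode_C_mul, cf_mode_C_mul, sub_zero, sub_neg_eq_add]; ring

/-- The unnormalized associated Legendre function `sin^m θ P_l^{(m)}(cos θ)`. -/
noncomputable def thetaFn (m l : ℕ) : BallFn :=
  sinTheta ^ m * aeval cosTheta (derivative^[m] (legendre l))

theorem thetaFn_add_two (m l : ℕ) : ((l : ℂ) + 2 - m) • thetaFn m (l + 2) =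
    (2 * (l : ℂ) + 3) • (cosTheta * thetaFn m (l + 1)) - ((l : ℂ) + 1 + m) • thetaFn m l := by
  have h := congrArg (fun p => sinTheta ^ m * aeval cosTheta p)
    (iterate_derivative_legendre_add_two m l)
  rw [← smul_eq_C_mul, ← smul_eq_C_mul, ← smul_eq_C_mul] at h
  simp only [map_smul, map_sub, map_mul, aeval_X, mul_sub, mul_smul_comm] at h
  rw [thetaFn, thetaFn, thetaFn, h, mul_left_comm]

/-- The functions of `θ` alone whose frequencies are at most `w`. -/
def Zonal (w : ℕ) (f : BallFn) : Prop :=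
  ∀ k a b, cf f k a b ≠ 0 → k = 0 ∧ a = 0 ∧ |b| ≤ w

theorem zonal_one : Zonal 0 1 := by
  intro k a b h
  rw [show (1 : BallFn) = mode 0 0 (C 1) from rfl, cf_mode, chebCoeff_C] at h
  split_ifs at h with h1 h2
  · exact ⟨h2, h1.1, by simp [h1.2]⟩
  · exact absurd rfl h
  · exact absurd rfl h

theorem Zonal.mul_of {w : ℕ} {f g : BallFn} (hf : Zonal w f)
    (h : ∀ k a b, cf f k a (b - 1) = 0 → cf f k a (b + 1) = 0 → cf g k a b = 0) :
    Zonal (w + 1) g := by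
  intro k a b hk
  have h1 : cf f k a (b - 1) ≠ 0 ∨ cf f k a (b + 1) ≠ 0 := by
    by_contra h'
    push Not at h'
    exact hk (h k a b h'.1 h'.2)
  rcases h1 with h1 | h1
  · obtain ⟨h2, h3, h4⟩ := hf _ _ _ h1
    refine ⟨h2, h3, ?_⟩
    rw [abs_le] at h4 ⊢
    push_cast; omega
  · obtain ⟨h2, h3, h4⟩ := hf _ _ _ h1
    refine ⟨h2, h3, ?_⟩
    rw [abs_le] at h4 ⊢
    push_cast; omega

theorem Zonal.cosTheta_mul {w : ℕ} {f : BallFn} (hf : Zonal w f) : Zonal (w + 1) (cosTheta * f) :=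
  hf.mul_of fun k a b h1 h2 => by rw [cf_cosTheta_mul, h1, h2]; simp

theorem Zonal.sinTheta_mul {w : ℕ} {f : BallFn} (hf : Zonal w f) : Zonal (w + 1) (sinTheta * f) :=
  hf.mul_of fun k a b h1 h2 => by rw [cf_sinTheta_mul, h1, h2]; simp

theorem Zonal.smul {w : ℕ} {f : BallFn} (hf : Zonal w f) (z : ℂ) : Zonal w (z • f) :=
  fun k a b h => hf k a b fun h' => h (by rw [cf_smul, h', mul_zero])

theorem zonal_sinTheta_pow (m : ℕ) : Zonal m (sinTheta ^ m) := by
  induction m with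
  | zero => rw [pow_zero]; exact zonal_one
  | succ m ih => rw [pow_succ']; exact ih.sinTheta_mul

theorem thetaFn_self (m : ℕ) : ∃ z : ℂ, thetaFn m m = z • sinTheta ^ m ∧
    thetaFn m (m + 1) = (z * (2 * (m : ℂ) + 1)) • (cosTheta * sinTheta ^ m) := by
  obtain ⟨z, h1, h2⟩ := iterate_derivative_legendre_self m
  refine ⟨z, ?_, ?_⟩
  · rw [thetaFn, h1, ← mul_one (C z), ← smul_eq_C_mul, map_smul, map_one, mul_smul_comm, mul_one]
  · rw [thetaFn, h2, ← mul_assoc, ← C_mul, ← smul_eq_C_mul, map_smul, aeval_X, mul_smul_comm,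
      mul_comm cosTheta]

theorem zonal_thetaFn (m i : ℕ) : Zonal (m + i) (thetaFn m (m + i)) := by
  obtain ⟨z, h0, h1⟩ := thetaFn_self m
  induction i using Nat.twoStepInduction with
  | zero => rw [add_zero, h0]; exact (zonal_sinTheta_pow m).smul z
  | one => rw [h1]; exact (zonal_sinTheta_pow m).cosTheta_mul.smul _
  | more i ih ih' =>
    have h := thetaFn_add_two m (m + i)
    have hz : (((m + i : ℕ) : ℂ) + 2 - m) ≠ 0 := by
      have : (((m + i : ℕ) : ℂ) + 2 - m) = ((i + 2 : ℕ) : ℂ) := by push_cast; ring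
      rw [this]
      exact Nat.cast_ne_zero.2 (by omega)
    intro k a b hk
    have hc := congrArg (fun f => cf f k a b) h
    simp only [cf_sub, cf_smul] at hc
    have h2 : cf (cosTheta * thetaFn m (m + i + 1)) k a b ≠ 0 ∨
        cf (thetaFn m (m + i)) k a b ≠ 0 := by
      by_contra h'
      push Not at h'
      rw [h'.1, h'.2, mul_zero, mul_zero, sub_zero] at hc
      exact hk ((mul_eq_zero.1 hc).resolve_left hz)
    rcases h2 with h2 | h2
    · have := Zonal.cosTheta_mul ih' k a b h2
      exact this
    · obtain ⟨h3, h4, h5⟩ := ih k a b h2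
      exact ⟨h3, h4, by omega⟩

/-- The polar Fourier coefficients of the associated Legendre functions of order `m`, and degree
`m + i`. -/
noncomputable def thetaCoeff (m : ℕ) (b : ℤ) (i : ℕ) : ℂ := cf (thetaFn m (m + i)) 0 0 b

/-- The coefficients of the recurrence for the associated Legendre functions of order `m`. -/
noncomputable def recAlpha (m i : ℕ) : ℂ := (2 * ((m + i : ℕ) : ℂ) + 3) / (2 * ((i : ℂ) + 2))

/-- The second coefficient of the recurrence for the associated Legendre functions. -/
noncomputable def recGamma (m i : ℕ) : ℂ := -(((m + i : ℕ) : ℂ) + 1 + m) / ((i : ℂ) + 2)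

theorem isRec_of_smul {m : ℕ} {a a' : ℤ → ℕ → ℂ}
    (h : ∀ j i, a' j i = 1 / 2 * (a (j - 1) i + a (j + 1) i))
    (h' : ∀ j i, (((m + i : ℕ) : ℂ) + 2 - m) * a j (i + 2) =
      (2 * ((m + i : ℕ) : ℂ) + 3) * a' j (i + 1) - (((m + i : ℕ) : ℂ) + 1 + m) * a j i) :
    IsRec (recAlpha m) (recGamma m) a := by
  intro j i
  have h1 := h' j i
  have hz : (i : ℂ) + 2 ≠ 0 := by exact_mod_cast (by omega : i + 2 ≠ 0)
  rw [show (((m + i : ℕ) : ℂ) + 2 - m) = (i : ℂ) + 2 by push_cast; ring, h] at h1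
  apply mul_left_cancel₀ hz
  rw [h1, recAlpha, recGamma]
  field_simp
  ring

theorem isRec_thetaCoeff (m : ℕ) : IsRec (recAlpha m) (recGamma m) (thetaCoeff m) := by
  refine isRec_of_smul (a' := fun b i => cf (cosTheta * thetaFn m (m + i)) 0 0 b)
    (fun j i => cf_cosTheta_mul _ _ _ _) fun j i => ?_
  have h := congrArg (fun f => cf f 0 0 j) (thetaFn_add_two m (m + i))
  simp only [cf_sub, cf_smul] at h
  exact h

theorem cf_thetaFn (m i k : ℕ) (a b : ℤ) : cf (thetaFn m (m + i)) k a b =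
    if k = 0 ∧ a = 0 then thetaCoeff m b i else 0 := by
  split_ifs with h
  · rw [h.1, h.2, thetaCoeff]
  · by_contra h'
    obtain ⟨h1, h2, _⟩ := zonal_thetaFn m i k a b h'
    exact h ⟨h1, h2⟩

theorem thetaCoeff_eq_zero {m i : ℕ} {b : ℤ} (h : ((m + i : ℕ) : ℤ) < |b|) : thetaCoeff m b i = 0
    := by
  by_contra h'
  obtain ⟨_, _, h1⟩ := zonal_thetaFn m i 0 0 b h'
  omega

/-- The normalization constant of `Y_l^m`. -/
noncomputable def sphNorm (l m : ℕ) : ℝ :=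
  Real.sqrt ((2 * l + 1) / (4 * Real.pi) * ((l - m).factorial : ℝ) / ((l + m).factorial : ℝ))

theorem sphY_eq (l : ℕ) (m : ℤ) :
    sphY l m = mode m 0 (C (sphNorm l m.natAbs : ℂ)) * thetaFn m.natAbs l := by
  rw [sphY, thetaFn, mul_assoc, sphNorm]

theorem cf_mul_sphY (p : ℂ[X]) (l : ℕ) (m : ℤ) (k : ℕ) (a b : ℤ) (h : m.natAbs ≤ l) :
    cf (mode 0 0 p * sphY l m) k a b = if a = m then
      chebCoeff p k * (sphNorm l m.natAbs * thetaCoeff m.natAbs b (l - m.natAbs)) else 0 := by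
  obtain ⟨i, rfl⟩ := Nat.exists_eq_add_of_le h
  have key : ∀ a' : ℤ, (thetaFn m.natAbs (m.natAbs + i)).coeff (a', b) =
      if a' = 0 then C (thetaCoeff m.natAbs b i) else 0 := by
    intro a'
    refine cheb_ext fun k => ?_
    have := cf_thetaFn m.natAbs i k a' b
    rw [cf] at this
    rw [this]
    by_cases h1 : a' = 0
    · simp only [h1, and_true, if_true, chebCoeff_C]
    · simp [h1]
  rw [sphY_eq, cf, coeff_mode_mul, coeff_mode_mul, sub_zero, sub_zero, sub_zero, key,
    Nat.add_sub_cancel_left]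
  simp only [sub_eq_zero]
  split_ifs
  · rw [mul_comm p, ← C_mul, chebCoeff_C_mul, mul_comm]
  · simp

/-- Extension of an array of CSH coefficients by zero. -/
noncomputable def extendCSH {n : ℕ} (c : CSHIdx n → ℂ) (k l : ℕ) (m : ℤ) : ℂ :=
  ∑ i : CSHIdx n, if k = i.1 ∧ l = i.2.1 ∧ m = i.2.2 then c i else 0

theorem extendCSH_apply {n : ℕ} (c : CSHIdx n → ℂ) (i : CSHIdx n) :
    extendCSH c i.1 i.2.1 i.2.2 = c i := by
  rw [extendCSH, Finset.sum_eq_single i]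
  · simp
  · rintro ⟨k, l, m⟩ _ hj
    refine if_neg fun ⟨h1, h2, h3⟩ => hj ?_
    obtain ⟨k', l', m'⟩ := i
    obtain rfl := Fin.ext h1
    obtain rfl := Fin.ext h2
    obtain rfl := Subtype.ext h3
    rfl
  · simp

theorem extendCSH_eq_zero {n : ℕ} (c : CSHIdx n → ℂ) {k l : ℕ} {m : ℤ}
    (h : ¬ (k ≤ n / 2 ∧ l ≤ n / 2 ∧ m.natAbs ≤ l)) : extendCSH c k l m = 0 := by
  refine Finset.sum_eq_zero fun i _ => if_neg ?_
  rintro ⟨rfl, rfl, rfl⟩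
  have h1 := i.1.2
  have h2 := i.2.1.2
  have h3 := Finset.mem_Icc.1 i.2.2.2
  omega

theorem extendCSH_mem {n : ℕ} {X : Type} (c : X → CSHIdx n → ℂ) (k l : ℕ) (m : ℤ) :
    (fun x => extendCSH (c x) k l m) ∈ insert (fun _ => 0) (Set.range fun i x => c x i) := by
  by_cases h : k ≤ n / 2 ∧ l ≤ n / 2 ∧ m.natAbs ≤ l
  · let i : CSHIdx n := (⟨k, by omega⟩, ⟨⟨l, by omega⟩,
      ⟨m, by rw [Finset.mem_Icc]; dsimp only; omega⟩⟩)
    exact Or.inr ⟨i, funext fun x => (extendCSH_apply (c x) i).symm⟩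
  · exact Or.inl (funext fun x => extendCSH_eq_zero (c x) h)

theorem cf_ofCSH {n : ℕ} (c : CSHIdx n → ℂ) (k : ℕ) (a b : ℤ) :
    cf (ofCSH c) k a b = ∑ i ∈ Finset.range (n / 2 + 1),
      sphNorm (a.natAbs + i) a.natAbs * extendCSH c k (a.natAbs + i) a *
        thetaCoeff a.natAbs b i := by
  have h1 : cf (ofCSH c) k a b = ∑ i : CSHIdx n, if k = i.1 ∧ a = i.2.2 then c i *
      (sphNorm i.2.1 a.natAbs * thetaCoeff a.natAbs b (i.2.1 - a.natAbs)) else 0 := by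
    rw [ofCSH, cf_sum]
    refine Finset.sum_congr rfl fun i _ => ?_
    have h3 := Finset.mem_Icc.1 i.2.2.2
    rw [cf_mul_sphY _ _ _ _ _ _ (by omega), chebCoeff_C_mul, chebCoeff_T]
    by_cases h1 : a = i.2.2
    · by_cases h2 : k = i.1
      · rw [if_pos h1, if_pos h2.symm, if_pos ⟨h2, h1⟩, mul_one, h1]
      · rw [if_pos h1, if_neg (Ne.symm h2), if_neg (by tauto)]; simp
    · rw [if_neg h1, if_neg (by tauto)]
  rw [h1]
  simp only [extendCSH, Finset.mul_sum, Finset.sum_mul]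
  rw [Finset.sum_comm]
  refine Finset.sum_congr rfl fun i _ => ?_
  have h2 := i.2.1.2
  have h3 := Finset.mem_Icc.1 i.2.2.2
  by_cases h : k = i.1 ∧ a = i.2.2
  · have ha : a.natAbs ≤ i.2.1 := by rw [h.2]; omega
    rw [if_pos h, Finset.sum_eq_single ((i.2.1 : ℕ) - a.natAbs), if_pos ⟨h.1, by omega, h.2⟩,
      Nat.add_sub_cancel' ha]
    · ring
    · intro j _ hj
      rw [if_neg (by omega)]; simp
    · intro h'; exact absurd (Finset.mem_range.2 (by omega)) h'
  · rw [if_neg h, Finset.sum_eq_zero]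
    intro j _
    rw [if_neg (by tauto)]; simp

theorem Bd.ofCSH {n : ℕ} (c : CSHIdx n → ℂ) : Bd (n / 2) (ofCSH c) := by
  intro k a b h
  rw [cf_ofCSH] at h
  obtain ⟨i, _, hi⟩ := Finset.exists_ne_zero_of_sum_ne_zero h
  have h1 : extendCSH c k (a.natAbs + i) a ≠ 0 := right_ne_zero_of_mul (left_ne_zero_of_mul hi)
  have h2 : k ≤ n / 2 ∧ a.natAbs + i ≤ n / 2 ∧ a.natAbs ≤ a.natAbs + i := by
    by_contra h'
    exact h1 (extendCSH_eq_zero c h')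
  have h3 : |b| ≤ ((a.natAbs + i : ℕ) : ℤ) := by
    by_contra h'
    exact right_ne_zero_of_mul hi (thetaCoeff_eq_zero (by omega))
  rw [Int.abs_eq_natAbs]
  exact ⟨h2.1, by omega, by omega⟩

theorem card_sq_le (N c : ℕ) : (N + 1) * (2 * N + 1) * c ≤ 2 * (N + 1) ^ 2 * c :=
  Nat.mul_le_mul_right _ (by nlinarith)

/-- The fast conversion of CSH coefficients to CFF coefficients. -/
theorem Der.ofCSH {X : Type} (n : ℕ) (c : X → CSHIdx n → ℂ) :
    Der (Set.range fun i x => c x i) (50000 * (n + 1) ^ 3 * lg n ^ 2)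
      (arr fun x => ofCSH (c x)) := by
  set N := n / 2 with hN
  set A : Set (X → ℂ) := Set.range fun i x => c x i with hA
  have h0 : Der A 1 {fun _ => 0} := Der.const 0
  have h1 : ∀ (k : ℕ) (a : ℤ), Der (A ∪ {fun _ => 0}) (20002 * (N + 1) * lg N ^ 2)
      ((fun b x => cf (BallNS.ofCSH (c x)) k a b) '' Finset.Icc (-N : ℤ) N) := by
    intro k a
    let F : ℕ → X → ℂ := fun i x =>
      (sphNorm (a.natAbs + i) a.natAbs : ℂ) * extendCSH (c x) k (a.natAbs + i) a
    have hF : Der (A ∪ {fun _ => 0}) ((Finset.range (N + 1)).card * 2)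
        (F '' Finset.range (N + 1)) := by
      refine Der.image _ _ fun i _ => ?_
      have := extendCSH_mem c k (a.natAbs + i) a
      exact (Der.of_mem (c := 0) (by rwa [Set.union_singleton])).smul _
    have h := hF.trans (Der.recSum (A := A ∪ {fun _ => 0} ∪ F '' Finset.range (N + 1)) N
      (recAlpha a.natAbs) (recGamma a.natAbs) (thetaCoeff a.natAbs) (isRec_thetaCoeff a.natAbs) F
      fun i hi => Or.inr ⟨i, Finset.mem_coe.2 (Finset.mem_range.2 (by omega)), rfl⟩)
    simp only [cf_ofCSH]
    refine h.mono_cost ?_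
    rw [Finset.card_range]
    have : 1 ≤ lg N ^ 2 := Nat.one_le_pow _ _ (by simp [lg])
    nlinarith
  have h2 := Der.biUnion (Finset.range (N + 1) ×ˢ Finset.Icc (-N : ℤ) N) _ fun i _ => h1 i.1 i.2
  rw [Finset.card_product, card_Icc_neg, Finset.card_range] at h2
  have h3 : Der (A ∪ {fun _ => 0}) _ (arr fun x => BallNS.ofCSH (c x)) :=
    Der.arr_of_box (D := N) (fun x => Bd.ofCSH (c x)) (h2.mono_right (by
      rintro _ ⟨⟨k, a, b⟩, hi, rfl⟩
      simp only [Set.mem_iUnion]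
      simp only [box, Finset.coe_product, Set.mem_prod, Finset.mem_coe] at hi
      exact ⟨(k, a), Finset.mem_product.2 ⟨hi.1, hi.2.1⟩, b, hi.2.2, rfl⟩))
  refine (h0.trans h3).mono_cost ?_
  have h4 := card_sq_le N (20002 * (N + 1) * lg N ^ 2)
  have h5 : (N + 1) ^ 3 ≤ (n + 1) ^ 3 := Nat.pow_le_pow_left (by omega) 3
  have h6 : lg N ^ 2 ≤ lg n ^ 2 := Nat.pow_le_pow_left (lg_mono (by omega)) 2
  have h7 := Nat.mul_le_mul h5 h6
  have h8 : 1 ≤ (n + 1) ^ 3 * lg n ^ 2 := Nat.mul_pos (by positivity) (by simp [lg])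
  nlinarith

end BallNS

namespace BallNS

open Polynomial Complex

/-! ### Projection onto spherical harmonics -/

theorem evalHom_algebraMap (z : ℂ) (r lam θ : ℝ) : evalHom r lam θ (algebraMap ℂ BallFn z) = z := by
  have h : algebraMap ℂ BallFn z = mode 0 0 (C z) := rfl
  rw [h, evalHom_mode]
  simp

theorem evalHom_aeval (f : BallFn) (p : ℂ[X]) (r lam θ : ℝ) :
    evalHom r lam θ (aeval f p) = p.eval (evalHom r lam θ f) := by
  rw [aeval_def, hom_eval₂]
  have : (evalHom r lam θ).comp (algebraMap ℂ BallFn) = RingHom.id ℂ :=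
    RingHom.ext fun z => evalHom_algebraMap z r lam θ
  rw [this]; rfl

theorem evalHom_cosTheta (r lam θ : ℝ) : evalHom r lam θ cosTheta = (Real.cos θ : ℂ) := by
  rw [cosTheta, map_add, evalHom_mode, evalHom_mode, Complex.ofReal_cos, Complex.cos, eval_C]
  have e1 : I * (((0 : ℤ) : ℂ) * (lam : ℂ) + ((1 : ℤ) : ℂ) * (θ : ℂ)) = θ * I := by push_cast; ring
  have e2 : I * (((0 : ℤ) : ℂ) * (lam : ℂ) + ((-1 : ℤ) : ℂ) * (θ : ℂ)) = -θ * I := by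
    push_cast; ring
  rw [e1, e2]; ring

theorem evalHom_sinTheta (r lam θ : ℝ) : evalHom r lam θ sinTheta = (Real.sin θ : ℂ) := by
  rw [sinTheta, map_add, evalHom_mode, evalHom_mode, Complex.ofReal_sin, Complex.sin,
    eval_C, eval_C]
  have e1 : I * (((0 : ℤ) : ℂ) * (lam : ℂ) + ((1 : ℤ) : ℂ) * (θ : ℂ)) = θ * I := by push_cast; ring
  have e2 : I * (((0 : ℤ) : ℂ) * (lam : ℂ) + ((-1 : ℤ) : ℂ) * (θ : ℂ)) = -θ * I := by
    push_cast; ring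
  rw [e1, e2]; ring

/-- The values of `sin^m θ P_l^{(m)}(cos θ)`. -/
noncomputable def thetaVal (m l : ℕ) (θ : ℝ) : ℂ :=
  (Real.sin θ : ℂ) ^ m * (derivative^[m] (legendre l)).eval (Real.cos θ : ℂ)

theorem evalHom_thetaFn (m l : ℕ) (r lam θ : ℝ) : evalHom r lam θ (thetaFn m l) = thetaVal m l θ
    := by
  rw [thetaFn, map_mul, map_pow, evalHom_sinTheta, evalHom_aeval, evalHom_cosTheta, thetaVal]

theorem conj_thetaVal (m l : ℕ) (θ : ℝ) : (starRingEnd ℂ) (thetaVal m l θ) = thetaVal m l θ := by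
  have h : (derivative^[m] (legendre l)).map (starRingEnd ℂ) = derivative^[m] (legendre l) := by
    rw [← iterate_derivative_map]
    congr 1
    rw [legendre, Polynomial.map_mul, ← iterate_derivative_map, map_C]
    simp only [map_div₀, map_mul, map_pow, map_one, map_natCast, map_ofNat, Polynomial.map_pow,
      Polynomial.map_sub, Polynomial.map_X, Polynomial.map_one]
  rw [thetaVal, map_mul, map_pow, Complex.conj_ofReal, ← eval_map_apply, h, Complex.conj_ofReal]

theorem eval_sphY (l : ℕ) (m : ℤ) (lam θ : ℝ) : (sphY l m).eval 1 lam θ =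
    sphNorm l m.natAbs * thetaVal m.natAbs l θ * exp (I * (m * lam)) := by
  rw [← evalHom_apply, sphY_eq, map_mul, evalHom_mode, evalHom_thetaFn, eval_C]
  push_cast
  rw [zero_mul, add_zero]; ring

theorem integral_exp_int (m : ℤ) : ∫ lam in (-Real.pi)..Real.pi, exp (I * ((m : ℂ) * (lam : ℂ))) =
    if m = 0 then 2 * (Real.pi : ℂ) else 0 := by
  split_ifs with h
  · subst h
    simp
    ring
  · have hm : I * (m : ℂ) ≠ 0 := mul_ne_zero I_ne_zero (Int.cast_ne_zero.2 h)
    have e : ∀ lam : ℝ, I * ((m : ℂ) * (lam : ℂ)) = I * m * lam := fun lam => by ring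
    simp only [e]
    rw [integral_exp_mul_complex hm, div_eq_zero_iff]
    refine Or.inl (sub_eq_zero.2 ?_)
    rw [Complex.exp_eq_exp_iff_exists_int]
    exact ⟨m, by push_cast; ring⟩

/-- The moments of the associated Legendre functions of order `m`, and degree `m + i`. -/
noncomputable def thetaMoment (m : ℕ) (b : ℤ) (i : ℕ) : ℂ :=
  ∫ θ in (0 : ℝ)..Real.pi, exp (I * ((b : ℂ) * (θ : ℂ))) * thetaVal m (m + i) θ * (Real.sin θ : ℂ)

theorem continuous_thetaVal (m l : ℕ) : Continuous (thetaVal m l) :=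
  ((Complex.continuous_ofReal.comp Real.continuous_sin).pow m).mul (continuous_eval_cos _)

theorem continuous_moment (m l : ℕ) (b : ℤ) : Continuous fun θ : ℝ =>
    exp (I * ((b : ℂ) * (θ : ℂ))) * thetaVal m l θ * (Real.sin θ : ℂ) := by
  have := continuous_thetaVal m l
  fun_prop

theorem cshCoeff_eq (f : BallFn) (D : ℕ) (hf : Bd D f) (k l : ℕ) (m : ℤ) (h : m.natAbs ≤ l) :
    cshCoeff f k l m = ∑ b ∈ Finset.Icc (-D : ℤ) D, cf f k m b *
      (2 * Real.pi * sphNorm l m.natAbs * thetaMoment m.natAbs b (l - m.natAbs)) := by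
  have h1 : ∀ ab : ℤ × ℤ, (∫ θ in (0 : ℝ)..Real.pi, ∫ lam in (-Real.pi)..Real.pi,
      exp (I * ((ab.1 : ℂ) * (lam : ℂ) + (ab.2 : ℂ) * (θ : ℂ)))
        * (starRingEnd ℂ) ((sphY l m).eval 1 lam θ) * (Real.sin θ : ℂ)) =
      if ab.1 = m then 2 * Real.pi * sphNorm l m.natAbs *
        thetaMoment m.natAbs ab.2 (l - m.natAbs) else 0 := by
    intro ab
    have e : ∀ θ lam : ℝ, exp (I * ((ab.1 : ℂ) * (lam : ℂ) + (ab.2 : ℂ) * (θ : ℂ)))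
        * (starRingEnd ℂ) ((sphY l m).eval 1 lam θ) * (Real.sin θ : ℂ) =
        (sphNorm l m.natAbs * (exp (I * ((ab.2 : ℂ) * (θ : ℂ))) * thetaVal m.natAbs l θ *
          (Real.sin θ : ℂ))) * exp (I * (((ab.1 - m : ℤ) : ℂ) * (lam : ℂ))) := by
      intro θ lam
      rw [eval_sphY, map_mul, map_mul, conj_thetaVal, Complex.conj_ofReal, ← Complex.exp_conj]
      have e1 : exp (I * ((ab.1 : ℂ) * (lam : ℂ) + (ab.2 : ℂ) * (θ : ℂ))) *
          exp ((starRingEnd ℂ) (I * (m * lam))) = exp (I * ((ab.2 : ℂ) * (θ : ℂ))) *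
            exp (I * (((ab.1 - m : ℤ) : ℂ) * (lam : ℂ))) := by
        rw [← exp_add, ← exp_add]
        congr 1
        simp only [map_mul, conj_I, Complex.conj_ofReal, map_intCast]
        push_cast; ring
      linear_combination (sphNorm l m.natAbs : ℂ) * thetaVal m.natAbs l θ * (Real.sin θ : ℂ) * e1
    simp only [e, intervalIntegral.integral_const_mul, integral_exp_int, sub_eq_zero]
    split_ifs
    · rw [intervalIntegral.integral_mul_const, intervalIntegral.integral_const_mul, thetaMoment,
        Nat.add_sub_cancel' h]
      ring
    · simp
  rw [cshCoeff, Finsupp.sum]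
  simp only [h1]
  refine Finset.sum_bij_ne_zero (fun ab _ _ => ab.2) ?_ ?_ ?_ ?_
  · intro ab _ h2
    have h3 := hf k ab.1 ab.2 (left_ne_zero_of_mul h2)
    rw [Finset.mem_Icc, ← abs_le]
    exact h3.2.2
  · intro x _ hx y _ hy hxy
    have e1 : x.1 = m := by by_contra h'; exact hx (by rw [if_neg h', mul_zero])
    have e2 : y.1 = m := by by_contra h'; exact hy (by rw [if_neg h', mul_zero])
    exact Prod.ext (e1.trans e2.symm) hxy
  · intro b _ hb
    have h2 : f.coeff (m, b) ≠ 0 := by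
      intro h'
      exact left_ne_zero_of_mul hb (by rw [cf, h', chebCoeff_zero])
    refine ⟨(m, b), Finsupp.mem_support_iff.2 h2, ?_, rfl⟩
    rw [if_pos rfl]
    exact hb
  · intro ab _ h2
    have e1 : ab.1 = m := by by_contra h'; exact h2 (by rw [if_neg h', mul_zero])
    rw [if_pos e1, cf, ← e1]

theorem thetaVal_add_two (m l : ℕ) (θ : ℝ) : ((l : ℂ) + 2 - m) * thetaVal m (l + 2) θ =
    (2 * (l : ℂ) + 3) * ((Real.cos θ : ℂ) * thetaVal m (l + 1) θ) -
      ((l : ℂ) + 1 + m) * thetaVal m l θ := by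
  have h := congrArg (fun p => p.eval (Real.cos θ : ℂ)) (iterate_derivative_legendre_add_two m l)
  simp only [eval_sub, eval_mul, eval_C, eval_X] at h
  simp only [thetaVal]
  linear_combination (Real.sin θ : ℂ) ^ m * h

theorem isRec_thetaMoment (m : ℕ) : IsRec (recAlpha m) (recGamma m) (thetaMoment m) := by
  have hi : ∀ (l : ℕ) (b : ℤ), IntervalIntegrable (fun θ : ℝ => exp (I * ((b : ℂ) * (θ : ℂ))) *
      thetaVal m l θ * (Real.sin θ : ℂ)) MeasureTheory.volume 0 Real.pi :=
    fun l b => (continuous_moment m l b).intervalIntegrable _ _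
  have hc : ∀ (l : ℕ) (b : ℤ), IntervalIntegrable (fun θ : ℝ => (Real.cos θ : ℂ) *
      (exp (I * ((b : ℂ) * (θ : ℂ))) * thetaVal m l θ * (Real.sin θ : ℂ)))
      MeasureTheory.volume 0 Real.pi :=
    fun l b => ((Complex.continuous_ofReal.comp Real.continuous_cos).mul
      (continuous_moment m l b)).intervalIntegrable _ _
  refine isRec_of_smul (a' := fun b i => ∫ θ in (0 : ℝ)..Real.pi, (Real.cos θ : ℂ) *
    (exp (I * ((b : ℂ) * (θ : ℂ))) * thetaVal m (m + i) θ * (Real.sin θ : ℂ))) ?_ ?_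
  · intro b i
    simp only [thetaMoment]
    rw [← intervalIntegral.integral_add (hi _ _) (hi _ _), ← intervalIntegral.integral_const_mul]
    refine intervalIntegral.integral_congr fun θ _ => ?_
    have e : ∀ s : ℤ, exp (I * (((b + s : ℤ) : ℂ) * (θ : ℂ))) =
        exp (I * ((b : ℂ) * (θ : ℂ))) * exp (s * θ * I) := by
      intro s
      rw [← exp_add]; congr 1; push_cast; ring
    have e1 := e 1
    have e2 := e (-1)
    rw [Int.cast_one, one_mul] at e1
    rw [Int.cast_neg, Int.cast_one, ← sub_eq_add_neg, neg_one_mul] at e2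
    rw [e1, e2, Complex.ofReal_cos, Complex.cos]
    ring
  · intro b i
    simp only [thetaMoment]
    rw [← intervalIntegral.integral_const_mul, ← intervalIntegral.integral_const_mul,
      ← intervalIntegral.integral_const_mul,
      ← intervalIntegral.integral_sub ((hc _ _).const_mul _) ((hi _ _).const_mul _)]
    refine intervalIntegral.integral_congr fun θ _ => ?_
    have h := thetaVal_add_two m (m + i) θ
    rw [show m + (i + 2) = m + i + 2 by ring, show m + (i + 1) = m + i + 1 by ring]
    linear_combination exp (I * ((b : ℂ) * (θ : ℂ))) * (Real.sin θ : ℂ) * h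

theorem integral_thetaVal (m l l' : ℕ) :
    ∫ θ in (0 : ℝ)..Real.pi, thetaVal m l' θ * thetaVal m l θ * (Real.sin θ : ℂ) =
      legendreGram m l l' := by
  rw [legendreGram, polarInt]
  refine intervalIntegral.integral_congr fun θ _ => ?_
  have h : (Real.sin θ : ℂ) ^ 2 = 1 - (Real.cos θ : ℂ) ^ 2 := by
    have := Real.sin_sq θ
    exact_mod_cast this
  simp only [thetaVal, eval_mul, eval_pow, eval_sub, eval_one, eval_X]
  rw [← h]
  ring

/-- The associated Legendre functions as sums of their Fourier series. -/
theorem sum_thetaCoeff_mul_moment (N m i i' : ℕ) (h : m + i' ≤ N) :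
    ∑ b ∈ Finset.Icc (-N : ℤ) N, thetaCoeff m b i' * thetaMoment m b i =
      legendreGram m (m + i) (m + i') := by
  have h0 : ∀ θ : ℝ, thetaVal m (m + i') θ =
      ∑ b ∈ Finset.Icc (-N : ℤ) N, thetaCoeff m b i' * exp (I * ((b : ℂ) * (θ : ℂ))) := by
    intro θ
    have h1 : thetaFn m (m + i') =
        ∑ b ∈ Finset.Icc (-N : ℤ) N, mode 0 b (C (thetaCoeff m b i')) := by
      refine cf_ext fun k a b => ?_
      rw [cf_thetaFn, cf_sum]
      simp only [cf_mode, chebCoeff_C]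
      by_cases hk : k = 0
      · by_cases ha : a = 0
        · simp only [hk, ha, true_and, if_true, and_self]
          rw [Finset.sum_ite_eq]
          split_ifs with hb
          · rfl
          · refine thetaCoeff_eq_zero ?_
            rw [Finset.mem_Icc, ← abs_le] at hb
            omega
        · simp [ha]
      · simp [hk]
    rw [← evalHom_thetaFn m (m + i') 0 0 θ, h1, map_sum]
    refine Finset.sum_congr rfl fun b _ => ?_
    rw [evalHom_mode, eval_C]
    push_cast
    rw [mul_zero, zero_add]
  rw [← integral_thetaVal]
  simp only [thetaMoment, ← intervalIntegral.integral_const_mul]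
  rw [← intervalIntegral.integral_finsetSum]
  · refine intervalIntegral.integral_congr fun θ _ => ?_
    rw [h0 θ, Finset.sum_mul, Finset.sum_mul]
    exact Finset.sum_congr rfl fun b _ => by ring
  · exact fun b _ => ((continuous_moment m _ b).intervalIntegrable _ _).const_mul _

theorem sphNorm_sq (l m : ℕ) (h : m ≤ l) :
    2 * Real.pi * (sphNorm l m : ℂ) * sphNorm l m * legendreGram m l l = 1 := by
  have h1 := legendreGram_self l m h
  have h2 : (sphNorm l m : ℂ) * sphNorm l m = (2 * (l : ℂ) + 1) / (4 * Real.pi) *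
      ((l - m).factorial : ℂ) / ((l + m).factorial : ℂ) := by
    rw [← Complex.ofReal_mul, sphNorm, Real.mul_self_sqrt (by positivity)]
    push_cast; rfl
  have h3 := Nat.cast_ne_zero (R := ℂ).2 (Nat.factorial_ne_zero (l + m))
  have h4 : (Real.pi : ℂ) ≠ 0 := Complex.ofReal_ne_zero.2 Real.pi_ne_zero
  rw [mul_assoc (2 * (Real.pi : ℂ)), h2]
  field_simp
  linear_combination 2 * h1

/-- The projection recovers the coefficients, as the spherical harmonics are orthonormal. -/
theorem toCSH_ofCSH {n : ℕ} (c : CSHIdx n → ℂ) : toCSH n (ofCSH c) = c := by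
  funext i
  have h2 := i.2.1.2
  have h3 := Finset.mem_Icc.1 i.2.2.2
  have h4 : (i.2.2 : ℤ).natAbs ≤ i.2.1 := by omega
  refine Eq.trans ?_ (extendCSH_apply c i)
  rw [toCSH]
  generalize (i.2.2 : ℤ) = μ at h4 ⊢
  generalize (i.2.1 : ℕ) = l at h2 h4 ⊢
  generalize (i.1 : ℕ) = k
  rw [cshCoeff_eq _ _ (Bd.ofCSH c) _ _ _ h4]
  simp only [cf_ofCSH, Finset.sum_mul]
  rw [Finset.sum_comm]
  set m := μ.natAbs with hm
  obtain ⟨j, rfl⟩ := Nat.exists_eq_add_of_le h4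
  have e : ∀ i' ∈ Finset.range (n / 2 + 1), ∑ b ∈ Finset.Icc (-(n / 2 : ℕ) : ℤ) (n / 2 : ℕ),
      sphNorm (m + i') m * extendCSH c k (m + i') μ * thetaCoeff m b i' *
        (2 * Real.pi * sphNorm (m + j) m * thetaMoment m b (m + j - m)) =
      if i' = j then extendCSH c k (m + j) μ else 0 := by
    intro i' hi'
    rw [Nat.add_sub_cancel_left]
    have e1 : ∀ b : ℤ, sphNorm (m + i') m * extendCSH c k (m + i') μ * thetaCoeff m b i' *
        (2 * Real.pi * sphNorm (m + j) m * thetaMoment m b j) =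
        2 * Real.pi * sphNorm (m + j) m * sphNorm (m + i') m * extendCSH c k (m + i') μ *
          (thetaCoeff m b i' * thetaMoment m b j) := fun b => by ring
    simp only [e1, ← Finset.mul_sum]
    by_cases hN : m + i' ≤ n / 2
    · rw [sum_thetaCoeff_mul_moment _ _ _ _ hN]
      split_ifs with hij
      · have := sphNorm_sq (m + j) m (by omega)
        rw [hij]
        linear_combination extendCSH c k (m + j) μ * this
      · rw [legendreGram_ne (by omega), mul_zero]
    · rw [extendCSH_eq_zero c (by tauto), if_neg (by omega)]
      simp
  rw [Finset.sum_congr rfl e, Finset.sum_ite_eq', if_pos (Finset.mem_range.2 (by omega))]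

/-- The fast projection of a function onto the CSH coefficients. -/
theorem Der.toCSH {X : Type} (n D : ℕ) (hD : n / 2 ≤ D) (f : X → BallFn) (hf : ∀ x, Bd D (f x)) :
    Der (arr f) (50000 * (D + 1) ^ 3 * lg D ^ 2) (Set.range fun i x => toCSH n (f x) i) := by
  have h1 : ∀ (k : ℕ) (m : ℤ), Der (arr f) (20000 * (D + 1) * lg D ^ 2)
      ((fun i x => ∑ b ∈ Finset.Icc (-D : ℤ) D, cf (f x) k m b * thetaMoment m.natAbs b i) ''
        Finset.range (D + 1)) := fun k m =>
    Der.recMoments D (recAlpha m.natAbs) (recGamma m.natAbs) (thetaMoment m.natAbs)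
      (isRec_thetaMoment m.natAbs) (fun b x => cf (f x) k m b) fun b _ => mem_arr f k m b
  have h2 := Der.biUnion (Finset.range (D + 1) ×ˢ Finset.Icc (-D : ℤ) D) _ fun i _ => h1 i.1 i.2
  rw [Finset.card_product, card_Icc_neg, Finset.card_range] at h2
  have h3 := h2.trans (Der.range (c := 2)
      (fun (i : CSHIdx n) x => BallNS.toCSH n (f x) i) fun i => by
    have h1 := i.1.2
    have h2 := i.2.1.2
    have h3 := Finset.mem_Icc.1 i.2.2.2
    have h4 : (i.2.2 : ℤ).natAbs ≤ i.2.1 := by omega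
    have e : (fun x => BallNS.toCSH n (f x) i) = fun x =>
        (2 * Real.pi * sphNorm i.2.1 (i.2.2 : ℤ).natAbs : ℂ) *
          ∑ b ∈ Finset.Icc (-D : ℤ) D, cf (f x) i.1 i.2.2 b *
            thetaMoment (i.2.2 : ℤ).natAbs b (i.2.1 - (i.2.2 : ℤ).natAbs) := by
      funext x
      rw [BallNS.toCSH, cshCoeff_eq _ D (hf x) _ _ _ h4, Finset.mul_sum]
      exact Finset.sum_congr rfl fun b _ => by ring
    rw [e]
    refine (Der.of_mem (c := 0) (Or.inr ?_)).smul _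
    simp only [Set.mem_iUnion]
    exact ⟨(i.1, i.2.2), Finset.mem_product.2 ⟨Finset.mem_range.2 (by omega),
      Finset.mem_Icc.2 (by omega)⟩, _, Finset.mem_coe.2 (Finset.mem_range.2 (by omega)), rfl⟩)
  refine h3.mono_cost ?_
  have h4 := card_sq_le D (20000 * (D + 1) * lg D ^ 2)
  have h5 : Fintype.card (CSHIdx n) ≤ 4 * (D + 1) ^ 3 := by
    have e1 : Fintype.card (CSHIdx n) ≤ Fintype.card (CFFIdx n) := by
      refine Fintype.card_le_of_injective (fun i => (i.1, ⟨i.2.2, ?_⟩, ⟨((i.2.1 : ℕ) : ℤ), ?_⟩)) ?_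
      · have h2 := i.2.1.2
        have h3 := Finset.mem_Icc.1 i.2.2.2
        rw [Finset.mem_Icc]; omega
      · have h2 := i.2.1.2
        rw [Finset.mem_Icc]; omega
      · rintro ⟨k, l, m⟩ ⟨k', l', m'⟩ h
        simp only [Prod.mk.injEq, Subtype.mk.injEq, Nat.cast_inj] at h
        obtain ⟨rfl, h1, h2⟩ := h
        obtain rfl := Fin.ext h2
        obtain rfl := Subtype.ext h1
        rfl
    refine e1.trans ?_
    rw [card_CFFIdx]
    calc (n / 2 + 1) * (2 * (n / 2) + 1) ^ 2 ≤ (D + 1) * (2 * (D + 1)) ^ 2 :=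
          Nat.mul_le_mul (by omega) (Nat.pow_le_pow_left (by omega) 2)
      _ = _ := by ring
  have h6 : 1 ≤ lg D ^ 2 := Nat.one_le_pow _ _ (by simp [lg])
  nlinarith [Nat.mul_le_mul_left (8 * (D + 1) ^ 3) h6]

end BallNS

namespace BallNS

open Polynomial Complex

/-! ### Banded linear systems -/

section

variable {X : Type}

/-- The pivot row after the rows `0, …, i` have been compared. The entry `0` of a row is its
right-hand side, and the entry `j + 1` is the coefficient of the unknown `j`. -/
noncomputable def pivotRow (r : ℕ → ℕ → X → ℂ) : ℕ → ℕ → X → ℂ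
  | 0, j => r 0 j
  | i + 1, j => fun x => if pivotRow r i 1 x = 0 then r (i + 1) j x else pivotRow r i j x

/-- The rows from which the first unknown has been eliminated. -/
noncomputable def reducedRow (r : ℕ → ℕ → X → ℂ) (i j : ℕ) : X → ℂ := fun x =>
  if pivotRow r i 1 x = 0 then pivotRow r i j x else
    r (i + 1) j x - r (i + 1) 1 x / pivotRow r i 1 x * pivotRow r i j x

/-- The defect of a row, with the right-hand side multiplied by `t`. -/
noncomputable def defect (N : ℕ) (t : ℂ) (Z : ℕ → ℂ) (v : ℕ → ℂ) : ℂ :=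
  ∑ j ∈ Finset.range N, v (j + 1) * Z j - v 0 * t

theorem defect_sub_mul (N : ℕ) (t : ℂ) (Z v w : ℕ → ℂ) (z : ℂ) :
    defect N t Z (fun j => v j - z * w j) = defect N t Z v - z * defect N t Z w := by
  simp only [defect, sub_mul, mul_sub, Finset.sum_sub_distrib, Finset.mul_sum, mul_assoc]
  ring

/-- The comparison of one more row is reversible: the new pivot row and the reduced row span the
same space as the old pivot row and the row. -/
theorem defect_reducedRow (r : ℕ → ℕ → X → ℂ) (i : ℕ) (x : X) (N : ℕ) (t : ℂ) (Z : ℕ → ℂ) :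
    (defect N t Z (fun j => pivotRow r (i + 1) j x) = 0 ∧
      defect N t Z (fun j => reducedRow r i j x) = 0) ↔
    (defect N t Z (fun j => pivotRow r i j x) = 0 ∧ defect N t Z (fun j => r (i + 1) j x) = 0) := by
  by_cases h : pivotRow r i 1 x = 0
  · simp only [pivotRow, reducedRow, h, if_true]
    exact and_comm
  · simp only [pivotRow, reducedRow, h, if_false, defect_sub_mul]
    constructor
    · rintro ⟨h1, h2⟩
      rw [h1, mul_zero, sub_zero] at h2
      exact ⟨h1, h2⟩
    · rintro ⟨h1, h2⟩
      rw [h1, h2, mul_zero, sub_zero]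
      exact ⟨rfl, rfl⟩

/-- The pivot row and the reduced rows are equivalent to the rows from which they arise, even if
the first column vanishes. -/
theorem forall_defect_iff (r : ℕ → ℕ → X → ℂ) (w : ℕ) (x : X) (N : ℕ) (t : ℂ) (Z : ℕ → ℂ) :
    (∀ i ≤ w, defect N t Z (fun j => r i j x) = 0) ↔
    (defect N t Z (fun j => pivotRow r w j x) = 0 ∧
      ∀ i < w, defect N t Z (fun j => reducedRow r i j x) = 0) := by
  induction w with
  | zero => simp [pivotRow]
  | succ w ih =>
    have e1 : (∀ i ≤ w + 1, defect N t Z (fun j => r i j x) = 0) ↔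
        (∀ i ≤ w, defect N t Z (fun j => r i j x) = 0) ∧
          defect N t Z (fun j => r (w + 1) j x) = 0 :=
      ⟨fun h => ⟨fun i hi => h i (by omega), h _ le_rfl⟩, fun h i hi => by
        rcases Nat.lt_or_eq_of_le hi with h' | rfl
        exacts [h.1 i (by omega), h.2]⟩
    have e2 : (∀ i < w + 1, defect N t Z (fun j => reducedRow r i j x) = 0) ↔
        (∀ i < w, defect N t Z (fun j => reducedRow r i j x) = 0) ∧
          defect N t Z (fun j => reducedRow r w j x) = 0 :=
      ⟨fun h => ⟨fun i hi => h i (by omega), h _ (by omega)⟩, fun h i hi => by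
        rcases Nat.lt_or_eq_of_le (Nat.le_of_lt_succ hi) with h' | rfl
        exacts [h.1 i h', h.2]⟩
    have h := defect_reducedRow r w x N t Z
    rw [e1, e2, ih]
    tauto

theorem reducedRow_one (r : ℕ → ℕ → X → ℂ) (i : ℕ) (x : X) : reducedRow r i 1 x = 0 := by
  rw [reducedRow]
  split_ifs with h
  · exact h
  · field_simp; ring

theorem eq_zero_of_pivotRow_one (r : ℕ → ℕ → X → ℂ) (w : ℕ) (x : X) (h : pivotRow r w 1 x = 0) :
    ∀ i ≤ w, r i 1 x = 0 := by
  induction w with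
  | zero =>
    intro i hi
    obtain rfl : i = 0 := by omega
    exact h
  | succ w ih =>
    intro i hi
    simp only [pivotRow] at h
    split_ifs at h with h'
    · rcases Nat.lt_or_eq_of_le hi with h1 | rfl
      exacts [ih h' i (by omega), h]
    · exact absurd h h'

theorem pivotRow_eq_zero (r : ℕ → ℕ → X → ℂ) (w j : ℕ) (h : ∀ i ≤ w, r i j = fun _ => 0) :
    ∀ i ≤ w, pivotRow r i j = fun _ => 0 := by
  intro i
  induction i with
  | zero => exact fun hi => h 0 hi
  | succ i ih =>
    intro hi
    funext x
    rw [pivotRow, ih (by omega), h _ hi]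
    simp

theorem reducedRow_eq_zero (r : ℕ → ℕ → X → ℂ) (w j : ℕ) (h : ∀ i ≤ w, r i j = fun _ => 0)
    (i : ℕ) (hi : i < w) : reducedRow r i j = fun _ => 0 := by
  funext x
  rw [reducedRow, pivotRow_eq_zero r w j h i hi.le, h _ hi]
  simp

/-- The entries of the pivot rows and of the reduced rows up to the row `s`, in the first `L`
unknowns. -/
def eliminationData (r : ℕ → ℕ → X → ℂ) (L s : ℕ) : Set (X → ℂ) :=
  {f | ∃ i ≤ s, ∃ j < L + 1, f = pivotRow r i j} ∪ {f | ∃ i < s, ∃ j < L + 1, f = reducedRow r i j}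

/-- The elimination of one unknown, with at most five operations per entry. -/
theorem Der.eliminate {A : Set (X → ℂ)} (r : ℕ → ℕ → X → ℂ) (L : ℕ) (hL : 0 < L)
    (hr : ∀ i j, r i j ∈ A) (s : ℕ) : Der A (s * ((L + 1) * 5)) (eliminationData r L s) := by
  induction s with
  | zero =>
    refine .done ?_
    rintro f (⟨i, hi, j, _, rfl⟩ | ⟨i, hi, _⟩)
    · obtain rfl : i = 0 := by omega
      exact hr 0 j
    · omega
  | succ s ih =>
    set B := A ∪ eliminationData r L s with hB
    have hp : ∀ j < L + 1, pivotRow r s j ∈ B := fun j hj => Or.inr (Or.inl ⟨s, le_rfl, j, hj, rfl⟩)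
    have hr' : ∀ j, r (s + 1) j ∈ B := fun j => Or.inl (hr _ _)
    have h0 : ∀ {f}, f ∈ B → Der B 0 {f} := fun h => Der.of_mem h
    have h1 : Der B ((L + 1) * 1) ((fun j => pivotRow r (s + 1) j) '' Finset.range (L + 1)) := by
      refine (Der.image (Finset.range (L + 1)) _ fun j hj => ?_).mono_cost
        (le_of_eq (by rw [Finset.card_range]))
      have hj' := Finset.mem_range.1 hj
      exact (h0 (hp 1 (by omega))).sel (h0 (hr' j)) (h0 (hp j hj'))
    have h2 : Der B ((L + 1) * 4) ((fun j => reducedRow r s j) '' Finset.range (L + 1)) := by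
      refine (Der.image (Finset.range (L + 1)) _ fun j hj => ?_).mono_cost
        (le_of_eq (by rw [Finset.card_range]))
      have hj' := Finset.mem_range.1 hj
      exact (h0 (hp 1 (by omega))).sel (h0 (hp j hj')) ((h0 (hr' j)).sub
        (((h0 (hr' 1)).div (h0 (hp 1 (by omega)))).mul (h0 (hp j hj'))))
    have h3 : Der B 0 (eliminationData r L s) := .done Set.subset_union_right
    refine (ih.trans (h3.union (h1.union h2))).mono le_rfl (le_of_eq (by ring)) ?_
    rintro f (⟨i, hi, j, hj, rfl⟩ | ⟨i, hi, j, hj, rfl⟩)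
    · rcases Nat.lt_or_eq_of_le hi with h | rfl
      · exact Or.inl (Or.inl ⟨i, by omega, j, hj, rfl⟩)
      · exact Or.inr (Or.inl ⟨j, by simpa using hj, rfl⟩)
    · rcases Nat.lt_or_eq_of_le (Nat.le_of_lt_succ hi) with h | rfl
      · exact Or.inl (Or.inr ⟨i, h, j, hj, rfl⟩)
      · exact Or.inr (Or.inr ⟨j, by simpa using hj, rfl⟩)

/-- The system that remains after the elimination of the first unknown from the rows `0, …, w`. -/
noncomputable def reducedSystem (w : ℕ) (r : ℕ → ℕ → X → ℂ) (i : ℕ) : ℕ → X → ℂ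
  | 0 => if i < w then reducedRow r i 0 else r (i + 1) 0
  | j + 1 => if i < w then reducedRow r i (j + 2) else r (i + 1) (j + 2)

theorem defect_succ (N : ℕ) (t : ℂ) (Z v : ℕ → ℂ) : defect (N + 1) t Z v =
    v 1 * Z 0 + (∑ j ∈ Finset.range N, v (j + 2) * Z (j + 1) - v 0 * t) := by
  rw [defect, Finset.sum_range_succ']; ring

theorem defect_reducedSystem (w : ℕ) (r : ℕ → ℕ → X → ℂ) (hw : ∀ i, w < i → r i 1 = fun _ => 0)
    (x : X) (N : ℕ) (t : ℂ) (Z : ℕ → ℂ) (i : ℕ) :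
    defect N t (fun j => Z (j + 1)) (fun j => reducedSystem w r i j x) =
      if i < w then defect (N + 1) t Z (fun j => reducedRow r i j x)
      else defect (N + 1) t Z (fun j => r (i + 1) j x) := by
  split_ifs with h
  · rw [defect_succ, reducedRow_one, zero_mul, zero_add, defect]
    simp only [reducedSystem, h, if_true]
  · rw [defect_succ, hw _ (by omega), zero_mul, zero_add, defect]
    simp only [reducedSystem, h, if_false]

/-- Elimination replaces a system by the pivot row and the reduced system. -/
theorem forall_defect_iff_reduced (w : ℕ) (r : ℕ → ℕ → X → ℂ)
    (hw : ∀ i, w < i → r i 1 = fun _ => 0) (x : X) (N : ℕ) (t : ℂ) (Z : ℕ → ℂ) :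
    (∀ i, defect (N + 1) t Z (fun j => r i j x) = 0) ↔
    (defect (N + 1) t Z (fun j => pivotRow r w j x) = 0 ∧
      ∀ i, defect N t (fun j => Z (j + 1)) (fun j => reducedSystem w r i j x) = 0) := by
  simp only [defect_reducedSystem w r hw]
  have h := forall_defect_iff r w x (N + 1) t Z
  constructor
  · intro h1
    obtain ⟨h2, h3⟩ := h.1 fun i _ => h1 i
    refine ⟨h2, fun i => ?_⟩
    split_ifs with hi
    exacts [h3 i hi, h1 _]
  · rintro ⟨h2, h3⟩ i
    rcases Nat.lt_or_ge w i with hi | hi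
    · have := h3 (i - 1)
      rwa [if_neg (by omega), show i - 1 + 1 = i by omega] at this
    · refine h.2 ⟨h2, fun i hi => ?_⟩ i hi
      have := h3 i
      rwa [if_pos hi] at this

/-- The cost of one step of the elimination for the bandwidth `w`. -/
def bandCost (w : ℕ) : ℕ := w * ((2 * w + 2) * 5) + (2 * w * 2 + 1) + 2

/-- Gaussian elimination for a banded system with `N` unknowns. The first `w + 1` rows involve the
unknowns up to `2 w`; below them, the row `i` involves the unknowns from `i - w` to `i + w`. If the
homogeneous system has only the zero solution, then every pivot is nonzero and `Y` agrees with every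
solution; the existence of a solution is not asserted, as there may be more rows than unknowns. -/
theorem Der.banded (w : ℕ) (N : ℕ) : ∀ (A : Set (X → ℂ)) (r : ℕ → ℕ → X → ℂ),
    (fun _ => 0) ∈ A → (∀ i j, r i j ∈ A) →
    (∀ i j, j + w < i → r i (j + 1) = fun _ => 0) →
    (∀ i j, max i w + w < j → r i (j + 1) = fun _ => 0) →
    ∃ Y : ℕ → X → ℂ, Der A (N * bandCost w) (Y '' Finset.range N) ∧ ∀ x,
      (∀ Z : ℕ → ℂ, (∀ i, defect N 0 Z (fun j => r i j x) = 0) → ∀ j < N, Z j = 0) →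
      ∀ Z : ℕ → ℂ, (∀ i, defect N 1 Z (fun j => r i j x) = 0) → ∀ j < N, Z j = Y j x := by
  induction N with
  | zero => exact fun A r _ _ _ _ => ⟨fun _ _ => 0, .done (by simp), fun x _ Z _ j hj => by omega⟩
  | succ N ih =>
    intro A r hA hr hlow hup
    have hcol : ∀ i, w < i → r i 1 = fun _ => 0 := fun i hi => hlow i 0 (by omega)
    -- the new data: the pivot row and the reduced rows, in the unknowns up to `2 w`
    set E := eliminationData r (2 * w + 1) w with hE
    have hE' : Der A (w * ((2 * w + 2) * 5)) E := Der.eliminate r (2 * w + 1) (by omega) hr w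
    have htail : ∀ j, 2 * w < j → ∀ i ≤ w, r i (j + 1) = fun _ => 0 := fun j hj i hi =>
      hup i j (by omega)
    have hpiv : ∀ j, pivotRow r w j ∈ A ∪ E := by
      intro j
      rcases Nat.lt_or_ge j (2 * w + 2) with hj | hj
      · exact Or.inr (Or.inl ⟨w, le_rfl, j, hj, rfl⟩)
      · obtain ⟨j, rfl⟩ : ∃ j', j = j' + 1 := ⟨j - 1, by omega⟩
        rw [pivotRow_eq_zero r w _ (htail j (by omega)) w le_rfl]
        exact Or.inl hA
    have hred : ∀ i < w, ∀ j, reducedRow r i j ∈ A ∪ E := by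
      intro i hi j
      rcases Nat.lt_or_ge j (2 * w + 2) with hj | hj
      · exact Or.inr (Or.inr ⟨i, hi, j, hj, rfl⟩)
      · obtain ⟨j, rfl⟩ : ∃ j', j = j' + 1 := ⟨j - 1, by omega⟩
        rw [reducedRow_eq_zero r w _ (htail j (by omega)) i hi]
        exact Or.inl hA
    obtain ⟨Y, hY, hsol⟩ := ih (A ∪ E) (reducedSystem w r) (Or.inl hA)
      (by
        rintro i (_ | j) <;> rw [reducedSystem] <;> split_ifs with h
        exacts [hred i h _, Or.inl (hr _ _), hred i h _, Or.inl (hr _ _)])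
      (by
        intro i j hij
        rw [reducedSystem, if_neg (by omega)]
        exact hlow _ _ (by omega))
      (by
        intro i j hij
        rw [reducedSystem]
        split_ifs with h
        · exact reducedRow_eq_zero r w _ (htail (j + 1) (by omega)) i h
        · exact hup _ _ (by omega))
    let S : X → ℂ := fun x => ∑ j ∈ Finset.range (min (2 * w) N), pivotRow r w (j + 2) x * Y j x
    let Y0 : X → ℂ := fun x => (pivotRow r w 0 x - S x) / pivotRow r w 1 x
    have hS : ∀ x, S x = ∑ j ∈ Finset.range N, pivotRow r w (j + 2) x * Y j x := by
      intro x
      refine Finset.sum_subset (Finset.range_mono (min_le_right _ _)) fun j hj hj' => ?_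
      rw [Finset.mem_range] at hj hj'
      rw [pivotRow_eq_zero r w _ (htail (j + 1) (by omega)) w le_rfl, zero_mul]
    refine ⟨fun j => Nat.casesOn j Y0 Y, ?_, ?_⟩
    · have h1 : Der (A ∪ E ∪ Y '' Finset.range N) (2 * w * 2 + 1) {S} := by
        refine (Der.sum (c := 1) (Finset.range (min (2 * w) N))
          (fun j x => pivotRow r w (j + 2) x * Y j x) fun j hj => ?_).mono_cost ?_
        · rw [Finset.mem_range] at hj
          exact (Der.of_mem (c := 0) (Or.inl (hpiv _))).mul
            (Der.of_mem (c := 0) (Or.inr ⟨j, by simp; omega, rfl⟩))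
        · rw [Finset.card_range]
          have := Nat.min_le_left (2 * w) N
          nlinarith
      have h2 : Der (A ∪ E ∪ Y '' Finset.range N) (2 * w * 2 + 1 + 2) {Y0} :=
        (((Der.of_mem (c := 0) (Or.inl (hpiv 0))).sub h1).div
          (Der.of_mem (c := 0) (Or.inl (hpiv 1)))).mono_cost (by omega)
      have h3 : Der (A ∪ E ∪ Y '' Finset.range N) 0 (Y '' Finset.range N) :=
        .done Set.subset_union_right
      refine (hE'.trans (hY.trans (h2.union h3))).mono le_rfl (le_of_eq ?_) ?_
      · rw [bandCost]; ring
      · rintro _ ⟨j, hj, rfl⟩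
        rcases j with _ | j
        · exact Or.inl rfl
        · exact Or.inr ⟨j, by simpa using hj, rfl⟩
    · intro x hker
      -- if the pivot vanished, so would the first column, and the first unit vector would solve the
      -- homogeneous system
      have hpos : pivotRow r w 1 x ≠ 0 := by
        intro h0
        have h1 := hker (fun j => if j = 0 then 1 else 0) (fun i => ?_) 0 (by omega)
        · simp at h1
        · rw [defect_succ]
          have : r i 1 x = 0 := by
            rcases Nat.lt_or_ge w i with hi | hi
            · rw [hcol i hi]
            · exact eq_zero_of_pivotRow_one r w x h0 i hi
          simp [this]
      have hker' : ∀ Z : ℕ → ℂ, (∀ i, defect N 0 Z (fun j => reducedSystem w r i j x) = 0) →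
          ∀ j < N, Z j = 0 := by
        intro Z hZ j hj
        let Z' : ℕ → ℂ := fun j => Nat.casesOn j
          (-(∑ j ∈ Finset.range N, pivotRow r w (j + 2) x * Z j) / pivotRow r w 1 x) Z
        refine hker Z' ((forall_defect_iff_reduced w r hcol x N 0 Z').2 ⟨?_, hZ⟩) (j + 1) (by omega)
        rw [defect_succ]
        change pivotRow r w 1 x * (-(∑ j ∈ Finset.range N, pivotRow r w (j + 2) x * Z j) /
          pivotRow r w 1 x) + (∑ j ∈ Finset.range N, pivotRow r w (j + 2) x * Z j -
            pivotRow r w 0 x * 0) = 0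
        rw [mul_div_cancel₀ _ hpos]
        ring
      intro Z hZ
      obtain ⟨h1, h2⟩ := (forall_defect_iff_reduced w r hcol x N 1 Z).1 hZ
      have h3 := hsol x hker' (fun j => Z (j + 1)) h2
      intro j hj
      rcases j with _ | j
      · rw [defect_succ] at h1
        have h4 : ∑ j ∈ Finset.range N, pivotRow r w (j + 2) x * Z (j + 1) = S x := by
          rw [hS]
          exact Finset.sum_congr rfl fun j hj => by rw [h3 j (Finset.mem_range.1 hj)]
        rw [h4] at h1
        change Z 0 = (pivotRow r w 0 x - S x) / pivotRow r w 1 x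
        rw [eq_div_iff hpos]
        linear_combination h1
      · exact h3 j (by omega)

end

end BallNS

namespace BallNS

open Polynomial Complex

/-! ### Almost banded linear systems -/

section

variable {X : Type}

theorem sum_range_seven_mul (m : ℕ) (f : ℕ → ℂ) : ∑ u ∈ Finset.range (7 * m), f u =
    ∑ k ∈ Finset.range m, ∑ s ∈ Finset.range 7, f (7 * k + s) := by
  induction m with
  | zero => simp
  | succ m ih =>
    rw [show 7 * (m + 1) = 7 * m + 7 by ring, Finset.sum_range_add, ih, Finset.sum_range_succ _ m]

theorem sum_block (m s : ℕ) (hs : s < 7) (f g Z : ℕ → ℂ) :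
    ∑ u ∈ Finset.range (7 * m), ((if u % 7 = 0 then f (u / 7) else 0) +
      if u % 7 = s then g (u / 7) else 0) * Z u =
    ∑ k ∈ Finset.range m, f k * Z (7 * k) + ∑ k ∈ Finset.range m, g k * Z (7 * k + s) := by
  rw [sum_range_seven_mul, ← Finset.sum_add_distrib]
  refine Finset.sum_congr rfl fun k _ => ?_
  have e : ∀ i ∈ Finset.range 7, ((if (7 * k + i) % 7 = 0 then f ((7 * k + i) / 7) else 0) +
      if (7 * k + i) % 7 = s then g ((7 * k + i) / 7) else 0) * Z (7 * k + i) =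
      (if i = 0 then f k * Z (7 * k) else 0) + if i = s then g k * Z (7 * k + s) else 0 := by
    intro i hi
    rw [Finset.mem_range] at hi
    rw [show (7 * k + i) % 7 = i by omega, show (7 * k + i) / 7 = k by omega]
    by_cases h1 : i = 0
    · subst h1
      by_cases h2 : 0 = s
      · subst h2; simp [add_mul]
      · simp [h2]
    · by_cases h2 : i = s
      · subst h2; simp [h1]
      · simp [h1, h2]
  rw [Finset.sum_congr rfl e, Finset.sum_add_distrib, Finset.sum_ite_eq', Finset.sum_ite_eq',
    if_pos (by simp), if_pos (by simpa using hs)]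

/-- The coefficient of the unknown `u` in the row `i` of the banded form of an almost banded system.
The unknown `7 k` is the unknown `k` of the given system, the unknown `7 k + e + 1` is the partial
sum up to `k` of the dense row `e`. -/
noncomputable def blockCoeff (M : ℕ) (β : ℕ → ℕ → X → ℂ) (W : ℕ → ℕ → ℂ) (i u : ℕ) : X → ℂ :=
  fun x => (if u % 7 = 0 then
      (if i % 7 = 0 then β (i / 7) (u / 7) x else
        if u / 7 = i / 7 ∧ i / 7 ≤ M then -W (i % 7 - 1) (i / 7) else 0) else 0) +
    if u % 7 = i % 7 then (if i % 7 = 0 then 0 else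
      (if u / 7 = i / 7 ∧ i / 7 ≤ M then 1 else 0) +
        if u / 7 + 1 = i / 7 then (if i / 7 ≤ M then -1 else if i / 7 = M + 1 then 1 else 0) else 0)
      else 0

theorem blockCoeff_cases (M : ℕ) (β : ℕ → ℕ → X → ℂ) (W : ℕ → ℕ → ℂ) (i u : ℕ) :
    blockCoeff M β W i u = β (i / 7) (u / 7) ∨ blockCoeff M β W i u = (fun _ => 0) ∨
      blockCoeff M β W i u = (fun _ => 1) ∨ blockCoeff M β W i u = (fun _ => -1) ∨
      ∃ e < 6, ∃ k ≤ M, blockCoeff M β W i u = fun _ => -W e k := by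
  unfold blockCoeff
  by_cases h1 : i % 7 = 0
  · by_cases h2 : u % 7 = 0
    · exact Or.inl (by simp [h1, h2])
    · exact Or.inr (Or.inl (by simp [h1, h2]))
  · by_cases h2 : u % 7 = 0
    · have h3 : ¬ 0 = i % 7 := fun h => h1 h.symm
      by_cases h4 : u / 7 = i / 7 ∧ i / 7 ≤ M
      · exact Or.inr (Or.inr (Or.inr (Or.inr ⟨i % 7 - 1, by omega, i / 7, h4.2, by
          simp [h1, h2, h3, h4]⟩)))
      · exact Or.inr (Or.inl (by simp [h1, h2, h3, h4]))
    · by_cases h3 : u % 7 = i % 7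
      · by_cases h4 : u / 7 = i / 7 ∧ i / 7 ≤ M
        · exact Or.inr (Or.inr (Or.inl (by simp [h1, h3, h4])))
        · by_cases h5 : u / 7 + 1 = i / 7
          · by_cases h6 : i / 7 ≤ M
            · exact Or.inr (Or.inr (Or.inr (Or.inl (by
                funext x
                rw [if_neg h2, if_pos h3, if_neg h1, if_neg h4, if_pos h5, if_pos h6]
                ring))))
            · by_cases h7 : i / 7 = M + 1
              · exact Or.inr (Or.inr (Or.inl (by simp [h1, h3, h5, h7])))
              · exact Or.inr (Or.inl (by simp [h1, h3, h5, h6, h7]))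
          · exact Or.inr (Or.inl (by simp [h1, h3, h4, h5]))
      · exact Or.inr (Or.inl (by simp [h2, h3]))

/-- The right-hand side of the row `i` of the banded form of an almost banded system. -/
noncomputable def blockRhs (M : ℕ) (ρ σ : ℕ → X → ℂ) (i : ℕ) : X → ℂ :=
  if i % 7 = 0 then ρ (i / 7) else if i / 7 = M + 1 then σ (i % 7 - 1) else fun _ => 0

/-- The banded form of an almost banded system with band rows `β`, `ρ` and dense rows `W`, `σ`. -/
noncomputable def blockRow (M : ℕ) (β : ℕ → ℕ → X → ℂ) (ρ : ℕ → X → ℂ) (W : ℕ → ℕ → ℂ)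
    (σ : ℕ → X → ℂ) (i : ℕ) : ℕ → X → ℂ
  | 0 => blockRhs M ρ σ i
  | u + 1 => blockCoeff M β W i u

theorem defect_blockRow (M : ℕ) (β : ℕ → ℕ → X → ℂ) (ρ : ℕ → X → ℂ) (W : ℕ → ℕ → ℂ)
    (σ : ℕ → X → ℂ) (x : X) (t : ℂ) (Z : ℕ → ℂ) (i s : ℕ) (hs : s < 7) :
    defect (7 * (M + 1)) t Z (fun j => blockRow M β ρ W σ (7 * i + s) j x) =
      if s = 0 then ∑ k ∈ Finset.range (M + 1), β i k x * Z (7 * k) - ρ i x * t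
      else (if i ≤ M then Z (7 * i + s) - W (s - 1) i * Z (7 * i) else 0) +
        (if i = 0 then 0 else if i ≤ M then -Z (7 * (i - 1) + s) else
          if i = M + 1 then Z (7 * M + s) - σ (s - 1) x * t else 0) := by
  simp only [defect, blockRow, blockCoeff, blockRhs]
  rw [show (7 * i + s) % 7 = s by omega, show (7 * i + s) / 7 = i by omega]
  have h := sum_block (M + 1) s hs
    (fun k => if s = 0 then β i k x else if k = i ∧ i ≤ M then -W (s - 1) i else 0)
    (fun k => if s = 0 then 0 else (if k = i ∧ i ≤ M then 1 else 0) + if k + 1 = i then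
      (if i ≤ M then -1 else if i = M + 1 then 1 else 0) else 0) Z
  rw [h]
  by_cases h0 : s = 0
  · simp [h0]
  · simp only [h0, if_false]
    have e1 : ∑ k ∈ Finset.range (M + 1), (if k = i ∧ i ≤ M then -W (s - 1) i else 0) * Z (7 * k) =
        if i ≤ M then -W (s - 1) i * Z (7 * i) else 0 := by
      by_cases hi : i ≤ M
      · rw [Finset.sum_eq_single i]
        · simp [hi]
        · intro k _ hk; simp [hk]
        · intro h'; exact absurd (Finset.mem_range.2 (by omega)) h'
      · simp [hi]
    have e2 : ∑ k ∈ Finset.range (M + 1), (if k = i ∧ i ≤ M then (1 : ℂ) else 0) * Z (7 * k + s) =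
        if i ≤ M then Z (7 * i + s) else 0 := by
      by_cases hi : i ≤ M
      · rw [Finset.sum_eq_single i]
        · simp [hi]
        · intro k _ hk; simp [hk]
        · intro h'; exact absurd (Finset.mem_range.2 (by omega)) h'
      · simp [hi]
    have e3 : ∑ k ∈ Finset.range (M + 1), (if k + 1 = i then
        (if i ≤ M then (-1 : ℂ) else if i = M + 1 then 1 else 0) else 0) * Z (7 * k + s) =
        if i = 0 then 0 else if i ≤ M then -Z (7 * (i - 1) + s) else
          if i = M + 1 then Z (7 * M + s) else 0 := by
      rcases i with _ | i
      · simp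
      · by_cases hi : i ≤ M
        · rw [Finset.sum_eq_single i]
          · rw [if_pos rfl, if_neg (Nat.succ_ne_zero i)]
            by_cases h1 : i + 1 ≤ M
            · simp [h1]
            · obtain rfl : i = M := by omega
              simp
          · intro k _ hk; simp [hk]
          · intro h'; exact absurd (Finset.mem_range.2 (by omega)) h'
        · rw [Finset.sum_eq_zero]
          · rw [if_neg (by omega), if_neg (by omega), if_neg (by omega)]
          · intro k hk
            rw [Finset.mem_range] at hk
            rw [if_neg (by omega), zero_mul]
    simp only [add_mul, Finset.sum_add_distrib, e1, e2, e3]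
    by_cases h1 : i = 0
    · subst h1; simp; ring
    · by_cases h2 : i ≤ M
      · have : i ≠ M + 1 := by omega
        simp [h1, h2, this]; ring
      · by_cases h3 : i = M + 1 <;> simp [h1, h2, h3]

/-- The defects of the banded form vanish exactly for the partial sums of the solutions of the
almost banded system. -/
theorem forall_blockRow_iff (M : ℕ) (β : ℕ → ℕ → X → ℂ) (ρ : ℕ → X → ℂ) (W : ℕ → ℕ → ℂ)
    (σ : ℕ → X → ℂ) (x : X) (t : ℂ) (Z : ℕ → ℂ) :
    (∀ i, defect (7 * (M + 1)) t Z (fun j => blockRow M β ρ W σ i j x) = 0) ↔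
    (∀ i, ∑ k ∈ Finset.range (M + 1), β i k x * Z (7 * k) = ρ i x * t) ∧
    (∀ e < 6, ∑ k ∈ Finset.range (M + 1), W e k * Z (7 * k) = σ e x * t) ∧
    ∀ e < 6, ∀ k ≤ M, Z (7 * k + (e + 1)) = ∑ i ∈ Finset.range (k + 1), W e i * Z (7 * i) := by
  constructor
  · intro h
    have h' : ∀ i s, s < 7 → _ := fun i s hs =>
      (defect_blockRow M β ρ W σ x t Z i s hs).symm.trans (h (7 * i + s))
    have hp : ∀ e < 6, ∀ k ≤ M, Z (7 * k + (e + 1)) =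
        ∑ i ∈ Finset.range (k + 1), W e i * Z (7 * i) := by
      intro e he k
      induction k with
      | zero =>
        intro _
        have := h' 0 (e + 1) (by omega)
        simp at this
        simp
        linear_combination this
      | succ k ih =>
        intro hk
        have := h' (k + 1) (e + 1) (by omega)
        simp only [Nat.add_eq_zero_iff, one_ne_zero, and_false, if_false, hk, if_true,
          Nat.add_sub_cancel] at this
        rw [Finset.sum_range_succ, ← ih (by omega)]
        linear_combination this
    refine ⟨fun i => ?_, fun e he => ?_, hp⟩
    · have := h' i 0 (by omega)
      rw [if_pos rfl] at this
      linear_combination this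
    · have := h' (M + 1) (e + 1) (by omega)
      simp at this
      rw [← hp e he M le_rfl]
      linear_combination this
  · rintro ⟨h1, h2, h3⟩ i
    obtain ⟨k, s, hs, rfl⟩ : ∃ k s, s < 7 ∧ i = 7 * k + s := ⟨i / 7, i % 7, by omega, by omega⟩
    rw [defect_blockRow M β ρ W σ x t Z k s hs]
    rcases s with _ | e
    · rw [if_pos rfl, h1, sub_self]
    · rw [if_neg (Nat.succ_ne_zero e), Nat.add_sub_cancel]
      rcases k with _ | k
      · rw [if_pos (Nat.zero_le M), h3 e (by omega) 0 (Nat.zero_le M)]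
        simp
      · rw [if_neg (Nat.succ_ne_zero k), Nat.add_sub_cancel]
        by_cases hk : k + 1 ≤ M
        · rw [if_pos hk, if_pos hk, h3 e (by omega) _ hk, h3 e (by omega) k (by omega),
            Finset.sum_range_succ _ (k + 1)]
          ring
        · rw [if_neg hk, if_neg hk]
          split_ifs with h
          · rw [h3 e (by omega) M le_rfl, h2 e (by omega)]; ring
          · ring

/-- Systems with `M + 1` unknowns, band rows and six dense rows with constant coefficients are
solved with `O(M)` operations, whenever they determine the solution. The partial sums of the six
dense rows become unknowns, so that each unknown `k` heads a block of `1 + 6 = 7` unknowns; the band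
of width `18` becomes one of width `7 * 18 = 126`. -/
theorem Der.almostBanded (M : ℕ) (A : Set (X → ℂ)) (β : ℕ → ℕ → X → ℂ) (ρ : ℕ → X → ℂ)
    (W : ℕ → ℕ → ℂ) (σ : ℕ → X → ℂ) (hβ : ∀ j k, β j k ∈ A) (hρ : ∀ j, ρ j ∈ A)
    (hσ : ∀ e, σ e ∈ A) (hlow : ∀ j k, k + 18 < j → β j k = fun _ => 0)
    (hup : ∀ j k, j + 18 < k → β j k = fun _ => 0) :
    ∃ Y : ℕ → X → ℂ, Der A ((M + 1) * (7 * bandCost 126 + 9)) (Y '' Finset.range (M + 1)) ∧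
      ∀ x, (∀ Z : ℕ → ℂ, (∀ j, ∑ k ∈ Finset.range (M + 1), β j k x * Z k = 0) →
        (∀ e < 6, ∑ k ∈ Finset.range (M + 1), W e k * Z k = 0) → ∀ k ≤ M, Z k = 0) →
      ∀ Z : ℕ → ℂ, (∀ j, ∑ k ∈ Finset.range (M + 1), β j k x * Z k = ρ j x) →
        (∀ e < 6, ∑ k ∈ Finset.range (M + 1), W e k * Z k = σ e x) → ∀ k ≤ M, Z k = Y k x := by
  let K : Set (X → ℂ) := ({fun _ => 0} ∪ ({fun _ => 1} ∪ {fun _ => -1})) ∪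
    ((fun p : ℕ × ℕ => fun _ => -W p.1 p.2) ''
      (Finset.range 6 ×ˢ Finset.range (M + 1) : Finset (ℕ × ℕ)))
  have hK : Der A (1 + (1 + 1) + (6 * (M + 1)) * 1) K := by
    refine ((Der.const 0).union ((Der.const 1).union (Der.const (-1)))).union ?_
    exact (Der.image (Finset.range 6 ×ˢ Finset.range (M + 1)) (fun p _ => -W p.1 p.2)
      fun p _ => Der.const _).mono_cost (le_of_eq (by simp))
  have k0 : (fun _ => 0) ∈ A ∪ K := Or.inr (Or.inl (Or.inl rfl))
  have k1 : (fun _ => 1) ∈ A ∪ K := Or.inr (Or.inl (Or.inr (Or.inl rfl)))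
  have k2 : (fun _ => -1) ∈ A ∪ K := Or.inr (Or.inl (Or.inr (Or.inr rfl)))
  obtain ⟨Y, hY, hsol⟩ := Der.banded 126 (7 * (M + 1)) (A ∪ K) (blockRow M β ρ W σ) k0
    (by
      rintro i (_ | u)
      · rw [blockRow, blockRhs]
        split_ifs
        exacts [Or.inl (hρ _), Or.inl (hσ _), k0]
      · rw [blockRow]
        rcases blockCoeff_cases M β W i u with h | h | h | h | ⟨e, he, k, hk, h⟩ <;> rw [h]
        exacts [Or.inl (hβ _ _), k0, k1, k2, Or.inr (Or.inr ⟨(e, k), by simp; omega, rfl⟩)])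
    (by
      intro i u h
      funext x
      simp only [blockRow, blockCoeff]
      by_cases h1 : i % 7 = 0
      · simp only [h1, if_true, hlow (i / 7) (u / 7) (by omega)]
        simp
      · rw [if_neg h1, if_neg h1, if_neg (by omega : ¬ (u / 7 = i / 7 ∧ i / 7 ≤ M)),
          if_neg (by omega : ¬ (u / 7 = i / 7 ∧ i / 7 ≤ M)),
          if_neg (by omega : ¬ u / 7 + 1 = i / 7)]
        simp)
    (by
      intro i u h
      funext x
      simp only [blockRow, blockCoeff]
      by_cases h1 : i % 7 = 0
      · by_cases h2 : u % 7 = 0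
        · simp only [h1, if_true, hup (i / 7) (u / 7) (by omega)]
          simp
        · simp [h1, h2]
      · rw [if_neg h1, if_neg h1, if_neg (by omega : ¬ (u / 7 = i / 7 ∧ i / 7 ≤ M)),
          if_neg (by omega : ¬ (u / 7 = i / 7 ∧ i / 7 ≤ M)),
          if_neg (by omega : ¬ u / 7 + 1 = i / 7)]
        simp)
  refine ⟨fun k => Y (7 * k), (hK.trans hY).mono le_rfl ?_ ?_, ?_⟩
  · have : 1 + (1 + 1) + 6 * (M + 1) * 1 + 7 * (M + 1) * bandCost 126 ≤
        (M + 1) * (7 * bandCost 126 + 9) := by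
      generalize bandCost 126 = b
      nlinarith
    exact this
  · rintro _ ⟨k, hk, rfl⟩
    rw [Finset.mem_coe, Finset.mem_range] at hk
    exact ⟨7 * k, by rw [Finset.mem_coe, Finset.mem_range]; omega, rfl⟩
  · intro x hker Z h1 h2 k hk
    let Z' : ℕ → ℂ := fun u => if u % 7 = 0 then Z (u / 7) else
      ∑ i ∈ Finset.range (u / 7 + 1), W (u % 7 - 1) i * Z i
    have hZ0 : ∀ k, Z' (7 * k) = Z k := fun k => by
      simp only [Z']
      rw [if_pos (by omega), show 7 * k / 7 = k by omega]
    have hZ1 : ∀ e < 6, ∀ k, Z' (7 * k + (e + 1)) = ∑ i ∈ Finset.range (k + 1), W e i * Z i :=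
      fun e he k => by
        simp only [Z']
        rw [if_neg (by omega), show (7 * k + (e + 1)) / 7 = k by omega,
          show (7 * k + (e + 1)) % 7 - 1 = e by omega]
    rw [← hZ0 k]
    refine hsol x ?_ Z' ?_ (7 * k) (by omega)
    · intro Q hQ
      obtain ⟨q1, q2, q3⟩ := (forall_blockRow_iff M β ρ W σ x 0 Q).1 hQ
      have hQ0 := hker (fun k => Q (7 * k)) (fun j => by rw [q1, mul_zero])
        fun e he => by rw [q2 e he, mul_zero]
      intro u hu
      obtain ⟨k, s, hs, rfl⟩ : ∃ k s, s < 7 ∧ u = 7 * k + s := ⟨u / 7, u % 7, by omega, by omega⟩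
      rcases s with _ | e
      · exact hQ0 k (by omega)
      · rw [q3 e (by omega) k (by omega)]
        refine Finset.sum_eq_zero fun i hi => ?_
        rw [Finset.mem_range] at hi
        rw [hQ0 i (by omega), mul_zero]
    · refine (forall_blockRow_iff M β ρ W σ x 1 Z').2 ⟨?_, ?_, ?_⟩
      · intro i
        simp only [hZ0, h1, mul_one]
      · intro e he
        simp only [hZ0, h2 e he, mul_one]
      · intro e he k _
        simp only [hZ0, hZ1 e he]

end

end BallNS

namespace BallNS

open Polynomial Complex

/-! ### Bandedness of the ultraspherical matrices -/

/-- The span of the `s`-th derivatives of `U_m`, `m ≥ m₀`; these are multiples of the ultraspherical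
polynomials `C_j^{(s + 1)}`, `j + s ≥ m₀`. -/
noncomputable def ultraSpan (s m₀ : ℕ) : Submodule ℂ ℂ[X] :=
  Submodule.span ℂ ((fun m : ℕ => derivative^[s] (Chebyshev.U ℂ (m : ℤ))) '' Set.Ici m₀)

theorem mem_ultraSpan {s m m₀ : ℕ} (h : m₀ ≤ m) :
    derivative^[s] (Chebyshev.U ℂ (m : ℤ)) ∈ ultraSpan s m₀ :=
  Submodule.subset_span ⟨m, h, rfl⟩

theorem ultraSpan_anti (s : ℕ) {m₀ m₁ : ℕ} (h : m₀ ≤ m₁) : ultraSpan s m₁ ≤ ultraSpan s m₀ :=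
  Submodule.span_mono (Set.image_mono (Set.Ici_subset_Ici.2 h))

theorem ultraSpan_map {s m₀ : ℕ} {S : Submodule ℂ ℂ[X]} (φ : ℂ[X] →ₗ[ℂ] ℂ[X])
    (h : ∀ m : ℕ, m₀ ≤ m → φ (derivative^[s] (Chebyshev.U ℂ (m : ℤ))) ∈ S) {p : ℂ[X]}
    (hp : p ∈ ultraSpan s m₀) : φ p ∈ S := by
  have : ultraSpan s m₀ ≤ S.comap φ := Submodule.span_le.2 (by
    rintro _ ⟨m, hm, rfl⟩
    exact h m hm)
  exact this hp

theorem derivative_mem_ultraSpan {s m₀ : ℕ} {p : ℂ[X]} (hp : p ∈ ultraSpan s m₀) :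
    derivative p ∈ ultraSpan (s + 1) m₀ :=
  ultraSpan_map derivative (fun m hm => by
    rw [← Function.iterate_succ_apply' derivative]
    exact mem_ultraSpan hm) hp

theorem U_eq_derivative (m : ℕ) : Chebyshev.U ℂ (m : ℤ) = C (1 / (2 * ((m : ℂ) + 1))) *
    (derivative (Chebyshev.U ℂ ((m + 1 : ℕ) : ℤ)) - derivative (Chebyshev.U ℂ ((m : ℤ) - 1))) := by
  have h1 := Chebyshev.T_derivative_eq_U (R := ℂ) ((m : ℤ) + 1)
  have h2 := congrArg derivative (Chebyshev.two_mul_T_eq_U_sub_U ℂ ((m : ℤ) - 1))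
  rw [show (m : ℤ) - 1 + 2 = m + 1 by ring, derivative_mul, h1, derivative_sub, derivative_ofNat,
    zero_mul, zero_add, add_sub_cancel_right] at h2
  push_cast
  rw [← h2, show (2 : ℂ[X]) = C 2 from rfl]
  have h3 : (2 * ((m : ℂ) + 1)) ≠ 0 := by exact_mod_cast (by omega : 2 * (m + 1) ≠ 0)
  have h4 : C (1 / (2 * ((m : ℂ) + 1))) * (C 2 * ((((m : ℤ) + 1 : ℤ) : ℂ[X]))) = 1 := by
    have : (((m : ℤ) + 1 : ℤ) : ℂ[X]) = C ((m : ℂ) + 1) := by push_cast; simp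
    rw [this, ← C_mul, ← C_mul, one_div_mul_cancel h3, C_1]
  rw [← mul_assoc, ← mul_assoc, mul_assoc (C _) (C 2), h4, one_mul]

theorem ultraSpan_le_succ (s m₀ : ℕ) : ultraSpan s m₀ ≤ ultraSpan (s + 1) (m₀ - 1) := by
  refine Submodule.span_le.2 ?_
  rintro _ ⟨m, hm, rfl⟩
  simp only [Set.mem_Ici] at hm
  beta_reduce
  rw [U_eq_derivative, iterate_derivative_C_mul, iterate_derivative_sub, ← smul_eq_C_mul,
    ← Function.iterate_succ_apply, ← Function.iterate_succ_apply]
  refine Submodule.smul_mem _ _ (Submodule.sub_mem _ (mem_ultraSpan (by omega)) ?_)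
  rcases m with _ | m
  · simp
  · rw [show ((m + 1 : ℕ) : ℤ) - 1 = (m : ℤ) by push_cast; ring]
    exact mem_ultraSpan (by omega)

theorem X_mul_mem_ultraSpan {s m₀ : ℕ} {p : ℂ[X]} (hp : p ∈ ultraSpan s m₀) :
    X * p ∈ ultraSpan s (m₀ - 1) := by
  refine ultraSpan_map (LinearMap.mulLeft ℂ (X : ℂ[X])) (fun m hm => ?_) hp
  rw [LinearMap.mulLeft_apply]
  have h2 : C (1 / 2 : ℂ) * 2 = 1 := by
    rw [show (2 : ℂ[X]) = C 2 from rfl, ← C_mul]; norm_num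
  have hU : X * Chebyshev.U ℂ (m : ℤ) = C (1 / 2) * (Chebyshev.U ℂ ((m + 1 : ℕ) : ℤ) +
      Chebyshev.U ℂ ((m : ℤ) - 1)) := by
    have h := Chebyshev.U_add_one ℂ (m : ℤ)
    push_cast
    rw [h]
    linear_combination -(X * Chebyshev.U ℂ (m : ℤ)) * h2
  have hmem : derivative^[s] (X * Chebyshev.U ℂ (m : ℤ)) ∈ ultraSpan s (m₀ - 1) := by
    rw [hU, iterate_derivative_C_mul, iterate_map_add, ← smul_eq_C_mul]
    refine Submodule.smul_mem _ _ (Submodule.add_mem _ (mem_ultraSpan (by omega)) ?_)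
    rcases m with _ | m
    · simp
    · rw [show ((m + 1 : ℕ) : ℤ) - 1 = (m : ℤ) by push_cast; ring]
      exact mem_ultraSpan (by omega)
  rcases s with _ | s
  · exact hmem
  · rw [iterate_derivative_X_mul] at hmem
    have h1 : C ((s : ℂ) + 1) * derivative^[s] (Chebyshev.U ℂ (m : ℤ)) ∈
        ultraSpan (s + 1) (m₀ - 1) := by
      rw [← smul_eq_C_mul]
      exact Submodule.smul_mem _ _ (ultraSpan_le_succ s m₀ (mem_ultraSpan hm))
    have := Submodule.sub_mem _ hmem h1
    rwa [add_sub_cancel_right] at this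

theorem ultraSpan_le (s d m₀ : ℕ) : ultraSpan s m₀ ≤ ultraSpan (s + d) (m₀ - d) := by
  induction d with
  | zero => exact le_rfl
  | succ d ih =>
    refine ih.trans ((ultraSpan_le_succ _ _).trans (le_of_eq ?_))
    rw [show m₀ - d - 1 = m₀ - (d + 1) by omega]; rfl

theorem X_pow_mul_mem_ultraSpan {s m₀ : ℕ} (i : ℕ) {p : ℂ[X]} (hp : p ∈ ultraSpan s m₀) :
    X ^ i * p ∈ ultraSpan s (m₀ - i) := by
  induction i with
  | zero => simpa using hp
  | succ i ih =>
    rw [pow_succ', mul_assoc, show m₀ - (i + 1) = m₀ - i - 1 by omega]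
    exact X_mul_mem_ultraSpan ih

theorem T_mem_ultraSpan (k : ℕ) : Chebyshev.T ℂ (k : ℤ) ∈ ultraSpan 0 (k - 2) := by
  have hU : ∀ m m₀ : ℕ, m₀ ≤ m → Chebyshev.U ℂ (m : ℤ) ∈ ultraSpan 0 m₀ := fun m m₀ h =>
    mem_ultraSpan (s := 0) h
  rcases k with _ | _ | k
  · have := hU 0 0 le_rfl
    simpa using this
  · have := Submodule.smul_mem _ (1 / 2 : ℂ) (hU 1 0 (Nat.zero_le _))
    have e : (1 / 2 : ℂ) • Chebyshev.U ℂ ((1 : ℕ) : ℤ) = Chebyshev.T ℂ ((0 + 1 : ℕ) : ℤ) := by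
      rw [smul_eq_C_mul, Nat.cast_one, Chebyshev.U_one, Chebyshev.T_one,
        show (2 : ℂ[X]) = C 2 from rfl, ← mul_assoc, ← C_mul]
      norm_num
    rwa [e] at this
  · have h := Chebyshev.two_mul_T_eq_U_sub_U ℂ (k : ℤ)
    have := Submodule.smul_mem _ (1 / 2 : ℂ) (Submodule.sub_mem _ (hU (k + 2) k (by omega))
      (hU k k le_rfl))
    have e : (1 / 2 : ℂ) • (Chebyshev.U ℂ ((k + 2 : ℕ) : ℤ) - Chebyshev.U ℂ (k : ℤ)) =
        Chebyshev.T ℂ ((k + 1 + 1 : ℕ) : ℤ) := by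
      push_cast
      rw [← h, smul_eq_C_mul, show (2 : ℂ[X]) = C 2 from rfl, ← mul_assoc, ← C_mul,
        show (k : ℤ) + 1 + 1 = k + 2 by ring]
      norm_num
    rwa [e] at this

theorem iterate_derivative_T_mem_ultraSpan (k s : ℕ) :
    derivative^[s + 1] (Chebyshev.T ℂ (k : ℤ)) ∈ ultraSpan s (k - 1) := by
  induction s with
  | zero =>
    rw [zero_add, Function.iterate_one, Chebyshev.T_derivative_eq_U]
    rcases k with _ | k
    · simp
    · rw [show ((k + 1 : ℕ) : ℤ) - 1 = (k : ℤ) by push_cast; ring]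
      have := Submodule.smul_mem _ ((k + 1 : ℕ) : ℂ)
        (mem_ultraSpan (s := 0) (m := k) (m₀ := k) le_rfl)
      simpa [smul_eq_C_mul] using this
  | succ s ih =>
    rw [Function.iterate_succ_apply']
    exact derivative_mem_ultraSpan ih

/-- All terms of the radial operators of order `2 q` are banded in the bases `C^{(2 q)}`. -/
theorem term_mem_ultraSpan (q k s i : ℕ) (hq : 1 ≤ q) (hs : s ≤ 2 * q) :
    X ^ i * (X ^ s * derivative^[s] (Chebyshev.T ℂ (k : ℤ))) ∈
      ultraSpan (2 * q - 1) (k - 1 - 2 * q - i) := by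
  have h : derivative^[s] (Chebyshev.T ℂ (k : ℤ)) ∈
      ultraSpan (2 * q - 1) (k - 1 - (2 * q - s)) := by
    rcases s with _ | s
    · have := ultraSpan_le 0 (2 * q - 1) (k - 2) (T_mem_ultraSpan k)
      rwa [zero_add, show k - 2 - (2 * q - 1) = k - 1 - (2 * q - 0) by omega] at this
    · have := ultraSpan_le s (2 * q - 1 - s) (k - 1) (iterate_derivative_T_mem_ultraSpan k s)
      rwa [show s + (2 * q - 1 - s) = 2 * q - 1 by omega,
        show k - 1 - (2 * q - 1 - s) = k - 1 - (2 * q - (s + 1)) by omega] at this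
  have h1 := X_pow_mul_mem_ultraSpan i (X_pow_mul_mem_ultraSpan s h)
  exact ultraSpan_anti _ (by omega) h1

theorem ultraBasis_apply (s j : ℕ) : ultraBasis s j = ultra s j := by
  rw [ultraBasis, Sequence.basis_eq_self]

theorem repr_eq_zero_of_mem_ultraSpan {s m₀ : ℕ} {p : ℂ[X]} (hp : p ∈ ultraSpan s m₀) {j : ℕ}
    (hj : j + s < m₀) : (ultraBasis s).repr p j = 0 := by
  have key : ultraSpan s m₀ ≤ LinearMap.ker ((ultraBasis s).coord j) := by
    refine Submodule.span_le.2 ?_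
    rintro _ ⟨m, hm, rfl⟩
    simp only [Set.mem_Ici] at hm
    obtain ⟨i, rfl⟩ : ∃ i, m = i + s := ⟨m - s, by omega⟩
    have h0 : (2 ^ s * (s.factorial : ℂ)) ≠ 0 :=
      mul_ne_zero (pow_ne_zero _ two_ne_zero) (Nat.cast_ne_zero.2 (Nat.factorial_ne_zero s))
    have h1 : derivative^[s] (Chebyshev.U ℂ ((i + s : ℕ) : ℤ)) =
        (2 ^ s * (s.factorial : ℂ)) • ultraBasis s i := by
      rw [ultraBasis_apply, ultra, smul_eq_C_mul, ← mul_assoc, ← C_mul, mul_one_div_cancel h0, C_1,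
        one_mul]
    rw [SetLike.mem_coe, LinearMap.mem_ker]
    beta_reduce
    rw [h1, map_smul, Module.Basis.coord_apply,
      Module.Basis.repr_self, Finsupp.single_apply, if_neg (by omega), smul_zero]
  exact key hp

theorem repr_eq_zero_of_degree_lt (s : ℕ) (d : ℕ) (p : ℂ[X]) (hp : p.degree < d) {j : ℕ}
    (hj : d ≤ j) : (ultraBasis s).repr p j = 0 := by
  induction d generalizing p with
  | zero =>
    have : p = 0 := by rwa [Nat.cast_zero, Nat.WithBot.lt_zero_iff, degree_eq_bot] at hp
    rw [this]; simp
  | succ d ih =>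
    have h0 : (ultra s d).coeff d ≠ 0 := coeff_ne_zero_of_eq_degree (degree_ultra s d)
    set z := p.coeff d / (ultra s d).coeff d with hz
    have h2 : (p - z • ultraBasis s d).degree < d := by
      rw [degree_lt_iff_coeff_zero]
      intro m hm
      rw [coeff_sub, coeff_smul, ultraBasis_apply, smul_eq_mul]
      rcases Nat.lt_or_eq_of_le hm with hm | rfl
      · rw [coeff_eq_zero_of_degree_lt (hp.trans_le (by exact_mod_cast hm)),
          coeff_eq_zero_of_degree_lt (by rw [degree_ultra]; exact_mod_cast hm), mul_zero, sub_zero]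
      · rw [hz, div_mul_cancel₀ _ h0, sub_self]
    have h3 := ih _ h2 (by omega)
    rw [map_sub, map_smul, Module.Basis.repr_self, Finsupp.sub_apply, Finsupp.smul_apply,
      Finsupp.single_apply, if_neg (by omega), smul_zero, sub_zero] at h3
    exact h3

/-- The span of `r^s (d/dr)^s p`, `s ≤ N`. -/
noncomputable def eulerSpan (p : ℂ[X]) (N : ℕ) : Submodule ℂ ℂ[X] :=
  Submodule.span ℂ ((fun s => X ^ s * derivative^[s] p) '' Set.Iic N)

theorem mem_eulerSpan (p : ℂ[X]) {s N : ℕ} (h : s ≤ N) :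
    X ^ s * derivative^[s] p ∈ eulerSpan p N := Submodule.subset_span ⟨s, h, rfl⟩

theorem eulerSpan_map {p : ℂ[X]} {N : ℕ} {S : Submodule ℂ ℂ[X]} (φ : ℂ[X] →ₗ[ℂ] ℂ[X])
    (h : ∀ s ≤ N, φ (X ^ s * derivative^[s] p) ∈ S) {u : ℂ[X]} (hu : u ∈ eulerSpan p N) :
    φ u ∈ S := by
  have : eulerSpan p N ≤ S.comap φ := Submodule.span_le.2 (by
    rintro _ ⟨s, hs, rfl⟩
    exact h s hs)
  exact this hu

theorem eulerSpan_mono (p : ℂ[X]) {N N' : ℕ} (h : N ≤ N') : eulerSpan p N ≤ eulerSpan p N' :=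
  Submodule.span_mono (Set.image_mono (Set.Iic_subset_Iic.2 h))

/-- The Euler operator `r d/dr`. -/
noncomputable def euler : ℂ[X] →ₗ[ℂ] ℂ[X] := LinearMap.mulLeft ℂ (X : ℂ[X]) ∘ₗ derivative

theorem euler_apply (p : ℂ[X]) : euler p = X * derivative p := rfl

theorem euler_mem_eulerSpan {p u : ℂ[X]} {N : ℕ} (hu : u ∈ eulerSpan p N) :
    euler u ∈ eulerSpan p (N + 1) := by
  refine eulerSpan_map euler (fun s hs => ?_) hu
  have e : euler (X ^ s * derivative^[s] p) =
      (s : ℂ) • (X ^ s * derivative^[s] p) + X ^ (s + 1) * derivative^[s + 1] p := by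
    rw [euler_apply, derivative_mul, derivative_X_pow, ← Function.iterate_succ_apply' derivative,
      smul_eq_C_mul]
    rcases s with _ | s
    · simp
    · rw [Nat.add_sub_cancel]; ring
  rw [e]
  exact Submodule.add_mem _ (Submodule.smul_mem _ _ (mem_eulerSpan p (by omega)))
    (mem_eulerSpan p (by omega))

theorem lapPow_succ (l j : ℕ) (p : ℂ[X]) : lapPow l (j + 1) p =
    euler (euler (lapPow l j p)) + (1 - 4 * (j : ℂ)) • euler (lapPow l j p) +
      (2 * (j : ℂ) * (2 * (j : ℂ) - 1) - (l : ℂ) * ((l : ℂ) + 1)) • lapPow l j p := by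
  rw [lapPow]
  simp only [euler_apply, smul_eq_C_mul, derivative_mul, derivative_X, C_sub, C_1]
  rw [show (2 : ℂ) = 1 + 1 by norm_num, C_add, C_1]
  ring

theorem lapPow_mem_eulerSpan (l j : ℕ) (p : ℂ[X]) : lapPow l j p ∈ eulerSpan p (2 * j) := by
  induction j with
  | zero => simpa [lapPow] using mem_eulerSpan p (le_refl 0)
  | succ j ih =>
    rw [lapPow_succ]
    exact Submodule.add_mem _ (Submodule.add_mem _ (euler_mem_eulerSpan (euler_mem_eulerSpan ih))
      (Submodule.smul_mem _ _ (eulerSpan_mono p (by omega) (euler_mem_eulerSpan ih))))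
      (Submodule.smul_mem _ _ (eulerSpan_mono p (by omega) ih))

/-- The operators `lapPow` as linear maps. -/
noncomputable def lapPowL (l : ℕ) : ℕ → ℂ[X] →ₗ[ℂ] ℂ[X]
  | 0 => LinearMap.id
  | j + 1 => euler ∘ₗ euler ∘ₗ lapPowL l j + (1 - 4 * (j : ℂ)) • euler ∘ₗ lapPowL l j +
      (2 * (j : ℂ) * (2 * (j : ℂ) - 1) - (l : ℂ) * ((l : ℂ) + 1)) • lapPowL l j

theorem lapPowL_apply (l j : ℕ) (p : ℂ[X]) : lapPowL l j p = lapPow l j p := by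
  induction j with
  | zero => rfl
  | succ j ih => rw [lapPow_succ, ← ih]; rfl

/-- The contribution of `∇_l^{2 i}` to the matrix `A_l`. -/
noncomputable def termMatrix (q l i j k : ℕ) : ℂ :=
  if i ≤ q then
    (ultraBasis (2 * q - 1)).repr (X ^ (2 * (q - i)) * lapPow l i (Chebyshev.T ℂ (k : ℤ))) j
  else 0

theorem ultraMatrix_eq (q : ℕ) (a : Fin 4 → ℂ) (l j k : ℕ) :
    ultraMatrix q a l j k = ∑ i : Fin 4, termMatrix q l i j k * a i := by
  rw [ultraMatrix, radialOp, map_sum, Finsupp.finsetSum_apply]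
  refine Finset.sum_congr rfl fun i _ => ?_
  rw [termMatrix]
  split_ifs
  · rw [mul_assoc, ← smul_eq_C_mul, map_smul, Finsupp.smul_apply, smul_eq_mul, mul_comm]
  · simp

theorem termMatrix_eq_zero {q l i j k : ℕ} (hq : 1 ≤ q) (h : ¬ (j ≤ k + 2 * q ∧ k ≤ j + 6 * q)) :
    termMatrix q l i j k = 0 := by
  rw [termMatrix]
  split_ifs with hi
  swap
  · rfl
  have hp := lapPow_mem_eulerSpan l i (Chebyshev.T ℂ (k : ℤ))
  by_cases hj : j ≤ k + 2 * q
  · refine repr_eq_zero_of_mem_ultraSpan (m₀ := k - 1 - 2 * q - 2 * q) ?_ (by omega)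
    exact eulerSpan_map (LinearMap.mulLeft ℂ (X ^ (2 * (q - i)) : ℂ[X]))
      (fun s hs => ultraSpan_anti _ (by omega)
        (term_mem_ultraSpan q k s (2 * (q - i)) hq (by omega))) hp
  · refine repr_eq_zero_of_degree_lt _ (k + 2 * q + 1) _ ?_ (by omega)
    rw [← mem_degreeLT]
    refine eulerSpan_map (LinearMap.mulLeft ℂ (X ^ (2 * (q - i)) : ℂ[X])) (fun s hs => ?_) hp
    rw [LinearMap.mulLeft_apply, mem_degreeLT]
    refine lt_of_le_of_lt degree_le_natDegree (Nat.cast_lt.2 (Nat.lt_succ_of_le ?_))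
    by_cases h0 : derivative^[s] (Chebyshev.T ℂ (k : ℤ)) = 0
    · simp [h0]
    have hd : (Chebyshev.T ℂ (k : ℤ)).natDegree = k := by
      rw [Chebyshev.natDegree_T]; simp
    have hs' : s ≤ k := by
      by_contra h'
      exact h0 (iterate_derivative_eq_zero (by omega))
    have h1 := natDegree_iterate_derivative (Chebyshev.T ℂ (k : ℤ)) s
    rw [hd] at h1
    refine natDegree_mul_le.trans ((Nat.add_le_add (natDegree_X_pow_le _) (natDegree_mul_le.trans
      (Nat.add_le_add (natDegree_X_pow_le _) h1))).trans ?_)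
    omega

/-- The matrix of the radial operator is banded. The degree gives the lower bandwidth; the upper one
counts the conversions from the Chebyshev basis to the ultraspherical basis and the multiplications
by `X`, each of which lowers the least index by a bounded amount. -/
theorem ultraMatrix_band {q : ℕ} (hq : 1 ≤ q) (a : Fin 4 → ℂ) (l j k : ℕ)
    (h : ultraMatrix q a l j k ≠ 0) : j ≤ k + 2 * q ∧ k ≤ j + 6 * q := by
  by_contra h'
  refine h ?_
  rw [ultraMatrix_eq]
  exact Finset.sum_eq_zero fun i _ => by rw [termMatrix_eq_zero hq h', zero_mul]

theorem convMatrix_eq_zero {q j k : ℕ} (hq : 1 ≤ q) (h : ¬ (j ≤ k ∧ k ≤ j + 4 * q)) :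
    convMatrix q j k = 0 := by
  rw [convMatrix]
  by_cases hj : j ≤ k
  · have := term_mem_ultraSpan q k 0 0 hq (Nat.zero_le _)
    simp only [pow_zero, one_mul, Function.iterate_zero, id_eq] at this
    exact repr_eq_zero_of_mem_ultraSpan this (by omega)
  · refine repr_eq_zero_of_degree_lt _ (k + 1) _ ?_ (by omega)
    rw [Chebyshev.degree_T]
    simp
    exact_mod_cast Nat.lt_succ_self k

theorem chebCoeff_X_pow_mul_T {i j k : ℕ} (h : ¬ (j ≤ k + i ∧ k ≤ j + i)) :
    chebCoeff (X ^ i * Chebyshev.T ℂ (k : ℤ)) j = 0 := by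
  induction i generalizing j with
  | zero => rw [pow_zero, one_mul, chebCoeff_T, if_neg (by omega)]
  | succ i ih =>
    rw [pow_succ', mul_assoc]
    rcases j with _ | j
    · rw [chebCoeff_X_mul_zero, ih (by omega), zero_div]
    · rw [chebCoeff_X_mul_succ, ih (by omega), ih (by omega)]; simp

end BallNS

namespace BallNS

open Polynomial Complex

/-! ### The radial solves -/

section

variable {Ω : Type}

/-- The number of operations per unknown of the radial solves. -/
def radialCost : ℕ := 7 * bandCost 126 + 600

theorem radialCost_aux₀ (m b : ℕ) : 1 + ((m + 1) * (37 * 13) + (m + 1) * 40) +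
    (m + 1) * (7 * b + 9) ≤ (m + 1) * (7 * b + 590) := by
  nlinarith [Nat.zero_le m, Nat.zero_le (m * b)]

theorem radialCost_aux (m b : ℕ) : 1 + 2 + (m + 1) * (7 * b + 590) ≤ (m + 1) * (7 * b + 600) := by
  nlinarith [Nat.zero_le m, Nat.zero_le (m * b)]

theorem one_le_radialCost_mul (m b : ℕ) : 1 ≤ (m + 1) * (7 * b + 600) :=
  Nat.mul_pos (Nat.succ_pos m) (Nat.succ_pos _)

/-- The solution of the systems that consist of the first rows of the ultraspherical system and of
six dense rows `W`, `σ`. -/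
theorem Der.radialSystem (n q l d : ℕ) (hq : 1 ≤ q) (hq' : q ≤ 3) (A : Set (Ω → ℂ))
    (a : Ω → Fin 4 → ℂ) (F : Ω → Fin (n / 2 + 1) → ℂ) (W : ℕ → ℕ → ℂ) (σ : ℕ → Ω → ℂ)
    (ha : ∀ i, (fun x => a x i) ∈ A) (hF : ∀ k, (fun x => F x k) ∈ A) (hσ : ∀ e, σ e ∈ A) :
    ∃ Y : Fin (n / 2 + 1) → Ω → ℂ,
      Der A ((n / 2 + 1) * (7 * bandCost 126 + 590)) (Set.range Y) ∧
      ∀ x, (∀ Z : Fin (n / 2 + 1) → ℂ, RowsHold n q (a x) l d 0 Z →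
        (∀ e < 6, ∑ k : Fin (n / 2 + 1), W e k * Z k = 0) → Z = 0) →
      ∀ Z, RowsHold n q (a x) l d (F x) Z →
        (∀ e < 6, ∑ k : Fin (n / 2 + 1), W e k * Z k = σ e x) → Z = fun k => Y k x := by
  classical
  let β : ℕ → ℕ → Ω → ℂ := fun j k => if j + d ≤ n / 2 ∧ j ≤ k + 18 ∧ k ≤ j + 18 then
    fun x => ultraMatrix q (a x) l j k else fun _ => 0
  let ρ : ℕ → Ω → ℂ := fun j => if j + d ≤ n / 2 then fun x => ∑ k ∈ Finset.univ.filter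
    (fun k : Fin (n / 2 + 1) => j ≤ k ∧ k ≤ j + 12), convMatrix q j k * F x k else fun _ => 0
  let Kβ : Set (Ω → ℂ) :=
    ⋃ j ∈ Finset.range (n / 2 + 1), (fun k => β j k) '' Finset.Icc (j - 18) (j + 18)
  let Kρ : Set (Ω → ℂ) := ρ '' Finset.range (n / 2 + 1)
  have hβ : ∀ j k, Der A 13 {β j k} := by
    intro j k
    simp only [β]
    split_ifs
    · have h := Der.lincomb (A := A) Finset.univ (fun i : Fin 4 => termMatrix q l i j k)
        (fun i x => a x i) fun i _ => ha i
      simpa only [ultraMatrix_eq, Finset.card_univ, Fintype.card_fin] using h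
    · exact (Der.const 0).mono_cost (by omega)
  have hρ : ∀ j, Der A 40 {ρ j} := by
    intro j
    simp only [ρ]
    split_ifs
    · refine (Der.lincomb (A := A) _ (fun k : Fin (n / 2 + 1) => convMatrix q j k)
        (fun k x => F x k) fun k _ => hF k).mono_cost ?_
      have : (Finset.univ.filter (fun k : Fin (n / 2 + 1) => j ≤ k ∧ k ≤ j + 12)).card ≤
          (Finset.Icc j (j + 12)).card := by
        refine Finset.card_le_card_of_injOn (fun k => (k : ℕ)) ?_ fun _ _ _ _ h => Fin.ext h
        intro k hk
        simpa using hk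
      rw [Nat.card_Icc] at this
      omega
    · exact (Der.const 0).mono_cost (by omega)
  have hKβ : Der A ((n / 2 + 1) * (37 * 13)) Kβ := by
    have h := Der.biUnion (A := A) (c := 37 * 13) (Finset.range (n / 2 + 1))
      (fun j => (fun k => β j k) '' Finset.Icc (j - 18) (j + 18)) fun j _ =>
        (Der.image (Finset.Icc (j - 18) (j + 18)) (fun k => β j k) fun k _ => hβ j k).mono_cost
          (Nat.mul_le_mul_right _ (by rw [Nat.card_Icc]; omega))
    rwa [Finset.card_range] at h
  have hKρ : Der A ((n / 2 + 1) * 40) Kρ := by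
    have h := Der.image (Finset.range (n / 2 + 1)) ρ fun j _ => hρ j
    rwa [Finset.card_range] at h
  have h0 : Der A 1 {fun _ => 0} := Der.const 0
  set B : Set (Ω → ℂ) := A ∪ ({fun _ => 0} ∪ (Kβ ∪ Kρ)) with hB
  have m0 : (fun _ => 0) ∈ B := Or.inr (Or.inl rfl)
  have mβ : ∀ j k, β j k ∈ B := by
    intro j k
    by_cases h : j + d ≤ n / 2 ∧ j ≤ k + 18 ∧ k ≤ j + 18
    · refine Or.inr (Or.inr (Or.inl ?_))
      simp only [Kβ, Set.mem_iUnion]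
      exact ⟨j, Finset.mem_range.2 (by omega), k, by simp; omega, rfl⟩
    · simp only [β, if_neg h]; exact m0
  have mρ : ∀ j, ρ j ∈ B := by
    intro j
    by_cases h : j + d ≤ n / 2
    · exact Or.inr (Or.inr (Or.inr ⟨j, by simp; omega, rfl⟩))
    · simp only [ρ, if_neg h]; exact m0
  obtain ⟨Y, hY, hsol⟩ := Der.almostBanded (n / 2) B β ρ W σ mβ mρ (fun e => Or.inl (hσ e))
    (fun j k h => if_neg (by omega)) (fun j k h => if_neg (by omega))
  -- the truncated rows and the banded rows coincide
  have rows : ∀ x (Z : ℕ → ℂ) j, ∑ k ∈ Finset.range (n / 2 + 1), β j k x * Z k =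
      if j + d ≤ n / 2 then ∑ k : Fin (n / 2 + 1), ultraMatrix q (a x) l j k * Z k else 0 := by
    intro x Z j
    split_ifs with h
    · rw [Finset.sum_range]
      refine Finset.sum_congr rfl fun k _ => ?_
      simp only [β, h, true_and]
      split_ifs with h'
      · rfl
      · have : ultraMatrix q (a x) l j k = 0 := by
          by_contra h''
          have := ultraMatrix_band hq _ _ _ _ h''
          omega
        rw [this]
    · exact Finset.sum_eq_zero fun k _ => by simp only [β, h, false_and, if_false, zero_mul]
  have rhs : ∀ x j, ρ j x =
      if j + d ≤ n / 2 then ∑ k : Fin (n / 2 + 1), convMatrix q j k * F x k else 0 := by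
    intro x j
    simp only [ρ]
    split_ifs with h
    · refine Finset.sum_subset (Finset.filter_subset _ _) fun k _ hk => ?_
      rw [convMatrix_eq_zero hq, zero_mul]
      intro h'
      exact hk (Finset.mem_filter.2 ⟨Finset.mem_univ k, h'.1, by omega⟩)
    · rfl
  -- arrays indexed by `Fin (n / 2 + 1)` as sequences
  let ext : (Fin (n / 2 + 1) → ℂ) → ℕ → ℂ := fun Z k => if h : k < n / 2 + 1 then Z ⟨k, h⟩ else 0
  have hext : ∀ Z (k : Fin (n / 2 + 1)), ext Z k = Z k := fun Z k => dif_pos k.2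
  refine ⟨fun k => Y k, ?_, ?_⟩
  · refine ((h0.union (hKβ.union hKρ)).trans hY).mono le_rfl ?_ ?_
    · exact radialCost_aux₀ _ _
    · rintro _ ⟨k, rfl⟩
      exact ⟨k, by simpa using Nat.lt_succ_iff.1 k.2, rfl⟩
  · intro x hker Z hrow hdense
    have h := hsol x ?_ (ext Z) ?_ ?_
    · funext k
      rw [← hext Z k]
      exact h k (Nat.lt_succ_iff.1 k.2)
    · intro Q hQ1 hQ2 k hk
      have hq0 := hker (fun k => Q k) (fun j hj => ?_) fun e he => ?_
      · exact congrFun hq0 ⟨k, by omega⟩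
      · have := hQ1 j
        rw [rows, if_pos hj] at this
        rw [this]
        simp
      · rw [← hQ2 e he, Finset.sum_range]
    · intro j
      rw [rows, rhs]
      split_ifs with h
      · simp only [hext]
        exact hrow j h
      · rfl
    · intro e he
      rw [← hdense e he, Finset.sum_range]
      simp only [hext]

/-- The values of the iterated radial Laplacians of the Chebyshev polynomials at `1` and `-1`. -/
noncomputable def closingRow (l e k : ℕ) : ℂ :=
  (lapPow l (e / 2) (Chebyshev.T ℂ (k : ℤ))).eval (if e % 2 = 0 then 1 else -1)

theorem sum_closingRow {n : ℕ} (l e : ℕ) (Z : Fin (n / 2 + 1) → ℂ) :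
    ∑ k : Fin (n / 2 + 1), closingRow l e k * Z k =
      (lapPow l (e / 2) (chebSum Z)).eval (if e % 2 = 0 then 1 else -1) := by
  rw [← lapPowL_apply, chebSum, map_sum, eval_finsetSum]
  refine Finset.sum_congr rfl fun k _ => ?_
  rw [← smul_eq_C_mul, map_smul, eval_smul, smul_eq_mul, lapPowL_apply, closingRow, mul_comm]

theorem closingConditions_iff {n q l : ℕ} (hq' : q ≤ 3) (Z : Fin (n / 2 + 1) → ℂ) :
    ClosingConditions n q l Z ↔ ∀ e < 6, 2 ≤ e → e / 2 < q →
      ∑ k : Fin (n / 2 + 1), closingRow l e k * Z k = 0 := by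
  simp only [sum_closingRow]
  constructor
  · intro h e _ he he'
    have := h (e / 2) (by omega) he'
    split_ifs
    exacts [this.1, this.2]
  · intro h j hj hj'
    have h1 := h (2 * j) (by omega) (by omega) (by omega)
    have h2 := h (2 * j + 1) (by omega) (by omega) (by omega)
    rw [show 2 * j / 2 = j by omega, if_pos (by omega)] at h1
    rw [show (2 * j + 1) / 2 = j by omega, if_neg (by omega)] at h2
    exact ⟨h1, h2⟩

theorem dirichletSystem_iff {n q l : ℕ} (hq : 1 ≤ q) (hq' : q ≤ 3) (a : Fin 4 → ℂ)
    (F : Fin (n / 2 + 1) → ℂ) (g : ℂ) (Z : Fin (n / 2 + 1) → ℂ) :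
    DirichletSystem n q a l F g Z ↔ RowsHold n q a l (2 * q) F Z ∧
      ∀ e < 6, ∑ k : Fin (n / 2 + 1), (if e / 2 < q then closingRow l e k else 0) * Z k =
        if e = 0 then g else if e = 1 then (-1) ^ l * g else 0 := by
  rw [DirichletSystem, closingConditions_iff hq']
  refine and_congr_right fun _ => ?_
  have h0 := sum_closingRow l 0 Z
  have h1 := sum_closingRow l 1 Z
  simp only [Nat.zero_div, lapPow, Nat.zero_mod, if_true] at h0
  simp only [show 1 / 2 = 0 by norm_num, lapPow, show 1 % 2 = 1 by norm_num, one_ne_zero,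
    if_false] at h1
  rw [← h0, ← h1]
  constructor
  · rintro ⟨e0, e1, e2⟩ e he
    by_cases hc : e / 2 < q
    · simp only [hc, if_true]
      split_ifs with c0 c1
      · rw [c0, e0]
      · rw [c1, e1]
      · exact e2 e he (by omega) hc
    · simp only [hc, if_false, zero_mul, Finset.sum_const_zero]
      rw [if_neg (by omega), if_neg (by omega)]
  · intro h
    refine ⟨?_, ?_, fun e he he' hc => ?_⟩
    · simpa [show 0 < q by omega] using h 0 (by omega)
    · simpa [show 0 < q by omega] using h 1 (by omega)
    · have := h e he
      simp only [hc, if_true] at this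
      rwa [if_neg (by omega), if_neg (by omega)] at this

theorem rowsHold_zero (n q : ℕ) (a : Fin 4 → ℂ) (l d : ℕ) : RowsHold n q a l d 0 0 := by
  intro j _
  simp

/-- The Dirichlet systems are solved with `O(n)` operations. A well-posed system has a solution, so
the computed vector, which agrees with every solution, is the solution. -/
theorem Der.dirichlet (n q l : ℕ) (hq : 1 ≤ q) (hq' : q ≤ 3) (A : Set (Ω → ℂ))
    (a : Ω → Fin 4 → ℂ) (F : Ω → Fin (n / 2 + 1) → ℂ) (g : Ω → ℂ)
    (ha : ∀ i, (fun x => a x i) ∈ A) (hF : ∀ k, (fun x => F x k) ∈ A) (hg : g ∈ A) :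
    ∃ Y : Fin (n / 2 + 1) → Ω → ℂ, Der A ((n / 2 + 1) * radialCost) (Set.range Y) ∧
      ∀ x, DirichletWellPosed n q (a x) l →
        ∀ Z, DirichletSystem n q (a x) l (F x) (g x) Z ↔ Z = fun k => Y k x := by
  have hK : Der A (1 + 2) ({fun _ => 0} ∪ {fun x => (-1) ^ l * g x}) :=
    (Der.const 0).union ((Der.of_mem (c := 0) hg).smul _)
  set B : Set (Ω → ℂ) := A ∪ ({fun _ => 0} ∪ {fun x => (-1) ^ l * g x}) with hB
  obtain ⟨Y, hY, hsol⟩ := Der.radialSystem n q l (2 * q) hq hq' B a F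
    (fun e k => if e / 2 < q then closingRow l e k else 0)
    (fun e => if e = 0 then g else if e = 1 then fun x => (-1) ^ l * g x else fun _ => 0)
    (fun i => Or.inl (ha i)) (fun k => Or.inl (hF k)) (fun e => by
      split_ifs
      exacts [Or.inl hg, Or.inr (Or.inr rfl), Or.inr (Or.inl rfl)])
  refine ⟨Y, (hK.trans hY).mono_cost ?_, fun x hx => ?_⟩
  · exact radialCost_aux _ _
  have hz : DirichletSystem n q (a x) l 0 0 0 := by
    rw [dirichletSystem_iff hq hq']
    exact ⟨rowsHold_zero n q _ l _, fun e _ => by simp⟩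
  have key : ∀ Z, DirichletSystem n q (a x) l (F x) (g x) Z → Z = fun k => Y k x := by
    intro Z hZ
    rw [dirichletSystem_iff hq hq'] at hZ
    refine hsol x (fun Q h1 h2 => ?_) Z hZ.1 fun e he => ?_
    · refine (hx 0 0).unique ?_ hz
      rw [dirichletSystem_iff hq hq']
      exact ⟨h1, fun e he => by rw [h2 e he]; simp⟩
    · rw [hZ.2 e he]
      split_ifs <;> rfl
  refine fun Z => ⟨key Z, ?_⟩
  rintro rfl
  obtain ⟨Z, hZ, _⟩ := hx (F x) (g x)
  rwa [← key Z hZ]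

/-- The integral condition. -/
noncomputable def integralRow (l k : ℕ) : ℂ :=
  ((∫ r in (0 : ℝ)..1, r ^ (l + 2) * (Chebyshev.T ℝ (k : ℤ)).eval r : ℝ) : ℂ)

theorem integralSystem_iff {n q l : ℕ} (hq' : q ≤ 3) (hl : l ≠ 0) (a : Fin 4 → ℂ)
    (F : Fin (n / 2 + 1) → ℂ) (p : ℂ) (Z : Fin (n / 2 + 1) → ℂ) :
    IntegralSystem n q a l F p Z ↔ RowsHold n q a l (2 * q - 1) F Z ∧
      ∀ e < 6, ∑ k : Fin (n / 2 + 1), (if e = 0 then integralRow l k else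
        if 2 ≤ e ∧ e / 2 < q then closingRow l e k else 0) * Z k = if e = 0 then -p else 0 := by
  rw [IntegralSystem, if_neg hl, closingConditions_iff hq']
  refine and_congr_right fun _ => ?_
  constructor
  · rintro ⟨e0, e2⟩ e he
    by_cases c0 : e = 0
    · simp only [c0, if_true]
      exact e0
    · simp only [c0, if_false]
      by_cases hc : 2 ≤ e ∧ e / 2 < q
      · simp only [hc, and_self, if_true]
        exact e2 e he hc.1 hc.2
      · simp only [hc, if_false, zero_mul, Finset.sum_const_zero]
  · intro h
    refine ⟨?_, fun e he he' hc => ?_⟩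
    · have := h 0 (by omega)
      simp only [if_true] at this
      exact this
    · have := h e he
      simp only [he', hc, show e ≠ 0 by omega, and_self, if_true, if_false] at this
      exact this

/-- The integral systems are solved with `O(n)` operations. -/
theorem Der.integral (n q l : ℕ) (hq : 1 ≤ q) (hq' : q ≤ 3) (A : Set (Ω → ℂ))
    (a : Ω → Fin 4 → ℂ) (F : Ω → Fin (n / 2 + 1) → ℂ) (p : Ω → ℂ)
    (ha : ∀ i, (fun x => a x i) ∈ A) (hF : ∀ k, (fun x => F x k) ∈ A) (hp : p ∈ A) :
    ∃ Y : Fin (n / 2 + 1) → Ω → ℂ, Der A ((n / 2 + 1) * radialCost) (Set.range Y) ∧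
      ∀ x, IntegralWellPosed n q (a x) l →
        ∀ Z, IntegralSystem n q (a x) l (F x) (p x) Z ↔ Z = fun k => Y k x := by
  by_cases hl : l = 0
  · refine ⟨fun _ _ => 0, (Der.const 0).mono le_rfl ?_ ?_, fun x _ Z => ?_⟩
    · exact one_le_radialCost_mul _ _
    · rintro _ ⟨k, rfl⟩; rfl
    · rw [IntegralSystem, if_pos hl]; rfl
  have hK : Der A (1 + 2) ({fun _ => 0} ∪ {fun x => (-1) * p x}) :=
    (Der.const 0).union ((Der.of_mem (c := 0) hp).smul _)
  set B : Set (Ω → ℂ) := A ∪ ({fun _ => 0} ∪ {fun x => (-1) * p x}) with hB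
  obtain ⟨Y, hY, hsol⟩ := Der.radialSystem n q l (2 * q - 1) hq hq' B a F
    (fun e k => if e = 0 then integralRow l k else
        if 2 ≤ e ∧ e / 2 < q then closingRow l e k else 0)
    (fun e => if e = 0 then fun x => (-1) * p x else fun _ => 0)
    (fun i => Or.inl (ha i)) (fun k => Or.inl (hF k)) (fun e => by
      split_ifs
      exacts [Or.inr (Or.inr rfl), Or.inr (Or.inl rfl)])
  refine ⟨Y, (hK.trans hY).mono_cost ?_, fun x hx => ?_⟩
  · exact radialCost_aux _ _
  have hz : IntegralSystem n q (a x) l 0 0 0 := by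
    rw [integralSystem_iff hq' hl]
    exact ⟨rowsHold_zero n q _ l _, fun e _ => by simp⟩
  have key : ∀ Z, IntegralSystem n q (a x) l (F x) (p x) Z → Z = fun k => Y k x := by
    intro Z hZ
    rw [integralSystem_iff hq' hl] at hZ
    refine hsol x (fun Q h1 h2 => ?_) Z hZ.1 fun e he => ?_
    · refine (hx 0 0).unique ?_ hz
      rw [integralSystem_iff hq' hl]
      exact ⟨h1, fun e he => by rw [h2 e he]; simp⟩
    · rw [hZ.2 e he]
      split_ifs
      · exact (neg_one_mul _).symm
      · rfl
  refine fun Z => ⟨key Z, ?_⟩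
  rintro rfl
  obtain ⟨Z, hZ, _⟩ := hx (F x) (p x)
  rwa [← key Z hZ]

/-- Multiplication of the right-hand side by `r^{2 q}`. -/
theorem Der.rhs (n q : ℕ) (hq' : q ≤ 3) (A : Set (Ω → ℂ)) (f : Ω → Fin (n / 2 + 1) → ℂ)
    (hf : ∀ k, (fun x => f x k) ∈ A) :
    Der A ((n / 2 + 1) * 40) (Set.range fun k x => rhsVec q (f x) k) := by
  classical
  have h : ∀ k : Fin (n / 2 + 1), Der A 40 {fun x => BallNS.rhsVec q (f x) k} := by
    intro k
    have e : (fun x => BallNS.rhsVec q (f x) k) = fun x => ∑ k' ∈ Finset.univ.filter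
        (fun k' : Fin (n / 2 + 1) => (k : ℕ) ≤ k' + 6 ∧ (k' : ℕ) ≤ k + 6),
        chebCoeff (X ^ (2 * q) * Chebyshev.T ℂ ((k' : ℕ) : ℤ)) k * f x k' := by
      funext x
      rw [BallNS.rhsVec, chebSum, Finset.mul_sum, chebCoeff_sum]
      have e1 : ∀ k' : Fin (n / 2 + 1), chebCoeff (X ^ (2 * q) * (C (f x k') *
          Chebyshev.T ℂ ((k' : ℕ) : ℤ))) k =
          chebCoeff (X ^ (2 * q) * Chebyshev.T ℂ ((k' : ℕ) : ℤ)) k * f x k' := by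
        intro k'
        rw [mul_left_comm, chebCoeff_C_mul, mul_comm]
      simp only [e1]
      refine (Finset.sum_subset (Finset.filter_subset _ _) fun k' _ hk' => ?_).symm
      rw [chebCoeff_X_pow_mul_T, zero_mul]
      intro h'
      exact hk' (Finset.mem_filter.2 ⟨Finset.mem_univ _, by omega, by omega⟩)
    rw [e]
    refine (Der.lincomb _ _ (fun (k' : Fin (n / 2 + 1)) x => f x k') fun k' _ => hf k').mono_cost ?_
    have : (Finset.univ.filter (fun k' : Fin (n / 2 + 1) => (k : ℕ) ≤ k' + 6 ∧
        (k' : ℕ) ≤ k + 6)).card ≤ (Finset.Icc ((k : ℕ) - 6) (k + 6)).card := by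
      refine Finset.card_le_card_of_injOn (fun k => (k : ℕ)) ?_ fun _ _ _ _ h => Fin.ext h
      intro k' hk'
      simp at hk' ⊢
      omega
    rw [Nat.card_Icc] at this
    omega
  have := Der.range _ h
  rwa [Fintype.card_fin] at this

end

end BallNS

namespace BallNS

open Polynomial Complex

/-! ### The linear stages of the time step -/

section

variable {Ω : Type}

theorem card_SHIdx_le (n : ℕ) : Fintype.card (SHIdx n) ≤ (n + 1) ^ 2 := by
  rw [Fintype.card_sigma]
  calc ∑ l : Fin (n / 2 + 1), Fintype.card {m : ℤ // m ∈ Finset.Icc (-((l : ℕ) : ℤ)) ((l : ℕ) : ℤ)}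
      ≤ ∑ _l : Fin (n / 2 + 1), (n + 1) := by
        refine Finset.sum_le_sum fun l _ => ?_
        rw [Fintype.card_coe, card_Icc_neg]
        have := l.2
        omega
    _ = (n / 2 + 1) * (n + 1) := by simp
    _ ≤ (n + 1) ^ 2 := by rw [sq]; exact Nat.mul_le_mul_right _ (by omega)

theorem card_CSHIdx_le (n : ℕ) : Fintype.card (CSHIdx n) ≤ (n + 1) ^ 3 := by
  rw [Fintype.card_prod, Fintype.card_fin, pow_succ']
  exact Nat.mul_le_mul (by omega) (card_SHIdx_le n)

/-- The radial functions of all spherical harmonics, assembled into one array. -/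
theorem Der.columns {n c : ℕ} {A : Set (Ω → ℂ)} (Y : SHIdx n → Fin (n / 2 + 1) → Ω → ℂ)
    (h : ∀ i, Der A c (Set.range (Y i))) :
    Der A (Fintype.card (SHIdx n) * c) (Set.range fun (j : CSHIdx n) x => Y j.2 j.1 x) := by
  refine (Der.biUnion Finset.univ (fun i => Set.range (Y i)) fun i _ => h i).mono_right ?_
  rintro _ ⟨j, rfl⟩
  simp only [Set.mem_iUnion]
  exact ⟨j.2, Finset.mem_univ _, j.1, rfl⟩

theorem forall_column_eq {n : ℕ} (Z : CSHIdx n → ℂ) (Y : SHIdx n → Fin (n / 2 + 1) → ℂ) :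
    (∀ i, column Z i = Y i) ↔ Z = fun j => Y j.2 j.1 :=
  ⟨fun h => funext fun j => congrFun (h j.2) j.1, fun h i => by rw [h]; rfl⟩

/-- The number of operations per unknown of a radial solve, the right-hand side included. -/
def solveCost : ℕ := 40 + radialCost

theorem Der.dirichletRhs (n q l : ℕ) (hq : 1 ≤ q) (hq' : q ≤ 3) (A : Set (Ω → ℂ))
    (a : Ω → Fin 4 → ℂ) (f : Ω → Fin (n / 2 + 1) → ℂ) (g : Ω → ℂ)
    (ha : ∀ i, (fun x => a x i) ∈ A) (hf : ∀ k, (fun x => f x k) ∈ A) (hg : g ∈ A) :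
    ∃ Y : Fin (n / 2 + 1) → Ω → ℂ, Der A ((n / 2 + 1) * solveCost) (Set.range Y) ∧
      ∀ x, DirichletWellPosed n q (a x) l →
        ∀ Z, DirichletSystem n q (a x) l (rhsVec q (f x)) (g x) Z ↔ Z = fun k => Y k x := by
  obtain ⟨Y, hY, h⟩ := Der.dirichlet n q l hq hq' (A ∪ Set.range fun k x => rhsVec q (f x) k) a
    (fun x => rhsVec q (f x)) g (fun i => Or.inl (ha i)) (fun k => Or.inr ⟨k, rfl⟩) (Or.inl hg)
  exact ⟨Y, ((Der.rhs n q hq' A f hf).trans hY).mono_cost (Nat.mul_add _ _ _).ge, h⟩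

theorem Der.integralRhs (n q l : ℕ) (hq : 1 ≤ q) (hq' : q ≤ 3) (A : Set (Ω → ℂ))
    (a : Ω → Fin 4 → ℂ) (f : Ω → Fin (n / 2 + 1) → ℂ) (p : Ω → ℂ)
    (ha : ∀ i, (fun x => a x i) ∈ A) (hf : ∀ k, (fun x => f x k) ∈ A) (hp : p ∈ A) :
    ∃ Y : Fin (n / 2 + 1) → Ω → ℂ, Der A ((n / 2 + 1) * solveCost) (Set.range Y) ∧
      ∀ x, IntegralWellPosed n q (a x) l →
        ∀ Z, IntegralSystem n q (a x) l (rhsVec q (f x)) (p x) Z ↔ Z = fun k => Y k x := by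
  obtain ⟨Y, hY, h⟩ := Der.integral n q l hq hq' (A ∪ Set.range fun k x => rhsVec q (f x) k) a
    (fun x => rhsVec q (f x)) p (fun i => Or.inl (ha i)) (fun k => Or.inr ⟨k, rfl⟩) (Or.inl hp)
  exact ⟨Y, ((Der.rhs n q hq' A f hf).trans hY).mono_cost (Nat.mul_add _ _ _).ge, h⟩

theorem columns_cost_le (n s : ℕ) :
    Fintype.card (SHIdx n) * ((n / 2 + 1) * s) ≤ s * (n + 1) ^ 3 := by
  calc Fintype.card (SHIdx n) * ((n / 2 + 1) * s) ≤ (n + 1) ^ 2 * ((n + 1) * s) :=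
        Nat.mul_le_mul (card_SHIdx_le n) (Nat.mul_le_mul_right _ (by omega))
    _ = _ := by ring

/-- The velocity potentials cost `O(n)` for each of the `O(n²)` spherical harmonics. -/
theorem Der.velocity (n : ℕ) (T : Ω → CSHIdx n → ℂ) :
    ∃ P : Ω → CSHIdx n → ℂ,
      Der (Set.range fun i x => T x i) ((10 + solveCost) * (n + 1) ^ 3)
        (Set.range fun i x => P x i) ∧
      ∀ x, VelocityWellPosed n → ∀ Z : CSHIdx n → ℂ,
        (∀ i : SHIdx n, DirichletSystem n 1 poissonCoeffs i.1 (rhsVec 1 (-column (T x) i)) 0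
          (column Z i)) ↔ Z = P x := by
  set A : Set (Ω → ℂ) := Set.range fun i x => T x i
  have hc : Der A (4 * 1) (Set.range fun (i : Fin 4) (_ : Ω) => poissonCoeffs i) := by
    have h := Der.range (A := A) (fun (i : Fin 4) (_ : Ω) => poissonCoeffs i) fun i => Der.const _
    rwa [Fintype.card_fin] at h
  have hT : Der A (Fintype.card (CSHIdx n) * 2) (Set.range fun i x => -1 * T x i) :=
    Der.range _ fun i => (Der.of_mem (A := A) (c := 0) ⟨i, rfl⟩).smul _
  set B : Set (Ω → ℂ) := A ∪
    (({fun _ => 0} ∪ Set.range fun (i : Fin 4) (_ : Ω) => poissonCoeffs i) ∪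
    Set.range fun i x => -1 * T x i) with hB
  choose Y hY hsol using fun i : SHIdx n => Der.dirichletRhs n 1 i.1 le_rfl (by norm_num) B
    (fun _ => poissonCoeffs) (fun x => -column (T x) i) (fun _ => 0)
    (fun j => Or.inr (Or.inl (Or.inr ⟨j, rfl⟩)))
    (fun k => Or.inr (Or.inr ⟨((k, i) : CSHIdx n), funext fun x => neg_one_mul (T x (k, i))⟩))
    (Or.inr (Or.inl (Or.inl rfl)))
  refine ⟨fun x j => Y j.2 j.1 x, ?_, fun x hx Z => ?_⟩
  · refine ((((Der.const 0).union hc).union hT).trans (Der.columns Y hY)).mono_cost ?_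
    have h2 := card_CSHIdx_le n
    have h3 : 1 ≤ (n + 1) ^ 3 := Nat.one_le_pow _ _ (by omega)
    rw [Nat.add_mul 10]
    refine Nat.add_le_add ?_ (columns_cost_le n solveCost)
    omega
  · rw [← forall_column_eq Z fun i k => Y i k x]
    exact forall_congr' fun i => hsol i x (hx _ (Nat.lt_succ_iff.1 i.1.2)) _

theorem halfOrder_cases (Γ₂ Γ₄ : ℝ) :
    ((Γ₄ : ℂ) = 0 ∧ (Γ₂ : ℂ) = 0 ∧ halfOrder Γ₂ Γ₄ = 1) ∨
      ((Γ₄ : ℂ) = 0 ∧ (Γ₂ : ℂ) ≠ 0 ∧ halfOrder Γ₂ Γ₄ = 2) ∨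
      ((Γ₄ : ℂ) ≠ 0 ∧ halfOrder Γ₂ Γ₄ = 3) := by
  unfold halfOrder
  by_cases h4 : Γ₄ = 0 <;> by_cases h2 : Γ₂ = 0 <;> simp [h4, h2]

/-- The order of the equation depends on the data: the solutions for all three orders are computed,
and zero tests select the one that applies. -/
theorem Der.selectOrder {κ : Type} [Fintype κ] {A : Set (Ω → ℂ)} {c : ℕ}
    (Sys : ℕ → Ω → (κ → ℂ) → Prop) (WP : ℕ → Ω → Prop) (Γ₂ Γ₄ : Ω → ℝ)
    (h₂ : (fun x => (Γ₂ x : ℂ)) ∈ A) (h₄ : (fun x => (Γ₄ x : ℂ)) ∈ A)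
    (h : ∀ q, 1 ≤ q → q ≤ 3 → ∃ Y : κ → Ω → ℂ, Der A c (Set.range Y) ∧
      ∀ x, WP q x → ∀ Z, Sys q x Z ↔ Z = fun k => Y k x) :
    ∃ Y : κ → Ω → ℂ, Der A (3 * c + Fintype.card κ * 2) (Set.range Y) ∧
      ∀ x, WP (halfOrder (Γ₂ x) (Γ₄ x)) x →
        ∀ Z, Sys (halfOrder (Γ₂ x) (Γ₄ x)) x Z ↔ Z = fun k => Y k x := by
  obtain ⟨Y₁, hY₁, hs₁⟩ := h 1 (by norm_num) (by norm_num)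
  obtain ⟨Y₂, hY₂, hs₂⟩ := h 2 (by norm_num) (by norm_num)
  obtain ⟨Y₃, hY₃, hs₃⟩ := h 3 (by norm_num) (by norm_num)
  refine ⟨fun k x => if (Γ₄ x : ℂ) = 0 then (if (Γ₂ x : ℂ) = 0 then Y₁ k x else Y₂ k x)
    else Y₃ k x, ?_, fun x hx Z => ?_⟩
  · refine (((hY₁.union hY₂).union hY₃).trans (Der.range (c := 2) _ fun k => ?_)).mono_cost
      (by omega)
    refine (Der.sel (a := 0) (b := 1) (c := 0) (Der.of_mem (Or.inl h₄)) ?_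
      (Der.of_mem (Or.inr (Or.inr ⟨k, rfl⟩)))).mono_cost (by omega)
    exact (Der.sel (a := 0) (b := 0) (c := 0) (Der.of_mem (Or.inl h₂))
      (Der.of_mem (Or.inr (Or.inl (Or.inl ⟨k, rfl⟩))))
      (Der.of_mem (Or.inr (Or.inl (Or.inr ⟨k, rfl⟩)))))
  · rcases halfOrder_cases (Γ₂ x) (Γ₄ x) with ⟨h4, h2, e⟩ | ⟨h4, h2, e⟩ | ⟨h4, e⟩ <;> rw [e] at hx ⊢
    · simp only [h4, h2, if_true]
      exact hs₁ x hx Z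
    · simp only [h4, h2, if_true, if_false]
      exact hs₂ x hx Z
    · simp only [h4, if_false]
      exact hs₃ x hx Z

/-- The implicit equations of the time step cost `O(n)` for each of the `O(n²)` spherical
harmonics. -/
theorem Der.vorticity (n : ℕ) (Γ₀ Γ₂ Γ₄ Δt : Ω → ℝ) (Pω Tω PN TN : Ω → CSHIdx n → ℂ)
    (g f : Ω → SHIdx n → ℂ) (A : Set (Ω → ℂ))
    (hp : ∀ i, (fun x => params (Γ₀ x) (Γ₂ x) (Γ₄ x) (Δt x) i) ∈ A)
    (hPω : ∀ i, (fun x => Pω x i) ∈ A) (hTω : ∀ i, (fun x => Tω x i) ∈ A)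
    (hPN : ∀ i, (fun x => PN x i) ∈ A) (hTN : ∀ i, (fun x => TN x i) ∈ A)
    (hg : ∀ i, (fun x => g x i) ∈ A) (hf : ∀ i, (fun x => f x i) ∈ A) :
    ∃ P T : Ω → CSHIdx n → ℂ,
      Der A ((30 + 6 * solveCost) * (n + 1) ^ 3)
        ((Set.range fun i x => P x i) ∪ Set.range fun i x => T x i) ∧
      ∀ x, VorticityWellPosed n (Γ₀ x) (Γ₂ x) (Γ₄ x) (Δt x) → ∀ Z W : CSHIdx n → ℂ,
        IsVorticity (Γ₀ x) (Γ₂ x) (Γ₄ x) (Δt x) (Pω x) (Tω x) (PN x) (TN x) (g x) (f x) Z W ↔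
          Z = P x ∧ W = T x := by
  have h₀ : (fun x => (Γ₀ x : ℂ)) ∈ A := hp 0
  have h₂ : (fun x => (Γ₂ x : ℂ)) ∈ A := hp 1
  have h₄ : (fun x => (Γ₄ x : ℂ)) ∈ A := hp 2
  have ht : (fun x => (Δt x : ℂ)) ∈ A := hp 3
  have hinv : Der A 2 {fun x => ((1 / Δt x : ℝ) : ℂ)} := by
    have h := (Der.const 1).div (Der.of_mem (c := 0) ht)
    simpa only [ofReal_div, ofReal_one] using h
  have hneg : ∀ Γ : Ω → ℝ, (fun x => (Γ x : ℂ)) ∈ A → Der A 2 {fun x => ((-Γ x : ℝ) : ℂ)} := by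
    intro Γ hΓ
    have h := (Der.of_mem (c := 0) hΓ).smul (-1)
    simpa only [neg_one_mul, ofReal_neg] using h
  have ha : Der A (4 * 2)
      (Set.range fun i x => stepCoeffs (Γ₀ x) (Γ₂ x) (Γ₄ x) (Δt x) i) := by
    have h := Der.range (A := A) (c := 2)
      (fun (i : Fin 4) x => stepCoeffs (Γ₀ x) (Γ₂ x) (Γ₄ x) (Δt x) i) (by
        intro i
        fin_cases i
        exacts [hinv, hneg _ h₀, Der.of_mem h₂, hneg _ h₄])
    rwa [Fintype.card_fin] at h
  have hrhs : ∀ u v : Ω → CSHIdx n → ℂ, (∀ i, (fun x => u x i) ∈ A) → (∀ i, (fun x => v x i) ∈ A) →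
      Der A (Fintype.card (CSHIdx n) * 4)
        (Set.range fun i x => ((1 / Δt x : ℝ) : ℂ) * u x i - v x i) := fun u v hu hv =>
    Der.range _ fun i => (hinv.mul (Der.of_mem (c := 0) (hu i))).sub (Der.of_mem (c := 0) (hv i))
  have hpre := (ha.union (hrhs Pω PN hPω hPN)).union (hrhs Tω TN hTω hTN)
  generalize hE : ((Set.range fun i x => stepCoeffs (Γ₀ x) (Γ₂ x) (Γ₄ x) (Δt x) i) ∪
    Set.range fun i x => ((1 / Δt x : ℝ) : ℂ) * Pω x i - PN x i) ∪
    (Set.range fun i x => ((1 / Δt x : ℝ) : ℂ) * Tω x i - TN x i) = E at hpre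
  have mE : ∀ i, (fun x => stepCoeffs (Γ₀ x) (Γ₂ x) (Γ₄ x) (Δt x) i) ∈ A ∪ E := fun i =>
    Or.inr (hE ▸ Or.inl (Or.inl ⟨i, rfl⟩))
  have mP : ∀ i k,
      (fun x => (((1 / Δt x : ℝ) : ℂ) • column (Pω x) i - column (PN x) i) k) ∈ A ∪ E :=
    fun i k => Or.inr (hE ▸ Or.inl (Or.inr ⟨(k, i), rfl⟩))
  have mT : ∀ i k,
      (fun x => (((1 / Δt x : ℝ) : ℂ) • column (Tω x) i - column (TN x) i) k) ∈ A ∪ E :=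
    fun i k => Or.inr (hE ▸ Or.inr ⟨(k, i), rfl⟩)
  choose Y hY hYsol using fun i : SHIdx n => Der.selectOrder
    (fun q x Z => DirichletSystem n q (stepCoeffs (Γ₀ x) (Γ₂ x) (Γ₄ x) (Δt x)) i.1
      (rhsVec q (((1 / Δt x : ℝ) : ℂ) • column (Pω x) i - column (PN x) i)) (g x i) Z)
    (fun q x => DirichletWellPosed n q (stepCoeffs (Γ₀ x) (Γ₂ x) (Γ₄ x) (Δt x)) i.1) Γ₂ Γ₄
    (Or.inl h₂) (Or.inl h₄) fun q h1 h3 => Der.dirichletRhs n q i.1 h1 h3 (A ∪ E) _ _ _ mE (mP i)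
      (Or.inl (hg i))
  choose V hV hVsol using fun i : SHIdx n => Der.selectOrder
    (fun q x Z => IntegralSystem n q (stepCoeffs (Γ₀ x) (Γ₂ x) (Γ₄ x) (Δt x)) i.1
      (rhsVec q (((1 / Δt x : ℝ) : ℂ) • column (Tω x) i - column (TN x) i)) (f x i) Z)
    (fun q x => IntegralWellPosed n q (stepCoeffs (Γ₀ x) (Γ₂ x) (Γ₄ x) (Δt x)) i.1) Γ₂ Γ₄
    (Or.inl h₂) (Or.inl h₄) fun q h1 h3 => Der.integralRhs n q i.1 h1 h3 (A ∪ E) _ _ _ mE (mT i)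
      (Or.inl (hf i))
  refine ⟨fun x j => Y j.2 j.1 x, fun x j => V j.2 j.1 x, ?_, fun x hx Z W => ?_⟩
  · refine (hpre.trans ((Der.columns Y hY).union (Der.columns V hV))).mono_cost ?_
    have h1 := columns_cost_le n (3 * solveCost + 2)
    have e : 3 * ((n / 2 + 1) * solveCost) + Fintype.card (Fin (n / 2 + 1)) * 2 =
        (n / 2 + 1) * (3 * solveCost + 2) := by rw [Fintype.card_fin]; ring
    have h2 := card_CSHIdx_le n
    have h3 : 1 ≤ (n + 1) ^ 3 := Nat.one_le_pow _ _ (by omega)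
    rw [e]
    generalize Fintype.card (SHIdx n) * ((n / 2 + 1) * (3 * solveCost + 2)) = u at h1 ⊢
    generalize solveCost = s at h1 ⊢
    generalize (n + 1) ^ 3 = m at h1 h2 h3 ⊢
    nlinarith
  · rw [← forall_column_eq Z fun i k => Y i k x, ← forall_column_eq W fun i k => V i k x,
      ← forall_and]
    refine forall_congr' fun i => ?_
    have := hx i.1 (Nat.lt_succ_iff.1 i.1.2)
    exact and_congr (hYsol i x this.1 _) (hVsol i x this.2 _)

end

end BallNS

namespace BallNS

open Polynomial Complex

/-! ### The nonlinear stage of the time step -/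

theorem two_le_lg (N : ℕ) : 2 ≤ lg N := by simp [lg]

theorem lg_two_mul_add_le (N d : ℕ) : lg (2 * N + d) ≤ (d + 2) * lg N := by
  have h1 : N < 2 ^ N.size := Nat.lt_size_self N
  have h2 : d < 2 ^ d := Nat.lt_two_pow_self
  have h3 : (2 * N + d).size ≤ N.size + 1 + d := by
    rw [Nat.size_le, pow_add, pow_succ]
    nlinarith [Nat.one_le_two_pow (n := N.size)]
  unfold lg
  nlinarith [Nat.zero_le (d * N.size)]

/-- Raising the degree and the grid parameter by constants changes the costs by constant factors. -/
theorem fast_cost_le (n D d C : ℕ) (hD : D ≤ n) (m : ℕ) (hm : m ≤ 2 * n + d) (K e : ℕ) :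
    C * (D + 1) ^ 3 + K * (m + 1) ^ 3 * lg m ^ e ≤
      (C + K * (d + 2) ^ 3 * (d + 2) ^ e) * ((n + 1) ^ 3 * lg n ^ e) := by
  have h1 : (D + 1) ^ 3 ≤ (n + 1) ^ 3 * lg n ^ e :=
    (Nat.pow_le_pow_left (by omega) 3).trans (Nat.le_mul_of_pos_right _
      (Nat.pow_pos (by have := two_le_lg n; omega)))
  have h2 : (m + 1) ^ 3 ≤ (d + 2) ^ 3 * (n + 1) ^ 3 := by
    rw [← mul_pow]
    exact Nat.pow_le_pow_left (by nlinarith [Nat.zero_le (d * n)]) 3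
  have h3 : lg m ^ e ≤ (d + 2) ^ e * lg n ^ e := by
    rw [← mul_pow]
    exact Nat.pow_le_pow_left ((lg_mono hm).trans (lg_two_mul_add_le n d)) e
  calc C * (D + 1) ^ 3 + K * (m + 1) ^ 3 * lg m ^ e
      ≤ C * ((n + 1) ^ 3 * lg n ^ e) +
        K * ((d + 2) ^ 3 * (n + 1) ^ 3) * ((d + 2) ^ e * lg n ^ e) := by gcongr
    _ = _ := by ring

theorem Fast.exists_bd {ι : Type} {Φ : (ι → BallFn) → BallFn} (h : Fast Φ) {D : ℕ}
    {f : ι → BallFn} (hf : ∀ i, Bd D (f i)) : ∃ E, Bd E (Φ f) := by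
  obtain ⟨d, _, h⟩ := h
  exact ⟨D + d, (h D).1 f hf⟩

theorem Fast.gridValues {ι : Type} {Φ : (ι → BallFn) → BallFn} (h : Fast Φ) :
    ∃ C : ℕ, ∀ D n : ℕ, D ≤ n → ∀ (Ω : Type) (f : Ω → ι → BallFn), (∀ x i, Bd D (f x i)) →
      Der (⋃ i, arr fun x => f x i) (C * ((n + 1) ^ 3 * lg n ^ 1))
        (Set.range fun i x => gridValues n (Φ (f x)) i) := by
  obtain ⟨d, C, h⟩ := h
  refine ⟨C + 1500 * (d + 2) ^ 3 * (d + 2) ^ 1, fun D n hD Ω f hf => ?_⟩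
  obtain ⟨h1, h2⟩ := h D
  have h3 := Der.gridValues (D + d) n (fun x => Φ (f x)) fun x => h1 _ (hf x)
  refine ((h2 Ω f hf).trans (h3.mono_left Set.subset_union_right)).mono_cost ?_
  have := fast_cost_le n D d C hD (D + d + n) (by omega) 1500 1
  rwa [pow_one (lg (D + d + n))] at this

theorem Fast.toCSH {ι : Type} {Φ : (ι → BallFn) → BallFn} (h : Fast Φ) :
    ∃ C : ℕ, ∀ D n : ℕ, n / 2 ≤ D → D ≤ n → ∀ (Ω : Type) (f : Ω → ι → BallFn),
      (∀ x i, Bd D (f x i)) →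
      Der (⋃ i, arr fun x => f x i) (C * ((n + 1) ^ 3 * lg n ^ 2))
        (Set.range fun i x => toCSH n (Φ (f x)) i) := by
  obtain ⟨d, C, h⟩ := h
  refine ⟨C + 50000 * (d + 2) ^ 3 * (d + 2) ^ 2, fun D n hD' hD Ω f hf => ?_⟩
  obtain ⟨h1, h2⟩ := h D
  have h3 := Der.toCSH n (D + d) (by omega) (fun x => Φ (f x)) fun x => h1 _ (hf x)
  refine ((h2 Ω f hf).trans (h3.mono_left Set.subset_union_right)).mono_cost ?_
  exact fast_cost_le n D d C hD (D + d) (by omega) 50000 2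

/-- The Cartesian components of the cross product of two vector fields given on the grid. -/
noncomputable def gridCross {n : ℕ} (W V : Fin 3 → CFFIdx n → ℂ) : Fin 3 → CFFIdx n → ℂ :=
  ![W 1 * V 2 - W 2 * V 1, W 2 * V 0 - W 0 * V 2, W 0 * V 1 - W 1 * V 0]

theorem EdgeSymm.mul {n : ℕ} {u v : CFFIdx n → ℂ} (hu : EdgeSymm u) (hv : EdgeSymm v) :
    EdgeSymm (u * v) :=
  ⟨fun k a a' b h h' => congrArg₂ (· * ·) (hu.1 k a a' b h h') (hv.1 k a a' b h h'),
    fun k a b b' h h' => congrArg₂ (· * ·) (hu.2 k a b b' h h') (hv.2 k a b b' h h')⟩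

theorem EdgeSymm.sub {n : ℕ} {u v : CFFIdx n → ℂ} (hu : EdgeSymm u) (hv : EdgeSymm v) :
    EdgeSymm (u - v) :=
  ⟨fun k a a' b h h' => congrArg₂ (· - ·) (hu.1 k a a' b h h') (hv.1 k a a' b h h'),
    fun k a b b' h h' => congrArg₂ (· - ·) (hu.2 k a b b' h h') (hv.2 k a b b' h h')⟩

theorem edgeSymm_gridCross {n : ℕ} {W V : Fin 3 → CFFIdx n → ℂ} (hW : ∀ j, EdgeSymm (W j))
    (hV : ∀ j, EdgeSymm (V j)) (j : Fin 3) : EdgeSymm (gridCross W V j) := by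
  have h : ∀ a b, EdgeSymm (W a * V b - W b * V a) := fun a b =>
    ((hW a).mul (hV b)).sub ((hW b).mul (hV a))
  fin_cases j
  exacts [h 1 2, h 2 0, h 0 1]

theorem Der.gridCross {Ω : Type} {n : ℕ} (W V : Ω → Fin 3 → CFFIdx n → ℂ) {A : Set (Ω → ℂ)}
    (hW : ∀ j i, (fun x => W x j i) ∈ A) (hV : ∀ j i, (fun x => V x j i) ∈ A) (j : Fin 3) :
    Der A (Fintype.card (CFFIdx n) * 3) (Set.range fun i x => gridCross (W x) (V x) j i) := by
  have h : ∀ a b i, Der A 3 {fun x => W x a i * V x b i - W x b i * V x a i} := fun a b i =>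
    ((Der.of_mem (c := 0) (hW a i)).mul (Der.of_mem (c := 0) (hV b i))).sub
      ((Der.of_mem (c := 0) (hW b i)).mul (Der.of_mem (c := 0) (hV a i)))
  refine Der.range _ fun i => ?_
  fin_cases j
  exacts [h 1 2 i, h 2 0 i, h 0 1 i]

theorem Der.ofCFF {Ω : Type} {n : ℕ} (d : Ω → CFFIdx n → ℂ) :
    Der (Set.range fun i x => d x i) 1 (arr fun x => ofCFF (d x)) := by
  refine (Der.const 0).keep.mono_right ?_
  rintro _ ⟨⟨k, a, b⟩, rfl⟩
  by_cases h : k ≤ n / 2 ∧ |a| ≤ (n / 2 : ℕ) ∧ |b| ≤ (n / 2 : ℕ)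
  · refine Or.inl ⟨(⟨k, by omega⟩, ⟨a, Finset.mem_Icc.2 (abs_le.1 h.2.1)⟩,
      ⟨b, Finset.mem_Icc.2 (abs_le.1 h.2.2)⟩), funext fun x => ?_⟩
    change _ = cf (BallNS.ofCFF (d x)) k a b
    rw [cf_ofCFF]
    exact (extend_apply (d x) (⟨k, by omega⟩, ⟨a, Finset.mem_Icc.2 (abs_le.1 h.2.1)⟩,
      ⟨b, Finset.mem_Icc.2 (abs_le.1 h.2.2)⟩)).symm
  · exact Or.inr (funext fun x => by
      change cf (BallNS.ofCFF (d x)) k a b = 0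
      rw [cf_ofCFF, extend_eq_zero _ h])

/-- The solution of `-∇₁² P = f` without `l = 0` component: division by the eigenvalues
`l (l + 1)`. -/
noncomputable def invSurfaceLap (n : ℕ) (f : BallFn) : CSHIdx n → ℂ := fun i =>
  if (i.2.1 : ℕ) = 0 then 0 else
    BallNS.toCSH n f i / (((i.2.1 : ℕ) : ℂ) * (((i.2.1 : ℕ) : ℂ) + 1))

theorem Der.invSurfaceLap {Ω : Type} (n : ℕ) (f : Ω → BallFn) :
    Der (Set.range fun i x => BallNS.toCSH n (f x) i) ((n + 1) ^ 3 * 2)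
      (Set.range fun i x => BallNS.invSurfaceLap n (f x) i) := by
  set A : Set (Ω → ℂ) := Set.range fun i x => BallNS.toCSH n (f x) i with hA
  refine (Der.range (c := 2) _ fun i => ?_).mono_cost
    (Nat.mul_le_mul_right _ (card_CSHIdx_le n))
  by_cases h : (i.2.1 : ℕ) = 0
  · simp only [BallNS.invSurfaceLap, if_pos h]
    exact (Der.const 0).mono_cost (by norm_num)
  · simp only [BallNS.invSurfaceLap, if_neg h]
    exact ((Der.of_mem (A := A) (c := 0) ⟨i, rfl⟩).div (Der.const _)).mono_cost (by norm_num)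

/-- The grid values of the velocity with given poloidal and toroidal scalars. -/
noncomputable def gridVel (n : ℕ) (P T : BallFn) (j : Fin 3) : CFFIdx n → ℂ :=
  gridValues n (ptField P T j)

/-- The grid values of the vorticity of the velocity with given poloidal and toroidal scalars. -/
noncomputable def gridVort (n : ℕ) (P T : BallFn) (j : Fin 3) : CFFIdx n → ℂ :=
  gridValues n (curl (ptField P T) j)

/-- The CFF coefficients of the interpolated product `ω × v`. -/
noncomputable def lamb {n : ℕ} (P T : CSHIdx n → ℂ) (j : Fin 3) : CFFIdx (dealias n) → ℂ :=
  interp (gridCross (gridVort (dealias n) (ofCSH P) (ofCSH T))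
    (gridVel (dealias n) (ofCSH P) (ofCSH T)) j)

theorem le_dealias (n : ℕ) : n ≤ dealias n := by unfold dealias; omega
theorem dealias_le (n : ℕ) : dealias n ≤ 2 * n := by unfold dealias; omega
theorem even_dealias (n : ℕ) : Even (dealias n) := even_two_mul _

/-- The interpolant of the product on the grid exists and is unique, since grid values have equal
values at opposite ends of the periods; hence the nonlinear terms are well defined. -/
theorem isNonlinear_iff {n : ℕ} (hn : n ≠ 0) (Pv Tv PN TN : CSHIdx n → ℂ) :
    IsNonlinear Pv Tv PN TN ↔
      PN = invSurfaceLap n (dot pos (curl fun j => ofCFF (lamb Pv Tv j))) ∧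
      TN = invSurfaceLap n (dot pos (curl (curl fun j => ofCFF (lamb Pv Tv j)))) := by
  have hn' : dealias n ≠ 0 := by have := le_dealias n; omega
  have hb : ∀ b : Bool, Bd (n / 2) (bif b then ofCSH Tv else ofCSH Pv) := by
    rintro (_ | _)
    exacts [Bd.ofCSH Pv, Bd.ofCSH Tv]
  have hV : ∀ j, EdgeSymm (gridVel (dealias n) (ofCSH Pv) (ofCSH Tv) j) := fun j => by
    obtain ⟨E, hE⟩ := (Fast.ptField j).exists_bd hb
    exact gridValues_edgeSymm hn' (even_dealias n) hE
  have hW : ∀ j, EdgeSymm (gridVort (dealias n) (ofCSH Pv) (ofCSH Tv) j) := fun j => by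
    obtain ⟨E, hE⟩ := (Fast.curl Fast.ptField j).exists_bd hb
    exact gridValues_edgeSymm hn' (even_dealias n) hE
  have key : ∀ w : Fin 3 → CFFIdx (dealias n) → ℂ,
      (∀ j, Interpolates (gridCross (gridVort (dealias n) (ofCSH Pv) (ofCSH Tv))
        (gridVel (dealias n) (ofCSH Pv) (ofCSH Tv)) j) (w j)) ↔ w = lamb Pv Tv := fun w => by
    rw [funext_iff]
    exact forall_congr' fun j =>
      interpolates_iff hn' (even_dealias n) (edgeSymm_gridCross hW hV j) (w j)
  constructor
  · rintro ⟨w, h0, h1, h2, h3, h4⟩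
    obtain rfl := (key w).1 fun j => by fin_cases j; exacts [h0, h1, h2]
    exact ⟨funext h3, funext h4⟩
  · rintro ⟨rfl, rfl⟩
    have h := (key _).2 rfl
    exact ⟨_, h 0, h 1, h 2, fun _ => rfl, fun _ => rfl⟩

/-- The nonlinear terms are computed from the velocity potentials with `O(n³ log² n)` operations. -/
theorem exists_der_nonlinear : ∃ C : ℕ, ∀ n : ℕ, n ≠ 0 → ∀ (Ω : Type) (Pv Tv : Ω → CSHIdx n → ℂ),
    ∃ PN TN : Ω → CSHIdx n → ℂ,
      Der ((Set.range fun i x => Pv x i) ∪ Set.range fun i x => Tv x i)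
        (C * ((n + 1) ^ 3 * lg n ^ 2))
        ((Set.range fun i x => PN x i) ∪ Set.range fun i x => TN x i) ∧
      ∀ x Z W, IsNonlinear (Pv x) (Tv x) Z W ↔ Z = PN x ∧ W = TN x := by
  choose CV hCV using fun j => (Fast.ptField j).gridValues
  choose CW hCW using fun j => (Fast.curl Fast.ptField j).gridValues
  have hc : ∀ j, Fast fun f : Fin 3 → BallFn => curl f j := fun j => Fast.curl (fun i => .proj i) j
  obtain ⟨CP, hCP⟩ := (Fast.dot_pos hc).toCSH
  obtain ⟨CT, hCT⟩ := (Fast.dot_pos (Fast.curl hc)).toCSH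
  set S := (∑ j, CV j) + ∑ j, CW j with hS
  refine ⟨172400 + 96 * S + CP + CT, fun n hn Ω Pv Tv =>
    ⟨_, _, ?_, fun x Z W => isNonlinear_iff hn (Pv x) (Tv x) Z W⟩⟩
  set N := dealias n with hN
  have hN1 := le_dealias n
  have hN2 := dealias_le n
  have hcost : (N + 1) ^ 3 * lg N ^ 1 ≤ 16 * ((n + 1) ^ 3 * lg n ^ 2) := by
    have h1 := fast_cost_le n 0 0 0 (Nat.zero_le n) N (by omega) 1 1
    have h2 : (n + 1) ^ 3 * lg n ^ 1 ≤ (n + 1) ^ 3 * lg n ^ 2 := Nat.mul_le_mul_left _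
      (Nat.pow_le_pow_right (by have := two_le_lg n; omega) (by norm_num))
    simp only [zero_mul, zero_add, one_mul] at h1
    omega
  let F : Ω → Bool → BallFn := fun x b => bif b then ofCSH (Tv x) else ofCSH (Pv x)
  have hF : ∀ x b, Bd (n / 2) (F x b) := by
    rintro x (_ | _)
    exacts [Bd.ofCSH (Pv x), Bd.ofCSH (Tv x)]
  -- the potentials as CFF series
  have s1 : Der ((Set.range fun i x => Pv x i) ∪ Set.range fun i x => Tv x i)
      (100000 * ((n + 1) ^ 3 * lg n ^ 2)) (⋃ b, arr fun x => F x b) := by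
    refine (((Der.ofCSH n Pv).mono_left Set.subset_union_left).union
      ((Der.ofCSH n Tv).mono_left Set.subset_union_right)).mono le_rfl (by linarith) ?_
    refine Set.iUnion_subset ?_
    rintro (_ | _)
    exacts [Set.subset_union_left, Set.subset_union_right]
  -- velocity and vorticity on the fine grid
  have s2 : Der (⋃ b, arr fun x => F x b) (96 * S * ((n + 1) ^ 3 * lg n ^ 2))
      ((⋃ j ∈ Finset.univ, Set.range fun i x => gridVel N (ofCSH (Pv x)) (ofCSH (Tv x)) j i) ∪
        ⋃ j ∈ Finset.univ, Set.range fun i x => gridVort N (ofCSH (Pv x)) (ofCSH (Tv x)) j i) := by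
    have hS1 : ∀ j, CV j ≤ S := fun j =>
      (Finset.single_le_sum (fun _ _ => Nat.zero_le _) (Finset.mem_univ j)).trans
        (Nat.le_add_right _ _)
    have hS2 : ∀ j, CW j ≤ S := fun j =>
      (Finset.single_le_sum (fun _ _ => Nat.zero_le _) (Finset.mem_univ j)).trans
        (Nat.le_add_left _ _)
    have h1 := Der.biUnion (Finset.univ : Finset (Fin 3)) _ fun j _ =>
      (hCV j (n / 2) N (by omega) Ω F hF).mono_cost (Nat.mul_le_mul_right _ (hS1 j))
    have h2 := Der.biUnion (Finset.univ : Finset (Fin 3)) _ fun j _ =>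
      (hCW j (n / 2) N (by omega) Ω F hF).mono_cost (Nat.mul_le_mul_right _ (hS2 j))
    refine (h1.union h2).mono_cost ?_
    rw [Finset.card_univ, Fintype.card_fin]
    calc _ = 6 * S * ((N + 1) ^ 3 * lg N ^ 1) := by ring
      _ ≤ 6 * S * (16 * ((n + 1) ^ 3 * lg n ^ 2)) := Nat.mul_le_mul_left _ hcost
      _ = _ := by ring
  -- their product as a CFF series
  have s3 : Der ((⋃ j ∈ Finset.univ, Set.range fun i x =>
        gridVel N (ofCSH (Pv x)) (ofCSH (Tv x)) j i) ∪
        ⋃ j ∈ Finset.univ, Set.range fun i x => gridVort N (ofCSH (Pv x)) (ofCSH (Tv x)) j i)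
      (72300 * ((n + 1) ^ 3 * lg n ^ 2))
      (⋃ j, arr fun x => ofCFF (lamb (Pv x) (Tv x) j)) := by
    generalize hB : (⋃ j ∈ Finset.univ, Set.range fun i x =>
        gridVel N (ofCSH (Pv x)) (ofCSH (Tv x)) j i) ∪
        (⋃ j ∈ Finset.univ, Set.range fun i x => gridVort N (ofCSH (Pv x)) (ofCSH (Tv x)) j i) = B
    have hV : ∀ j i, (fun x => gridVel N (ofCSH (Pv x)) (ofCSH (Tv x)) j i) ∈ B := fun j i =>
      hB ▸ Or.inl (Set.mem_biUnion (Finset.mem_univ j) ⟨i, rfl⟩)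
    have hW : ∀ j i, (fun x => gridVort N (ofCSH (Pv x)) (ofCSH (Tv x)) j i) ∈ B := fun j i =>
      hB ▸ Or.inr (Set.mem_biUnion (Finset.mem_univ j) ⟨i, rfl⟩)
    have h1 := fun j => (Der.gridCross (fun x => gridVort N (ofCSH (Pv x)) (ofCSH (Tv x)))
      (fun x => gridVel N (ofCSH (Pv x)) (ofCSH (Tv x))) hW hV j).trans
        ((Der.interp N _).mono_left Set.subset_union_right)
    have h2 := fun j => (h1 j).trans ((Der.ofCFF _).mono_left Set.subset_union_right)
    refine (Der.biUnion (Finset.univ : Finset (Fin 3)) _ fun j _ => h2 j).mono le_rfl ?_ ?_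
    · rw [Finset.card_univ, Fintype.card_fin]
      have h3 := card_CFFIdx_le (le_refl N)
      have h4 := Nat.mul_le_mul_left ((N + 1) ^ 3) (two_le_lg N)
      have h5 : 1 ≤ (N + 1) ^ 3 := Nat.one_le_pow _ _ (by omega)
      rw [pow_one] at hcost
      have h6 : 1500 * (N + 1) ^ 3 * lg N = 1500 * ((N + 1) ^ 3 * lg N) := by ring
      omega
    · exact Set.iUnion_subset fun j => Set.subset_biUnion_of_mem
        (u := fun j => arr fun x => ofCFF (lamb (Pv x) (Tv x) j)) (Finset.mem_univ j)
  -- the two scalars of its curl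
  have hw : ∀ x j, Bd (N / 2) (ofCFF (lamb (Pv x) (Tv x) j)) := fun x j => Bd.ofCFF _
  have s4 := ((hCP (N / 2) n (by omega) (by omega) Ω _ hw).trans
    ((Der.invSurfaceLap n _).mono_left Set.subset_union_right)).union
    ((hCT (N / 2) n (by omega) (by omega) Ω _ hw).trans
      ((Der.invSurfaceLap n _).mono_left Set.subset_union_right))
  refine (s1.trans ((s2.trans ((s3.trans (s4.mono_left Set.subset_union_right)).mono_left
    Set.subset_union_right)).mono_left Set.subset_union_right)).mono_cost ?_
  have h1 : (n + 1) ^ 3 ≤ (n + 1) ^ 3 * lg n ^ 2 := Nat.le_mul_of_pos_right _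
      (Nat.pow_pos (by have := two_le_lg n; omega))
  generalize (n + 1) ^ 3 * lg n ^ 2 = u at h1 ⊢
  nlinarith

end BallNS

namespace BallNS

open Polynomial Complex

/-! ### The programs -/

theorem Der.exists_program₂ {Ω ι κ κ' : Type} [Fintype ι] {c : ℕ} (π : Ω → ι → ℂ) (F : Ω → κ → ℂ)
    (G : Ω → κ' → ℂ) (h : Der (Set.range fun i x => π x i) c
      ((Set.range fun k x => F x k) ∪ Set.range fun k x => G x k)) :
    ∃ P : Program ι (κ ⊕ κ'), P.cost ≤ Fintype.card ι + c ∧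
      ∀ x, P.eval (π x) = Sum.elim (F x) (G x) :=
  Der.exists_program π (fun k x => Sum.elim (F x) (G x) k) (h.mono_right (by
    rintro _ ⟨k | k, rfl⟩
    exacts [Or.inl ⟨k, rfl⟩, Or.inr ⟨k, rfl⟩]))

theorem le_cube_mul_lg (n e : ℕ) : (n + 1) ^ 3 ≤ (n + 1) ^ 3 * lg n ^ e :=
  Nat.le_mul_of_pos_right _ (Nat.pow_pos (by have := two_le_lg n; omega))

theorem exists_velocityProgram : ∃ C : ℕ, ∀ n : ℕ,
    ∃ P : Program (CSHIdx n ⊕ CSHIdx n) (CSHIdx n ⊕ CSHIdx n),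
      P.cost ≤ C * ((n + 1) ^ 3 * lg n ^ 0) ∧
      (VelocityWellPosed n → ∀ Pω Tω Pv Tv : CSHIdx n → ℂ,
        IsVelocity Pω Tω Pv Tv ↔ Sum.elim Pv Tv = P.eval (Sum.elim Pω Tω)) := by
  refine ⟨12 + solveCost, fun n => ?_⟩
  obtain ⟨Pv, hPv, hsol⟩ := Der.velocity n
    (fun x : (CSHIdx n → ℂ) × (CSHIdx n → ℂ) => x.2)
  obtain ⟨P, hP, hev⟩ := Der.exists_program₂
    (fun x : (CSHIdx n → ℂ) × (CSHIdx n → ℂ) => Sum.elim x.1 x.2) Pv (fun x => x.1)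
    ((hPv.mono_left (by rintro _ ⟨i, rfl⟩; exact ⟨Sum.inr i, rfl⟩)).union
      (.done (c := 0) (by rintro _ ⟨i, rfl⟩; exact ⟨Sum.inl i, rfl⟩)))
  refine ⟨P, hP.trans ?_, fun hw Pω Tω Z W => ?_⟩
  · rw [Fintype.card_sum, pow_zero, mul_one, show 12 + solveCost = 2 + (10 + solveCost) by ring,
      Nat.add_mul 2]
    have := card_CSHIdx_le n
    generalize (10 + solveCost) * (n + 1) ^ 3 = u
    omega
  · rw [hev (Pω, Tω), Sum.elim_eq_iff, IsVelocity, hsol (Pω, Tω) hw]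

theorem exists_nonlinearProgram : ∃ C : ℕ, ∀ n : ℕ, n ≠ 0 →
    ∃ P : Program (CSHIdx n ⊕ CSHIdx n) (CSHIdx n ⊕ CSHIdx n),
      P.cost ≤ C * ((n + 1) ^ 3 * lg n ^ 2) ∧
      ∀ Pv Tv PN TN : CSHIdx n → ℂ,
        IsNonlinear Pv Tv PN TN ↔ Sum.elim PN TN = P.eval (Sum.elim Pv Tv) := by
  obtain ⟨C, hC⟩ := exists_der_nonlinear
  refine ⟨2 + C, fun n hn => ?_⟩
  obtain ⟨PN, TN, hN, hsol⟩ := hC n hn _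
    (fun x : (CSHIdx n → ℂ) × (CSHIdx n → ℂ) => x.1) fun x => x.2
  obtain ⟨P, hP, hev⟩ := Der.exists_program₂
    (fun x : (CSHIdx n → ℂ) × (CSHIdx n → ℂ) => Sum.elim x.1 x.2) PN TN
    (hN.mono_left (by
      rintro _ (⟨i, rfl⟩ | ⟨i, rfl⟩)
      exacts [⟨Sum.inl i, rfl⟩, ⟨Sum.inr i, rfl⟩]))
  refine ⟨P, hP.trans ?_, fun Pv Tv Z W => ?_⟩
  · rw [Fintype.card_sum]
    have h1 := card_CSHIdx_le n
    have h2 := le_cube_mul_lg n 2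
    rw [Nat.add_mul]
    omega
  · rw [hev (Pv, Tv), Sum.elim_eq_iff, hsol (Pv, Tv)]

theorem exists_vorticityProgram : ∃ C : ℕ, ∀ n : ℕ,
    ∃ P : Program
        (Fin 4 ⊕ ((CSHIdx n ⊕ CSHIdx n) ⊕ (CSHIdx n ⊕ CSHIdx n)) ⊕ (SHIdx n ⊕ SHIdx n))
        (CSHIdx n ⊕ CSHIdx n),
      P.cost ≤ C * ((n + 1) ^ 3 * lg n ^ 0) ∧
      ∀ Γ₀ Γ₂ Γ₄ Δt : ℝ, VorticityWellPosed n Γ₀ Γ₂ Γ₄ Δt →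
        ∀ (Pω Tω PN TN : CSHIdx n → ℂ) (g f : SHIdx n → ℂ) (Pω' Tω' : CSHIdx n → ℂ),
          IsVorticity Γ₀ Γ₂ Γ₄ Δt Pω Tω PN TN g f Pω' Tω' ↔
            Sum.elim Pω' Tω' = P.eval (Sum.elim (params Γ₀ Γ₂ Γ₄ Δt)
              (Sum.elim (Sum.elim (Sum.elim Pω Tω) (Sum.elim PN TN)) (Sum.elim g f))) := by
  refine ⟨40 + 6 * solveCost, fun n => ?_⟩
  let Ω := (Fin 4 → ℝ) × (((CSHIdx n → ℂ) × (CSHIdx n → ℂ)) × ((CSHIdx n → ℂ) × (CSHIdx n → ℂ))) ×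
    ((SHIdx n → ℂ) × (SHIdx n → ℂ))
  let π : Ω → (Fin 4 ⊕ ((CSHIdx n ⊕ CSHIdx n) ⊕ (CSHIdx n ⊕ CSHIdx n)) ⊕ (SHIdx n ⊕ SHIdx n)) → ℂ :=
    fun x => Sum.elim (params (x.1 0) (x.1 1) (x.1 2) (x.1 3))
      (Sum.elim (Sum.elim (Sum.elim x.2.1.1.1 x.2.1.1.2) (Sum.elim x.2.1.2.1 x.2.1.2.2))
        (Sum.elim x.2.2.1 x.2.2.2))
  obtain ⟨Z, W, hZ, hsol⟩ := Der.vorticity n (fun x : Ω => x.1 0) (fun x => x.1 1) (fun x => x.1 2)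
    (fun x => x.1 3) (fun x => x.2.1.1.1) (fun x => x.2.1.1.2) (fun x => x.2.1.2.1)
    (fun x => x.2.1.2.2) (fun x => x.2.2.1) (fun x => x.2.2.2) (Set.range fun i x => π x i)
    (fun i => ⟨.inl i, rfl⟩) (fun i => ⟨.inr (.inl (.inl (.inl i))), rfl⟩)
    (fun i => ⟨.inr (.inl (.inl (.inr i))), rfl⟩) (fun i => ⟨.inr (.inl (.inr (.inl i))), rfl⟩)
    (fun i => ⟨.inr (.inl (.inr (.inr i))), rfl⟩) (fun i => ⟨.inr (.inr (.inl i)), rfl⟩)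
    (fun i => ⟨.inr (.inr (.inr i)), rfl⟩)
  obtain ⟨P, hP, hev⟩ := Der.exists_program₂ π Z W hZ
  refine ⟨P, hP.trans ?_, fun Γ₀ Γ₂ Γ₄ Δt hw Pω Tω PN TN g f Pω' Tω' => ?_⟩
  · simp only [Fintype.card_sum, Fintype.card_fin, pow_zero, mul_one]
    have h1 := card_CSHIdx_le n
    have h2 : Fintype.card (SHIdx n) ≤ (n + 1) ^ 3 :=
      (card_SHIdx_le n).trans (Nat.pow_le_pow_right (by omega) (by norm_num))
    have h3 : 1 ≤ (n + 1) ^ 3 := Nat.one_le_pow _ _ (by omega)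
    rw [show 40 + 6 * solveCost = 10 + (30 + 6 * solveCost) by ring, Nat.add_mul 10]
    generalize (30 + 6 * solveCost) * (n + 1) ^ 3 = u
    omega
  · have h1 := hev (![Γ₀, Γ₂, Γ₄, Δt], ((Pω, Tω), (PN, TN)), (g, f))
    have h2 := hsol (![Γ₀, Γ₂, Γ₄, Δt], ((Pω, Tω), (PN, TN)), (g, f)) hw Pω' Tω'
    rw [← Sum.elim_eq_iff, ← h1] at h2
    exact h2

theorem exists_timeStepProgram : ∃ C : ℕ, ∀ n : ℕ, n ≠ 0 →
    ∃ P : Program (Fin 4 ⊕ (CSHIdx n ⊕ CSHIdx n) ⊕ (SHIdx n ⊕ SHIdx n)) (CSHIdx n ⊕ CSHIdx n),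
      P.cost ≤ C * ((n + 1) ^ 3 * lg n ^ 2) ∧
      ∀ Γ₀ Γ₂ Γ₄ Δt : ℝ, VelocityWellPosed n → VorticityWellPosed n Γ₀ Γ₂ Γ₄ Δt →
        ∀ (Pω Tω : CSHIdx n → ℂ) (g f : SHIdx n → ℂ) (Pω' Tω' : CSHIdx n → ℂ),
          IsTimeStep Γ₀ Γ₂ Γ₄ Δt Pω Tω g f Pω' Tω' ↔
            Sum.elim Pω' Tω' = P.eval (Sum.elim (params Γ₀ Γ₂ Γ₄ Δt)
              (Sum.elim (Sum.elim Pω Tω) (Sum.elim g f))) := by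
  obtain ⟨C, hC⟩ := exists_der_nonlinear
  refine ⟨50 + 7 * solveCost + C, fun n hn => ?_⟩
  let Ω := (Fin 4 → ℝ) × ((CSHIdx n → ℂ) × (CSHIdx n → ℂ)) × ((SHIdx n → ℂ) × (SHIdx n → ℂ))
  let π : Ω → (Fin 4 ⊕ (CSHIdx n ⊕ CSHIdx n) ⊕ (SHIdx n ⊕ SHIdx n)) → ℂ :=
    fun x => Sum.elim (params (x.1 0) (x.1 1) (x.1 2) (x.1 3))
      (Sum.elim (Sum.elim x.2.1.1 x.2.1.2) (Sum.elim x.2.2.1 x.2.2.2))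
  have hP : ∀ i, (fun x : Ω => x.2.1.1 i) ∈ Set.range fun i x => π x i := fun i =>
    ⟨.inr (.inl (.inl i)), rfl⟩
  have hT : ∀ i, (fun x : Ω => x.2.1.2 i) ∈ Set.range fun i x => π x i := fun i =>
    ⟨.inr (.inl (.inr i)), rfl⟩
  obtain ⟨Pv, hv, hvsol⟩ := Der.velocity n (fun x : Ω => x.2.1.2)
  obtain ⟨PN, TN, hN, hNsol⟩ := hC n hn Ω Pv fun x => x.2.1.1
  obtain ⟨Z, W, hZ, hsol⟩ := Der.vorticity n (fun x : Ω => x.1 0) (fun x => x.1 1) (fun x => x.1 2)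
    (fun x => x.1 3) (fun x => x.2.1.1) (fun x => x.2.1.2) PN TN (fun x => x.2.2.1)
    (fun x => x.2.2.2) (((Set.range fun i x => π x i) ∪ Set.range fun i x => Pv x i) ∪
      ((Set.range fun i x => PN x i) ∪ Set.range fun i x => TN x i))
    (fun i => Or.inl (Or.inl ⟨.inl i, rfl⟩)) (fun i => Or.inl (Or.inl (hP i)))
    (fun i => Or.inl (Or.inl (hT i))) (fun i => Or.inr (Or.inl ⟨i, rfl⟩))
    (fun i => Or.inr (Or.inr ⟨i, rfl⟩)) (fun i => Or.inl (Or.inl ⟨.inr (.inr (.inl i)), rfl⟩))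
    (fun i => Or.inl (Or.inl ⟨.inr (.inr (.inr i)), rfl⟩))
  have hv' := hv.mono_left (A' := Set.range fun i x => π x i) (by rintro _ ⟨i, rfl⟩; exact hT i)
  have hN' := hN.mono_left (A' := (Set.range fun i x => π x i) ∪ Set.range fun i x => Pv x i) (by
    rintro _ (h | ⟨i, rfl⟩)
    exacts [Or.inr h, Or.inl (hP i)])
  obtain ⟨P, hP, hev⟩ := Der.exists_program₂ π Z W (hv'.trans (hN'.trans hZ))
  refine ⟨P, hP.trans ?_, fun Γ₀ Γ₂ Γ₄ Δt hw hw' Pω Tω g f Pω' Tω' => ?_⟩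
  · simp only [Fintype.card_sum, Fintype.card_fin]
    have h1 := card_CSHIdx_le n
    have h2 : Fintype.card (SHIdx n) ≤ (n + 1) ^ 3 :=
      (card_SHIdx_le n).trans (Nat.pow_le_pow_right (by omega) (by norm_num))
    have h3 : 1 ≤ (n + 1) ^ 3 := Nat.one_le_pow _ _ (by omega)
    have h4 := le_cube_mul_lg n 2
    have h5 := Nat.mul_le_mul_left (40 + 7 * solveCost) h4
    rw [show 50 + 7 * solveCost + C = 10 + (40 + 7 * solveCost) + C by ring, Nat.add_mul _ C,
      Nat.add_mul 10 (40 + 7 * solveCost)]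
    have h6 : (10 + solveCost) * (n + 1) ^ 3 + (30 + 6 * solveCost) * (n + 1) ^ 3 =
      (40 + 7 * solveCost) * (n + 1) ^ 3 := by ring
    generalize (10 + solveCost) * (n + 1) ^ 3 = u at h6 ⊢
    generalize (30 + 6 * solveCost) * (n + 1) ^ 3 = u' at h6 ⊢
    generalize (40 + 7 * solveCost) * (n + 1) ^ 3 = v at h5 h6
    generalize (40 + 7 * solveCost) * ((n + 1) ^ 3 * lg n ^ 2) = v' at h5 ⊢
    omega
  · set x : Ω := (![Γ₀, Γ₂, Γ₄, Δt], (Pω, Tω), (g, f)) with hx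
    have h1 := hev x
    have h2 := hsol x hw' Pω' Tω'
    rw [← Sum.elim_eq_iff, ← h1] at h2
    refine Iff.trans ?_ h2
    constructor
    · rintro ⟨pv, tv, pn, tn, ⟨h3, rfl⟩, h4, h5⟩
      obtain rfl := (hvsol x hw pv).1 h3
      obtain ⟨rfl, rfl⟩ := (hNsol x pn tn).1 h4
      exact h5
    · exact fun h5 => ⟨Pv x, Pω, PN x, TN x, ⟨(hvsol x hw _).2 rfl, rfl⟩,
        (hNsol x _ _).2 ⟨rfl, rfl⟩, h5⟩

/-- The CFF coefficients of a function. -/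
noncomputable def cffCoeffs (n : ℕ) (f : BallFn) : CFFIdx n → ℂ := fun i => cf f i.1 i.2.1 i.2.2

theorem ofCFF_eq_iff {n : ℕ} {f : BallFn} (hf : Bd (n / 2) f) (d : CFFIdx n → ℂ) :
    ofCFF d = f ↔ d = cffCoeffs n f := by
  constructor
  · rintro rfl
    funext i
    rw [cffCoeffs, cf_ofCFF, extend_apply]
  · rintro rfl
    refine cf_ext fun k a b => ?_
    rw [cf_ofCFF]
    by_cases h : k ≤ n / 2 ∧ |a| ≤ (n / 2 : ℕ) ∧ |b| ≤ (n / 2 : ℕ)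
    · exact extend_apply (cffCoeffs n f) (⟨k, by omega⟩, ⟨a, Finset.mem_Icc.2 (abs_le.1 h.2.1)⟩,
        ⟨b, Finset.mem_Icc.2 (abs_le.1 h.2.2)⟩)
    · rw [extend_eq_zero _ h, hf.cf_eq_zero (by omega)]

theorem exists_cshToCFFProgram : ∃ C : ℕ, ∀ n : ℕ,
    ∃ P : Program (CSHIdx n) (CFFIdx n),
      P.cost ≤ C * ((n + 1) ^ 3 * lg n ^ 2) ∧
      ∀ (c : CSHIdx n → ℂ) (d : CFFIdx n → ℂ), ofCFF d = ofCSH c ↔ d = P.eval c := by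
  refine ⟨50001, fun n => ?_⟩
  obtain ⟨P, hP, hev⟩ := Der.exists_program (fun c : CSHIdx n → ℂ => c)
    (fun k c => cffCoeffs n (ofCSH c) k) ((Der.ofCSH n fun c => c).mono_right (by
      rintro _ ⟨k, rfl⟩
      exact mem_arr _ _ _ _))
  refine ⟨P, hP.trans ?_, fun c d => ?_⟩
  · have h1 := card_CSHIdx_le n
    have h2 := le_cube_mul_lg n 2
    rw [mul_assoc]
    omega
  · rw [ofCFF_eq_iff (Bd.ofCSH c), hev c]

theorem exists_cffToCSHProgram : ∃ C : ℕ, ∀ n : ℕ,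
    ∃ P : Program (CFFIdx n) (CSHIdx n),
      P.cost ≤ C * ((n + 1) ^ 3 * lg n ^ 2) ∧ ∀ d : CFFIdx n → ℂ, P.eval d = toCSH n (ofCFF d) := by
  refine ⟨50005, fun n => ?_⟩
  obtain ⟨P, hP, hev⟩ := Der.exists_program (fun d : CFFIdx n → ℂ => d)
    (fun k d => toCSH n (ofCFF d) k) ((Der.ofCFF fun d => d).trans ((Der.toCSH n n (by omega) _
      fun d => (Bd.ofCFF d).mono (by omega)).mono_left Set.subset_union_right))
  refine ⟨P, hP.trans ?_, hev⟩
  have h1 := card_CFFIdx_le (le_refl n)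
  have h2 := le_cube_mul_lg n 2
  have h3 : 1 ≤ (n + 1) ^ 3 := Nat.one_le_pow _ _ (by omega)
  rw [mul_assoc]
  omega

theorem exists_gridValuesProgram : ∃ C : ℕ, ∀ n : ℕ,
    ∃ P : Program (CFFIdx n) (CFFIdx n),
      P.cost ≤ C * ((n + 1) ^ 3 * lg n ^ 1) ∧
      ∀ d : CFFIdx n → ℂ, P.eval d = gridValues n (ofCFF d) := by
  refine ⟨4 + (1 + 1500 * (0 + 2) ^ 3 * (0 + 2) ^ 1), fun n => ?_⟩
  obtain ⟨P, hP, hev⟩ := Der.exists_program (fun d : CFFIdx n → ℂ => d)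
    (fun k d => gridValues n (ofCFF d) k) ((Der.ofCFF fun d => d).trans ((Der.gridValues n n _
      fun d => (Bd.ofCFF d).mono (by omega)).mono_left Set.subset_union_right))
  refine ⟨P, hP.trans ?_, hev⟩
  have h1 := card_CFFIdx_le (le_refl n)
  have h2 := le_cube_mul_lg n 1
  have h3 := fast_cost_le n 0 0 1 (Nat.zero_le n) (n + n) (by omega) 1500 1
  rw [pow_one (lg (n + n))] at h3
  rw [Nat.add_mul 4]
  omega

theorem exists_interpProgram : ∃ C : ℕ, ∀ n : ℕ, n ≠ 0 → Even n →
    ∃ P : Program (CFFIdx n) (CFFIdx n),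
      P.cost ≤ C * ((n + 1) ^ 3 * lg n ^ 1) ∧
      ∀ v : CFFIdx n → ℂ, EdgeSymm v → ∀ d : CFFIdx n → ℂ, Interpolates v d ↔ d = P.eval v := by
  refine ⟨1504, fun n hn he => ?_⟩
  obtain ⟨P, hP, hev⟩ := Der.exists_program (fun d : CFFIdx n → ℂ => d)
    (fun k d => interp d k) (Der.interp n fun d => d)
  refine ⟨P, hP.trans ?_, fun v hv d => ?_⟩
  · have h1 := card_CFFIdx_le (le_refl n)
    have h2 := le_cube_mul_lg n 1
    rw [mul_assoc, ← pow_one (lg n)]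
    simp only [pow_one] at h2 ⊢
    omega
  · rw [interpolates_iff hn he hv, hev v]

theorem exists_dirichletProgram : ∃ C : ℕ, ∀ n q l : ℕ, 1 ≤ q → q ≤ 3 →
    ∃ P : Program (Fin 4 ⊕ Fin (n / 2 + 1) ⊕ Unit) (Fin (n / 2 + 1)),
      P.cost ≤ C * (n + 1) ∧
      ∀ a : Fin 4 → ℂ, DirichletWellPosed n q a l →
        ∀ (F : Fin (n / 2 + 1) → ℂ) (g : ℂ) (Z : Fin (n / 2 + 1) → ℂ),
          DirichletSystem n q a l F g Z ↔ Z = P.eval (Sum.elim a (Sum.elim F fun _ => g)) := by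
  refine ⟨6 + radialCost, fun n q l hq hq' => ?_⟩
  let Ω := (Fin 4 → ℂ) × (Fin (n / 2 + 1) → ℂ) × ℂ
  let π : Ω → (Fin 4 ⊕ Fin (n / 2 + 1) ⊕ Unit) → ℂ :=
    fun x => Sum.elim x.1 (Sum.elim x.2.1 fun _ => x.2.2)
  obtain ⟨Y, hY, hsol⟩ := Der.dirichlet n q l hq hq' (Set.range fun i x => π x i)
    (fun x : Ω => x.1) (fun x => x.2.1) (fun x => x.2.2) (fun i => ⟨.inl i, rfl⟩)
    (fun k => ⟨.inr (.inl k), rfl⟩) ⟨.inr (.inr ()), rfl⟩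
  obtain ⟨P, hP, hev⟩ := Der.exists_program π Y hY
  refine ⟨P, hP.trans ?_, fun a hw F g Z => ?_⟩
  · have h1 : (n / 2 + 1) * radialCost ≤ (n + 1) * radialCost :=
      Nat.mul_le_mul_right _ (by omega)
    simp only [Fintype.card_sum, Fintype.card_fin, Fintype.card_unit]
    rw [Nat.add_mul 6, Nat.mul_comm radialCost]
    generalize (n + 1) * radialCost = u at h1 ⊢
    generalize (n / 2 + 1) * radialCost = u' at h1 ⊢
    omega
  · rw [hsol (a, F, g) hw Z]
    exact Eq.congr_right (hev (a, F, g)).symm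

theorem exists_integralProgram : ∃ C : ℕ, ∀ n q l : ℕ, 1 ≤ q → q ≤ 3 →
    ∃ P : Program (Fin 4 ⊕ Fin (n / 2 + 1) ⊕ Unit) (Fin (n / 2 + 1)),
      P.cost ≤ C * (n + 1) ∧
      ∀ a : Fin 4 → ℂ, IntegralWellPosed n q a l →
        ∀ (F : Fin (n / 2 + 1) → ℂ) (p : ℂ) (Z : Fin (n / 2 + 1) → ℂ),
          IntegralSystem n q a l F p Z ↔ Z = P.eval (Sum.elim a (Sum.elim F fun _ => p)) := by
  refine ⟨6 + radialCost, fun n q l hq hq' => ?_⟩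
  let Ω := (Fin 4 → ℂ) × (Fin (n / 2 + 1) → ℂ) × ℂ
  let π : Ω → (Fin 4 ⊕ Fin (n / 2 + 1) ⊕ Unit) → ℂ :=
    fun x => Sum.elim x.1 (Sum.elim x.2.1 fun _ => x.2.2)
  obtain ⟨Y, hY, hsol⟩ := Der.integral n q l hq hq' (Set.range fun i x => π x i)
    (fun x : Ω => x.1) (fun x => x.2.1) (fun x => x.2.2) (fun i => ⟨.inl i, rfl⟩)
    (fun k => ⟨.inr (.inl k), rfl⟩) ⟨.inr (.inr ()), rfl⟩
  obtain ⟨P, hP, hev⟩ := Der.exists_program π Y hY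
  refine ⟨P, hP.trans ?_, fun a hw F p Z => ?_⟩
  · have h1 : (n / 2 + 1) * radialCost ≤ (n + 1) * radialCost :=
      Nat.mul_le_mul_right _ (by omega)
    simp only [Fintype.card_sum, Fintype.card_fin, Fintype.card_unit]
    rw [Nat.add_mul 6, Nat.mul_comm radialCost]
    generalize (n + 1) * radialCost = u at h1 ⊢
    generalize (n / 2 + 1) * radialCost = u' at h1 ⊢
    omega
  · rw [hsol (a, F, p) hw Z]
    exact Eq.congr_right (hev (a, F, p)).symm

/-! ### The costs in terms of logarithms -/

/-- The bound uses `n ≥ 2`, so that `log n` is bounded below. -/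
theorem lg_le_log {n : ℕ} (hn : 2 ≤ n) : (lg n : ℝ) ≤ 6 * Real.log n := by
  have hs : 0 < n.size := Nat.size_pos.2 (by omega)
  have h1 : 2 ^ (n.size - 1) ≤ n := Nat.lt_size.1 (by omega)
  have h2 : ((n.size - 1 : ℕ) : ℝ) * Real.log 2 ≤ Real.log n := by
    rw [← Real.log_pow]
    exact Real.log_le_log (by positivity) (by exact_mod_cast h1)
  have h3 : Real.log 2 ≤ Real.log n := Real.log_le_log (by norm_num) (by exact_mod_cast hn)
  have h4 := Real.log_two_gt_d9
  rw [Nat.cast_sub hs, Nat.cast_one] at h2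
  have h5 : (lg n : ℝ) = n.size + 2 := by simp [lg]
  have h6 : (1 : ℝ) ≤ n.size := by exact_mod_cast hs
  rw [h5]
  nlinarith

/-- The cost bounds in terms of `n + 1` and `lg n` give bounds in terms of `n` and `log n`. -/
theorem cost_le {c C n e : ℕ} {K : ℝ} (hn : 2 ≤ n) (h : c ≤ C * ((n + 1) ^ 3 * lg n ^ e))
    (hK : 8 * 6 ^ e * (C : ℝ) ≤ K) : (c : ℝ) ≤ K * (n : ℝ) ^ 3 * Real.log n ^ e := by
  have hn' : (2 : ℝ) ≤ n := by exact_mod_cast hn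
  have h0 : 0 ≤ Real.log n := Real.log_nonneg (by linarith)
  have h1 : (n + 1 : ℝ) ^ 3 ≤ 8 * (n : ℝ) ^ 3 := by
    calc (n + 1 : ℝ) ^ 3 ≤ (2 * n) ^ 3 := pow_le_pow_left₀ (by linarith) (by linarith) 3
      _ = _ := by ring
  have h2 : (lg n : ℝ) ^ e ≤ 6 ^ e * Real.log n ^ e := by
    rw [← mul_pow]
    exact pow_le_pow_left₀ (by positivity) (lg_le_log hn) e
  calc (c : ℝ) ≤ C * ((n + 1) ^ 3 * lg n ^ e) := by exact_mod_cast h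
    _ ≤ C * (8 * (n : ℝ) ^ 3 * (6 ^ e * Real.log n ^ e)) := by gcongr
    _ = (8 * 6 ^ e * C) * (n : ℝ) ^ 3 * Real.log n ^ e := by ring
    _ ≤ _ := by gcongr

theorem dof_le {n : ℕ} (hn : 2 ≤ n) : (dof n : ℝ) ≤ 24 * (n : ℝ) ^ 3 := by
  have h : dof n ≤ 24 * n ^ 3 := by
    calc 3 * (n / 2 + 1) * (n + 1) ^ 2 ≤ 3 * (2 * n) * (2 * n) ^ 2 :=
          Nat.mul_le_mul (by omega) (Nat.pow_le_pow_left (by omega) 2)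
      _ = _ := by ring
  exact_mod_cast h

theorem cube_mul_log_le_dof {n : ℕ} (hn : 2 ≤ n) {K : ℝ} (hK : 0 ≤ K) :
    K * (n : ℝ) ^ 3 * Real.log n ^ 2 ≤ K * (dof n : ℝ) * Real.log (dof n) ^ 2 := by
  have h : n ^ 3 ≤ dof n := by
    calc n ^ 3 = n * n ^ 2 := by ring
      _ ≤ 3 * (n / 2 + 1) * (n + 1) ^ 2 :=
          Nat.mul_le_mul (by omega) (Nat.pow_le_pow_left (by omega) 2)
  have h' : n ≤ dof n := (Nat.le_self_pow (by norm_num) n).trans h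
  have h0 : (0 : ℝ) < n := by exact_mod_cast (by omega : 0 < n)
  have h1 : 0 ≤ Real.log n := Real.log_natCast_nonneg n
  have h2 : Real.log n ≤ Real.log (dof n) := Real.log_le_log h0 (by exact_mod_cast h')
  have h3 : (n : ℝ) ^ 3 ≤ dof n := by exact_mod_cast h
  gcongr

end BallNS
theorem mainTheorem4 : ∃ K : ℝ, 0 < K ∧ ∀ n : ℕ, 2 ≤ n → Even n →
    -- the number of degrees of freedom is `O(n³)`
    (BallNS.dof n : ℝ) ≤ K * (n : ℝ) ^ 3 ∧
    -- one time step: `O(N log² N)`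
    (∃ P : BallNS.Program
        (Fin 4 ⊕ (BallNS.CSHIdx n ⊕ BallNS.CSHIdx n) ⊕ (BallNS.SHIdx n ⊕ BallNS.SHIdx n))
        (BallNS.CSHIdx n ⊕ BallNS.CSHIdx n),
      (P.cost : ℝ) ≤ K * (BallNS.dof n : ℝ) * Real.log (BallNS.dof n : ℝ) ^ 2 ∧
      ∀ Γ₀ Γ₂ Γ₄ Δt : ℝ, 0 < Δt → BallNS.VelocityWellPosed n →
        BallNS.VorticityWellPosed n Γ₀ Γ₂ Γ₄ Δt →
        ∀ (Pω Tω : BallNS.CSHIdx n → ℂ) (g f : BallNS.SHIdx n → ℂ)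
          (Pω' Tω' : BallNS.CSHIdx n → ℂ),
          BallNS.IsTimeStep Γ₀ Γ₂ Γ₄ Δt Pω Tω g f Pω' Tω' ↔
            Sum.elim Pω' Tω' = P.eval (Sum.elim (BallNS.params Γ₀ Γ₂ Γ₄ Δt)
              (Sum.elim (Sum.elim Pω Tω) (Sum.elim g f)))) ∧
    -- first stage: `O(n³)`
    (∃ P : BallNS.Program (BallNS.CSHIdx n ⊕ BallNS.CSHIdx n)
        (BallNS.CSHIdx n ⊕ BallNS.CSHIdx n),
      (P.cost : ℝ) ≤ K * (n : ℝ) ^ 3 ∧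
      (BallNS.VelocityWellPosed n → ∀ Pω Tω Pv Tv : BallNS.CSHIdx n → ℂ,
        BallNS.IsVelocity Pω Tω Pv Tv ↔ Sum.elim Pv Tv = P.eval (Sum.elim Pω Tω))) ∧
    -- second stage, the nonlinear term: `O(n³ log² n)`
    (∃ P : BallNS.Program (BallNS.CSHIdx n ⊕ BallNS.CSHIdx n)
        (BallNS.CSHIdx n ⊕ BallNS.CSHIdx n),
      (P.cost : ℝ) ≤ K * (n : ℝ) ^ 3 * Real.log (n : ℝ) ^ 2 ∧
      ∀ Pv Tv PN TN : BallNS.CSHIdx n → ℂ,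
        BallNS.IsNonlinear Pv Tv PN TN ↔ Sum.elim PN TN = P.eval (Sum.elim Pv Tv)) ∧
    -- third stage, the implicit solves: `O(n³)`
    (∃ P : BallNS.Program
        (Fin 4 ⊕ ((BallNS.CSHIdx n ⊕ BallNS.CSHIdx n) ⊕ (BallNS.CSHIdx n ⊕ BallNS.CSHIdx n)) ⊕
          (BallNS.SHIdx n ⊕ BallNS.SHIdx n))
        (BallNS.CSHIdx n ⊕ BallNS.CSHIdx n),
      (P.cost : ℝ) ≤ K * (n : ℝ) ^ 3 ∧
      ∀ Γ₀ Γ₂ Γ₄ Δt : ℝ, 0 < Δt → BallNS.VorticityWellPosed n Γ₀ Γ₂ Γ₄ Δt →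
        ∀ (Pω Tω PN TN : BallNS.CSHIdx n → ℂ) (g f : BallNS.SHIdx n → ℂ)
          (Pω' Tω' : BallNS.CSHIdx n → ℂ),
          BallNS.IsVorticity Γ₀ Γ₂ Γ₄ Δt Pω Tω PN TN g f Pω' Tω' ↔
            Sum.elim Pω' Tω' = P.eval (Sum.elim (BallNS.params Γ₀ Γ₂ Γ₄ Δt)
              (Sum.elim (Sum.elim (Sum.elim Pω Tω) (Sum.elim PN TN)) (Sum.elim g f)))) ∧
    -- CSH coefficients to CFF coefficients: `O(n³ log² n)`
    (∃ P : BallNS.Program (BallNS.CSHIdx n) (BallNS.CFFIdx n),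
      (P.cost : ℝ) ≤ K * (n : ℝ) ^ 3 * Real.log (n : ℝ) ^ 2 ∧
      ∀ (c : BallNS.CSHIdx n → ℂ) (d : BallNS.CFFIdx n → ℂ),
        BallNS.ofCFF d = BallNS.ofCSH c ↔ d = P.eval c) ∧
    -- CFF coefficients to CSH coefficients: `O(n³ log² n)`
    (∃ P : BallNS.Program (BallNS.CFFIdx n) (BallNS.CSHIdx n),
      (P.cost : ℝ) ≤ K * (n : ℝ) ^ 3 * Real.log (n : ℝ) ^ 2 ∧
      (∀ d : BallNS.CFFIdx n → ℂ, P.eval d = BallNS.toCSH n (BallNS.ofCFF d)) ∧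
      ∀ (c : BallNS.CSHIdx n → ℂ) (d : BallNS.CFFIdx n → ℂ),
        BallNS.ofCFF d = BallNS.ofCSH c → P.eval d = c) ∧
    -- CFF coefficients to values at the CFF points: `O(n³ log n)`
    (∃ P : BallNS.Program (BallNS.CFFIdx n) (BallNS.CFFIdx n),
      (P.cost : ℝ) ≤ K * (n : ℝ) ^ 3 * Real.log (n : ℝ) ∧
      ∀ d : BallNS.CFFIdx n → ℂ, P.eval d = BallNS.gridValues n (BallNS.ofCFF d)) ∧
    -- values at the CFF points to CFF coefficients: `O(n³ log n)`
    (∃ P : BallNS.Program (BallNS.CFFIdx n) (BallNS.CFFIdx n),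
      (P.cost : ℝ) ≤ K * (n : ℝ) ^ 3 * Real.log (n : ℝ) ∧
      ∀ v : BallNS.CFFIdx n → ℂ, BallNS.EdgeSymm v →
        ∀ d : BallNS.CFFIdx n → ℂ, BallNS.Interpolates v d ↔ d = P.eval v) ∧
    -- the radial solves for each `(l, m)`: almost banded systems, solved in `O(n)`
    ∀ q : ℕ, 1 ≤ q → q ≤ 3 → ∀ l : ℕ, l ≤ n / 2 →
      (∀ (a : Fin 4 → ℂ) (j k : ℕ), BallNS.ultraMatrix q a l j k ≠ 0 →
        j ≤ k + 2 * q ∧ k ≤ j + 6 * q) ∧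
      (∃ P : BallNS.Program (Fin 4 ⊕ Fin (n / 2 + 1) ⊕ Unit) (Fin (n / 2 + 1)),
        (P.cost : ℝ) ≤ K * (n : ℝ) ∧
        ∀ a : Fin 4 → ℂ, BallNS.DirichletWellPosed n q a l →
          ∀ (F : Fin (n / 2 + 1) → ℂ) (g : ℂ) (X : Fin (n / 2 + 1) → ℂ),
            BallNS.DirichletSystem n q a l F g X ↔
              X = P.eval (Sum.elim a (Sum.elim F fun _ => g))) ∧
      (∃ P : BallNS.Program (Fin 4 ⊕ Fin (n / 2 + 1) ⊕ Unit) (Fin (n / 2 + 1)),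
        (P.cost : ℝ) ≤ K * (n : ℝ) ∧
        ∀ a : Fin 4 → ℂ, BallNS.IntegralWellPosed n q a l →
          ∀ (F : Fin (n / 2 + 1) → ℂ) (p : ℂ) (X : Fin (n / 2 + 1) → ℂ),
            BallNS.IntegralSystem n q a l F p X ↔
              X = P.eval (Sum.elim a (Sum.elim F fun _ => p))) := by
  obtain ⟨C₁, h₁⟩ := BallNS.exists_timeStepProgram
  obtain ⟨C₂, h₂⟩ := BallNS.exists_velocityProgram
  obtain ⟨C₃, h₃⟩ := BallNS.exists_nonlinearProgram
  obtain ⟨C₄, h₄⟩ := BallNS.exists_vorticityProgram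
  obtain ⟨C₅, h₅⟩ := BallNS.exists_cshToCFFProgram
  obtain ⟨C₆, h₆⟩ := BallNS.exists_cffToCSHProgram
  obtain ⟨C₇, h₇⟩ := BallNS.exists_gridValuesProgram
  obtain ⟨C₈, h₈⟩ := BallNS.exists_interpProgram
  obtain ⟨C₉, h₉⟩ := BallNS.exists_dirichletProgram
  obtain ⟨C₁₀, h₁₀⟩ := BallNS.exists_integralProgram
  set S := C₁ + C₂ + C₃ + C₄ + C₅ + C₆ + C₇ + C₈ + C₉ + C₁₀ with hS
  -- `288 = 8 * 6 ^ 2` bounds the constants of all the conversions to natural logarithms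
  have hK : ∀ {C : ℕ}, C ≤ S → ∀ e ≤ 2, 8 * 6 ^ e * (C : ℝ) ≤ 288 * S + 24 := by
    intro C hC e he
    have h1 : (C : ℝ) ≤ S := by exact_mod_cast hC
    have h2 : (0 : ℝ) ≤ C := Nat.cast_nonneg C
    interval_cases e <;> linarith
  have hlin : ∀ {c C n : ℕ}, C ≤ S → 2 ≤ n → c ≤ C * (n + 1) →
      (c : ℝ) ≤ (288 * S + 24) * (n : ℝ) := by
    intro c C n hC hn hc
    have h1 : c ≤ (288 * S + 24) * n := by nlinarith [Nat.mul_le_mul hC (by omega : n + 1 ≤ 2 * n)]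
    exact_mod_cast h1
  refine ⟨288 * S + 24, by positivity, fun n hn he => ⟨?_, ?_, ?_, ?_, ?_, ?_, ?_, ?_, ?_, ?_⟩⟩
  · refine (BallNS.dof_le hn).trans ?_
    gcongr
    linarith [Nat.cast_nonneg (α := ℝ) S]
  · obtain ⟨P, hP, h⟩ := h₁ n (by omega)
    exact ⟨P, (BallNS.cost_le hn hP (hK (by omega) 2 le_rfl)).trans
      (BallNS.cube_mul_log_le_dof hn (by positivity)),
      fun Γ₀ Γ₂ Γ₄ Δt _ => h Γ₀ Γ₂ Γ₄ Δt⟩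
  · obtain ⟨P, hP, h⟩ := h₂ n
    exact ⟨P, by simpa using BallNS.cost_le hn hP (hK (by omega) 0 (by norm_num)), h⟩
  · obtain ⟨P, hP, h⟩ := h₃ n (by omega)
    exact ⟨P, BallNS.cost_le hn hP (hK (by omega) 2 le_rfl), h⟩
  · obtain ⟨P, hP, h⟩ := h₄ n
    exact ⟨P, by simpa using BallNS.cost_le hn hP (hK (by omega) 0 (by norm_num)),
      fun Γ₀ Γ₂ Γ₄ Δt _ => h Γ₀ Γ₂ Γ₄ Δt⟩
  · obtain ⟨P, hP, h⟩ := h₅ n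
    exact ⟨P, BallNS.cost_le hn hP (hK (by omega) 2 le_rfl), h⟩
  · obtain ⟨P, hP, h⟩ := h₆ n
    exact ⟨P, BallNS.cost_le hn hP (hK (by omega) 2 le_rfl), h,
      fun c d hcd => by rw [h, hcd, BallNS.toCSH_ofCSH]⟩
  · obtain ⟨P, hP, h⟩ := h₇ n
    exact ⟨P, by simpa using BallNS.cost_le hn hP (hK (by omega) 1 (by norm_num)), h⟩
  · obtain ⟨P, hP, h⟩ := h₈ n (by omega) he
    exact ⟨P, by simpa using BallNS.cost_le hn hP (hK (by omega) 1 (by norm_num)), h⟩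
  · intro q hq hq' l _
    obtain ⟨P, hP, h⟩ := h₉ n q l hq hq'
    obtain ⟨Q, hQ, h'⟩ := h₁₀ n q l hq hq'
    exact ⟨fun a j k => BallNS.ultraMatrix_band hq a l j k, ⟨P, hlin (by omega) hn hP, h⟩,
      ⟨Q, hlin (by omega) hn hQ, h'⟩⟩
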